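/- **Setting.** Primitive recursive (p.r.) set functions are those of Jensen and Karp: they are generated from the constants $\emptyset$ and $\omega$, projections, $(x,y)\mapsto x\cup\{y\}$ and $(x_0,x_1,x_2,x_3)\mapsto x_0$ if $x_2\in x_3$, else $x_1$, by composition and by the recursion $R(x,\mathbf y)=H(\bigcup\{R(v,\mathbf y)\mid v\in x\},x,\mathbf y)$. A class is p.r. if it has the form $\{x\mid \emptyset\in F(x)\}$ with $F$ p.r. Functions and classes may depend on parameters. $\mathsf{ATR_0^{set}}$ is the first-order theory in the language with $\in$, $=$ and a function symbol for each construction of a p.r. set function. Its axioms are the defining equations of these symbols, extensionality, foundation (every non-empty set has an $\in$-minimal element), infinity, axiom beta (every well-founded relation $r$ admits a function $f$ on its field with $f(y)=\{f(x)\mid (x,y)\in r\}$) and countability (every set injects into $\omega$). **Predilators and dilators.** Let $\mathsf{Nat}$ be the category of the orders $n=\{0,\dots,n-1\}$ and order embeddings. A *predilator* $D$ is a functor from $\mathsf{Nat}$ to linear orders and embeddings that is monotone ($f\le g$ pointwise implies $D(f)\le D(g)$), together with natural maps $\operatorname{supp}_n$ from $D(n)$ to the set of subsets of $n$, such that $\operatorname{supp}_n(\sigma)\subseteq\operatorname{rng}(f)$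 implies $\sigma\in\operatorname{rng}(D(f))$ for every $f:m\to n$. Its trace is $\operatorname{Tr}(D)=\{(\sigma,n)\mid \sigma\in D(n),\ \operatorname{supp}_n(\sigma)=n\}$. For a linear order $X$, let $D(X)$ be the set of pairs $(\sigma,a)$ with $a\subseteq X$ finite and $(\sigma,|a|)\in\operatorname{Tr}(D)$. Here $(\sigma,a)<(\tau,b)$ holds if $D(f)(\sigma)<D(g)(\tau)$ in $D(|a\cup b|)$, where $f:|a|\to|a\cup b|$ and $g:|b|\to|a\cup b|$ are induced by the inclusions of $a$ and $b$ in $a\cup b$. A *dilator* is a predilator $D$ such that $D(X)$ is well-founded for every well order $X$. **Components.** For trace elements, $(\sigma,n)\ll(\tau,k)$ means that $D(f)(\sigma)<D(g)(\tau)$ for all embeddings $f:n\to n+k$ and $g:k\to n+k$. Write $\equiv$ for the equivalence relation of being $\ll$-incomparable, and let $L=\operatorname{Tr}(D)/{\equiv}$ be linearly ordered by $\ll$. For $\alpha\in L$ let $D_\alpha\subseteq D$ be the subfunctor of all $D(f)(\sigma)$ with $(\sigma,k)\in\alpha$ and $f:k\to n$. Then the $D_\alpha$ are connected (have one $\equiv$-class)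 and $D\cong\sum_{\alpha\in L}D_\alpha$. We say that $D$ has type $0$ if $L=\emptyset$; type $\omega$ if $L\ne\emptyset$ has no largest element; type $1$ if $L$ has a largest element $\mu$ and $D_\mu\cong 1$ (the constant functor with one-element values); and type $\Omega$ if $L$ has a largest element $\mu$ and $D_\mu\not\cong 1$. **Separation of variables.** Let $E\not\cong 1$ be connected. For $(\sigma,n)\in\operatorname{Tr}(E)$ let $i(\sigma)$ be the unique $i<n$ such that $f(i)<g(i)$ implies $E(f)(\sigma)<E(g)(\sigma)$ for all embeddings $f,g:n\to 2n$. For an ordinal $\gamma$ let $\{E\}^\gamma(n)$ be the suborder of $E(\gamma+n)$ that consists of all $(\sigma,\{a_0<\dots<a_{k-1}\})$ such that $i(\sigma)$ is the largest $i<k$ with $a_i<\gamma$. Morphisms $f$ act as $E(\gamma+f)$, where $\gamma+f$ is the identity below $\gamma$ and maps $\gamma+x$ to $\gamma+f(x)$. The support of $(\sigma,a)$ is $\{x<n\mid\gamma+x\in a\}$. **Predecessors.** For an ordinal $\xi$, put $$P_\xi(D)=\begin{cases}\emptyset&\text{if $D$ has type }0,\\ \{\sum_{\alpha<\mu}D_\alpha\}&\text{if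 $D$ has type }1\text{ with }\mu=\max L,\\ \{\sum_{\alpha<\nu}D_\alpha\mid\nu\in L\}&\text{if $D$ has type }\omega,\\ \{\sum_{\alpha<\mu}D_\alpha+\{D_\mu\}^\gamma\mid\gamma<\xi\}&\text{if $D$ has type }\Omega\text{ with }\mu=\max L.\end{cases}$$ **Theorem (Guarded Induction on Dilators).** For all p.r. function symbols that define a class $Q$ and a function $G$ (with arbitrary parameters), the following is provable in $\mathsf{ATR_0^{set}}$; equivalently, it holds in every model of $\mathsf{ATR_0^{set}}$, with all the notions above interpreted in the model. Suppose that $G(D)$ is an ordinal for every dilator $D$, and that every dilator $D$ with $P_{G(D)}(D)\subseteq Q$ lies in $Q$. Then $Q$ contains every dilator. -/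

import Mathlib

open FirstOrder FirstOrder.Language

universe u

namespace PRST

/-! ## The language of primitive recursive set theory with `ω` -/

/-- Function symbols: one for each construction of a primitive recursive set function of
Jensen and Karp, with `∅` and `ω` as constants. -/
inductive PRSet : ℕ → Type
  | emp : PRSet 0
  | omega : PRSet 0
  | proj {n : ℕ} (i : Fin n) : PRSet n
  /-- `(x, y) ↦ x ∪ {y}` -/
  | adj : PRSet 2
  /-- `(x₀, x₁, x₂, x₃) ↦ x₀` if `x₂ ∈ x₃`, and `x₁` otherwise -/
  | cond : PRSet 4
  /-- `x ↦ F(G₀(x), …, Gₘ₋₁(x))` -/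
  | comp {n m : ℕ} (F : PRSet m) (G : Fin m → PRSet n) : PRSet n
  /-- the function `R` with `R(x, y) = H(⋃ {R(v, y) | v ∈ x}, x, y)` -/
  | recur {k : ℕ} (H : PRSet (k + 2)) : PRSet (k + 1)

/-- The only relation symbol (besides equality) is the binary `∈`. -/
inductive PRRel : ℕ → Type
  | mem : PRRel 2

/-- The language of primitive recursive set theory. -/
def prsLang : Language := ⟨PRSet, PRRel⟩

/-! ## The theory `ATR₀^set`

In the sentences below `&i` is the variable bound by the `i`-th enclosing quantifier, where the
outermost one has index `0`. -/

section Theory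

/-- Terms with variables among `&0, …, &(n-1)`. -/
abbrev Tm (n : ℕ) := prsLang.Term (Empty ⊕ Fin n)

/-- Formulas with free variables among `&0, …, &(n-1)`. -/
abbrev Fml (n : ℕ) := prsLang.BoundedFormula Empty n

def fn {n m : ℕ} (f : PRSet m) (t : Fin m → Tm n) : Tm n := Term.func (L := prsLang) f t

def tEmp {n : ℕ} : Tm n := fn PRSet.emp ![]

def tOmega {n : ℕ} : Tm n := fn PRSet.omega ![]

def tAdj {n : ℕ} (s t : Tm n) : Tm n := fn PRSet.adj ![s, t]

/-- Kuratowski pairs `{{s}, {s, t}}`. -/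
def tPair {n : ℕ} (s t : Tm n) : Tm n :=
  tAdj (tAdj tEmp (tAdj tEmp s)) (tAdj (tAdj tEmp s) t)

def fMem {n : ℕ} (s t : Tm n) : Fml n :=
  BoundedFormula.rel (L := prsLang) (R := PRRel.mem) ![s, t]

/-- All variables of the context. -/
def vars (n : ℕ) : Fin n → Tm n := fun i => &i

def axExt : prsLang.Sentence :=
  ∀' ∀' ((∀' (fMem &2 &0 ⇔ fMem &2 &1)) ⟹ ((&0 : Tm 2) =' &1))

def axFoundation : prsLang.Sentence :=
  ∀' ((∃' fMem &1 &0) ⟹ ∃' (fMem &1 &0 ⊓ ∀' (fMem &2 &0 ⟹ ∼(fMem &2 &1))))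

/-- Infinity: `z ∈ ω` if and only if `z` is empty or `z = m ∪ {m}` for some `m ∈ ω`. -/
def axInfinity : prsLang.Sentence :=
  ∀' (fMem &0 tOmega ⇔ (((&0 : Tm 1) =' tEmp) ⊔
    ∃' (fMem &1 tOmega ⊓ ((&0 : Tm 2) =' tAdj &1 &1))))

def axEmp : prsLang.Sentence := ∀' ∼(fMem &0 tEmp)

def axProj (n : ℕ) (i : Fin n) : prsLang.Sentence :=
  BoundedFormula.alls (fn (PRSet.proj i) (vars n) =' vars n i)

def axAdj : prsLang.Sentence :=
  ∀' ∀' ∀' (fMem &2 (tAdj &0 &1) ⇔ (fMem &2 &0 ⊔ ((&2 : Tm 3) =' &1)))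

def axCond : prsLang.Sentence :=
  ∀' ∀' ∀' ∀' ((fMem &2 &3 ⟹ (fn PRSet.cond (vars 4) =' &0)) ⊓
    (∼(fMem &2 &3) ⟹ (fn PRSet.cond (vars 4) =' &1)))

def axComp (n m : ℕ) (F : PRSet m) (G : Fin m → PRSet n) : prsLang.Sentence :=
  BoundedFormula.alls
    (fn (PRSet.comp F G) (vars n) =' fn F (fun i => fn (G i) (vars n)))

/-- For all `x = &0` and `y = &1, …, &k` there is `u` such that
`z ∈ u ↔ ∃ v ∈ x, z ∈ R(v, y)` for all `z`, and `R(x, y) = H(u, x, y)`. -/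
def axRecur (k : ℕ) (H : PRSet (k + 2)) : prsLang.Sentence :=
  BoundedFormula.alls (n := k + 1) (∃'
    ((∀' (fMem &(Fin.last (k + 2)) &((Fin.last (k + 1)).castSucc) ⇔
        ∃' (fMem &(Fin.last (k + 3)) &0 ⊓
          fMem &((Fin.last (k + 2)).castSucc)
            (fn (PRSet.recur H) (Fin.cons &(Fin.last (k + 3))
              (fun i : Fin k => &((i.succ.castAdd 3)))))))) ⊓
      (fn (PRSet.recur H) (fun i : Fin (k + 1) => &(i.castSucc)) ='
        fn H (Fin.cons &(Fin.last (k + 1)) (fun i : Fin (k + 1) => &(i.castSucc))))))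

/-- `t` lies in the field of the relation `r = &0`. -/
def inField {n : ℕ} : Fml (n + 2) :=
  ∃' (fMem (tPair &(Fin.last (n + 2)) &((Fin.last (n + 1)).castSucc)) &0 ⊔
    fMem (tPair &((Fin.last (n + 1)).castSucc) &(Fin.last (n + 2))) &0)

/-- Axiom beta: every well-founded relation `r` admits a function `f` whose domain is the field of
`r`, with `f(y) = {f(x) | (x, y) ∈ r}`. -/
def axBeta : prsLang.Sentence :=
  ∀' ((∀' ((∃' fMem &2 &1) ⟹
        ∃' (fMem &2 &1 ⊓ ∀' (fMem &3 &1 ⟹ ∼(fMem (tPair &3 &2) &0))))) ⟹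
    ∃' ((∀' (fMem &2 &1 ⟹ ∃' (inField ⊓ ∃' ((&2 : Tm 5) =' tPair &3 &4)))) ⊓
      (∀' (inField ⟹ ∃' fMem (tPair &2 &3) &1)) ⊓
      (∀' ∀' ∀' (fMem (tPair &2 &3) &1 ⟹ fMem (tPair &2 &4) &1 ⟹ ((&3 : Tm 5) =' &4))) ⊓
      (∀' ∀' (fMem (tPair &2 &3) &1 ⟹
        ∀' (fMem &4 &3 ⇔ ∃' (fMem (tPair &5 &2) &0 ⊓ fMem (tPair &5 &4) &1))))))

/-- Countability: every set `x` admits an injection `g : x → ω`. -/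
def axCount : prsLang.Sentence :=
  ∀' ∃' ((∀' (fMem &2 &1 ⟹ ∃' ∃' (fMem &3 &0 ⊓ fMem &4 tOmega ⊓ ((&2 : Tm 5) =' tPair &3 &4)))) ⊓
    (∀' (fMem &2 &0 ⟹ ∃' fMem (tPair &2 &3) &1)) ⊓
    (∀' ∀' ∀' (fMem (tPair &2 &3) &1 ⟹ fMem (tPair &2 &4) &1 ⟹ ((&3 : Tm 5) =' &4))) ⊓
    (∀' ∀' ∀' (fMem (tPair &2 &4) &1 ⟹ fMem (tPair &3 &4) &1 ⟹ ((&2 : Tm 5) =' &3))))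

/-- Primitive recursive set theory with infinity, `PRSω`. -/
inductive PRSomega : prsLang.Sentence → Prop
  | ext : PRSomega axExt
  | foundation : PRSomega axFoundation
  | infinity : PRSomega axInfinity
  | emp : PRSomega axEmp
  | proj (n : ℕ) (i : Fin n) : PRSomega (axProj n i)
  | adj : PRSomega axAdj
  | cond : PRSomega axCond
  | comp (n m : ℕ) (F : PRSet m) (G : Fin m → PRSet n) : PRSomega (axComp n m F G)
  | recur (k : ℕ) (H : PRSet (k + 2)) : PRSomega (axRecur k H)

/-- `ATR₀^set` extends `PRSω` by axiom beta and the axiom of countability. -/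
def ATR0set : prsLang.Theory := {φ | PRSomega φ ∨ φ = axBeta ∨ φ = axCount}

end Theory

/-! ## Basic set theory inside a structure `M`

All notions below are internal to `M`: every quantifier ranges over elements of `M`, so that each
predicate is given by a first-order formula. -/

section Basic

variable {M : Type u} [prsLang.Structure M]

/-- The interpretation of a primitive recursive function symbol. -/
def ev {n : ℕ} (f : PRSet n) (x : Fin n → M) : M := Structure.funMap (L := prsLang) f x

def Mem (x y : M) : Prop := Structure.RelMap (L := prsLang) (M := M) PRRel.mem ![x, y]

infix:50 " ∈ₛ " => Mem

variable (M) in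
def emp : M := ev PRSet.emp ![]

variable (M) in
def om : M := ev PRSet.omega ![]

def adj (x y : M) : M := ev PRSet.adj ![x, y]

/-- Kuratowski pairs. -/
def pr (x y : M) : M := adj (adj (emp M) (adj (emp M) x)) (adj (adj (emp M) x) y)

/-- `x` is an ordinal: a transitive set of transitive sets. -/
def IsOrd (x : M) : Prop :=
  (∀ y, y ∈ₛ x → ∀ z, z ∈ₛ y → z ∈ₛ x) ∧
    ∀ y, y ∈ₛ x → ∀ z, z ∈ₛ y → ∀ w, w ∈ₛ z → w ∈ₛ y

/-- `f` is a function with domain `a`. -/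
def IsFun (f a : M) : Prop :=
  (∀ p, p ∈ₛ f → ∃ x y, x ∈ₛ a ∧ p = pr x y) ∧ ∀ x, x ∈ₛ a → ∃! y, pr x y ∈ₛ f

/-- `f` is a function from `a` to `b`. -/
def IsMap (f a b : M) : Prop := IsFun f a ∧ ∀ x y, pr x y ∈ₛ f → y ∈ₛ b

/-- `r` is a set of pairs of elements of `A`. -/
def IsRelOn (r A : M) : Prop := ∀ p, p ∈ₛ r → ∃ x y, x ∈ₛ A ∧ y ∈ₛ A ∧ p = pr x y

/-- `(A, r)` is a (strict) linear order. -/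
def IsLinOrd (A r : M) : Prop :=
  IsRelOn r A ∧ (∀ x, ¬ pr x x ∈ₛ r) ∧
    (∀ x y z, pr x y ∈ₛ r → pr y z ∈ₛ r → pr x z ∈ₛ r) ∧
    ∀ x y, x ∈ₛ A → y ∈ₛ A → pr x y ∈ₛ r ∨ x = y ∨ pr y x ∈ₛ r

/-- `(A, r)` is a well order. -/
def IsWellOrd (A r : M) : Prop :=
  IsLinOrd A r ∧ ∀ Z, (∃ z, z ∈ₛ Z) → (∀ z, z ∈ₛ Z → z ∈ₛ A) →
    ∃ z, z ∈ₛ Z ∧ ∀ w, w ∈ₛ Z → ¬ pr w z ∈ₛ r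

/-- `f : m → n` is a morphism of the category `Nat`. -/
def IsMor (m n f : M) : Prop :=
  m ∈ₛ om M ∧ n ∈ₛ om M ∧ IsMap f m n ∧
    ∀ i j x y, i ∈ₛ j → pr i x ∈ₛ f → pr j y ∈ₛ f → x ∈ₛ y

/-- `δ = γ + x` for ordinals `γ`, `x`: there is an increasing bijection from `x` onto `δ ∖ γ`. -/
def IsAdd (γ x δ : M) : Prop :=
  IsOrd γ ∧ IsOrd x ∧ IsOrd δ ∧ (∀ z, z ∈ₛ γ → z ∈ₛ δ) ∧
    ∃ s, IsFun s x ∧ (∀ i j y z, i ∈ₛ j → pr i y ∈ₛ s → pr j z ∈ₛ s → y ∈ₛ z) ∧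
      ∀ y, (∃ i, pr i y ∈ₛ s) ↔ y ∈ₛ δ ∧ ¬ y ∈ₛ γ

/-- `a` is a finite subset of the set `A`, linearly ordered by `lt`, with `n = |a|` and with
increasing enumeration `e = en_a : n → A`. -/
def IsEnum (A : M) (lt : M → M → Prop) (a n e : M) : Prop :=
  n ∈ₛ om M ∧ IsMap e n A ∧
    (∀ i j x y, i ∈ₛ j → pr i x ∈ₛ e → pr j y ∈ₛ e → lt x y) ∧
    ∀ x, x ∈ₛ a ↔ ∃ i, pr i x ∈ₛ e

end Basic

/-! ## The axioms, unfolded in a structure `M` -/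

section Realize
variable {M : Type u} [prsLang.Structure M]

theorem realize_fn {n m : ℕ} (f : PRSet m) (t : Fin m → Tm n) (v : Empty ⊕ Fin n → M) :
    (fn f t).realize v = ev f (fun i => (t i).realize v) := rfl

theorem realize_tEmp {n : ℕ} (v : Empty ⊕ Fin n → M) : (tEmp : Tm n).realize v = emp M := by
  simp only [tEmp, realize_fn, emp]; congr 1; funext i; exact i.elim0

theorem realize_tOmega {n : ℕ} (v : Empty ⊕ Fin n → M) : (tOmega : Tm n).realize v = om M := by
  simp only [tOmega, realize_fn, om]; congr 1; funext i; exact i.elim0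

theorem realize_tAdj {n : ℕ} (s t : Tm n) (v : Empty ⊕ Fin n → M) :
    (tAdj s t).realize v = adj (s.realize v) (t.realize v) := by
  simp only [tAdj, realize_fn, adj]; congr 1; funext i; fin_cases i <;> rfl

theorem realize_tPair {n : ℕ} (s t : Tm n) (v : Empty ⊕ Fin n → M) :
    (tPair s t).realize v = pr (s.realize v) (t.realize v) := by
  simp only [tPair, pr, realize_tAdj, realize_tEmp]

theorem realize_fMem {n : ℕ} (s t : Tm n) (v : Empty → M) (xs : Fin n → M) :
    (fMem s t).Realize v xs ↔
      s.realize (Sum.elim v xs) ∈ₛ t.realize (Sum.elim v xs) := by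
  simp only [Mem]
  have h : ![s.realize (Sum.elim v xs), t.realize (Sum.elim v xs)] =
      fun i => ((![s, t] : Fin 2 → Tm n) i).realize (Sum.elim v xs) := by
    funext i; fin_cases i <;> rfl
  rw [h]; rfl

theorem realize_axExt : M ⊨ axExt ↔ ∀ x y : M, (∀ z, z ∈ₛ x ↔ z ∈ₛ y) → x = y := by
  simp [axExt, Sentence.Realize, Formula.Realize, realize_fMem, Fin.snoc]

theorem realize_axFoundation : M ⊨ axFoundation ↔
    ∀ x : M, (∃ y, y ∈ₛ x) → ∃ y, y ∈ₛ x ∧ ∀ z, z ∈ₛ x → ¬ z ∈ₛ y := by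
  simp [axFoundation, Sentence.Realize, Formula.Realize, realize_fMem, Fin.snoc]

theorem realize_axInfinity : M ⊨ axInfinity ↔
    ∀ z : M, z ∈ₛ om M ↔ z = emp M ∨ ∃ m, m ∈ₛ om M ∧ z = adj m m := by
  simp [axInfinity, Sentence.Realize, Formula.Realize, realize_fMem, realize_tEmp,
    realize_tOmega, realize_tAdj, Fin.snoc]

theorem realize_axEmp : M ⊨ axEmp ↔ ∀ z : M, ¬ z ∈ₛ emp M := by
  simp [axEmp, Sentence.Realize, Formula.Realize, realize_fMem, realize_tEmp, Fin.snoc]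

theorem realize_axProj (n : ℕ) (i : Fin n) : M ⊨ axProj n i ↔
    ∀ x : Fin n → M, ev (PRSet.proj i) x = x i := by
  exact BoundedFormula.realize_alls.trans Iff.rfl

theorem realize_axAdj : M ⊨ axAdj ↔
    ∀ x y z : M, z ∈ₛ adj x y ↔ z ∈ₛ x ∨ z = y := by
  simp [axAdj, Sentence.Realize, Formula.Realize, realize_fMem, realize_tAdj, Fin.snoc]

theorem realize_axCond : M ⊨ axCond ↔ ∀ a b c d : M,
    (c ∈ₛ d → ev PRSet.cond ![a, b, c, d] = a) ∧ (¬ c ∈ₛ d → ev PRSet.cond ![a, b, c, d] = b) := by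
  have key : ∀ a b c d : M, (fun i : Fin 4 => (Fin.snoc (Fin.snoc (Fin.snoc
      (Fin.snoc (default : Fin 0 → M) a : Fin 1 → M) b : Fin 2 → M) c : Fin 3 → M) d : Fin 4 → M) i)
      = ![a, b, c, d] := by
    intro a b c d; funext i; fin_cases i <;> rfl
  simp only [axCond, Sentence.Realize, Formula.Realize, BoundedFormula.realize_all,
    BoundedFormula.realize_inf, BoundedFormula.realize_imp, BoundedFormula.realize_not,
    BoundedFormula.realize_bdEqual, realize_fMem, realize_fn, vars, Term.realize_var,
    Function.comp, Sum.elim_inr, key]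
  rfl

theorem realize_axComp (n m : ℕ) (F : PRSet m) (G : Fin m → PRSet n) : M ⊨ axComp n m F G ↔
    ∀ x : Fin n → M, ev (PRSet.comp F G) x = ev F (fun i => ev (G i) x) := by
  exact BoundedFormula.realize_alls.trans Iff.rfl

theorem realize_axRecur (k : ℕ) (H : PRSet (k + 2)) : M ⊨ axRecur k H ↔
    ∀ (x : M) (y : Fin k → M), ∃ u : M,
      (∀ z, z ∈ₛ u ↔ ∃ v, v ∈ₛ x ∧ z ∈ₛ ev (PRSet.recur H) (Fin.cons v y)) ∧
      ev (PRSet.recur H) (Fin.cons x y) = ev H (Fin.cons u (Fin.cons x y)) := by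
  refine BoundedFormula.realize_alls.trans ?_
  have e1 : ∀ (t : Fin (k + 1) → M) (u : M) (f : PRSet (k + 2)),
      ev f (fun i => Term.realize (L := prsLang)
        (Sum.elim (default : Empty → M) (Fin.snoc t u : Fin (k + 2) → M))
        ((Fin.cons (Term.var (Sum.inr (Fin.last (k + 1)))) (fun i : Fin (k + 1) => Term.var (Sum.inr i.castSucc)) :
          Fin (k + 2) → Tm (k + 2)) i)) = ev f (Fin.cons u t) := by
    intro t u f
    congr 1; funext i
    refine Fin.cases ?_ (fun i => ?_) i <;> simp
  have e2 : ∀ (t : Fin (k + 1) → M) (u z v : M) (f : PRSet (k + 1)),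
      ev f (fun i => Term.realize (L := prsLang)
        (Sum.elim (default : Empty → M)
          (Fin.snoc (Fin.snoc (Fin.snoc t u : Fin (k + 2) → M) z : Fin (k + 3) → M) v :
            Fin (k + 4) → M))
        ((Fin.cons (Term.var (Sum.inr (Fin.last (k + 3)))) (fun i : Fin k => Term.var (Sum.inr (i.succ.castAdd 3))) :
          Fin (k + 1) → Tm (k + 4)) i)) = ev f (Fin.cons v (Fin.tail t)) := by
    intro t u z v f
    congr 1; funext i
    refine Fin.cases ?_ (fun i => ?_) i
    · simp
    · have : (i.succ.castAdd 3 : Fin (k + 4)) = i.succ.castSucc.castSucc.castSucc := rfl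
      rw [Fin.cons_succ, Fin.cons_succ, Term.realize_var, Sum.elim_inr, this, Fin.snoc_castSucc,
        Fin.snoc_castSucc, Fin.snoc_castSucc]
      rfl
  have e0 : ∀ (t : Fin (k + 1) → M) (u z v : M),
      (Fin.snoc (Fin.snoc (Fin.snoc t u : Fin (k + 2) → M) z : Fin (k + 3) → M) v :
            Fin (k + 4) → M) 0 = t 0 := by
    intro t u z v
    have : (0 : Fin (k + 4)) = (0 : Fin (k + 1)).castSucc.castSucc.castSucc := rfl
    rw [this]; simp
  simp only [BoundedFormula.realize_ex, BoundedFormula.realize_inf, BoundedFormula.realize_all,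
    BoundedFormula.realize_iff, realize_fMem, BoundedFormula.realize_bdEqual, realize_fn,
    Term.realize_var, Function.comp, Sum.elim_inr, e0, Fin.snoc_last, Fin.snoc_castSucc]
  simp only [e1, e2]
  constructor
  · intro h x y
    simpa only [Fin.cons_zero, Fin.tail_cons] using h (Fin.cons x y)
  · intro h t
    have := h (t 0) (Fin.tail t)
    rwa [Fin.cons_self_tail] at this

theorem realize_inField {n : ℕ} (v : Empty → M) (xs : Fin (n + 2) → M) :
    (inField (n := n)).Realize v xs ↔
      ∃ x, pr x (xs (Fin.last _)) ∈ₛ xs 0 ∨ pr (xs (Fin.last _)) x ∈ₛ xs 0 := by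
  have h0 : ∀ x : M, (Fin.snoc xs x : Fin (n + 3) → M) 0 = xs 0 := fun x =>
    Fin.snoc_castSucc (α := fun _ => M) x xs 0
  simp [inField, realize_fMem, realize_tPair, h0]

theorem realize_axBeta : M ⊨ axBeta ↔ ∀ r : M,
    (∀ a, (∃ x, x ∈ₛ a) → ∃ y, y ∈ₛ a ∧ ∀ x, x ∈ₛ a → ¬ pr x y ∈ₛ r) →
    ∃ f, (∀ p, p ∈ₛ f → ∃ y, (∃ x, pr x y ∈ₛ r ∨ pr y x ∈ₛ r) ∧ ∃ v, p = pr y v) ∧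
      (∀ y, (∃ x, pr x y ∈ₛ r ∨ pr y x ∈ₛ r) → ∃ v, pr y v ∈ₛ f) ∧
      (∀ y v w, pr y v ∈ₛ f → pr y w ∈ₛ f → v = w) ∧
      (∀ y v, pr y v ∈ₛ f → ∀ z, z ∈ₛ v ↔ ∃ x, pr x y ∈ₛ r ∧ pr x z ∈ₛ f) := by
  simp [axBeta, Sentence.Realize, Formula.Realize, realize_fMem, realize_tPair,
    realize_inField, Fin.snoc, and_assoc]

theorem realize_axCount : M ⊨ axCount ↔ ∀ x : M, ∃ g,
    (∀ p, p ∈ₛ g → ∃ y n, y ∈ₛ x ∧ n ∈ₛ om M ∧ p = pr y n) ∧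
    (∀ y, y ∈ₛ x → ∃ n, pr y n ∈ₛ g) ∧
    (∀ y n m, pr y n ∈ₛ g → pr y m ∈ₛ g → n = m) ∧
    (∀ y z n, pr y n ∈ₛ g → pr z n ∈ₛ g → y = z) := by
  simp [axCount, Sentence.Realize, Formula.Realize, realize_fMem, realize_tPair, realize_tOmega,
    Fin.snoc, and_assoc]

end Realize

/-! ## Predilators -/

/-- The relations that describe a functor `D : Nat → LO` together with functions
`supp_n : D(n) → [n]^{<ω}`, given as definable relations on `M`. -/
structure Data (M : Type u) where
  /-- `el n σ`: `σ ∈ D(n)` -/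
  el : M → M → Prop
  /-- `lt n σ τ`: `σ < τ` in `D(n)` -/
  lt : M → M → M → Prop
  /-- `act m n f σ τ`: `D(f)(σ) = τ` for `f : m → n` -/
  act : M → M → M → M → M → Prop
  /-- `supp n σ a`: `supp_n(σ) = a` -/
  supp : M → M → M → Prop

section Predilators

variable {M : Type u} [prsLang.Structure M]

/-- `D = (O, F, S)`, where `O` maps `n ∈ ω` to a set with a binary relation, `F` maps each
morphism `f : m → n` of `Nat`, represented by `(m, (n, f))`, to a function from (the carrier of)
`O(m)` to `O(n)`, and `S` maps `n ∈ ω` to a function from `O(n)` to the set of subsets of `n`. -/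
def IsData (D : M) : Prop :=
  ∃ O F S, D = pr O (pr F S) ∧
    IsFun O (om M) ∧
    (∀ n p, pr n p ∈ₛ O → ∃ A r, p = pr A r ∧ IsRelOn r A) ∧
    (∀ p, p ∈ₛ F → ∃ m n f g, IsMor m n f ∧ p = pr (pr m (pr n f)) g) ∧
    (∀ m n f, IsMor m n f → ∃! g, pr (pr m (pr n f)) g ∈ₛ F) ∧
    (∀ m n f g A r B s, pr (pr m (pr n f)) g ∈ₛ F → pr m (pr A r) ∈ₛ O → pr n (pr B s) ∈ₛ O →
      IsMap g A B) ∧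
    IsFun S (om M) ∧
    (∀ n g A r, pr n g ∈ₛ S → pr n (pr A r) ∈ₛ O →
      IsFun g A ∧ ∀ σ a, pr σ a ∈ₛ g → ∀ i, i ∈ₛ a → i ∈ₛ n)

/-- The relations described by the set `D = (O, F, S)`. -/
def dat (D : M) : Data M where
  el n σ := ∃ O F S A r, D = pr O (pr F S) ∧ pr n (pr A r) ∈ₛ O ∧ σ ∈ₛ A
  lt n σ τ := ∃ O F S A r, D = pr O (pr F S) ∧ pr n (pr A r) ∈ₛ O ∧ pr σ τ ∈ₛ r
  act m n f σ τ := ∃ O F S g, D = pr O (pr F S) ∧ pr (pr m (pr n f)) g ∈ₛ F ∧ pr σ τ ∈ₛ g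
  supp n σ a := ∃ O F S g, D = pr O (pr F S) ∧ pr n g ∈ₛ S ∧ pr σ a ∈ₛ g

/-- The set `D` is the triple `(O, F, S)` that represents the relations `P`. -/
def Codes (D : M) (P : Data M) : Prop :=
  IsData D ∧
    (∀ n, n ∈ₛ om M → ∀ σ, (dat D).el n σ ↔ P.el n σ) ∧
    (∀ n, n ∈ₛ om M → ∀ σ τ, (dat D).lt n σ τ ↔ P.lt n σ τ) ∧
    (∀ m n f, IsMor m n f → ∀ σ τ, (dat D).act m n f σ τ ↔ P.act m n f σ τ) ∧
    (∀ n, n ∈ₛ om M → ∀ σ a, (dat D).supp n σ a ↔ P.supp n σ a)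

/-- The conditions on a monotone functor `Nat → LO` with natural support functions that satisfy
the support condition. -/
structure Data.Laws (P : Data M) : Prop where
  irrefl : ∀ n σ, n ∈ₛ om M → ¬ P.lt n σ σ
  trans : ∀ n σ τ ρ, n ∈ₛ om M → P.lt n σ τ → P.lt n τ ρ → P.lt n σ ρ
  total : ∀ n σ τ, n ∈ₛ om M → P.el n σ → P.el n τ → P.lt n σ τ ∨ σ = τ ∨ P.lt n τ σ
  /-- each `D(f)` is an embedding -/
  emb : ∀ m n f σ τ σ' τ', IsMor m n f → P.act m n f σ σ' → P.act m n f τ τ' →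
    P.lt m σ τ → P.lt n σ' τ'
  map_id : ∀ n f σ, IsMor n n f → (∀ i, i ∈ₛ n → pr i i ∈ₛ f) → P.el n σ → P.act n n f σ σ
  map_comp : ∀ m n k f g h σ τ ρ, IsMor m n f → IsMor n k g → IsMor m k h →
    (∀ i j l, pr i j ∈ₛ f → pr j l ∈ₛ g → pr i l ∈ₛ h) →
    P.act m n f σ τ → P.act n k g τ ρ → P.act m k h σ ρ
  monotone : ∀ m n f g σ τ ρ, IsMor m n f → IsMor m n g →
    (∀ i x y, pr i x ∈ₛ f → pr i y ∈ₛ g → x ∈ₛ y ∨ x = y) →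
    P.act m n f σ τ → P.act m n g σ ρ → P.lt n τ ρ ∨ τ = ρ
  supp_nat : ∀ m n f σ τ a b, IsMor m n f → P.act m n f σ τ → P.supp m σ a → P.supp n τ b →
    ∀ y, y ∈ₛ b ↔ ∃ x, x ∈ₛ a ∧ pr x y ∈ₛ f
  /-- if `supp_n(σ) ⊆ rng(f)`, then `σ ∈ rng(D(f))` -/
  supp_cond : ∀ m n f σ a, IsMor m n f → P.supp n σ a →
    (∀ y, y ∈ₛ a → ∃ x, pr x y ∈ₛ f) → ∃ τ, P.act m n f τ σ

/-- `D` is a predilator. -/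
def IsPredilator (D : M) : Prop := IsData D ∧ (dat D).Laws

/-- `(σ, n) ∈ Tr(D)` -/
def Data.Tr (P : Data M) (σ n : M) : Prop := n ∈ₛ om M ∧ P.el n σ ∧ P.supp n σ n

/-- `(σ, a)` is an element of the extension `D(A)`, for a set `A` linearly ordered by `lt`. -/
def Data.ExtEl (P : Data M) (A : M) (lt : M → M → Prop) (σ a : M) : Prop :=
  ∃ n e, IsEnum A lt a n e ∧ P.Tr σ n

/-- `(σ, a) < (τ, b)` in `D(A)`: this is decided in `D(|a ∪ b|)`. -/
def Data.ExtLt (P : Data M) (A : M) (lt : M → M → Prop) (σ a τ b : M) : Prop :=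
  P.ExtEl A lt σ a ∧ P.ExtEl A lt τ b ∧
  ∃ c n k l ea eb ec f g σ' τ', (∀ x, x ∈ₛ c ↔ x ∈ₛ a ∨ x ∈ₛ b) ∧
    IsEnum A lt a n ea ∧ IsEnum A lt b k eb ∧ IsEnum A lt c l ec ∧
    IsMor n l f ∧ (∀ i j x, pr i j ∈ₛ f → pr i x ∈ₛ ea → pr j x ∈ₛ ec) ∧
    IsMor k l g ∧ (∀ i j x, pr i j ∈ₛ g → pr i x ∈ₛ eb → pr j x ∈ₛ ec) ∧
    P.act n l f σ σ' ∧ P.act k l g τ τ' ∧ P.lt l σ' τ'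

/-- `D` is a dilator: a predilator such that `D(A)` is well-founded for every well order
`(A, r)`. -/
def IsDilator (D : M) : Prop :=
  IsPredilator D ∧ ∀ A r, IsWellOrd A r →
    ∀ Z, (∃ z, z ∈ₛ Z) →
      (∀ z, z ∈ₛ Z → ∃ σ a, z = pr σ a ∧ (dat D).ExtEl A (fun x y => pr x y ∈ₛ r) σ a) →
      ∃ τ b, pr τ b ∈ₛ Z ∧
        ∀ σ a, pr σ a ∈ₛ Z → ¬ (dat D).ExtLt A (fun x y => pr x y ∈ₛ r) σ a τ b

/-! ## Connected components and sums -/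

/-- `(σ, n) ≪ (τ, k)` for trace elements. -/
def Data.LL (P : Data M) (σ n τ k : M) : Prop :=
  ∃ N, IsAdd n k N ∧ ∀ f g σ' τ', IsMor n N f → IsMor k N g →
    P.act n N f σ σ' → P.act k N g τ τ' → P.lt N σ' τ'

/-- `(σ, n) ≡ (τ, k)` for trace elements. -/
def Data.Eqv (P : Data M) (σ n τ k : M) : Prop := ¬ P.LL σ n τ k ∧ ¬ P.LL τ k σ n

/-- `α` is an element of the order `L = Tr(D)/≡`, i.e. a class of trace elements. -/
def Data.Comp (P : Data M) (α : M) : Prop :=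
  ∃ σ n, P.Tr σ n ∧ ∀ p, p ∈ₛ α ↔ ∃ τ k, p = pr τ k ∧ P.Tr τ k ∧ P.Eqv σ n τ k

/-- `α < β` in `L = Tr(D)/≡`. -/
def Data.CompLt (P : Data M) (α β : M) : Prop :=
  P.Comp α ∧ P.Comp β ∧ ∃ σ n τ k, pr σ n ∈ₛ α ∧ pr τ k ∈ₛ β ∧ P.LL σ n τ k

/-- `σ ∈ D[α](n)` for a set `α` of trace elements: we have `σ = D(en_a)(σ₀)` with `a = supp_n(σ)`
and `(σ₀, |a|) ∈ α`. -/
def Data.subEl (P : Data M) (α n σ : M) : Prop :=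
  P.el n σ ∧ ∃ a k e σ₀, P.supp n σ a ∧ IsMor k n e ∧ (∀ y, y ∈ₛ a ↔ ∃ i, pr i y ∈ₛ e) ∧
    P.act k n e σ₀ σ ∧ pr σ₀ k ∈ₛ α

/-- `D[α]`. For `α ∈ L` this is the connected component `D_α`. -/
def Data.sub (P : Data M) (α : M) : Data M where
  el n σ := P.subEl α n σ
  lt n σ τ := P.subEl α n σ ∧ P.subEl α n τ ∧ P.lt n σ τ
  act m n f σ τ := P.subEl α m σ ∧ P.act m n f σ τ
  supp n σ a := P.subEl α n σ ∧ P.supp n σ a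

/-- `∑ D_α`, where `α` ranges over the class `I` linearly ordered by `lt`. -/
def sigma (I : M → Prop) (lt : M → M → Prop) (E : M → Data M) : Data M where
  el n ρ := ∃ α σ, ρ = pr α σ ∧ I α ∧ (E α).el n σ
  lt n ρ ρ' := ∃ α σ β τ, ρ = pr α σ ∧ ρ' = pr β τ ∧ I α ∧ I β ∧
    (E α).el n σ ∧ (E β).el n τ ∧ (lt α β ∨ α = β ∧ (E α).lt n σ τ)
  act m n f ρ ρ' := ∃ α σ τ, ρ = pr α σ ∧ ρ' = pr α τ ∧ I α ∧ (E α).act m n f σ τ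
  supp n ρ a := ∃ α σ, ρ = pr α σ ∧ I α ∧ (E α).supp n σ a

/-- `∑_{α < ν} D_α`, where `D ≅ ∑_{α ∈ L} D_α` with connected `D_α`. -/
def Data.below (P : Data M) (ν : M) : Data M :=
  sigma (fun α => P.CompLt α ν) P.CompLt P.sub

/-- `D + E`, i.e. the sum with index set `2 = {0, 1}`. -/
def Data.add (P Q : Data M) : Data M where
  el n ρ := ∃ σ, (ρ = pr (emp M) σ ∧ P.el n σ) ∨ (ρ = pr (adj (emp M) (emp M)) σ ∧ Q.el n σ)
  lt n ρ ρ' := ∃ σ τ,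
    (ρ = pr (emp M) σ ∧ ρ' = pr (emp M) τ ∧ P.lt n σ τ) ∨
    (ρ = pr (emp M) σ ∧ ρ' = pr (adj (emp M) (emp M)) τ ∧ P.el n σ ∧ Q.el n τ) ∨
    (ρ = pr (adj (emp M) (emp M)) σ ∧ ρ' = pr (adj (emp M) (emp M)) τ ∧ Q.lt n σ τ)
  act m n f ρ ρ' := ∃ σ τ,
    (ρ = pr (emp M) σ ∧ ρ' = pr (emp M) τ ∧ P.act m n f σ τ) ∨
    (ρ = pr (adj (emp M) (emp M)) σ ∧ ρ' = pr (adj (emp M) (emp M)) τ ∧ Q.act m n f σ τ)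
  supp n ρ a := ∃ σ, (ρ = pr (emp M) σ ∧ P.supp n σ a) ∨
    (ρ = pr (adj (emp M) (emp M)) σ ∧ Q.supp n σ a)

/-! ## Separation of variables -/

/-- `i = i(σ)` for `(σ, n) ∈ Tr(D)`, where `D ≠ 1` is connected. -/
def Data.Imp (P : Data M) (σ n i : M) : Prop :=
  i ∈ₛ n ∧ ∃ N, IsAdd n n N ∧ ∀ f g x y σ' τ', IsMor n N f → IsMor n N g →
    pr i x ∈ₛ f → pr i y ∈ₛ g → x ∈ₛ y →
    P.act n N f σ σ' → P.act n N g σ τ' → P.lt N σ' τ'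

/-- `(σ, a) ∈ {D}^γ(n)`: this is an element of `D(γ + n)` such that `i(σ)` is the maximal `i` for
which the `i`-th element of `a` lies below `γ`. -/
def Data.sepEl (P : Data M) (γ n σ a : M) : Prop :=
  ∃ N k e i x, IsAdd γ n N ∧ IsEnum N Mem a k e ∧ P.Tr σ k ∧ P.Imp σ k i ∧
    pr i x ∈ₛ e ∧ x ∈ₛ γ ∧ ∀ j y, pr j y ∈ₛ e → y ∈ₛ γ → j ∈ₛ i ∨ j = i

/-- `y = (γ + f)(x)`. -/
def AddMap (γ f x y : M) : Prop :=
  (x ∈ₛ γ ∧ y = x) ∨ ∃ i j, pr i j ∈ₛ f ∧ IsAdd γ i x ∧ IsAdd γ j y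

/-- `{D}^γ` for connected `D ≠ 1` and an ordinal `γ`. -/
def Data.sep (P : Data M) (γ : M) : Data M where
  el n ρ := ∃ σ a, ρ = pr σ a ∧ P.sepEl γ n σ a
  lt n ρ ρ' := ∃ σ a τ b, ρ = pr σ a ∧ ρ' = pr τ b ∧ P.sepEl γ n σ a ∧ P.sepEl γ n τ b ∧
    ∃ N, IsAdd γ n N ∧ P.ExtLt N Mem σ a τ b
  act m _ f ρ ρ' := ∃ σ a b, ρ = pr σ a ∧ ρ' = pr σ b ∧ P.sepEl γ m σ a ∧
    ∀ y, y ∈ₛ b ↔ ∃ x, x ∈ₛ a ∧ AddMap γ f x y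
  supp n ρ c := ∃ σ a, ρ = pr σ a ∧ P.sepEl γ n σ a ∧
    ∀ i, i ∈ₛ c ↔ i ∈ₛ n ∧ ∃ x, x ∈ₛ a ∧ IsAdd γ i x

/-! ## Types and predecessors -/

/-- `μ` is the largest element of `L = Tr(D)/≡`, i.e. `L = μ + 1`. -/
def Data.Top (P : Data M) (μ : M) : Prop :=
  P.Comp μ ∧ ∀ α, P.Comp α → α = μ ∨ P.CompLt α μ

/-- The predilator is (isomorphic to) the constant `1`. -/
def Data.IsOne (P : Data M) : Prop := ∀ n, n ∈ₛ om M → ∃! σ, P.el n σ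

/-- `D` has type `0`. -/
def Data.Type0 (P : Data M) : Prop := ¬ ∃ α, P.Comp α

/-- `D` has type `1`, with `L = μ + 1`. -/
def Data.Type1 (P : Data M) (μ : M) : Prop := P.Top μ ∧ (P.sub μ).IsOne

/-- `D` has type `ω`. -/
def Data.TypeOmega (P : Data M) : Prop := (∃ α, P.Comp α) ∧ ¬ ∃ μ, P.Top μ

/-- `D` has type `Ω`, with `L = μ + 1`. -/
def Data.TypeBigOmega (P : Data M) (μ : M) : Prop := P.Top μ ∧ ¬ (P.sub μ).IsOne

/-- `D' ∈ P_ξ(D)`. There is no such `D'` if `D` has type `0`. -/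
def IsPred (ξ D D' : M) : Prop :=
  (∃ μ, (dat D).Type1 μ ∧ Codes D' ((dat D).below μ)) ∨
  ((dat D).TypeOmega ∧ ∃ ν, (dat D).Comp ν ∧ Codes D' ((dat D).below ν)) ∨
  (∃ μ, (dat D).TypeBigOmega μ ∧ ∃ γ, IsOrd γ ∧ γ ∈ₛ ξ ∧
    Codes D' (((dat D).below μ).add (((dat D).sub μ).sep γ)))

/-- `x` lies in the primitive recursive class `{x | 0 ∈ q(x, p)}` with parameters `p`. -/
def InClass {k : ℕ} (q : PRSet (k + 1)) (p : Fin k → M) (x : M) : Prop :=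
  emp M ∈ₛ ev q (Fin.cons x p)

end Predilators

end PRST

set_option linter.unusedSectionVars false
set_option synthInstance.maxHeartbeats 400000
set_option synthInstance.maxSize 4096

/-! Write `P_ξ(D)` for the predecessors and let `D₀` be a dilator outside of `Q`. The predecessors
of a given `D` lie in a set that is primitive recursive in `D`, so `ω` iterations produce a set `T ∋
D₀` that is closed under predecessors (`exists_closure`). The order type of `D(X)`, for one
well-chosen well order `X`, drops when `D ∈ T` is replaced by a predecessor. An element of `T`
outside of `Q` with minimal order type then contradicts the assumption, once all elements of `T` are
known to be dilators.

The well order is `X = δ·ω + A`, where `δ` includes `ω` and every ordinal `γ ∈ G(D)` with `D ∈ T`.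
Moving each copy of `δ` to the next one embeds `X` into itself and leaves copy `0` free. An element
of `∑_{α<μ} D_α` becomes an element of `D` when its index is forgotten, and its arguments are then
shifted (`Room.reduces_below`). An element of `{D_μ}^γ(X)` is an element of `D_μ(γ + X)`, and `γ +
X` embeds into `X` by sending `γ` to copy `0` and shifting the rest (`Room.reduces_sep`). All images
lie below a single element of `D_μ` with arguments in copy `2`. For smaller components this is the
order of the components. For `{D_μ}^γ` the important coordinate is in copy `0`, so moving it to copy
`1` increases the element, and within one component a sufficiently large choice of arguments
outweighs the choice of the trace element (`Room.sep_Lt_bound`).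

To see that each `D ∈ T` is a dilator, let `A` be an arbitrary well order. Well-foundedness of
`D(X)` quantifies over all subsets, but foundation for sets yields induction only for primitive
recursive properties. Axiom beta turns well-foundedness of `D₀(X)` into a set `θ` of ranks
(`IsDilator.exists_ranked`). That `D(X)` is ranked by `θ` is primitive recursive, and it passes to
predecessors with an element of `θ` in place of `θ` (`Data.Reduces.ranked`). Hence all `D(X)` with
`D ∈ T` are ranked, and `D(A)` is well-founded since `A` is a final segment of `X`
(`Ranked.exists_minimal`). Before this point the value `G(D)` need not be an ordinal, so only its
elements that are ordinals are taken into account.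

The remaining work keeps all of this primitive recursive. The classes `PRf` and `PRp` derive
primitive recursiveness from the form of an expression, each notion receives a version with bounded
quantifiers, and families of predilators given by relations are turned into sets (`codes_code`),
which are determined by the relations (`Codes.unique`). -/

namespace PRST

/-! ## Primitive recursive functions on a model -/

/-- `M` is a model of `ATR₀^set`. -/
class SetModel (M : Type u) [prsLang.Structure M] : Prop where
  out : M ⊨ ATR0set

section PRFunctions

variable {M : Type u} [prsLang.Structure M]

/-- The function `F` is primitive recursive in parameters from `M`. -/
class PRf {n : ℕ} (F : (Fin n → M) → M) : Prop where
  out : ∃ (k : ℕ) (p : Fin k → M) (f : PRSet (n + k)), ∀ x, F x = ev f (Fin.append x p)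

variable [SetModel M]

theorem models_of {φ : prsLang.Sentence} (h : PRSomega φ) : M ⊨ φ :=
  (SetModel.out (M := M)).realize_of_mem _ (Or.inl h)

theorem mext {x y : M} (h : ∀ z, z ∈ₛ x ↔ z ∈ₛ y) : x = y :=
  realize_axExt.1 (models_of PRSomega.ext) x y h

theorem foundation (x : M) (h : ∃ y, y ∈ₛ x) : ∃ y, y ∈ₛ x ∧ ∀ z, z ∈ₛ x → ¬ z ∈ₛ y :=
  realize_axFoundation.1 (models_of PRSomega.foundation) x h

theorem mem_om_iff (z : M) : z ∈ₛ om M ↔ z = emp M ∨ ∃ m, m ∈ₛ om M ∧ z = adj m m :=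
  realize_axInfinity.1 (models_of PRSomega.infinity) z

@[simp] theorem not_mem_emp (z : M) : ¬ z ∈ₛ emp M :=
  realize_axEmp.1 (models_of PRSomega.emp) z

@[simp] theorem mem_adj {x y z : M} : z ∈ₛ adj x y ↔ z ∈ₛ x ∨ z = y :=
  realize_axAdj.1 (models_of PRSomega.adj) x y z

theorem ev_proj {n : ℕ} (i : Fin n) (x : Fin n → M) : ev (PRSet.proj i) x = x i :=
  (realize_axProj n i).1 (models_of (PRSomega.proj n i)) x

theorem ev_comp {n m : ℕ} (F : PRSet m) (G : Fin m → PRSet n) (x : Fin n → M) :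
    ev (PRSet.comp F G) x = ev F (fun i => ev (G i) x) :=
  (realize_axComp n m F G).1 (models_of (PRSomega.comp n m F G)) x

theorem ev_cond_pos {a b c d : M} (h : c ∈ₛ d) : ev PRSet.cond ![a, b, c, d] = a :=
  (realize_axCond.1 (models_of PRSomega.cond) a b c d).1 h

theorem ev_cond_neg {a b c d : M} (h : ¬ c ∈ₛ d) : ev PRSet.cond ![a, b, c, d] = b :=
  (realize_axCond.1 (models_of PRSomega.cond) a b c d).2 h

theorem ev_recur {k : ℕ} (H : PRSet (k + 2)) (x : M) (y : Fin k → M) : ∃ u : M,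
      (∀ z, z ∈ₛ u ↔ ∃ v, v ∈ₛ x ∧ z ∈ₛ ev (PRSet.recur H) (Fin.cons v y)) ∧
      ev (PRSet.recur H) (Fin.cons x y) = ev H (Fin.cons u (Fin.cons x y)) :=
  (realize_axRecur k H).1 (models_of (PRSomega.recur k H)) x y

instance PRf.proj {n : ℕ} (i : Fin n) : PRf (fun x : Fin n → M => x i) :=
  ⟨0, Fin.elim0, PRSet.proj (Fin.castAdd 0 i), fun x => by simp [ev_proj]⟩

instance PRf.const {n : ℕ} (c : M) : PRf (fun _ : Fin n → M => c) :=
  ⟨1, fun _ => c, PRSet.proj (Fin.natAdd n 0), fun x => by simp [ev_proj]⟩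

/-- Each `G i` comes with its own list of parameters. The lists are concatenated along `Σ i, Fin (k
i)`, and each `G i` reads off its own segment. -/
theorem PRf.ev {n m : ℕ} (f : PRSet m) (G : Fin m → (Fin n → M) → M) (hG : ∀ i, PRf (G i)) :
    PRf (fun x => ev f (fun i => G i x)) := by
  choose k p g h using fun i => (hG i).out
  refine ⟨∑ i, k i, fun j => p (finSigmaFinEquiv.symm j).1 (finSigmaFinEquiv.symm j).2,
    PRSet.comp f (fun i => PRSet.comp (g i) (Fin.addCases (fun a => PRSet.proj (Fin.castAdd _ a))
      (fun b => PRSet.proj (Fin.natAdd n (finSigmaFinEquiv ⟨i, b⟩))))), fun x => ?_⟩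
  rw [ev_comp]
  congr 1; funext i
  rw [ev_comp, h]
  congr 1; funext j
  refine Fin.addCases (fun a => ?_) (fun b => ?_) j
  · simp [ev_proj]
  · simp only [Fin.append_right, Fin.addCases_right, ev_proj]
    exact congrArg (fun s : Σ i, Fin (k i) => p s.1 s.2)
      (Equiv.symm_apply_apply finSigmaFinEquiv ⟨i, b⟩).symm

theorem PRf.subst {n m : ℕ} {F : (Fin m → M) → M} (hF : PRf F) (G : Fin m → (Fin n → M) → M)
    (hG : ∀ i, PRf (G i)) : PRf (fun x => F (fun i => G i x)) := by
  obtain ⟨k, q, f, hf⟩ := hF.out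
  have := PRf.ev f (Fin.addCases G (fun b _ => q b) : Fin (m + k) → (Fin n → M) → M)
    (fun i => Fin.addCases (fun a => by simpa using hG a) (fun b => by simpa using PRf.const _) i)
  convert this using 2 with x
  rw [hf]
  congr 1; funext j
  refine Fin.addCases (fun a => ?_) (fun b => ?_) j <;> simp

/-- The parameters of `H` have to be passed along the recursion as additional fixed arguments. -/
theorem PRf.exists_recur {n : ℕ} {H : (Fin (n + 2) → M) → M} (hH : PRf H) :
    ∃ R : (Fin (n + 1) → M) → M, PRf R ∧ ∀ (x : M) (y : Fin n → M), ∃ u : M,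
      (∀ z, z ∈ₛ u ↔ ∃ v, v ∈ₛ x ∧ z ∈ₛ R (Fin.cons v y)) ∧
      R (Fin.cons x y) = H (Fin.cons u (Fin.cons x y)) := by
  obtain ⟨k, p, h, hh⟩ := hH.out
  -- Identifies the arguments `(u, x, y)` followed by the parameters with the argument list of a
  -- symbol to which `recur` applies.
  let σ : Fin (n + 2 + k) → Fin (n + k + 2) :=
    Fin.addCases (Fin.cons 0 (Fin.cons 1 (fun a : Fin n => (Fin.castAdd k a).succ.succ)))
      (fun b => (Fin.natAdd n b).succ.succ)
  let h' : PRSet (n + k + 2) := PRSet.comp h (fun j => PRSet.proj (σ j))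
  refine ⟨fun x => PRST.ev (PRSet.recur h') (Fin.cons (x 0) (Fin.append (Fin.tail x) p)), ?_, ?_⟩
  · have := PRf.ev (n := n + 1) (PRSet.recur h') (Fin.cons (fun x => x 0)
      (Fin.addCases (fun i x => x i.succ) (fun b _ => p b)) :
        Fin (n + k + 1) → (Fin (n + 1) → M) → M) (by
      intro i
      refine Fin.cases ?_ (fun i => Fin.addCases (fun a => ?_) (fun b => ?_) i) i
      · exact PRf.proj 0
      · simpa using PRf.proj (M := M) a.succ
      · simpa using PRf.const (M := M) (p b))
    convert this using 3 with x
    funext i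
    refine Fin.cases ?_ (fun i => Fin.addCases (fun a => ?_) (fun b => ?_) i) i <;>
      simp [Fin.tail]
  · intro x y
    obtain ⟨u, hu, hR⟩ := ev_recur h' x (Fin.append y p)
    refine ⟨u, by simpa using hu, ?_⟩
    simp only [Fin.cons_zero, Fin.tail_cons]
    rw [hR, ev_comp, hh]
    congr 1; funext j
    rw [ev_proj]
    refine Fin.addCases (fun a => ?_) (fun b => ?_) j
    · refine Fin.cases ?_ (fun a => Fin.cases ?_ (fun a => ?_) a) a
      · simp [σ]
      · simp only [σ, Fin.addCases_left, Fin.cons_succ, Fin.cons_zero, Fin.append_left]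
        rfl
      · simp [σ]
    · simp [σ]

end PRFunctions
-- Bounded logic and elementary operations on sets
section Derived
open Classical

variable {M : Type u} [prsLang.Structure M]

/-- The set `{∅}`, used as a truth value. -/
noncomputable def one (M : Type u) [prsLang.Structure M] : M := adj (emp M) (emp M)

/-- The relation `φ` is primitive recursive in parameters from `M`. -/
class PRp {n : ℕ} (φ : (Fin n → M) → Prop) : Prop where
  out : PRf (fun x => if φ x then one M else emp M)

/-- `⋃ {F v | v ∈ a}` -/
noncomputable def iUn (a : M) (F : M → M) : M :=
  if h : ∃ u, ∀ z, z ∈ₛ u ↔ ∃ v, v ∈ₛ a ∧ z ∈ₛ F v then h.choose else emp M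

/-- `{v ∈ a | φ v}` -/
noncomputable def sep (a : M) (φ : M → Prop) : M :=
  iUn a (fun v => if φ v then adj (emp M) v else emp M)

/-- `{F v | v ∈ a}` -/
noncomputable def img (a : M) (F : M → M) : M := iUn a (fun v => adj (emp M) (F v))

noncomputable def sUn (a : M) : M := iUn a (fun v => v)

noncomputable def un (a b : M) : M := sUn (adj (adj (emp M) a) b)

variable [SetModel M]

theorem PRf.comp1 {n : ℕ} (F : M → M) (h : PRf (fun x : Fin 1 → M => F (x 0)))
    (a : (Fin n → M) → M) [ha : PRf a] : PRf (fun x => F (a x)) :=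
  h.subst ![a] (by intro i; fin_cases i; exact ha)

theorem PRf.comp2 {n : ℕ} (F : M → M → M) (h : PRf (fun x : Fin 2 → M => F (x 0) (x 1)))
    (a b : (Fin n → M) → M) [ha : PRf a] [hb : PRf b] : PRf (fun x => F (a x) (b x)) :=
  h.subst ![a, b] (by intro i; fin_cases i; exacts [ha, hb])

theorem PRf.comp3 {n : ℕ} (F : M → M → M → M)
    (h : PRf (fun x : Fin 3 → M => F (x 0) (x 1) (x 2)))
    (a b c : (Fin n → M) → M) [ha : PRf a] [hb : PRf b] [hc : PRf c] :
    PRf (fun x => F (a x) (b x) (c x)) :=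
  h.subst ![a, b, c] (by intro i; fin_cases i; exacts [ha, hb, hc])

instance PRf.adj {n : ℕ} (a b : (Fin n → M) → M) [ha : PRf a] [hb : PRf b] :
    PRf (fun x => adj (a x) (b x)) := by
  have := PRf.ev PRSet.adj ![a, b] (by intro i; fin_cases i; exacts [ha, hb])
  convert this using 2 with x
  rw [PRST.adj]
  congr 1
  funext i; fin_cases i <;> rfl

instance PRf.pr {n : ℕ} (a b : (Fin n → M) → M) [ha : PRf a] [hb : PRf b] :
    PRf (fun x => pr (a x) (b x)) := by
  unfold PRST.pr; infer_instance

theorem emp_ne_one : emp M ≠ one M := fun h =>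
  not_mem_emp (emp M) (by nth_rw 2 [h]; simp [one])

instance PRf.cond {n : ℕ} (a b c d : (Fin n → M) → M) [ha : PRf a] [hb : PRf b] [hc : PRf c]
    [hd : PRf d] : PRf (fun x => if c x ∈ₛ d x then a x else b x) := by
  have := PRf.ev PRSet.cond ![a, b, c, d] (by intro i; fin_cases i; exacts [ha, hb, hc, hd])
  convert this using 2 with x
  have e : (fun i => (![a, b, c, d] : Fin 4 → (Fin n → M) → M) i x) = ![a x, b x, c x, d x] := by
    funext i; fin_cases i <;> rfl
  rw [e]
  split_ifs with h
  · rw [ev_cond_pos h]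
  · rw [ev_cond_neg h]

instance PRp.mem {n : ℕ} (a b : (Fin n → M) → M) [PRf a] [PRf b] :
    PRp (fun x => a x ∈ₛ b x) := ⟨inferInstance⟩

instance PRp.const {n : ℕ} (p : Prop) : PRp (fun _ : Fin n → M => p) := ⟨inferInstance⟩

omit [SetModel M] in
theorem PRp.of_iff {n : ℕ} {φ ψ : (Fin n → M) → Prop} (h : PRp φ) (e : ∀ x, ψ x ↔ φ x) : PRp ψ := by
  rwa [show ψ = φ from funext fun x => propext (e x)]

instance PRf.ite {n : ℕ} (φ : (Fin n → M) → Prop) (a b : (Fin n → M) → M) [h : PRp φ]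
    [PRf a] [PRf b] : PRf (fun x => if φ x then a x else b x) := by
  have := h.out
  have h2 : PRf (fun x => if emp M ∈ₛ (if φ x then one M else emp M) then a x else b x) :=
    inferInstance
  convert h2 using 3 with x
  split_ifs <;> simp_all [one]

theorem PRp.eqv {n : ℕ} (a b : (Fin n → M) → M) [PRf a] [PRf b] :
    PRp (fun x => a x = b x) :=
  (inferInstance : PRp (fun x => a x ∈ₛ PRST.adj (emp M) (b x))).of_iff (fun x => by simp)

attribute [instance] PRp.eqv

instance PRp.not {n : ℕ} (φ : (Fin n → M) → Prop) [PRp φ] : PRp (fun x => ¬ φ x) := by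
  have h2 : PRf (fun x => if φ x then emp M else one M) := inferInstance
  refine ⟨?_⟩
  convert h2 using 2 with x
  by_cases h : φ x <;> simp [h]

instance PRp.and {n : ℕ} (φ ψ : (Fin n → M) → Prop) [PRp φ] [PRp ψ] :
    PRp (fun x => φ x ∧ ψ x) := by
  have h3 := PRp.out (φ := ψ)
  have h2 : PRf (fun x => if φ x then (if ψ x then one M else emp M) else emp M) := inferInstance
  refine ⟨?_⟩
  convert h2 using 2 with x
  by_cases h : φ x <;> simp [h]

instance PRp.or {n : ℕ} (φ ψ : (Fin n → M) → Prop) [PRp φ] [PRp ψ] :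
    PRp (fun x => φ x ∨ ψ x) :=
  (inferInstance : PRp (fun x => ¬ (¬ φ x ∧ ¬ ψ x))).of_iff (fun x => by tauto)

instance PRp.imp {n : ℕ} (φ ψ : (Fin n → M) → Prop) [PRp φ] [PRp ψ] :
    PRp (fun x => φ x → ψ x) :=
  (inferInstance : PRp (fun x => ¬ φ x ∨ ψ x)).of_iff (fun x => by tauto)

instance PRp.iff {n : ℕ} (φ ψ : (Fin n → M) → Prop) [PRp φ] [PRp ψ] :
    PRp (fun x => φ x ↔ ψ x) :=
  (inferInstance : PRp (fun x => (φ x → ψ x) ∧ (ψ x → φ x))).of_iff (fun x => by tauto)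

theorem PRp.subst {n m : ℕ} {φ : (Fin m → M) → Prop} (h : PRp φ) (G : Fin m → (Fin n → M) → M)
    (hG : ∀ i, PRf (G i)) : PRp (fun x => φ (fun i => G i x)) :=
  ⟨h.out.subst G hG⟩

theorem PRp.comp1 {n : ℕ} (F : M → Prop) (h : PRp (fun x : Fin 1 → M => F (x 0)))
    (a : (Fin n → M) → M) [ha : PRf a] : PRp (fun x => F (a x)) :=
  h.subst ![a] (by intro i; fin_cases i; exact ha)

theorem PRp.comp2 {n : ℕ} (F : M → M → Prop) (h : PRp (fun x : Fin 2 → M => F (x 0) (x 1)))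
    (a b : (Fin n → M) → M) [ha : PRf a] [hb : PRf b] : PRp (fun x => F (a x) (b x)) :=
  h.subst ![a, b] (by intro i; fin_cases i; exacts [ha, hb])

theorem PRp.comp3 {n : ℕ} (F : M → M → M → Prop)
    (h : PRp (fun x : Fin 3 → M => F (x 0) (x 1) (x 2)))
    (a b c : (Fin n → M) → M) [ha : PRf a] [hb : PRf b] [hc : PRf c] :
    PRp (fun x => F (a x) (b x) (c x)) :=
  h.subst ![a, b, c] (by intro i; fin_cases i; exacts [ha, hb, hc])

theorem PRp.comp4 {n : ℕ} (F : M → M → M → M → Prop)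
    (h : PRp (fun x : Fin 4 → M => F (x 0) (x 1) (x 2) (x 3)))
    (a b c d : (Fin n → M) → M) [ha : PRf a] [hb : PRf b] [hc : PRf c] [hd : PRf d] :
    PRp (fun x => F (a x) (b x) (c x) (d x)) :=
  h.subst ![a, b, c, d] (by intro i; fin_cases i; exacts [ha, hb, hc, hd])

theorem PRp.comp5 {n : ℕ} (F : M → M → M → M → M → Prop)
    (h : PRp (fun x : Fin 5 → M => F (x 0) (x 1) (x 2) (x 3) (x 4)))
    (a b c d e : (Fin n → M) → M) [ha : PRf a] [hb : PRf b] [hc : PRf c] [hd : PRf d]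
    [he : PRf e] :
    PRp (fun x => F (a x) (b x) (c x) (d x) (e x)) :=
  h.subst ![a, b, c, d, e] (by intro i; fin_cases i; exacts [ha, hb, hc, hd, he])

theorem PRp.comp6 {n : ℕ} (F : M → M → M → M → M → M → Prop)
    (h : PRp (fun x : Fin 6 → M => F (x 0) (x 1) (x 2) (x 3) (x 4) (x 5)))
    (a b c d e f : (Fin n → M) → M) [ha : PRf a] [hb : PRf b] [hc : PRf c] [hd : PRf d]
    [he : PRf e] [hf : PRf f] :
    PRp (fun x => F (a x) (b x) (c x) (d x) (e x) (f x)) :=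
  h.subst ![a, b, c, d, e, f] (by intro i; fin_cases i; exacts [ha, hb, hc, hd, he, hf])

/-- The recursion scheme provides unions over values of the recursive function itself, not over
values of `F`. The remedy is to carry `a` along as a parameter and to put `R(x) = F(x)` for `x ∈ a`,
and otherwise to return the union of the earlier values. As `a ∉ a`, the value at `a` is the union
of all `F(v)` with `v ∈ a`. -/
theorem PRf.iUn_spec {n : ℕ} (F : (Fin (n + 1) → M) → M) [hF : PRf F] :
    ∃ R : (Fin (n + 1) → M) → M, PRf R ∧ ∀ (a : M) (y : Fin n → M) (z : M),
      z ∈ₛ R (Fin.cons a y) ↔ ∃ v, v ∈ₛ a ∧ z ∈ₛ F (Fin.cons v y) := by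
  have hF' : PRf (fun x : Fin (n + 3) → M => F (Fin.cons (x 1) (fun i => x i.succ.succ.succ))) := by
    have := hF.subst (n := n + 3) (Fin.cons (fun x => x 1) (fun i x => x i.succ.succ.succ))
      (fun i => Fin.cases (PRf.proj 1) (fun i => PRf.proj i.succ.succ.succ) i)
    convert this using 3 with x
    funext i
    refine Fin.cases ?_ (fun i => ?_) i <;> simp
  have hH : PRf (fun x : Fin (n + 3) → M => if x 1 ∈ₛ x 2 then
      F (Fin.cons (x 1) (fun i => x i.succ.succ.succ)) else x 0) := inferInstance
  obtain ⟨R, hR, h⟩ := hH.exists_recur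
  have h2 : ∀ (v a : M) (y : Fin n → M), v ∈ₛ a →
      R (Fin.cons v (Fin.cons a y)) = F (Fin.cons v y) := by
    intro v a y hv
    obtain ⟨u, -, hu⟩ := h v (Fin.cons a y)
    rw [hu]
    exact if_pos hv
  have h3 : ∀ a : M, ¬ a ∈ₛ a := by
    intro a ha
    obtain ⟨y, hy, hz⟩ := foundation (PRST.adj (emp M) a) ⟨a, by simp⟩
    rw [mem_adj] at hy
    obtain rfl : y = a := by simpa using hy
    exact hz y (by simp) ha
  refine ⟨fun x => R (Fin.cons (x 0) x), ?_, fun a y z => ?_⟩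
  · have := hR.subst (n := n + 1) (Fin.cons (fun x => x 0) (fun i x => x i))
      (fun i => Fin.cases (PRf.proj 0) (fun i => PRf.proj i) i)
    convert this using 3 with x
    funext i
    refine Fin.cases ?_ (fun i => ?_) i <;> simp
  · obtain ⟨u, hu, e⟩ := h a (Fin.cons a y)
    have e' : R (Fin.cons a (Fin.cons a y)) = u := by
      rw [e]; exact if_neg (h3 a)
    simp only [Fin.cons_zero]
    rw [e', hu]
    refine exists_congr fun v => and_congr_right fun hv => ?_
    rw [h2 v a y hv]

/-- The function `F` may depend on the arguments `y` of a surrounding function, so it is presented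
as a section of a primitive recursive `G`. -/
theorem mem_iUn' {F : M → M} {n : ℕ} (y : Fin n → M) (G : (Fin (n + 1) → M) → M) [PRf G]
    (e : ∀ v, F v = G (Fin.cons v y)) {a z : M} :
    z ∈ₛ iUn a F ↔ ∃ v, v ∈ₛ a ∧ z ∈ₛ F v := by
  obtain ⟨R, -, hR⟩ := PRf.iUn_spec G
  have h : ∃ u, ∀ z, z ∈ₛ u ↔ ∃ v, v ∈ₛ a ∧ z ∈ₛ F v :=
    ⟨R (Fin.cons a y), fun z => by simp only [e]; exact hR a y z⟩
  rw [iUn, dif_pos h]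
  exact h.choose_spec z

theorem mem_iUn {F : M → M} [h : PRf (fun x : Fin 1 → M => F (x 0))] {a z : M} :
    z ∈ₛ iUn a F ↔ ∃ v, v ∈ₛ a ∧ z ∈ₛ F v :=
  mem_iUn' (fun i : Fin 0 => i.elim0) (fun x : Fin 1 → M => F (x 0)) (fun _ => rfl)

instance PRf.iUn {n : ℕ} (a : (Fin n → M) → M) (F : M → (Fin n → M) → M) [ha : PRf a]
    [hF : PRf (fun x : Fin (n + 1) → M => F (x 0) (fun i => x i.succ))] :
    PRf (fun x => iUn (a x) (fun v => F v x)) := by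
  obtain ⟨R, h1, hR⟩ := PRf.iUn_spec (fun x : Fin (n + 1) → M => F (x 0) (fun i => x i.succ))
  have := h1.subst (n := n) (Fin.cons a (fun i x => x i))
    (fun i => Fin.cases ha (fun i => PRf.proj i) i)
  convert this using 2 with x
  refine mext fun z => ?_
  rw [mem_iUn' x (fun x : Fin (n + 1) → M => F (x 0) (fun i => x i.succ)) (fun v => by simp)]
  have e : (fun i => (Fin.cons a (fun i x => x i) : Fin (n + 1) → (Fin n → M) → M) i x)
      = Fin.cons (a x) x := by
    funext i
    refine Fin.cases ?_ (fun i => ?_) i <;> simp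
  rw [e, hR]
  simp

instance PRf.img {n : ℕ} (a : (Fin n → M) → M) (F : M → (Fin n → M) → M) [ha : PRf a]
    [hF : PRf (fun x : Fin (n + 1) → M => F (x 0) (fun i => x i.succ))] :
    PRf (fun x => img (a x) (fun v => F v x)) := by
  unfold PRST.img; infer_instance

theorem mem_img {F : M → M} [h : PRf (fun x : Fin 1 → M => F (x 0))] {a z : M} :
    z ∈ₛ img a F ↔ ∃ v, v ∈ₛ a ∧ z = F v := by
  simp [img, mem_iUn]

instance PRf.sep {n : ℕ} (a : (Fin n → M) → M) (φ : M → (Fin n → M) → Prop) [ha : PRf a]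
    [hF : PRp (fun x : Fin (n + 1) → M => φ (x 0) (fun i => x i.succ))] :
    PRf (fun x => sep (a x) (fun v => φ v x)) := by
  unfold PRST.sep
  have : PRf (fun x : Fin (n + 1) → M => if φ (x 0) (fun i => x i.succ) then
    PRST.adj (emp M) (x 0) else emp M) := inferInstance
  infer_instance

theorem mem_sep {φ : M → Prop} [h : PRp (fun x : Fin 1 → M => φ (x 0))] {a z : M} :
    z ∈ₛ sep a φ ↔ z ∈ₛ a ∧ φ z := by
  rw [sep, mem_iUn]
  constructor
  · rintro ⟨v, hv, h⟩
    split_ifs at h with hφ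
    · simp only [mem_adj, not_mem_emp, false_or] at h
      exact h ▸ ⟨hv, hφ⟩
    · exact absurd h (not_mem_emp z)
  · rintro ⟨h1, h2⟩
    exact ⟨z, h1, by simp [h2]⟩

/-- A bounded existential statement says that a set given by separation is non-empty. The bound
variable is inserted at index `0`, which is the form in which nested quantifiers are found by
instance search. -/
instance PRp.bex {n : ℕ} (a : (Fin n → M) → M) (φ : M → (Fin n → M) → Prop) [ha : PRf a]
    [hF : PRp (fun x : Fin (n + 1) → M => φ (x 0) (fun i => x i.succ))] :
    PRp (fun x => ∃ v, v ∈ₛ a x ∧ φ v x) := by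
  have h : PRp (fun x => ¬ PRST.sep (a x) (fun v => φ v x) = emp M) := inferInstance
  refine h.of_iff fun x => ?_
  have : PRp (fun y : Fin 1 → M => φ (y 0) x) := by
    have := hF.subst (Fin.cons (fun y => y 0) (fun i _ => x i) :
      Fin (n + 1) → (Fin 1 → M) → M)
      (fun i => Fin.cases (PRf.proj 0) (fun i => PRf.const (x i)) i)
    exact this
  constructor
  · rintro ⟨v, h1, h2⟩ h3
    exact not_mem_emp v (h3 ▸ mem_sep.2 ⟨h1, h2⟩)
  · intro h3
    by_contra h4
    refine h3 (mext fun z => ?_)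
    rw [mem_sep]
    exact iff_of_false (fun h => h4 ⟨z, h⟩) (not_mem_emp z)

instance PRp.ball {n : ℕ} (a : (Fin n → M) → M) (φ : M → (Fin n → M) → Prop) [ha : PRf a]
    [hF : PRp (fun x : Fin (n + 1) → M => φ (x 0) (fun i => x i.succ))] :
    PRp (fun x => ∀ v, v ∈ₛ a x → φ v x) :=
  (inferInstance : PRp (fun x => ¬ ∃ v, v ∈ₛ a x ∧ ¬ φ v x)).of_iff (fun x => by
    push Not; rfl)

instance PRf.sUn {n : ℕ} (a : (Fin n → M) → M) [ha : PRf a] : PRf (fun x => sUn (a x)) := by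
  unfold PRST.sUn; infer_instance

@[simp] theorem mem_sUn {a z : M} : z ∈ₛ sUn a ↔ ∃ v, v ∈ₛ a ∧ z ∈ₛ v := mem_iUn

instance PRf.un {n : ℕ} (a b : (Fin n → M) → M) [ha : PRf a] [hb : PRf b] :
    PRf (fun x => un (a x) (b x)) := by
  unfold PRST.un; infer_instance

@[simp] theorem mem_un {a b z : M} : z ∈ₛ un a b ↔ z ∈ₛ a ∨ z ∈ₛ b := by
  simp only [un, mem_sUn, mem_adj, not_mem_emp, false_or]
  constructor
  · rintro ⟨v, rfl | rfl, h⟩ <;> simp [h]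
  · rintro (h | h)
    exacts [⟨a, by simp, h⟩, ⟨b, by simp, h⟩]

end Derived
-- Pairs, functions, ordinals and recursion on natural numbers
section SetTheory
open Classical

variable {M : Type u} [prsLang.Structure M]

/-- Both coordinates of a Kuratowski pair lie in `⋃ p`, which bounds the search. The outer union
extracts the only element of a singleton, and it yields `∅` when `p` is not a pair. -/
noncomputable def fst (p : M) : M :=
  sUn (sep (sUn p) (fun x => ∃ y, y ∈ₛ sUn p ∧ p = pr x y))

noncomputable def snd (p : M) : M :=
  sUn (sep (sUn p) (fun y => ∃ x, x ∈ₛ sUn p ∧ p = pr x y))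

/-- The value of the function `f` at `x`. -/
noncomputable def app (f x : M) : M := sUn (sep (sUn (sUn f)) (fun y => pr x y ∈ₛ f))

noncomputable def prod (a b : M) : M := iUn a (fun x => img b (fun y => pr x y))

/-- The function with domain `a` and values `F x`. -/
noncomputable def lam (a : M) (F : M → M) : M := img a (fun x => pr x (F x))

def suc (n : M) : M := adj n n

variable [SetModel M]

theorem sing_inj {x y : M} (h : adj (emp M) x = adj (emp M) y) : x = y := by
  have : x ∈ₛ adj (emp M) y := h ▸ by simp
  simpa using this

theorem upair_eq {x y z : M} (h : adj (adj (emp M) x) y = adj (emp M) z) : x = z ∧ y = z := by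
  have h1 : x ∈ₛ adj (emp M) z := h ▸ by simp
  have h2 : y ∈ₛ adj (emp M) z := h ▸ by simp
  exact ⟨by simpa using h1, by simpa using h2⟩

theorem mem_pr {x y z : M} :
    z ∈ₛ pr x y ↔ z = adj (emp M) x ∨ z = adj (adj (emp M) x) y := by simp [pr]

@[simp] theorem pr_inj {a b c d : M} : pr a b = pr c d ↔ a = c ∧ b = d := by
  refine ⟨fun h => ?_, fun ⟨h1, h2⟩ => h1 ▸ h2 ▸ rfl⟩
  have h1 : adj (emp M) a ∈ₛ pr c d := h ▸ mem_pr.2 (Or.inl rfl)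
  obtain rfl : a = c := by
    rcases mem_pr.1 h1 with h1 | h1
    · exact sing_inj h1
    · exact (upair_eq h1.symm).1.symm
  refine ⟨rfl, ?_⟩
  have h2 : adj (adj (emp M) a) b ∈ₛ pr a d := h ▸ mem_pr.2 (Or.inr rfl)
  have h3 : adj (adj (emp M) a) d ∈ₛ pr a b := h ▸ mem_pr.2 (Or.inr rfl)
  rcases mem_pr.1 h2 with h2 | h2
  · have hb := (upair_eq h2).2
    rcases mem_pr.1 h3 with h3 | h3
    · rw [hb, (upair_eq h3).2]
    · rw [h2] at h3
      rw [hb, (upair_eq h3).2]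
  · have hb : b ∈ₛ adj (adj (emp M) a) d := h2 ▸ by simp
    have hd : d ∈ₛ adj (adj (emp M) a) b := h2 ▸ by simp
    simp only [mem_adj, not_mem_emp, false_or] at hb hd
    rcases hb with hb | hb
    · rcases hd with hd | hd
      · rw [hb, hd]
      · exact hd.symm
    · exact hb

theorem left_mem_sUn_pr (x y : M) : x ∈ₛ sUn (pr x y) :=
  mem_sUn.2 ⟨adj (emp M) x, mem_pr.2 (Or.inl rfl), by simp⟩

theorem right_mem_sUn_pr (x y : M) : y ∈ₛ sUn (pr x y) :=
  mem_sUn.2 ⟨_, mem_pr.2 (Or.inr rfl), by simp⟩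

instance PRf.fst {n : ℕ} (a : (Fin n → M) → M) [PRf a] : PRf (fun x => fst (a x)) :=
  PRf.comp1 PRST.fst (by unfold PRST.fst; infer_instance) a

instance PRf.snd {n : ℕ} (a : (Fin n → M) → M) [PRf a] : PRf (fun x => snd (a x)) :=
  PRf.comp1 PRST.snd (by unfold PRST.snd; infer_instance) a

instance PRf.app {n : ℕ} (f a : (Fin n → M) → M) [PRf f] [PRf a] :
    PRf (fun x => app (f x) (a x)) :=
  PRf.comp2 PRST.app (by unfold PRST.app; infer_instance) f a

instance PRf.prod {n : ℕ} (f a : (Fin n → M) → M) [PRf f] [PRf a] :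
    PRf (fun x => prod (f x) (a x)) :=
  PRf.comp2 PRST.prod (by unfold PRST.prod; infer_instance) f a

instance PRf.suc {n : ℕ} (a : (Fin n → M) → M) [PRf a] : PRf (fun x => suc (a x)) := by
  unfold PRST.suc; infer_instance

instance PRf.lam {n : ℕ} (a : (Fin n → M) → M) (F : M → (Fin n → M) → M) [ha : PRf a]
    [hF : PRf (fun x : Fin (n + 1) → M => F (x 0) (fun i => x i.succ))] :
    PRf (fun x => lam (a x) (fun v => F v x)) := by
  unfold PRST.lam
  have : PRf (fun x : Fin (n + 1) → M => PRST.pr (x 0) (F (x 0) (fun i => x i.succ))) :=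
    inferInstance
  infer_instance

theorem sUn_unique {a x : M} (h : ∀ z, z ∈ₛ a ↔ z = x) : sUn a = x :=
  mext fun z => by simp [h]

@[simp] theorem fst_pr (x y : M) : fst (pr x y) = x := by
  refine sUn_unique fun z => ?_
  rw [mem_sep]
  constructor
  · rintro ⟨-, y', -, h⟩; exact (pr_inj.1 h).1.symm
  · rintro rfl; exact ⟨left_mem_sUn_pr _ _, y, right_mem_sUn_pr _ _, rfl⟩

@[simp] theorem snd_pr (x y : M) : snd (pr x y) = y := by
  refine sUn_unique fun z => ?_
  rw [mem_sep]
  constructor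
  · rintro ⟨-, y', -, h⟩; exact (pr_inj.1 h).2.symm
  · rintro rfl; exact ⟨right_mem_sUn_pr _ _, x, left_mem_sUn_pr _ _, rfl⟩

@[simp] theorem mem_prod {a b z : M} : z ∈ₛ prod a b ↔ ∃ x y, x ∈ₛ a ∧ y ∈ₛ b ∧ z = pr x y := by
  simp only [prod, mem_iUn, mem_img]
  exact ⟨fun ⟨x, hx, y, hy, h⟩ => ⟨x, y, hx, hy, h⟩, fun ⟨x, y, hx, hy, h⟩ => ⟨x, hx, y, hy, h⟩⟩

theorem pr_mem_prod {a b x y : M} : pr x y ∈ₛ prod a b ↔ x ∈ₛ a ∧ y ∈ₛ b := by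
  rw [mem_prod]
  constructor
  · rintro ⟨x', y', hx, hy, h⟩
    obtain ⟨rfl, rfl⟩ := pr_inj.1 h
    exact ⟨hx, hy⟩
  · rintro ⟨hx, hy⟩; exact ⟨x, y, hx, hy, rfl⟩

theorem mem_sUn_sUn {f x y : M} (h : pr x y ∈ₛ f) : x ∈ₛ sUn (sUn f) ∧ y ∈ₛ sUn (sUn f) := by
  obtain ⟨v, hv, hx⟩ := mem_sUn.1 (left_mem_sUn_pr x y)
  obtain ⟨w, hw, hy⟩ := mem_sUn.1 (right_mem_sUn_pr x y)
  exact ⟨mem_sUn.2 ⟨v, mem_sUn.2 ⟨_, h, hv⟩, hx⟩, mem_sUn.2 ⟨w, mem_sUn.2 ⟨_, h, hw⟩, hy⟩⟩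

theorem app_eq {f x y : M} (h : pr x y ∈ₛ f) (hu : ∀ z, pr x z ∈ₛ f → z = y) : app f x = y := by
  refine sUn_unique fun z => ?_
  rw [mem_sep]
  constructor
  · rintro ⟨-, hz⟩; exact hu z hz
  · rintro rfl; exact ⟨(mem_sUn_sUn h).2, h⟩

theorem IsFun.mem_iff {f a : M} (h : IsFun f a) {x y : M} :
    pr x y ∈ₛ f ↔ x ∈ₛ a ∧ y = app f x := by
  have key : ∀ x, x ∈ₛ a → pr x (app f x) ∈ₛ f := by
    intro x hx
    obtain ⟨y, hy, hu⟩ := h.2 x hx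
    rwa [app_eq hy hu]
  constructor
  · intro hxy
    obtain ⟨x', y', hx, e⟩ := h.1 _ hxy
    obtain ⟨rfl, rfl⟩ := pr_inj.1 e
    exact ⟨hx, (h.2 x hx).unique hxy (key x hx)⟩
  · rintro ⟨hx, rfl⟩; exact key x hx

theorem IsFun.ext {f g a : M} (hf : IsFun f a) (hg : IsFun g a)
    (h : ∀ x, x ∈ₛ a → app f x = app g x) : f = g := by
  refine mext fun p => ⟨fun hp => ?_, fun hp => ?_⟩
  · obtain ⟨x, y, hx, rfl⟩ := hf.1 p hp
    rw [hf.mem_iff] at hp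
    exact hg.mem_iff.2 ⟨hx, h x hx ▸ hp.2⟩
  · obtain ⟨x, y, hx, rfl⟩ := hg.1 p hp
    rw [hg.mem_iff] at hp
    exact hf.mem_iff.2 ⟨hx, h x hx ▸ hp.2⟩

theorem IsMap.app_mem {f a b x : M} (h : IsMap f a b) (hx : x ∈ₛ a) : app f x ∈ₛ b :=
  h.2 x _ (h.1.mem_iff.2 ⟨hx, rfl⟩)

theorem mem_lam {a x y : M} {F : M → M} [PRf (fun x : Fin 1 → M => F (x 0))] :
    pr x y ∈ₛ lam a F ↔ x ∈ₛ a ∧ y = F x := by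
  simp only [lam, mem_img, pr_inj]
  constructor
  · rintro ⟨v, hv, rfl, rfl⟩; exact ⟨hv, rfl⟩
  · rintro ⟨hx, rfl⟩; exact ⟨x, hx, rfl, rfl⟩

theorem isFun_lam (a : M) (F : M → M) [PRf (fun x : Fin 1 → M => F (x 0))] :
    IsFun (lam a F) a := by
  refine ⟨fun p hp => ?_, fun x hx => ⟨F x, mem_lam.2 ⟨hx, rfl⟩, fun y hy => (mem_lam.1 hy).2⟩⟩
  obtain ⟨v, hv, rfl⟩ := mem_img.1 hp
  exact ⟨v, _, hv, rfl⟩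

theorem app_lam {a x : M} {F : M → M} [PRf (fun x : Fin 1 → M => F (x 0))] (hx : x ∈ₛ a) :
    app (lam a F) x = F x :=
  ((isFun_lam a F).mem_iff.1 (mem_lam.2 ⟨hx, rfl⟩)).2.symm

theorem isMap_lam {a b : M} {F : M → M} [PRf (fun x : Fin 1 → M => F (x 0))]
    (h : ∀ x, x ∈ₛ a → F x ∈ₛ b) : IsMap (lam a F) a b :=
  ⟨isFun_lam a F, fun x y hxy => by
    obtain ⟨hx, rfl⟩ := mem_lam.1 hxy; exact h x hx⟩

/-! ### Induction, ordinals and natural numbers -/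

/-- Foundation for the set of counterexamples in `a`. This set exists because `φ` is primitive
recursive, and for this reason every induction in the proof is arranged to have a primitive
recursive induction formula. -/
theorem mem_induction (a : M) (φ : M → Prop) [PRp (fun x : Fin 1 → M => φ (x 0))]
    (h : ∀ x, x ∈ₛ a → (∀ y, y ∈ₛ x → y ∈ₛ a → φ y) → φ x) : ∀ x, x ∈ₛ a → φ x := by
  intro x hx
  by_contra hn
  obtain ⟨y, hy, hm⟩ := foundation (sep a (fun z => ¬ φ z)) ⟨x, mem_sep.2 ⟨hx, hn⟩⟩
  rw [mem_sep] at hy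
  refine hy.2 (h y hy.1 fun z hz hza => ?_)
  by_contra hnz
  exact hm z (mem_sep.2 ⟨hza, hnz⟩) hz

theorem mem_irrefl (a : M) : ¬ a ∈ₛ a := fun h => by
  obtain ⟨y, hy, hm⟩ := foundation (adj (emp M) a) ⟨a, by simp⟩
  obtain rfl : y = a := by simpa using hy
  exact hm y (by simp) h

theorem mem_asymm {a b : M} (h : a ∈ₛ b) : ¬ b ∈ₛ a := fun h' => by
  obtain ⟨y, hy, hm⟩ := foundation (adj (adj (emp M) a) b) ⟨a, by simp⟩
  simp only [mem_adj, not_mem_emp, false_or] at hy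
  rcases hy with rfl | rfl
  · exact hm b (by simp) h'
  · exact hm a (by simp) h

instance PRp.isOrd {n : ℕ} (a : (Fin n → M) → M) [PRf a] : PRp (fun x => IsOrd (a x)) :=
  PRp.comp1 IsOrd (by unfold IsOrd; infer_instance) a

omit [SetModel M] in
theorem IsOrd.trans {a x y : M} (h : IsOrd a) (h1 : x ∈ₛ y) (h2 : y ∈ₛ a) : x ∈ₛ a :=
  h.1 y h2 x h1

omit [SetModel M] in
theorem IsOrd.of_mem {a x : M} (h : IsOrd a) (hx : x ∈ₛ a) : IsOrd x :=
  ⟨h.2 x hx, fun y hy => h.2 y (h.trans hy hx)⟩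

theorem IsOrd.suc {a : M} (h : IsOrd a) : IsOrd (suc a) := by
  constructor
  · intro y hy z hz
    rcases mem_adj.1 hy with hy | rfl
    · exact mem_adj.2 (Or.inl (h.trans hz hy))
    · exact mem_adj.2 (Or.inl hz)
  · intro y hy
    rcases mem_adj.1 hy with hy | rfl
    · exact h.2 y hy
    · exact h.1

@[simp] theorem mem_suc {a x : M} : x ∈ₛ suc a ↔ x ∈ₛ a ∨ x = a := mem_adj

theorem IsOrd.trichotomy {a b : M} (ha : IsOrd a) (hb : IsOrd b) : a ∈ₛ b ∨ a = b ∨ b ∈ₛ a := by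
  -- Passing to successors makes `a` and `b` themselves elements of the sets on which the two
  -- inductions run.
  have key : ∀ x, x ∈ₛ PRST.suc a → ∀ y, y ∈ₛ PRST.suc b → x ∈ₛ y ∨ x = y ∨ y ∈ₛ x := by
    refine mem_induction _ _ fun x hx ihx => ?_
    refine mem_induction _ _ fun y hy ihy => ?_
    by_contra hn
    push Not at hn
    refine hn.2.1 (mext fun z => ⟨fun hz => ?_, fun hz => ?_⟩)
    · rcases ihx z hz (ha.suc.trans hz hx) y hy with h | rfl | h
      · exact h
      · exact absurd hz hn.2.2
      · exact absurd (ha.suc.of_mem hx |>.trans h hz) hn.2.2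
    · rcases ihy z hz (hb.suc.trans hz hy) with h | rfl | h
      · exact absurd (hb.suc.of_mem hy |>.trans h hz) hn.1
      · exact absurd hz hn.1
      · exact h
  exact key a (by simp) b (by simp)

theorem emp_mem_om : emp M ∈ₛ om M := (mem_om_iff _).2 (Or.inl rfl)

theorem suc_mem_om {n : M} (h : n ∈ₛ om M) : suc n ∈ₛ om M := (mem_om_iff _).2 (Or.inr ⟨n, h, rfl⟩)

theorem om_induction (φ : M → Prop) [PRp (fun x : Fin 1 → M => φ (x 0))] (h0 : φ (emp M))
    (hs : ∀ n, n ∈ₛ om M → φ n → φ (suc n)) : ∀ n, n ∈ₛ om M → φ n := by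
  refine mem_induction _ _ fun n hn ih => ?_
  rcases (mem_om_iff n).1 hn with rfl | ⟨m, hm, rfl⟩
  · exact h0
  · exact hs m hm (ih m (by simp) hm)

theorem mem_om_of_mem {n : M} (hn : n ∈ₛ om M) : ∀ x, x ∈ₛ n → x ∈ₛ om M := by
  refine om_induction (fun n => ∀ x, x ∈ₛ n → x ∈ₛ om M) ?_ ?_ n hn
  · intro x hx; exact absurd hx (not_mem_emp x)
  · intro n hn ih x hx
    rcases mem_suc.1 hx with hx | rfl
    exacts [ih x hx, hn]

theorem isOrd_emp : IsOrd (emp M) :=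
  ⟨fun y hy => absurd hy (not_mem_emp y), fun y hy => absurd hy (not_mem_emp y)⟩

theorem isOrd_of_mem_om {n : M} (hn : n ∈ₛ om M) : IsOrd n :=
  om_induction IsOrd isOrd_emp (fun _ _ h => h.suc) n hn

theorem isOrd_om : IsOrd (om M) :=
  ⟨fun _ hy => mem_om_of_mem hy, fun _ hy => (isOrd_of_mem_om hy).1⟩

theorem om_trichotomy {n m : M} (hn : n ∈ₛ om M) (hm : m ∈ₛ om M) : n ∈ₛ m ∨ n = m ∨ m ∈ₛ n :=
  (isOrd_of_mem_om hn).trichotomy (isOrd_of_mem_om hm)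

theorem suc_inj {n m : M} (h : suc n = suc m) : n = m := by
  have h1 : n ∈ₛ suc m := h ▸ by simp
  have h2 : m ∈ₛ suc n := h ▸ by simp
  rcases mem_suc.1 h1 with h1 | h1
  · rcases mem_suc.1 h2 with h2 | h2
    · exact absurd h1 (mem_asymm h2)
    · exact h2.symm
  · exact h1

theorem suc_mem_suc {n i : M} (hn : n ∈ₛ om M) (h : i ∈ₛ n) : suc i ∈ₛ suc n := by
  have hi := mem_om_of_mem hn i h
  rcases om_trichotomy (suc_mem_om hi) (suc_mem_om hn) with h' | h' | h'
  · exact h'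
  · obtain rfl := suc_inj h'; exact absurd h (mem_irrefl _)
  · rcases mem_suc.1 h' with h' | h'
    · exact absurd h (mem_asymm ((isOrd_of_mem_om hi).trans (mem_suc.2 (Or.inr rfl)) h'))
    · exact absurd h (h' ▸ mem_asymm (by simp : n ∈ₛ suc n))

/-! ### Recursion along `ω` -/

/-- The scheme gives access to the union of all earlier values only. As `S` enlarges its first
argument, the values increase along `ω`, so that the union over `i < n + 1` is the value at `n`. -/
theorem exists_om_recursion (B : M → M) (S : M → M → M) [PRf (fun x : Fin 1 → M => B (x 0))]
    [PRf (fun x : Fin 2 → M => S (x 0) (x 1))] (hS : ∀ u y z, z ∈ₛ u → z ∈ₛ S u y) :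
    ∃ R : M → M → M, PRf (fun x : Fin 2 → M => R (x 0) (x 1)) ∧ (∀ y, R y (emp M) = B y) ∧
      (∀ y n, n ∈ₛ om M → R y (suc n) = S (R y n) y) ∧
      ∀ y n i z, n ∈ₛ om M → i ∈ₛ n → z ∈ₛ R y i → z ∈ₛ R y n := by
  have hB : PRf (fun x : Fin 3 → M => B (x 2)) := PRf.comp1 B inferInstance _
  have hS' : PRf (fun x : Fin 3 → M => S (x 0) (x 2)) := PRf.comp2 S inferInstance _ _
  have hH : PRf (fun x : Fin 3 → M => if x 1 = emp M then B (x 2) else S (x 0) (x 2)) :=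
    inferInstance
  obtain ⟨R, hR, h⟩ := hH.exists_recur
  have hR' : PRf (fun x : Fin 2 → M => R (Fin.cons (x 1) (fun _ => x 0))) := by
    have := hR.subst (n := 2) ![fun x => x 1, fun x => x 0]
      (by intro i; fin_cases i; exacts [PRf.proj 1, PRf.proj 0])
    convert this using 3 with x
    funext i; fin_cases i <;> rfl
  refine ⟨fun y x => R (Fin.cons x (fun _ => y)), hR', fun y => ?_, ?_⟩
  · obtain ⟨u, -, hu⟩ := h (emp M) (fun _ => y)
    simp only [hu]
    exact if_pos rfl
  have hne : ∀ n : M, suc n ≠ emp M := fun n hn => not_mem_emp n (hn ▸ by simp)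
  -- The equation at `n + 1` needs that the values have increased up to `n`, while monotonicity up
  -- to `n + 1` needs this equation. Hence monotonicity at `n` is a hypothesis here and is
  -- discharged in the induction below.
  have key : ∀ y n, n ∈ₛ om M → (∀ i, i ∈ₛ n → ∀ z, z ∈ₛ R (Fin.cons i (fun _ => y)) →
      z ∈ₛ R (Fin.cons n (fun _ => y))) →
      R (Fin.cons (suc n) (fun _ => y)) = S (R (Fin.cons n (fun _ => y))) y := by
    intro y n hn ih
    obtain ⟨u, hu, e⟩ := h (suc n) (fun _ => y)
    rw [e]
    have : u = R (Fin.cons n (fun _ => y)) := by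
      refine mext fun z => ?_
      rw [hu]
      constructor
      · rintro ⟨v, hv, hz⟩
        rcases mem_suc.1 hv with hv | rfl
        exacts [ih v hv z hz, hz]
      · intro hz; exact ⟨n, by simp, hz⟩
    rw [← this]
    exact if_neg (hne n)
  have mono : ∀ y n, n ∈ₛ om M → (∀ i, i ∈ₛ n → ∀ z, z ∈ₛ R (Fin.cons i (fun _ => y)) →
      z ∈ₛ R (Fin.cons n (fun _ => y))) := by
    intro y
    have p : ∀ {m : ℕ} (a : (Fin m → M) → M) [PRf a],
        PRf (fun x => R (Fin.cons (a x) (fun _ => y))) := fun a _ =>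
      PRf.comp2 (fun a b => R (Fin.cons b (fun _ => a))) hR' (fun _ => y) a
    refine om_induction (fun n => ∀ i, i ∈ₛ n → ∀ z, z ∈ₛ R (Fin.cons i (fun _ => y)) →
      z ∈ₛ R (Fin.cons n (fun _ => y))) ?_ ?_
    · intro i hi; exact absurd hi (not_mem_emp i)
    · intro n hn ih i hi z hz
      rw [key y n hn ih]
      refine hS _ _ _ ?_
      rcases mem_suc.1 hi with hi | rfl
      exacts [ih i hi z hz, hz]
  exact ⟨fun y n hn => key y n hn (mono y n hn), fun y n i z hn hi => mono y n hn i hi z⟩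

end SetTheory
-- Finite sets, sums with natural numbers and finite increasing sequences
section Finite
open Classical

variable {M : Type u} [prsLang.Structure M] [SetModel M]

/-! ### Transitive closure, finite subsets and ordinal addition -/

theorem exists_tc (M : Type u) [prsLang.Structure M] [SetModel M] :
    ∃ R : M → M → M, PRf (fun x : Fin 2 → M => R (x 0) (x 1)) ∧ (∀ y, R y (emp M) = y) ∧
      (∀ y n, n ∈ₛ om M → R y (suc n) = un (R y n) (sUn (R y n))) ∧
      ∀ y n i z, n ∈ₛ om M → i ∈ₛ n → z ∈ₛ R y i → z ∈ₛ R y n :=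
  exists_om_recursion (fun y => y) (fun u _ => un u (sUn u)) (fun _ _ _ h => by simp [h])

/-- A transitive set that includes `a`. -/
noncomputable def tc (a : M) : M := iUn (om M) (fun n => (exists_tc M).choose a n)

instance PRf.tcAux {n : ℕ} (a b : (Fin n → M) → M) [PRf a] [PRf b] :
    PRf (fun x => (exists_tc M).choose (a x) (b x)) :=
  PRf.comp2 _ (exists_tc M).choose_spec.1 a b

instance PRf.tc {n : ℕ} (a : (Fin n → M) → M) [PRf a] : PRf (fun x => tc (a x)) :=
  PRf.comp1 PRST.tc (by unfold PRST.tc; infer_instance) a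

theorem subset_tc {a x : M} (h : x ∈ₛ a) : x ∈ₛ tc a := by
  rw [tc, mem_iUn]
  exact ⟨emp M, emp_mem_om, by rwa [(exists_tc M).choose_spec.2.1]⟩

theorem tc_trans {a x y : M} (h : x ∈ₛ y) (hy : y ∈ₛ tc a) : x ∈ₛ tc a := by
  rw [tc, mem_iUn] at *
  obtain ⟨n, hn, hy⟩ := hy
  refine ⟨suc n, suc_mem_om hn, ?_⟩
  rw [(exists_tc M).choose_spec.2.2.1 a n hn]
  simp only [mem_un, mem_sUn]
  exact Or.inr ⟨y, hy, h⟩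

theorem left_mem_tc {a x y : M} (h : pr x y ∈ₛ tc a) : x ∈ₛ tc a := by
  obtain ⟨v, hv, hx⟩ := mem_sUn.1 (left_mem_sUn_pr x y)
  exact tc_trans hx (tc_trans hv h)

theorem right_mem_tc {a x y : M} (h : pr x y ∈ₛ tc a) : y ∈ₛ tc a := by
  obtain ⟨v, hv, hx⟩ := mem_sUn.1 (right_mem_sUn_pr x y)
  exact tc_trans hx (tc_trans hv h)

theorem exists_fin (M : Type u) [prsLang.Structure M] [SetModel M] :
    ∃ R : M → M → M, PRf (fun x : Fin 2 → M => R (x 0) (x 1)) ∧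
      (∀ y, R y (emp M) = adj (emp M) (emp M)) ∧
      (∀ y n, n ∈ₛ om M → R y (suc n) = un (R y n) (iUn (R y n) (fun c => img y (adj c)))) ∧
      ∀ y n i z, n ∈ₛ om M → i ∈ₛ n → z ∈ₛ R y i → z ∈ₛ R y n :=
  exists_om_recursion (fun _ => adj (emp M) (emp M)) (fun u y => un u (iUn u (fun c => img y (adj c))))
    (fun _ _ _ h => by simp [h])

/-- The set of finite subsets of `a`. -/
noncomputable def fin (a : M) : M := iUn (om M) (fun n => (exists_fin M).choose a n)

instance PRf.finAux {n : ℕ} (a b : (Fin n → M) → M) [PRf a] [PRf b] :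
    PRf (fun x => (exists_fin M).choose (a x) (b x)) :=
  PRf.comp2 _ (exists_fin M).choose_spec.1 a b

instance PRf.fin {n : ℕ} (a : (Fin n → M) → M) [PRf a] : PRf (fun x => fin (a x)) :=
  PRf.comp1 PRST.fin (by unfold PRST.fin; infer_instance) a

theorem emp_mem_fin (a : M) : emp M ∈ₛ fin a := by
  rw [fin, mem_iUn]
  exact ⟨emp M, emp_mem_om, by rw [(exists_fin M).choose_spec.2.1]; simp⟩

theorem adj_mem_fin {a c x : M} (hc : c ∈ₛ fin a) (hx : x ∈ₛ a) : adj c x ∈ₛ fin a := by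
  rw [fin, mem_iUn] at *
  obtain ⟨n, hn, hc⟩ := hc
  refine ⟨suc n, suc_mem_om hn, ?_⟩
  rw [(exists_fin M).choose_spec.2.2.1 a n hn]
  simp only [mem_un, mem_iUn, mem_img]
  exact Or.inr ⟨c, hc, x, hx, rfl⟩

theorem img_mem_fin {n a : M} (hn : n ∈ₛ om M) (F : M → M) [PRf (fun x : Fin 1 → M => F (x 0))]
    (h : ∀ i, i ∈ₛ n → F i ∈ₛ a) : img n F ∈ₛ fin a := by
  have hF : ∀ {m : ℕ} (b : (Fin m → M) → M) [PRf b], PRf (fun x => F (b x)) :=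
    fun b _ => PRf.comp1 F inferInstance b
  refine om_induction (fun n => (∀ i, i ∈ₛ n → F i ∈ₛ a) → img n F ∈ₛ fin a) ?_ ?_ n hn h
  · intro _
    convert emp_mem_fin a
    exact mext fun z => by simp [mem_img]
  · intro n _ ih h
    have e : img (suc n) F = adj (img n F) (F n) := by
      refine mext fun z => ?_
      simp only [mem_img, mem_adj, mem_suc]
      constructor
      · rintro ⟨v, hv | rfl, rfl⟩
        exacts [Or.inl ⟨v, hv, rfl⟩, Or.inr rfl]
      · rintro (⟨v, hv, rfl⟩ | rfl)
        exacts [⟨v, Or.inl hv, rfl⟩, ⟨n, Or.inr rfl, rfl⟩]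
    rw [e]
    exact adj_mem_fin (ih fun i hi => h i (by simp [hi])) (h n (by simp))

/-- This puts the supports of all elements into a single set, so that the support functions of a
predilator can be formed by separation. -/
theorem sep_mem_fin {n : M} (hn : n ∈ₛ om M) (φ : M → Prop) [PRp (fun x : Fin 1 → M => φ (x 0))] :
    sep n φ ∈ₛ fin (om M) := by
  have hF : ∀ {m : ℕ} (b : (Fin m → M) → M) [PRf b], PRp (fun x => φ (b x)) :=
    fun b _ => PRp.comp1 φ inferInstance b
  refine om_induction (fun n => sep n φ ∈ₛ fin (om M)) ?_ ?_ n hn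
  · convert emp_mem_fin (om M)
    exact mext fun z => by simp [mem_sep]
  · intro n hn ih
    by_cases h : φ n
    · have e : sep (suc n) φ = adj (sep n φ) n := by
        refine mext fun z => ?_
        simp only [mem_sep, mem_adj, mem_suc]
        constructor
        · rintro ⟨h1 | h1, h2⟩ <;> simp [h1, h2]
        · rintro (h1 | rfl) <;> simp [*]
      rw [e]
      exact adj_mem_fin ih hn
    · have e : sep (suc n) φ = sep n φ := by
        refine mext fun z => ?_
        simp only [mem_sep, mem_suc]
        constructor
        · rintro ⟨h1 | rfl, h2⟩
          exacts [⟨h1, h2⟩, absurd h2 h]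
        · rintro ⟨h1, h2⟩; exact ⟨Or.inl h1, h2⟩
      rwa [e]

theorem exists_add (M : Type u) [prsLang.Structure M] [SetModel M] :
    ∃ R : M → M → M, PRf (fun x : Fin 2 → M => R (x 0) (x 1)) ∧
      (∀ y, R y (emp M) = y) ∧ (∀ y n, n ∈ₛ om M → R y (suc n) = suc (R y n)) ∧
      ∀ y n i z, n ∈ₛ om M → i ∈ₛ n → z ∈ₛ R y i → z ∈ₛ R y n :=
  exists_om_recursion (fun y => y) (fun u _ => suc u) (fun _ _ _ h => by simp [h])

/-- `γ + n` for `n ∈ ω` -/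
noncomputable def add (γ n : M) : M := (exists_add M).choose γ n

instance PRf.add {n : ℕ} (a b : (Fin n → M) → M) [PRf a] [PRf b] :
    PRf (fun x => add (a x) (b x)) :=
  PRf.comp2 _ (exists_add M).choose_spec.1 a b

@[simp] theorem add_emp (γ : M) : add γ (emp M) = γ := (exists_add M).choose_spec.2.1 γ

theorem add_suc {γ n : M} (hn : n ∈ₛ om M) : add γ (suc n) = suc (add γ n) :=
  (exists_add M).choose_spec.2.2.1 γ n hn

theorem mem_add {γ n : M} (hn : n ∈ₛ om M) :
    ∀ z, z ∈ₛ add γ n ↔ z ∈ₛ γ ∨ ∃ i, i ∈ₛ n ∧ z = add γ i := by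
  have : ∀ z, z ∈ₛ add γ n → z ∈ₛ γ ∨ ∃ i, i ∈ₛ n ∧ z = add γ i := by
    refine om_induction (fun n => ∀ z, z ∈ₛ add γ n → z ∈ₛ γ ∨ ∃ i, i ∈ₛ n ∧ z = add γ i) ?_ ?_ n hn
    · intro z hz; left; simpa using hz
    · intro n hn ih z hz
      rw [add_suc hn, mem_suc] at hz
      rcases hz with hz | rfl
      · rcases ih z hz with h | ⟨i, hi, h⟩
        exacts [Or.inl h, Or.inr ⟨i, by simp [hi], h⟩]
      · exact Or.inr ⟨n, by simp, rfl⟩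
  refine fun z => ⟨this z, ?_⟩
  refine om_induction (fun n => z ∈ₛ γ ∨ (∃ i, i ∈ₛ n ∧ z = add γ i) → z ∈ₛ add γ n) ?_ ?_ n hn
  · rintro (h | ⟨i, hi, -⟩)
    exacts [by simpa using h, absurd hi (not_mem_emp i)]
  · intro n hn ih h
    rw [add_suc hn, mem_suc]
    rcases h with h | ⟨i, hi, rfl⟩
    · exact Or.inl (ih (Or.inl h))
    · rcases mem_suc.1 hi with hi | rfl
      exacts [Or.inl (ih (Or.inr ⟨i, hi, rfl⟩)), Or.inr rfl]

theorem isOrd_add {γ n : M} (hγ : IsOrd γ) (hn : n ∈ₛ om M) : IsOrd (add γ n) := by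
  refine om_induction (fun n => IsOrd (add γ n)) (by simpa) ?_ n hn
  intro n hn ih
  rw [add_suc hn]
  exact ih.suc

theorem add_not_mem {γ n : M} (hn : n ∈ₛ om M) : ¬ add γ n ∈ₛ γ := fun h =>
  mem_irrefl _ ((mem_add hn _).2 (Or.inl h))

theorem add_mem_add {γ i j : M} (hj : j ∈ₛ om M) (h : i ∈ₛ j) : add γ i ∈ₛ add γ j :=
  (mem_add hj _).2 (Or.inr ⟨i, h, rfl⟩)

theorem add_inj {γ i j : M} (hi : i ∈ₛ om M) (hj : j ∈ₛ om M) (h : add γ i = add γ j) : i = j := by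
  rcases om_trichotomy hi hj with h' | h' | h'
  · exact absurd (add_mem_add hj h') (by rw [h]; exact mem_irrefl _)
  · exact h'
  · exact absurd (add_mem_add hi h') (by rw [h]; exact mem_irrefl _)

theorem add_mem_add_iff {γ i j : M} (hi : i ∈ₛ om M) (hj : j ∈ₛ om M) :
    add γ i ∈ₛ add γ j ↔ i ∈ₛ j := by
  refine ⟨fun h => ?_, add_mem_add hj⟩
  rcases om_trichotomy hi hj with h' | rfl | h'
  · exact h'
  · exact absurd h (mem_irrefl _)
  · exact absurd h (mem_asymm (add_mem_add hi h'))

theorem add_mem_om {n k : M} (hn : n ∈ₛ om M) (hk : k ∈ₛ om M) : add n k ∈ₛ om M := by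
  refine om_induction (fun k => add n k ∈ₛ om M) (by simpa) ?_ k hk
  intro k hk ih
  rw [add_suc hk]
  exact suc_mem_om ih

theorem suc_add {n k : M} (hk : k ∈ₛ om M) : add (suc n) k = suc (add n k) := by
  refine om_induction (fun k => add (suc n) k = suc (add n k)) (by simp) ?_ k hk
  intro k hk ih
  rw [add_suc hk, add_suc hk, ih]

theorem emp_add {k : M} (hk : k ∈ₛ om M) : add (emp M) k = k := by
  refine om_induction (fun k => add (emp M) k = k) (by simp) ?_ k hk
  intro k hk ih
  rw [add_suc hk, ih]

theorem isAdd_add {γ n : M} (hγ : IsOrd γ) (hn : n ∈ₛ om M) : IsAdd γ n (add γ n) := by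
  refine ⟨hγ, isOrd_of_mem_om hn, isOrd_add hγ hn, fun z hz => (mem_add hn z).2 (Or.inl hz),
    lam n (add γ), isFun_lam n _, ?_, ?_⟩
  · intro i j y z hij hi hj
    obtain ⟨hi', rfl⟩ := mem_lam.1 hi
    obtain ⟨hj', rfl⟩ := mem_lam.1 hj
    exact add_mem_add (mem_om_of_mem hn j hj') hij
  · intro y
    simp only [mem_lam, mem_add hn]
    constructor
    · rintro ⟨i, hi, rfl⟩
      exact ⟨Or.inr ⟨i, hi, rfl⟩, add_not_mem (mem_om_of_mem hn i hi)⟩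
    · rintro ⟨h | h, h'⟩
      exacts [absurd h h', h]

/-- By induction on `i`, an increasing enumeration of `δ ∖ γ` can only be `i ↦ γ + i`. So the
relation defined via an order isomorphism agrees with the primitive recursive `add` when the right
summand is a natural number. -/
theorem isAdd_iff {γ n δ : M} (hn : n ∈ₛ om M) : IsAdd γ n δ ↔ IsOrd γ ∧ δ = add γ n := by
  constructor
  swap
  · rintro ⟨h, rfl⟩; exact isAdd_add h hn
  rintro ⟨hγ, -, hδ, hsub, s, hs, hinc, hrng⟩
  refine ⟨hγ, ?_⟩
  have hv : ∀ i, i ∈ₛ n → app s i ∈ₛ δ ∧ ¬ app s i ∈ₛ γ := fun i hi =>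
    (hrng _).1 ⟨i, hs.mem_iff.2 ⟨hi, rfl⟩⟩
  have hlt : ∀ i, i ∈ₛ n → ∀ j, j ∈ₛ n → i ∈ₛ j → app s i ∈ₛ app s j := fun i hi j hj h =>
    hinc i j _ _ h (hs.mem_iff.2 ⟨hi, rfl⟩) (hs.mem_iff.2 ⟨hj, rfl⟩)
  have hno := isOrd_of_mem_om hn
  have key : ∀ i, i ∈ₛ n → app s i = add γ i := by
    refine mem_induction _ _ fun i hi ih => mext fun z => ?_
    rw [mem_add (mem_om_of_mem hn i hi)]
    constructor
    · intro hz
      by_cases hzγ : z ∈ₛ γ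
      · exact Or.inl hzγ
      · obtain ⟨j, hj⟩ := (hrng z).2 ⟨hδ.trans hz (hv i hi).1, hzγ⟩
        obtain ⟨hj', rfl⟩ := hs.mem_iff.1 hj
        have hji : j ∈ₛ i := by
          rcases (hno.of_mem hj').trichotomy (hno.of_mem hi) with h | rfl | h
          · exact h
          · exact absurd hz (mem_irrefl _)
          · exact absurd hz (mem_asymm (hlt i hi j hj' h))
        exact Or.inr ⟨j, hji, ih j hji hj'⟩
    · rintro (hz | ⟨j, hj, rfl⟩)
      · rcases (hδ.of_mem (hv i hi).1).trichotomy (hγ.of_mem hz) with h | h | h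
        · exact absurd (hγ.trans h hz) (hv i hi).2
        · exact absurd (h ▸ hz) (hv i hi).2
        · exact h
      · have hjn := hno.trans hj hi
        rw [← ih j hj hjn]
        exact hlt j hjn i hi hj
  refine mext fun z => ?_
  rw [mem_add hn]
  constructor
  · intro hz
    by_cases hzγ : z ∈ₛ γ
    · exact Or.inl hzγ
    · obtain ⟨j, hj⟩ := (hrng z).2 ⟨hz, hzγ⟩
      obtain ⟨hj', rfl⟩ := hs.mem_iff.1 hj
      exact Or.inr ⟨j, hj', key j hj'⟩
  · rintro (hz | ⟨j, hj, rfl⟩)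
    · exact hsub z hz
    · rw [← key j hj]; exact (hv j hj).1

/-! ### Increasing maps from natural numbers into linear orders -/

omit [SetModel M] in
/-- `lt` is a strict linear order on the elements of `A`. -/
structure LinOn (A : M) (lt : M → M → Prop) : Prop where
  irrefl : ∀ x, x ∈ₛ A → ¬ lt x x
  trans : ∀ x y z, x ∈ₛ A → y ∈ₛ A → z ∈ₛ A → lt x y → lt y z → lt x z
  total : ∀ x y, x ∈ₛ A → y ∈ₛ A → lt x y ∨ x = y ∨ lt y x

theorem IsOrd.linOn {a : M} (h : IsOrd a) : LinOn a Mem where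
  irrefl x _ := mem_irrefl x
  trans _ _ _ _ _ hz h1 h2 := (h.of_mem hz).trans h1 h2
  total _ _ hx hy := (h.of_mem hx).trichotomy (h.of_mem hy)

/-- `e` is an increasing map from `n ∈ ω` into the set `A`, ordered by `lt`. -/
def Inc (A : M) (lt : M → M → Prop) (n e : M) : Prop :=
  n ∈ₛ om M ∧ IsMap e n A ∧ ∀ i j x y, i ∈ₛ j → pr i x ∈ₛ e → pr j y ∈ₛ e → lt x y

omit [SetModel M] in
theorem isMor_iff {m n f : M} : IsMor m n f ↔ n ∈ₛ om M ∧ Inc n Mem m f := by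
  simp only [IsMor, Inc]; tauto

omit [SetModel M] in
theorem isEnum_iff {A a n e : M} {lt : M → M → Prop} :
    IsEnum A lt a n e ↔ Inc A lt n e ∧ ∀ x, x ∈ₛ a ↔ ∃ i, pr i x ∈ₛ e := by
  simp only [IsEnum, Inc]; tauto

variable {A : M} {lt : M → M → Prop}

theorem Inc.app_mem {n e i : M} (h : Inc A lt n e) (hi : i ∈ₛ n) : app e i ∈ₛ A :=
  h.2.1.app_mem hi

theorem Inc.mem_iff {n e i x : M} (h : Inc A lt n e) : pr i x ∈ₛ e ↔ i ∈ₛ n ∧ x = app e i :=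
  h.2.1.1.mem_iff

theorem Inc.app_lt {n e i j : M} (h : Inc A lt n e) (hj : j ∈ₛ n) (hij : i ∈ₛ j) :
    lt (app e i) (app e j) :=
  h.2.2 i j _ _ hij (h.mem_iff.2 ⟨(isOrd_of_mem_om h.1).trans hij hj, rfl⟩) (h.mem_iff.2 ⟨hj, rfl⟩)

theorem Inc.ext {B : M} {lt' : M → M → Prop} {n e e' : M} (h : Inc A lt n e) (h' : Inc B lt' n e')
    (hx : ∀ i, i ∈ₛ n → app e i = app e' i) : e = e' :=
  h.2.1.1.ext h'.2.1.1 hx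

theorem inc_lam {n : M} (hn : n ∈ₛ om M) (F : M → M) [PRf (fun x : Fin 1 → M => F (x 0))]
    (hF : ∀ i, i ∈ₛ n → F i ∈ₛ A) (hlt : ∀ i j, i ∈ₛ j → j ∈ₛ n → lt (F i) (F j)) :
    Inc A lt n (lam n F) :=
  ⟨hn, isMap_lam hF, fun i j x y hij hi hj => by
    obtain ⟨hi', rfl⟩ := mem_lam.1 hi
    obtain ⟨hj', rfl⟩ := mem_lam.1 hj
    exact hlt i j hij hj'⟩

/-- All finite sequences in `A` belong to one primitive recursive set, which makes quantifiers over
them bounded. -/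
theorem Inc.mem_fin {n e : M} (h : Inc A lt n e) : e ∈ₛ fin (prod (om M) A) := by
  have e1 : e = img n (fun i => pr i (app e i)) := by
    refine mext fun p => ?_
    rw [mem_img]
    constructor
    · intro hp
      obtain ⟨i, x, hi, rfl⟩ := h.2.1.1.1 p hp
      exact ⟨i, hi, by rw [(h.mem_iff.1 hp).2]⟩
    · rintro ⟨i, hi, rfl⟩; exact h.mem_iff.2 ⟨hi, rfl⟩
  rw [e1]
  exact img_mem_fin h.1 _ fun i hi => pr_mem_prod.2 ⟨mem_om_of_mem h.1 i hi, h.app_mem hi⟩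

theorem Inc.lt_iff {n e i j : M} (hA : LinOn A lt) (h : Inc A lt n e) (hi : i ∈ₛ n) (hj : j ∈ₛ n) :
    lt (app e i) (app e j) ↔ i ∈ₛ j := by
  refine ⟨fun hl => ?_, h.app_lt hj⟩
  rcases om_trichotomy (mem_om_of_mem h.1 i hi) (mem_om_of_mem h.1 j hj) with h' | rfl | h'
  · exact h'
  · exact absurd hl (hA.irrefl _ (h.app_mem hi))
  · exact absurd (hA.trans _ _ _ (h.app_mem hi) (h.app_mem hj) (h.app_mem hi) hl (h.app_lt hi h'))
      (hA.irrefl _ (h.app_mem hi))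

theorem Inc.inj {n e i j : M} (hA : LinOn A lt) (h : Inc A lt n e) (hi : i ∈ₛ n) (hj : j ∈ₛ n)
    (he : app e i = app e j) : i = j := by
  rcases om_trichotomy (mem_om_of_mem h.1 i hi) (mem_om_of_mem h.1 j hj) with h' | h' | h'
  · have := h.app_lt hj h'
    rw [he] at this
    exact absurd this (hA.irrefl _ (h.app_mem hj))
  · exact h'
  · have := h.app_lt hi h'
    rw [he] at this
    exact absurd this (hA.irrefl _ (h.app_mem hj))

/-- A version with bounded quantifiers, for the instance `PRp.inc`. -/
theorem inc_iff {n e : M} : Inc A lt n e ↔ n ∈ₛ om M ∧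
    (∀ p, p ∈ₛ e → ∃ x, x ∈ₛ n ∧ ∃ y, y ∈ₛ A ∧ p = pr x y) ∧
    (∀ x, x ∈ₛ n → ∃ y, y ∈ₛ A ∧ ∀ z, z ∈ₛ A → (pr x z ∈ₛ e ↔ z = y)) ∧
    ∀ j, j ∈ₛ n → ∀ i, i ∈ₛ j → lt (app e i) (app e j) := by
  constructor
  · intro h
    refine ⟨h.1, fun p hp => ?_, fun x hx => ⟨app e x, h.app_mem hx, fun z _ => by
      simp [h.mem_iff, hx]⟩, fun j hj i hij => h.app_lt hj hij⟩
    obtain ⟨x, y, hx, rfl⟩ := h.2.1.1.1 p hp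
    exact ⟨x, hx, y, h.2.1.2 x y hp, rfl⟩
  · rintro ⟨hn, h1, h2, h3⟩
    have hA : ∀ x y, pr x y ∈ₛ e → x ∈ₛ n ∧ y ∈ₛ A := by
      intro x y hp
      obtain ⟨x', hx', y', hy', e⟩ := h1 _ hp
      obtain ⟨rfl, rfl⟩ := pr_inj.1 e
      exact ⟨hx', hy'⟩
    have hfun : IsFun e n := by
      refine ⟨fun p hp => ?_, fun x hx => ?_⟩
      · obtain ⟨x', hx', y', hy', e⟩ := h1 _ hp
        exact ⟨x', y', hx', e⟩
      · obtain ⟨y, hy, h⟩ := h2 x hx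
        exact ⟨y, (h y hy).2 rfl, fun z hz => (h z (hA _ _ hz).2).1 hz⟩
    refine ⟨hn, ⟨hfun, fun x y hp => (hA x y hp).2⟩, fun i j x y hij hi hj => ?_⟩
    obtain ⟨hi', rfl⟩ := hfun.mem_iff.1 hi
    obtain ⟨hj', rfl⟩ := hfun.mem_iff.1 hj
    exact h3 j hj' i hij

instance PRp.inc {n : ℕ} (a b c : (Fin n → M) → M) [PRf a] [PRf b] [PRf c]
    [h : PRp (fun x : Fin 2 → M => lt (x 0) (x 1))] :
    PRp (fun x => Inc (a x) lt (b x) (c x)) := by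
  refine PRp.comp3 (fun a b c => Inc a lt b c) ?_ a b c
  have hlt : ∀ {m : ℕ} (a b : (Fin m → M) → M) [PRf a] [PRf b], PRp (fun x => lt (a x) (b x)) :=
    fun a b _ _ => PRp.comp2 lt h a b
  simp only [inc_iff]
  infer_instance

instance PRp.isMor {n : ℕ} (a b c : (Fin n → M) → M) [PRf a] [PRf b] [PRf c] :
    PRp (fun x => IsMor (a x) (b x) (c x)) := by
  simp only [isMor_iff]
  infer_instance

/-- The set of finite functions on `ω`, which includes all morphisms of `Nat`. -/
noncomputable def mors (M : Type u) [prsLang.Structure M] [SetModel M] : M :=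
  fin (prod (om M) (om M))

omit [SetModel M] in
theorem Inc.mono {B n e : M} {lt' : M → M → Prop} (h : Inc A lt n e)
    (h1 : ∀ x, x ∈ₛ A → x ∈ₛ B) (h2 : ∀ x y, x ∈ₛ A → y ∈ₛ A → lt x y → lt' x y) : Inc B lt' n e :=
  ⟨h.1, ⟨h.2.1.1, fun x y hx => h1 y (h.2.1.2 x y hx)⟩, fun i j x y hij hi hj =>
    h2 x y (h.2.1.2 i x hi) (h.2.1.2 j y hj) (h.2.2 i j x y hij hi hj)⟩

theorem IsMor.mem_mors {m n f : M} (h : IsMor m n f) : f ∈ₛ mors M :=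
  Inc.mem_fin (lt := Mem) (n := m)
    ((isMor_iff.1 h).2.mono (fun x hx => mem_om_of_mem h.2.1 x hx) (fun _ _ _ _ h => h))

omit [SetModel M] in
theorem IsMor.inc {m n f : M} (h : IsMor m n f) : Inc n Mem m f := (isMor_iff.1 h).2

theorem IsMor.app_mem {m n f i : M} (h : IsMor m n f) (hi : i ∈ₛ m) : app f i ∈ₛ n :=
  h.inc.app_mem hi

theorem linOn_of_mem_om {n : M} (hn : n ∈ₛ om M) : LinOn n Mem := (isOrd_of_mem_om hn).linOn

/-- `h ∘ f` for `f` with domain `n` -/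
noncomputable def cmp (n h f : M) : M := lam n (fun i => app h (app f i))

theorem app_cmp {n h f i : M} (hi : i ∈ₛ n) : app (cmp n h f) i = app h (app f i) := app_lam hi

theorem Inc.cmp {n N h f : M} (hh : Inc A lt N h) (hf : IsMor n N f) : Inc A lt n (cmp n h f) :=
  inc_lam hf.1 _ (fun _ hi => hh.app_mem (hf.app_mem hi)) fun _ _ hij hj =>
    hh.app_lt (hf.app_mem hj) (hf.inc.app_lt hj hij)

theorem IsMor.cmp {m n k f g : M} (hf : IsMor m n f) (hg : IsMor n k g) :
    IsMor m k (cmp m g f) := isMor_iff.2 ⟨hg.2.1, hg.inc.cmp hf⟩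

theorem Inc.map {B : M} {lt' : M → M → Prop} {n e : M} (h : Inc A lt n e) (φ : M → M)
    [PRf (fun x : Fin 1 → M => φ (x 0))] (h1 : ∀ x, x ∈ₛ A → φ x ∈ₛ B)
    (h2 : ∀ x y, x ∈ₛ A → y ∈ₛ A → lt x y → lt' (φ x) (φ y)) :
    Inc B lt' n (lam n (fun i => φ (app e i))) := by
  have : PRf (fun x : Fin 1 → M => φ (app e (x 0))) := PRf.comp1 φ inferInstance _
  exact inc_lam h.1 _ (fun i hi => h1 _ (h.app_mem hi)) fun i j hij hj =>
    h2 _ _ (h.app_mem ((isOrd_of_mem_om h.1).trans hij hj)) (h.app_mem hj) (h.app_lt hj hij)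

/-- If the range of `e` is included in the range of `h`, then `e` factors through `h`. -/
theorem Inc.exists_lift {n l e h : M} (hA : LinOn A lt) (he : Inc A lt n e) (hh : Inc A lt l h)
    (H : ∀ i, i ∈ₛ n → ∃ j, j ∈ₛ l ∧ app h j = app e i) :
    ∃ f, IsMor n l f ∧ ∀ i, i ∈ₛ n → app h (app f i) = app e i := by
  let F : M → M := fun i => sUn (sep l (fun j => app h j = app e i))
  have hF : PRf (fun x : Fin 1 → M => F (x 0)) := by simp only [F]; infer_instance
  have key : ∀ i, i ∈ₛ n → F i ∈ₛ l ∧ app h (F i) = app e i := by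
    intro i hi
    obtain ⟨j, hj, e⟩ := H i hi
    have : F i = j := by
      refine sUn_unique fun z => ?_
      rw [mem_sep]
      exact ⟨fun hz => hh.inj hA hz.1 hj (hz.2.trans e.symm), fun hz => hz ▸ ⟨hj, e⟩⟩
    rw [this]; exact ⟨hj, e⟩
  have hno := isOrd_of_mem_om he.1
  refine ⟨lam n F, isMor_iff.2 ⟨hh.1, inc_lam he.1 F (fun i hi => (key i hi).1) ?_⟩, ?_⟩
  · intro i j hij hj
    have hi := hno.trans hij hj
    refine (hh.lt_iff hA (key i hi).1 (key j hj).1).1 ?_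
    rw [(key i hi).2, (key j hj).2]
    exact he.app_lt hj hij
  · intro i hi
    rw [app_lam hi]; exact (key i hi).2

theorem Inc.restrict {n e m : M} (h : Inc A lt n e) (hm : m ∈ₛ suc n) :
    Inc A lt m (lam m (app e)) := by
  have hs : ∀ i, i ∈ₛ m → i ∈ₛ n := by
    rcases mem_suc.1 hm with hm | rfl
    · exact fun i hi => (isOrd_of_mem_om h.1).trans hi hm
    · exact fun i hi => hi
  exact inc_lam (mem_om_of_mem (suc_mem_om h.1) m hm) _ (fun i hi => h.app_mem (hs i hi))
    fun i j hij hj => h.app_lt (hs j hj) hij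

theorem Inc.append {l h x : M} (hh : Inc A lt l h) (hx : x ∈ₛ A)
    (H : ∀ j, j ∈ₛ l → lt (app h j) x) :
    ∃ h', Inc A lt (suc l) h' ∧ (∀ j, j ∈ₛ l → app h' j = app h j) ∧ app h' l = x := by
  let F : M → M := fun j => if j ∈ₛ l then app h j else x
  have hF : PRf (fun x : Fin 1 → M => F (x 0)) := by simp only [F]; infer_instance
  refine ⟨lam (suc l) F, inc_lam (suc_mem_om hh.1) F ?_ ?_, ?_, ?_⟩
  · intro i _
    simp only [F]
    split_ifs with h
    exacts [hh.app_mem h, hx]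
  · intro i j hij hj
    simp only [F]
    rcases mem_suc.1 hj with hj | rfl
    · rw [if_pos hj, if_pos ((isOrd_of_mem_om hh.1).trans hij hj)]
      exact hh.app_lt hj hij
    · rw [if_neg (mem_irrefl _), if_pos hij]
      exact H i hij
  · intro j hj
    rw [app_lam (by simp [hj])]; exact if_pos hj
  · rw [app_lam (by simp)]; exact if_neg (mem_irrefl _)

/-- `h : l → A` enumerates the values of `e₁` on `a` and of `e₂` on `b`. -/
def Covers (e₁ e₂ a b l h : M) : Prop :=
  (∀ i, i ∈ₛ a → ∃ j, j ∈ₛ l ∧ app h j = app e₁ i) ∧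
  (∀ i, i ∈ₛ b → ∃ j, j ∈ₛ l ∧ app h j = app e₂ i) ∧
  ∀ j, j ∈ₛ l → (∃ i, i ∈ₛ a ∧ app h j = app e₁ i) ∨ ∃ i, i ∈ₛ b ∧ app h j = app e₂ i

/-- Merging of two finite increasing sequences. The larger of the two last entries is removed (both
of them if they are equal), the remaining initial segments are merged, and the removed entry is
appended. The bound `n + k` on the length matters because `≪` and `i(σ)` are defined by embeddings
into `n + k` and `n + n`. -/
theorem exists_covers {n k e₁ e₂ : M} (hA : LinOn A lt)
    [hlt : PRp (fun x : Fin 2 → M => lt (x 0) (x 1))] (h₁ : Inc A lt n e₁) (h₂ : Inc A lt k e₂) :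
    ∃ l h, (∀ i, i ∈ₛ l → i ∈ₛ add n k) ∧ Inc A lt l h ∧ Covers e₁ e₂ n k l h := by
  have hsn := suc_mem_om h₁.1
  have hsk := suc_mem_om h₂.1
  have hCov : ∀ {m : ℕ} (a b c d : (Fin m → M) → M) [PRf a] [PRf b] [PRf c] [PRf d],
      PRp (fun x => Covers e₁ e₂ (a x) (b x) (c x) (d x)) := by
    intro m a b c d _ _ _ _
    exact PRp.comp4 (Covers e₁ e₂) (by unfold Covers; infer_instance) a b c d
  -- Induction on a bound `N` for the sum of the lengths. The witnesses `l` and `h` range over sets,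
  -- since the induction formula must be primitive recursive.
  have key : ∀ N, N ∈ₛ om M → ∀ a, a ∈ₛ suc n → ∀ b, b ∈ₛ suc k → add a b ∈ₛ suc N →
      ∃ l, l ∈ₛ suc N ∧ ∃ h, h ∈ₛ fin (prod (om M) A) ∧ Inc A lt l h ∧ Covers e₁ e₂ a b l h := by
    have c0 : ∀ N b, b ∈ₛ suc k → add (emp M) b ∈ₛ suc N → ∃ l, l ∈ₛ suc N ∧
        ∃ h, h ∈ₛ fin (prod (om M) A) ∧ Inc A lt l h ∧ Covers e₁ e₂ (emp M) b l h := by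
      intro N b hb hab
      rw [emp_add (mem_om_of_mem hsk b hb)] at hab
      refine ⟨b, hab, _, (h₂.restrict hb).mem_fin, h₂.restrict hb,
        fun i hi => absurd hi (not_mem_emp i), fun i hi => ⟨i, hi, app_lam hi⟩,
        fun j hj => Or.inr ⟨j, hj, app_lam hj⟩⟩
    have c1 : ∀ N a, a ∈ₛ suc n → add a (emp M) ∈ₛ suc N → ∃ l, l ∈ₛ suc N ∧
        ∃ h, h ∈ₛ fin (prod (om M) A) ∧ Inc A lt l h ∧ Covers e₁ e₂ a (emp M) l h := by
      intro N a ha hab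
      rw [add_emp] at hab
      refine ⟨a, hab, _, (h₁.restrict ha).mem_fin, h₁.restrict ha,
        fun i hi => ⟨i, hi, app_lam hi⟩, fun i hi => absurd hi (not_mem_emp i),
        fun j hj => Or.inl ⟨j, hj, app_lam hj⟩⟩
    refine om_induction (fun N => ∀ a, a ∈ₛ suc n → ∀ b, b ∈ₛ suc k → add a b ∈ₛ suc N →
      ∃ l, l ∈ₛ suc N ∧ ∃ h, h ∈ₛ fin (prod (om M) A) ∧ Inc A lt l h ∧
        Covers e₁ e₂ a b l h) ?_ ?_
    · intro a ha b hb hab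
      have : a = emp M := by
        refine mext fun z => iff_of_false (fun hz => ?_) (not_mem_emp z)
        have h1 := (mem_add (γ := a) (mem_om_of_mem hsk b hb) z).2 (Or.inl hz)
        rw [mem_suc] at hab
        rcases hab with hab | hab
        · exact not_mem_emp _ hab
        · exact not_mem_emp _ (hab ▸ h1)
      subst this
      exact c0 _ b hb hab
    · intro N hN ih a ha b hb hab
      have hao := mem_om_of_mem hsn a ha
      have hbo := mem_om_of_mem hsk b hb
      rcases (mem_om_iff a).1 hao with rfl | ⟨a', ha', rfl⟩
      · exact c0 _ b hb hab
      rcases (mem_om_iff b).1 hbo with rfl | ⟨b', hb', rfl⟩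
      · exact c1 _ _ ha hab
      change add (suc a') (suc b') ∈ₛ _ at hab
      have sub : ∀ {x y z : M}, y ∈ₛ om M → x ∈ₛ om M → suc x ∈ₛ suc y → x ∈ₛ y := by
        intro x y z hy hx h
        rcases om_trichotomy hx hy with h' | rfl | h'
        · exact h'
        · exact absurd h (mem_irrefl _)
        · exact absurd h (mem_asymm (suc_mem_suc hx h'))
      have haN : a' ∈ₛ n := by
        rcases mem_suc.1 ha with h | h
        · exact (isOrd_of_mem_om h₁.1).trans (mem_suc.2 (Or.inr rfl)) h
        · exact h ▸ mem_suc.2 (Or.inr rfl)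
      have hbK : b' ∈ₛ k := by
        rcases mem_suc.1 hb with h | h
        · exact (isOrd_of_mem_om h₂.1).trans (mem_suc.2 (Or.inr rfl)) h
        · exact h ▸ mem_suc.2 (Or.inr rfl)
      have hs1 : add (suc a') b' ∈ₛ suc N := by
        rw [add_suc hb'] at hab
        exact sub (z := N) (suc_mem_om hN) (add_mem_om hao hb') hab
      have hs2 : add a' (suc b') ∈ₛ suc N := by
        rw [suc_add (suc_mem_om hb')] at hab
        exact sub (z := N) (suc_mem_om hN) (add_mem_om ha' (suc_mem_om hb')) hab
      have hs3 : add a' b' ∈ₛ suc N := by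
        rw [add_suc hb'] at hs2
        exact (isOrd_of_mem_om (suc_mem_om hN)).trans (mem_suc.2 (Or.inr rfl)) hs2
      have e1le : ∀ i, i ∈ₛ suc a' → lt (app e₁ i) (app e₁ a') ∨ i = a' := by
        intro i hi
        rcases mem_suc.1 hi with hi | hi
        exacts [Or.inl (h₁.app_lt haN hi), Or.inr hi]
      have e2le : ∀ i, i ∈ₛ suc b' → lt (app e₂ i) (app e₂ b') ∨ i = b' := by
        intro i hi
        rcases mem_suc.1 hi with hi | hi
        exacts [Or.inl (h₂.app_lt hbK hi), Or.inr hi]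
      have hi1 : ∀ i, i ∈ₛ suc a' → i ∈ₛ n := fun i hi => by
        rcases mem_suc.1 hi with hi | rfl
        exacts [(isOrd_of_mem_om h₁.1).trans hi haN, haN]
      have hi2 : ∀ i, i ∈ₛ suc b' → i ∈ₛ k := fun i hi => by
        rcases mem_suc.1 hi with hi | rfl
        exacts [(isOrd_of_mem_om h₂.1).trans hi hbK, hbK]
      have hAa := h₁.app_mem haN
      have hAb := h₂.app_mem hbK
      rcases hA.total _ _ hAa hAb with hl | hl | hl
      · obtain ⟨l, hlN, h, -, hI, hc1, hc2, hc3⟩ := ih _ ha b' (by simp [hbK]) hs1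
        obtain ⟨h', hI', hh1, hh2⟩ := hI.append hAb (by
          intro j hj
          rcases hc3 j hj with ⟨i, hi, e⟩ | ⟨i, hi, e⟩
          · rw [e]
            rcases e1le i hi with h | rfl
            · exact hA.trans _ _ _ (h₁.app_mem (hi1 i hi)) hAa hAb h hl
            · exact hl
          · rw [e]; exact h₂.app_lt hbK hi)
        refine ⟨suc l, suc_mem_suc (suc_mem_om hN) hlN, h', hI'.mem_fin, hI', ?_, ?_, ?_⟩
        · intro i hi
          obtain ⟨j, hj, e⟩ := hc1 i hi
          exact ⟨j, by simp [hj], by rw [hh1 j hj, e]⟩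
        · intro i hi
          rcases mem_suc.1 hi with hi | rfl
          · obtain ⟨j, hj, e⟩ := hc2 i hi
            exact ⟨j, by simp [hj], by rw [hh1 j hj, e]⟩
          · exact ⟨l, by simp, hh2⟩
        · intro j hj
          rcases mem_suc.1 hj with hj | rfl
          · rw [hh1 j hj]
            rcases hc3 j hj with h | ⟨i, hi, h⟩
            exacts [Or.inl h, Or.inr ⟨i, mem_suc.2 (Or.inl hi), h⟩]
          · exact Or.inr ⟨b', by simp, hh2⟩
      · obtain ⟨l, hlN, h, -, hI, hc1, hc2, hc3⟩ := ih a' (by simp [haN]) b' (by simp [hbK]) hs3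
        obtain ⟨h', hI', hh1, hh2⟩ := hI.append hAb (by
          intro j hj
          rcases hc3 j hj with ⟨i, hi, e⟩ | ⟨i, hi, e⟩
          · rw [e, ← hl]; exact h₁.app_lt haN hi
          · rw [e]; exact h₂.app_lt hbK hi)
        refine ⟨suc l, suc_mem_suc (suc_mem_om hN) hlN, h', hI'.mem_fin, hI', ?_, ?_, ?_⟩
        · intro i hi
          rcases mem_suc.1 hi with hi | rfl
          · obtain ⟨j, hj, e⟩ := hc1 i hi
            exact ⟨j, by simp [hj], by rw [hh1 j hj, e]⟩
          · exact ⟨l, by simp, hh2.trans hl.symm⟩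
        · intro i hi
          rcases mem_suc.1 hi with hi | rfl
          · obtain ⟨j, hj, e⟩ := hc2 i hi
            exact ⟨j, by simp [hj], by rw [hh1 j hj, e]⟩
          · exact ⟨l, by simp, hh2⟩
        · intro j hj
          rcases mem_suc.1 hj with hj | rfl
          · rw [hh1 j hj]
            rcases hc3 j hj with ⟨i, hi, h⟩ | ⟨i, hi, h⟩
            exacts [Or.inl ⟨i, mem_suc.2 (Or.inl hi), h⟩, Or.inr ⟨i, mem_suc.2 (Or.inl hi), h⟩]
          · exact Or.inr ⟨b', by simp, hh2⟩
      · obtain ⟨l, hlN, h, -, hI, hc1, hc2, hc3⟩ := ih a' (by simp [haN]) _ hb hs2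
        obtain ⟨h', hI', hh1, hh2⟩ := hI.append hAa (by
          intro j hj
          rcases hc3 j hj with ⟨i, hi, e⟩ | ⟨i, hi, e⟩
          · rw [e]; exact h₁.app_lt haN hi
          · rw [e]
            rcases e2le i hi with h | rfl
            · exact hA.trans _ _ _ (h₂.app_mem (hi2 i hi)) hAb hAa h hl
            · exact hl)
        refine ⟨suc l, suc_mem_suc (suc_mem_om hN) hlN, h', hI'.mem_fin, hI', ?_, ?_, ?_⟩
        · intro i hi
          rcases mem_suc.1 hi with hi | rfl
          · obtain ⟨j, hj, e⟩ := hc1 i hi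
            exact ⟨j, by simp [hj], by rw [hh1 j hj, e]⟩
          · exact ⟨l, by simp, hh2⟩
        · intro i hi
          obtain ⟨j, hj, e⟩ := hc2 i hi
          exact ⟨j, by simp [hj], by rw [hh1 j hj, e]⟩
        · intro j hj
          rcases mem_suc.1 hj with hj | rfl
          · rw [hh1 j hj]
            rcases hc3 j hj with ⟨i, hi, h⟩ | h
            exacts [Or.inl ⟨i, mem_suc.2 (Or.inl hi), h⟩, Or.inr h]
          · exact Or.inl ⟨a', by simp, hh2⟩
  have hN := add_mem_om h₁.1 h₂.1
  obtain ⟨l, hl, h, -, hI, hc⟩ := key _ hN n (by simp) k (by simp) (by simp)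
  refine ⟨l, h, ?_, hI, hc⟩
  rcases mem_suc.1 hl with hl | rfl
  · exact fun i hi => (isOrd_of_mem_om hN).trans hi hl
  · exact fun i hi => hi

end Finite
-- Predilators as functors and their extension to linear orders
section GoodData
open Classical

variable {M : Type u} [prsLang.Structure M]

/-- `P` consists of total functions between the sets `D(n)` and satisfies the laws of
predilators. -/
structure Data.Good (P : Data M) : Prop where
  laws : P.Laws
  lt_el : ∀ {n σ τ}, n ∈ₛ om M → P.lt n σ τ → P.el n σ ∧ P.el n τ
  act_el : ∀ {m n f σ τ}, IsMor m n f → P.act m n f σ τ → P.el m σ ∧ P.el n τ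
  act_ex : ∀ {m n f σ}, IsMor m n f → P.el m σ → ∃ τ, P.act m n f σ τ
  act_fun : ∀ {m n f σ τ ρ}, IsMor m n f → P.act m n f σ τ → P.act m n f σ ρ → τ = ρ
  supp_el : ∀ {n σ a}, n ∈ₛ om M → P.supp n σ a → P.el n σ
  supp_ex : ∀ {n σ}, n ∈ₛ om M → P.el n σ → ∃ a, P.supp n σ a
  supp_fun : ∀ {n σ a b}, n ∈ₛ om M → P.supp n σ a → P.supp n σ b → a = b
  supp_sub : ∀ {n σ a i}, n ∈ₛ om M → P.supp n σ a → i ∈ₛ a → i ∈ₛ n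

/-- `D(f)(σ)` for `f : m → n` -/
noncomputable def Data.mp (P : Data M) (m n f σ : M) : M :=
  if h : ∃ τ, P.act m n f σ τ then h.choose else emp M

noncomputable def Data.sp (P : Data M) (n σ : M) : M :=
  if h : ∃ a, P.supp n σ a then h.choose else emp M

/-- `D(h)(σ) < D(h')(τ)` in `D(A)`, for increasing maps `e : n → A` and `e' : k → A`. -/
def Data.Lt (P : Data M) (A : M) (lt : M → M → Prop) (n σ e k τ e' : M) : Prop :=
  ∃ N h f g σ' τ', Inc A lt N h ∧ IsMor n N f ∧ IsMor k N g ∧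
    (∀ i, i ∈ₛ n → app h (app f i) = app e i) ∧ (∀ i, i ∈ₛ k → app h (app g i) = app e' i) ∧
    P.act n N f σ σ' ∧ P.act k N g τ τ' ∧ P.lt N σ' τ'

variable [SetModel M]

theorem isMor_id {n : M} (hn : n ∈ₛ om M) : IsMor n n (lam n (fun i => i)) :=
  isMor_iff.2 ⟨hn, inc_lam hn _ (fun _ h => h) (fun _ _ h _ => h)⟩

theorem isMor_of_subset {m n : M} (hm : m ∈ₛ om M) (hn : n ∈ₛ om M) (h : ∀ i, i ∈ₛ m → i ∈ₛ n) :
    IsMor m n (lam m (fun i => i)) :=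
  isMor_iff.2 ⟨hn, inc_lam hm _ h (fun _ _ h _ => h)⟩

theorem isMor_add_left {n k : M} (hn : n ∈ₛ om M) (hk : k ∈ₛ om M) :
    IsMor n (add n k) (lam n (fun i => i)) :=
  isMor_of_subset hn (add_mem_om hn hk) fun i hi => (mem_add hk i).2 (Or.inl hi)

theorem isMor_add_right {n k : M} (hn : n ∈ₛ om M) (hk : k ∈ₛ om M) :
    IsMor k (add n k) (lam k (add n)) :=
  isMor_iff.2 ⟨add_mem_om hn hk, inc_lam hk _ (fun _ hi => add_mem_add hk hi)
    (fun _ j hij hj => add_mem_add (mem_om_of_mem hk j hj) hij)⟩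

theorem IsMor.le_app {m n f : M} (hf : IsMor m n f) :
    ∀ i, i ∈ₛ m → i ∈ₛ app f i ∨ i = app f i := by
  refine mem_induction m _ fun i hi ih => ?_
  have ho := isOrd_of_mem_om (mem_om_of_mem hf.2.1 _ (hf.app_mem hi))
  rcases om_trichotomy (mem_om_of_mem hf.1 i hi) (mem_om_of_mem hf.2.1 _ (hf.app_mem hi))
    with h | h | h
  · exact Or.inl h
  · exact Or.inr h
  · have hm := (isOrd_of_mem_om hf.1).trans h hi
    have hlt := hf.inc.app_lt hi h
    rcases ih _ h hm with h' | h'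
    · exact absurd hlt (mem_asymm h')
    · rw [← h'] at hlt; exact absurd hlt (mem_irrefl _)

theorem IsMor.subset {m n f : M} (hf : IsMor m n f) {i : M} (hi : i ∈ₛ m) : i ∈ₛ n := by
  rcases hf.le_app i hi with h | h
  · exact (isOrd_of_mem_om hf.2.1).trans h (hf.app_mem hi)
  · rw [h]; exact hf.app_mem hi

/-- The two enumerations factor through each other by embeddings `f` and `g`. Both satisfy `i ≤
f(i)` and `i ≤ g(i)`, and `g(f(i)) = i`, so `f` is the identity. -/
theorem IsEnum.unique {A a n e n' e' : M} {lt : M → M → Prop} (hA : LinOn A lt)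
    (h : IsEnum A lt a n e) (h' : IsEnum A lt a n' e') : n = n' ∧ e = e' := by
  rw [isEnum_iff] at h h'
  have h1 : ∀ i, i ∈ₛ n → ∃ j, j ∈ₛ n' ∧ app e' j = app e i := fun i hi => by
    obtain ⟨j, hj⟩ := (h'.2 (app e i)).1 ((h.2 _).2 ⟨i, h.1.mem_iff.2 ⟨hi, rfl⟩⟩)
    rw [h'.1.mem_iff] at hj
    exact ⟨j, hj.1, hj.2.symm⟩
  have h2 : ∀ i, i ∈ₛ n' → ∃ j, j ∈ₛ n ∧ app e j = app e' i := fun i hi => by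
    obtain ⟨j, hj⟩ := (h.2 (app e' i)).1 ((h'.2 _).2 ⟨i, h'.1.mem_iff.2 ⟨hi, rfl⟩⟩)
    rw [h.1.mem_iff] at hj
    exact ⟨j, hj.1, hj.2.symm⟩
  obtain ⟨f, hf, hfe⟩ := h.1.exists_lift hA h'.1 h1
  obtain ⟨g, hg, hge⟩ := h'.1.exists_lift hA h.1 h2
  obtain rfl : n = n' := mext fun z => ⟨hf.subset, hg.subset⟩
  refine ⟨rfl, h.1.ext h'.1 fun i hi => ?_⟩
  have hfi := hf.app_mem hi
  have hgf : app g (app f i) = i := h.1.inj hA (hg.app_mem hfi) hi (by rw [hge _ hfi, hfe i hi])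
  have : app f i = i := by
    rcases hf.le_app i hi with h1 | h1
    · rcases hg.le_app _ hfi with h2 | h2
      · rw [hgf] at h2; exact absurd h1 (mem_asymm h2)
      · rw [hgf] at h2; exact h2
    · exact h1.symm
  rw [← hfe i hi, this]

section
variable {P : Data M} (hP : P.Good)
include hP

theorem Data.Good.act_iff {m n f σ τ : M} (hf : IsMor m n f) (hσ : P.el m σ) :
    P.act m n f σ τ ↔ τ = P.mp m n f σ := by
  have h := hP.act_ex hf hσ
  have h2 : P.act m n f σ (P.mp m n f σ) := by
    rw [Data.mp, dif_pos h]; exact h.choose_spec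
  exact ⟨fun h' => hP.act_fun hf h' h2, fun h' => h' ▸ h2⟩

theorem Data.Good.act_mp {m n f σ : M} (hf : IsMor m n f) (hσ : P.el m σ) :
    P.act m n f σ (P.mp m n f σ) := (hP.act_iff hf hσ).2 rfl

theorem Data.Good.mp_el {m n f σ : M} (hf : IsMor m n f) (hσ : P.el m σ) :
    P.el n (P.mp m n f σ) := (hP.act_el hf (hP.act_mp hf hσ)).2

theorem Data.Good.supp_iff {n σ a : M} (hn : n ∈ₛ om M) (hσ : P.el n σ) :
    P.supp n σ a ↔ a = P.sp n σ := by
  have h := hP.supp_ex hn hσ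
  have h2 : P.supp n σ (P.sp n σ) := by
    rw [Data.sp, dif_pos h]; exact h.choose_spec
  exact ⟨fun h' => hP.supp_fun hn h' h2, fun h' => h' ▸ h2⟩

theorem Data.Good.supp_sp {n σ : M} (hn : n ∈ₛ om M) (hσ : P.el n σ) :
    P.supp n σ (P.sp n σ) := (hP.supp_iff hn hσ).2 rfl

theorem Data.Good.sp_sub {n σ i : M} (hn : n ∈ₛ om M) (hσ : P.el n σ) (hi : i ∈ₛ P.sp n σ) :
    i ∈ₛ n := hP.supp_sub hn (hP.supp_sp hn hσ) hi

theorem Data.Good.mp_id {n f σ : M} (hf : IsMor n n f) (hσ : P.el n σ)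
    (h : ∀ i, i ∈ₛ n → app f i = i) : P.mp n n f σ = σ :=
  ((hP.act_iff hf hσ).1 (hP.laws.map_id n f σ hf
    (fun i hi => hf.inc.mem_iff.2 ⟨hi, (h i hi).symm⟩) hσ)).symm

theorem Data.Good.mp_mp' {m n k f g h σ : M} (hf : IsMor m n f) (hg : IsMor n k g)
    (hh : IsMor m k h) (hσ : P.el m σ) (e : ∀ i, i ∈ₛ m → app g (app f i) = app h i) :
    P.mp n k g (P.mp m n f σ) = P.mp m k h σ := by
  refine (hP.act_iff hh hσ).1 (hP.laws.map_comp m n k f g h σ _ _ hf hg hh ?_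
    (hP.act_mp hf hσ) (hP.act_mp hg (hP.mp_el hf hσ)))
  intro i j l hij hjl
  obtain ⟨hi, rfl⟩ := hf.inc.mem_iff.1 hij
  obtain ⟨hj, rfl⟩ := hg.inc.mem_iff.1 hjl
  exact hh.inc.mem_iff.2 ⟨hi, e i hi⟩

theorem Data.Good.mp_mp {m n k f g σ : M} (hf : IsMor m n f) (hg : IsMor n k g)
    (hσ : P.el m σ) : P.mp n k g (P.mp m n f σ) = P.mp m k (cmp m g f) σ :=
  hP.mp_mp' hf hg (hf.cmp hg) hσ fun _ hi => (app_cmp hi).symm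

theorem Data.Good.lt_irrefl {n σ : M} (hn : n ∈ₛ om M) : ¬ P.lt n σ σ := hP.laws.irrefl n σ hn

theorem Data.Good.lt_trans {n σ τ ρ : M} (hn : n ∈ₛ om M) (h1 : P.lt n σ τ) (h2 : P.lt n τ ρ) :
    P.lt n σ ρ := hP.laws.trans n σ τ ρ hn h1 h2

theorem Data.Good.lt_total {n σ τ : M} (hn : n ∈ₛ om M) (hσ : P.el n σ) (hτ : P.el n τ) :
    P.lt n σ τ ∨ σ = τ ∨ P.lt n τ σ := hP.laws.total n σ τ hn hσ hτ

theorem Data.Good.lt_negtrans {n σ τ ρ : M} (hn : n ∈ₛ om M) (hρ : P.el n ρ) (h : P.lt n σ τ) :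
    P.lt n σ ρ ∨ P.lt n ρ τ := by
  rcases hP.lt_total hn (hP.lt_el hn h).1 hρ with h' | rfl | h'
  · exact Or.inl h'
  · exact Or.inr h
  · exact Or.inr (hP.lt_trans hn h' h)

theorem Data.Good.mp_lt_iff {m n f σ τ : M} (hf : IsMor m n f) (hσ : P.el m σ) (hτ : P.el m τ) :
    P.lt n (P.mp m n f σ) (P.mp m n f τ) ↔ P.lt m σ τ := by
  have key : ∀ {σ τ}, P.el m σ → P.el m τ → P.lt m σ τ →
      P.lt n (P.mp m n f σ) (P.mp m n f τ) := fun h1 h2 h =>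
    hP.laws.emb m n f _ _ _ _ hf (hP.act_mp hf h1) (hP.act_mp hf h2) h
  refine ⟨fun h => ?_, key hσ hτ⟩
  rcases hP.lt_total hf.1 hσ hτ with h' | rfl | h'
  · exact h'
  · exact absurd h (hP.lt_irrefl hf.2.1)
  · exact absurd (hP.lt_trans hf.2.1 h (key hτ hσ h')) (hP.lt_irrefl hf.2.1)

theorem Data.Good.mp_inj {m n f σ τ : M} (hf : IsMor m n f) (hσ : P.el m σ) (hτ : P.el m τ)
    (h : P.mp m n f σ = P.mp m n f τ) : σ = τ := by
  rcases hP.lt_total hf.1 hσ hτ with h' | h' | h'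
  · have := (hP.mp_lt_iff hf hσ hτ).2 h'
    rw [h] at this; exact absurd this (hP.lt_irrefl hf.2.1)
  · exact h'
  · have := (hP.mp_lt_iff hf hτ hσ).2 h'
    rw [h] at this; exact absurd this (hP.lt_irrefl hf.2.1)

theorem Data.Good.mp_mono {m n f g σ : M} (hf : IsMor m n f) (hg : IsMor m n g) (hσ : P.el m σ)
    (h : ∀ i, i ∈ₛ m → app f i ∈ₛ app g i ∨ app f i = app g i) :
    P.lt n (P.mp m n f σ) (P.mp m n g σ) ∨ P.mp m n f σ = P.mp m n g σ := by
  refine hP.laws.monotone m n f g σ _ _ hf hg ?_ (hP.act_mp hf hσ) (hP.act_mp hg hσ)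
  intro i x y hx hy
  obtain ⟨hi, rfl⟩ := hf.inc.mem_iff.1 hx
  obtain ⟨-, rfl⟩ := hg.inc.mem_iff.1 hy
  exact h i hi

theorem Data.Good.mem_sp_mp {m n f σ : M} (hf : IsMor m n f) (hσ : P.el m σ) (y : M) :
    y ∈ₛ P.sp n (P.mp m n f σ) ↔ ∃ x, x ∈ₛ P.sp m σ ∧ y = app f x := by
  rw [hP.laws.supp_nat m n f σ _ _ _ hf (hP.act_mp hf hσ) (hP.supp_sp hf.1 hσ)
    (hP.supp_sp hf.2.1 (hP.mp_el hf hσ))]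
  refine exists_congr fun x => and_congr_right fun hx => ?_
  rw [hf.inc.mem_iff]
  exact and_iff_right (hP.sp_sub hf.1 hσ hx)

theorem Data.Good.exists_mp {m n f σ : M} (hf : IsMor m n f) (hσ : P.el n σ)
    (h : ∀ y, y ∈ₛ P.sp n σ → ∃ x, x ∈ₛ m ∧ y = app f x) :
    ∃ τ, P.el m τ ∧ P.mp m n f τ = σ := by
  obtain ⟨τ, hτ⟩ := hP.laws.supp_cond m n f σ _ hf (hP.supp_sp hf.2.1 hσ) (fun y hy => by
    obtain ⟨x, hx, e⟩ := h y hy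
    exact ⟨x, hf.inc.mem_iff.2 ⟨hx, e⟩⟩)
  have h1 := (hP.act_el hf hτ).1
  exact ⟨τ, h1, ((hP.act_iff hf h1).1 hτ).symm⟩

theorem Data.Good.tr_iff {n σ : M} : P.Tr σ n ↔ n ∈ₛ om M ∧ P.el n σ ∧ P.sp n σ = n := by
  refine and_congr_right fun hn => and_congr_right fun hσ => ?_
  rw [hP.supp_iff hn hσ]; exact eq_comm

omit hP in
-- By this factorization, a comparison in `D(A)` takes place in `D(l)` for a natural number `l`.
theorem exists_factor {A n k e₁ e₂ : M} {lt : M → M → Prop} (hA : LinOn A lt)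
    [PRp (fun x : Fin 2 → M => lt (x 0) (x 1))] (h₁ : Inc A lt n e₁) (h₂ : Inc A lt k e₂) :
    ∃ l h f g, (∀ i, i ∈ₛ l → i ∈ₛ add n k) ∧ Inc A lt l h ∧ IsMor n l f ∧ IsMor k l g ∧
      (∀ i, i ∈ₛ n → app h (app f i) = app e₁ i) ∧ (∀ i, i ∈ₛ k → app h (app g i) = app e₂ i) ∧
      Covers e₁ e₂ n k l h := by
  obtain ⟨l, h, hl, hI, hc⟩ := exists_covers hA h₁ h₂
  obtain ⟨f, hf, hf'⟩ := h₁.exists_lift hA hI hc.1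
  obtain ⟨g, hg, hg'⟩ := h₂.exists_lift hA hI hc.2.1
  exact ⟨l, h, f, g, hl, hI, hf, hg, hf', hg', hc⟩

variable {A : M} {lt : M → M → Prop} (hA : LinOn A lt)
  [PRp (fun x : Fin 2 → M => lt (x 0) (x 1))]
include hA

/-- The choice of the common enumeration in `Data.Lt` is irrelevant: two of them factor through a
third one, and the maps `D(u)` and `D(v)` preserve and reflect the order. -/
theorem Data.Good.lt_iff_of_factor {n σ e k τ e' N h f g : M} (hσ : P.el n σ) (hτ : P.el k τ)
    (hh : Inc A lt N h) (hf : IsMor n N f) (hg : IsMor k N g)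
    (hfe : ∀ i, i ∈ₛ n → app h (app f i) = app e i)
    (hge : ∀ i, i ∈ₛ k → app h (app g i) = app e' i) :
    P.Lt A lt n σ e k τ e' ↔ P.lt N (P.mp n N f σ) (P.mp k N g τ) := by
  constructor
  · rintro ⟨N', h', f', g', σ', τ', hh', hf', hg', hfe', hge', ha, ha', hl⟩
    obtain rfl := (hP.act_iff hf' hσ).1 ha
    obtain rfl := (hP.act_iff hg' hτ).1 ha'
    obtain ⟨l, H, u, v, -, hH, hu, hv, huh, hvh, -⟩ := exists_factor hA hh hh'
    rw [← hP.mp_lt_iff hu (hP.mp_el hf hσ) (hP.mp_el hg hτ), hP.mp_mp hf hu hσ,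
      hP.mp_mp hg hu hτ]
    rw [← hP.mp_lt_iff hv (hP.mp_el hf' hσ) (hP.mp_el hg' hτ),
      hP.mp_mp' hf' hv (hf.cmp hu) hσ, hP.mp_mp' hg' hv (hg.cmp hu) hτ] at hl
    · exact hl
    · intro i hi
      have h1 := hg'.app_mem hi
      have h2 := hg.app_mem hi
      refine hH.inj hA (hv.app_mem h1) ((hg.cmp hu).app_mem hi) ?_
      rw [app_cmp hi, hvh _ h1, huh _ h2, hge i hi, hge' i hi]
    · intro i hi
      have h1 := hf'.app_mem hi
      have h2 := hf.app_mem hi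
      refine hH.inj hA (hv.app_mem h1) ((hf.cmp hu).app_mem hi) ?_
      rw [app_cmp hi, hvh _ h1, huh _ h2, hfe i hi, hfe' i hi]
  · intro hl
    exact ⟨N, h, f, g, _, _, hh, hf, hg, hfe, hge, hP.act_mp hf hσ, hP.act_mp hg hτ, hl⟩

omit hP in
theorem exists_factor₃ {a b c e₁ e₂ e₃ : M} (h₁ : Inc A lt a e₁) (h₂ : Inc A lt b e₂)
    (h₃ : Inc A lt c e₃) : ∃ N h f₁ f₂ f₃, Inc A lt N h ∧ IsMor a N f₁ ∧ IsMor b N f₂ ∧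
      IsMor c N f₃ ∧ (∀ i, i ∈ₛ a → app h (app f₁ i) = app e₁ i) ∧
      (∀ i, i ∈ₛ b → app h (app f₂ i) = app e₂ i) ∧
      ∀ i, i ∈ₛ c → app h (app f₃ i) = app e₃ i := by
  obtain ⟨l, h, f, g, -, hh, hf, hg, hfe, hge, -⟩ := exists_factor hA h₁ h₂
  obtain ⟨N, H, u, v, -, hH, hu, hv, hue, hve, -⟩ := exists_factor hA hh h₃
  refine ⟨N, H, _, _, v, hH, hf.cmp hu, hg.cmp hu, hv, ?_, ?_, hve⟩
  · intro i hi; rw [app_cmp hi, hue _ (hf.app_mem hi), hfe i hi]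
  · intro i hi; rw [app_cmp hi, hue _ (hg.app_mem hi), hge i hi]

theorem Data.Good.Lt_asymm {n σ e k τ e' : M} (hσ : P.el n σ) (hτ : P.el k τ)
    (he : Inc A lt n e) (he' : Inc A lt k e') (h : P.Lt A lt n σ e k τ e') :
    ¬ P.Lt A lt k τ e' n σ e := by
  obtain ⟨l, u, f, g, -, hu, hf, hg, hfe, hge, -⟩ := exists_factor hA he he'
  rw [hP.lt_iff_of_factor hA hσ hτ hu hf hg hfe hge] at h
  rw [hP.lt_iff_of_factor hA hτ hσ hu hg hf hge hfe]
  exact fun h' => hP.lt_irrefl hu.1 (hP.lt_trans hu.1 h h')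

theorem Data.Good.Lt_irrefl {n σ e : M} (hσ : P.el n σ)
    (he : Inc A lt n e) : ¬ P.Lt A lt n σ e n σ e :=
  fun h => hP.Lt_asymm hA hσ hσ he he h h

/-- Linearity of `D(N)` for an `N` that contains all three sequences. This form serves for chains
that mix strict and non-strict inequalities, where the latter are given as negations of `Data.Lt`.
-/
theorem Data.Good.Lt_negtrans {a σ e b τ e' c ρ e'' : M} (hσ : P.el a σ) (hτ : P.el b τ)
    (hρ : P.el c ρ) (he : Inc A lt a e) (he' : Inc A lt b e') (he'' : Inc A lt c e'')
    (h : P.Lt A lt a σ e b τ e') :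
    P.Lt A lt a σ e c ρ e'' ∨ P.Lt A lt c ρ e'' b τ e' := by
  obtain ⟨N, u, f, g, w, hu, hf, hg, hw, hfe, hge, hwe⟩ := exists_factor₃ hA he he' he''
  rw [hP.lt_iff_of_factor hA hσ hτ hu hf hg hfe hge] at h
  rw [hP.lt_iff_of_factor hA hσ hρ hu hf hw hfe hwe, hP.lt_iff_of_factor hA hρ hτ hu hw hg hwe hge]
  exact hP.lt_negtrans hu.1 (hP.mp_el hw hρ) h

theorem Data.Good.Lt_trans {a σ e b τ e' c ρ e'' : M} (hσ : P.el a σ) (hτ : P.el b τ)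
    (hρ : P.el c ρ) (he : Inc A lt a e) (he' : Inc A lt b e') (he'' : Inc A lt c e'')
    (h : P.Lt A lt a σ e b τ e') (h' : P.Lt A lt b τ e' c ρ e'') : P.Lt A lt a σ e c ρ e'' := by
  rcases hP.Lt_negtrans hA hσ hτ hρ he he' he'' h with h1 | h1
  · exact h1
  · exact absurd h1 (hP.Lt_asymm hA hτ hρ he' he'' h')

/-- `D` is monotone on increasing maps into `A`. -/
theorem Data.Good.not_Lt_of_le {n σ e e' : M} (hσ : P.el n σ)
    (he : Inc A lt n e) (he' : Inc A lt n e')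
    (h : ∀ i, i ∈ₛ n → lt (app e i) (app e' i) ∨ app e i = app e' i) :
    ¬ P.Lt A lt n σ e' n σ e := by
  obtain ⟨l, u, f, g, -, hu, hf, hg, hfe, hge, -⟩ := exists_factor hA he he'
  rw [hP.lt_iff_of_factor hA hσ hσ hu hg hf hge hfe]
  intro hl
  rcases hP.mp_mono hf hg hσ (fun i hi => by
    rcases h i hi with h | h
    · left
      rw [← hu.lt_iff hA (hf.app_mem hi) (hg.app_mem hi), hfe i hi, hge i hi]; exact h
    · right
      exact hu.inj hA (hf.app_mem hi) (hg.app_mem hi) (by rw [hfe i hi, hge i hi, h])) with h' | h'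
  · exact hP.lt_irrefl hu.1 (hP.lt_trans hu.1 h' hl)
  · rw [h'] at hl; exact hP.lt_irrefl hu.1 hl

/-- Linearity makes the images in `D(l)` equal. Trace elements have full support, so by naturality
the support of the common image is the range of either embedding. Hence the embeddings coincide, and
`D(f)` is injective. -/
theorem Data.Good.eq_of_not_Lt {n σ e k τ e' : M} (hσ : P.Tr σ n) (hτ : P.Tr τ k)
    (he : Inc A lt n e) (he' : Inc A lt k e') (h1 : ¬ P.Lt A lt n σ e k τ e')
    (h2 : ¬ P.Lt A lt k τ e' n σ e) : n = k ∧ e = e' ∧ σ = τ := by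
  rw [hP.tr_iff] at hσ hτ
  obtain ⟨l, u, f, g, -, hu, hf, hg, hfe, hge, -⟩ := exists_factor hA he he'
  rw [hP.lt_iff_of_factor hA hσ.2.1 hτ.2.1 hu hf hg hfe hge] at h1
  rw [hP.lt_iff_of_factor hA hτ.2.1 hσ.2.1 hu hg hf hge hfe] at h2
  have heq : P.mp n l f σ = P.mp k l g τ := by
    rcases hP.lt_total hu.1 (hP.mp_el hf hσ.2.1) (hP.mp_el hg hτ.2.1) with h | h | h
    exacts [absurd h h1, h, absurd h h2]
  have hs1 := hP.mem_sp_mp hf hσ.2.1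
  have hs2 := hP.mem_sp_mp hg hτ.2.1
  rw [heq, hσ.2.2] at hs1
  rw [hτ.2.2] at hs2
  have e1 : IsEnum l Mem (P.sp l (P.mp k l g τ)) n f := isEnum_iff.2 ⟨hf.inc, fun x => by
    rw [hs1]; simp only [hf.inc.mem_iff]⟩
  have e2 : IsEnum l Mem (P.sp l (P.mp k l g τ)) k g := isEnum_iff.2 ⟨hg.inc, fun x => by
    rw [hs2]; simp only [hg.inc.mem_iff]⟩
  obtain ⟨rfl, rfl⟩ := e1.unique (linOn_of_mem_om hu.1) e2
  refine ⟨rfl, he.ext he' fun i hi => by rw [← hfe i hi, hge i hi], hP.mp_inj hf hσ.2.1 hτ.2.1 heq⟩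

/-- Links the comparison of pairs `(σ, a)` with finite sets `a` to the comparison via increasing
enumerations, which is used in all later arguments. -/
theorem Data.Good.extLt_iff {a b n σ e k τ e' : M} (hσ : P.Tr σ n) (hτ : P.Tr τ k)
    (he : IsEnum A lt a n e) (he' : IsEnum A lt b k e') :
    P.ExtLt A lt σ a τ b ↔ P.Lt A lt n σ e k τ e' := by
  have hI := (isEnum_iff.1 he).1
  have hI' := (isEnum_iff.1 he').1
  constructor
  · rintro ⟨-, -, c, n', k', l, ea, eb, ec, f, g, σ', τ', -, hea, heb, hec, hf, hfe, hg, hge,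
      h1, h2, h3⟩
    obtain ⟨rfl, rfl⟩ := hea.unique hA he
    obtain ⟨rfl, rfl⟩ := heb.unique hA he'
    have hec := (isEnum_iff.1 hec).1
    have aux : ∀ {n f e}, Inc A lt n e → IsMor n l f → (∀ i j x, pr i j ∈ₛ f → pr i x ∈ₛ e →
        pr j x ∈ₛ ec) → ∀ i, i ∈ₛ n → app ec (app f i) = app e i := by
      intro n f e hI hf H i hi
      have := H i _ _ (hf.inc.mem_iff.2 ⟨hi, rfl⟩) (hI.mem_iff.2 ⟨hi, rfl⟩)
      exact (hec.mem_iff.1 this).2.symm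
    exact ⟨l, ec, f, g, σ', τ', hec, hf, hg, aux hI hf hfe, aux hI' hg hge, h1, h2, h3⟩
  · intro h
    obtain ⟨l, u, f, g, -, hu, hf, hg, hfe, hge, hc⟩ := exists_factor hA hI hI'
    rw [hP.lt_iff_of_factor hA hσ.2.1 hτ.2.1 hu hf hg hfe hge] at h
    have aux : ∀ {n f e}, Inc A lt n e → IsMor n l f →
        (∀ i, i ∈ₛ n → app u (app f i) = app e i) → (∀ i j x, pr i j ∈ₛ f → pr i x ∈ₛ e →
        pr j x ∈ₛ u) := by
      intro n f e hI hf H i j x hj hx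
      obtain ⟨hi, rfl⟩ := hf.inc.mem_iff.1 hj
      obtain ⟨-, rfl⟩ := hI.mem_iff.1 hx
      exact hu.mem_iff.2 ⟨hf.app_mem hi, (H i hi).symm⟩
    refine ⟨⟨n, e, he, hσ⟩, ⟨k, e', he', hτ⟩, un a b, n, k, l, e, e', u, f, g, _, _, fun x => by
      simp, he, he', isEnum_iff.2 ⟨hu, fun x => ?_⟩, hf, aux hI hf hfe, hg, aux hI' hg hge,
      hP.act_mp hf hσ.2.1, hP.act_mp hg hτ.2.1, h⟩
    rw [mem_un, (isEnum_iff.1 he).2, (isEnum_iff.1 he').2]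
    simp only [hu.mem_iff, hI.mem_iff, hI'.mem_iff]
    constructor
    · rintro (⟨i, hi, rfl⟩ | ⟨i, hi, rfl⟩)
      · obtain ⟨j, hj, e⟩ := hc.1 i hi
        exact ⟨j, hj, e.symm⟩
      · obtain ⟨j, hj, e⟩ := hc.2.1 i hi
        exact ⟨j, hj, e.symm⟩
    · rintro ⟨j, hj, rfl⟩
      exact hc.2.2 j hj

/-- The order on `D(A)` is preserved under increasing maps `φ : A → B`. -/
theorem Data.Good.Lt_map {B : M} {lt' : M → M → Prop} (hB : LinOn B lt')
    [PRp (fun x : Fin 2 → M => lt' (x 0) (x 1))] {n σ e k τ e' : M} (hσ : P.el n σ)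
    (hτ : P.el k τ) (he : Inc A lt n e) (he' : Inc A lt k e') (φ : M → M)
    [hφ : PRf (fun x : Fin 1 → M => φ (x 0))] (h1 : ∀ x, x ∈ₛ A → φ x ∈ₛ B)
    (h2 : ∀ x y, x ∈ₛ A → y ∈ₛ A → lt x y → lt' (φ x) (φ y)) {w w' : M}
    (hw : ∀ i, i ∈ₛ n → app w i = φ (app e i)) (hw' : ∀ i, i ∈ₛ k → app w' i = φ (app e' i)) :
    P.Lt B lt' n σ w k τ w' ↔ P.Lt A lt n σ e k τ e' := by
  obtain ⟨l, u, f, g, -, hu, hf, hg, hfe, hge, -⟩ := exists_factor hA he he'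
  rw [hP.lt_iff_of_factor hA hσ hτ hu hf hg hfe hge]
  have : PRf (fun x : Fin 1 → M => φ (app u (x 0))) := PRf.comp1 φ hφ _
  refine hP.lt_iff_of_factor hB hσ hτ (hu.map φ h1 h2) hf hg ?_ ?_
  · intro i hi
    rw [app_lam (hf.app_mem hi), hfe i hi, hw i hi]
  · intro i hi
    rw [app_lam (hg.app_mem hi), hge i hi, hw' i hi]

end

end GoodData
-- Normal forms, the linear order of the components and their sums
section Components
open Classical

variable {M : Type u} [prsLang.Structure M] [SetModel M]

theorem isData_iff {O F S : M} : IsData (pr O (pr F S)) ↔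
    IsFun O (om M) ∧
    (∀ n p, pr n p ∈ₛ O → ∃ A r, p = pr A r ∧ IsRelOn r A) ∧
    (∀ p, p ∈ₛ F → ∃ m n f g, IsMor m n f ∧ p = pr (pr m (pr n f)) g) ∧
    (∀ m n f, IsMor m n f → ∃! g, pr (pr m (pr n f)) g ∈ₛ F) ∧
    (∀ m n f g A r B s, pr (pr m (pr n f)) g ∈ₛ F → pr m (pr A r) ∈ₛ O → pr n (pr B s) ∈ₛ O →
      IsMap g A B) ∧
    IsFun S (om M) ∧
    (∀ n g A r, pr n g ∈ₛ S → pr n (pr A r) ∈ₛ O →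
      IsFun g A ∧ ∀ σ a, pr σ a ∈ₛ g → ∀ i, i ∈ₛ a → i ∈ₛ n) := by
  constructor
  · rintro ⟨O', F', S', e, h⟩
    simp only [pr_inj] at e
    obtain ⟨rfl, rfl, rfl⟩ := e
    exact h
  · intro h; exact ⟨O, F, S, rfl, h⟩

section
variable {O F S : M}

theorem dat_el {n σ : M} : (dat (pr O (pr F S))).el n σ ↔ ∃ A r, pr n (pr A r) ∈ₛ O ∧ σ ∈ₛ A := by
  constructor
  · rintro ⟨O', F', S', A, r, e, h⟩
    simp only [pr_inj] at e
    obtain ⟨rfl, rfl, rfl⟩ := e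
    exact ⟨A, r, h⟩
  · rintro ⟨A, r, h⟩; exact ⟨O, F, S, A, r, rfl, h⟩

theorem dat_lt {n σ τ : M} :
    (dat (pr O (pr F S))).lt n σ τ ↔ ∃ A r, pr n (pr A r) ∈ₛ O ∧ pr σ τ ∈ₛ r := by
  constructor
  · rintro ⟨O', F', S', A, r, e, h⟩
    simp only [pr_inj] at e
    obtain ⟨rfl, rfl, rfl⟩ := e
    exact ⟨A, r, h⟩
  · rintro ⟨A, r, h⟩; exact ⟨O, F, S, A, r, rfl, h⟩

theorem dat_act {m n f σ τ : M} : (dat (pr O (pr F S))).act m n f σ τ ↔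
    ∃ g, pr (pr m (pr n f)) g ∈ₛ F ∧ pr σ τ ∈ₛ g := by
  constructor
  · rintro ⟨O', F', S', g, e, h⟩
    simp only [pr_inj] at e
    obtain ⟨rfl, rfl, rfl⟩ := e
    exact ⟨g, h⟩
  · rintro ⟨g, h⟩; exact ⟨O, F, S, g, rfl, h⟩

theorem dat_supp {n σ a : M} : (dat (pr O (pr F S))).supp n σ a ↔
    ∃ g, pr n g ∈ₛ S ∧ pr σ a ∈ₛ g := by
  constructor
  · rintro ⟨O', F', S', g, e, h⟩
    simp only [pr_inj] at e
    obtain ⟨rfl, rfl, rfl⟩ := e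
    exact ⟨g, h⟩
  · rintro ⟨g, h⟩; exact ⟨O, F, S, g, rfl, h⟩

end

theorem IsData.exists_obj {O F S n : M} (h : IsData (pr O (pr F S))) (hn : n ∈ₛ om M) :
    ∃ A r, pr n (pr A r) ∈ₛ O ∧ IsRelOn r A ∧
      ∀ A' r', pr n (pr A' r') ∈ₛ O → A' = A ∧ r' = r := by
  rw [isData_iff] at h
  obtain ⟨p, hp, hu⟩ := h.1.2 n hn
  obtain ⟨A, r, rfl, hr⟩ := h.2.1 n p hp
  exact ⟨A, r, hp, hr, fun A' r' h' => pr_inj.1 (hu _ h')⟩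

theorem IsPredilator.good {D : M} (hD : IsPredilator D) : (dat D).Good := by
  obtain ⟨hd, hL⟩ := hD
  obtain ⟨O, F, S, rfl, -⟩ := id hd
  have hi := isData_iff.1 hd
  obtain ⟨hO, hO2, hF, hF2, hF3, hS, hS2⟩ := hi
  refine ⟨hL, ?_, ?_, ?_, ?_, ?_, ?_, ?_, ?_⟩
  · intro n σ τ hn h
    obtain ⟨A, r, h1, h2⟩ := dat_lt.1 h
    obtain ⟨A', r', e, hr⟩ := hO2 n _ h1
    obtain ⟨rfl, rfl⟩ := pr_inj.1 e
    obtain ⟨x, y, hx, hy, e⟩ := hr _ h2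
    obtain ⟨rfl, rfl⟩ := pr_inj.1 e
    exact ⟨dat_el.2 ⟨A, r, h1, hx⟩, dat_el.2 ⟨A, r, h1, hy⟩⟩
  · intro m n f σ τ hf h
    obtain ⟨g, h1, h2⟩ := dat_act.1 h
    obtain ⟨A, r, hA, -⟩ := hd.exists_obj hf.1
    obtain ⟨B, s, hB, -⟩ := hd.exists_obj hf.2.1
    have hg := hF3 m n f g A r B s h1 hA hB
    exact ⟨dat_el.2 ⟨A, r, hA, (hg.1.mem_iff.1 h2).1⟩, dat_el.2 ⟨B, s, hB, hg.2 _ _ h2⟩⟩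
  · intro m n f σ hf h
    obtain ⟨A, r, hA, hσ⟩ := dat_el.1 h
    obtain ⟨B, s, hB, -⟩ := hd.exists_obj hf.2.1
    obtain ⟨g, hg, -⟩ := hF2 m n f hf
    have hm := hF3 m n f g A r B s hg hA hB
    exact ⟨app g σ, dat_act.2 ⟨g, hg, hm.1.mem_iff.2 ⟨hσ, rfl⟩⟩⟩
  · intro m n f σ τ ρ hf h h'
    obtain ⟨g, h1, h2⟩ := dat_act.1 h
    obtain ⟨g', h1', h2'⟩ := dat_act.1 h'
    obtain rfl := (hF2 m n f hf).unique h1 h1'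
    obtain ⟨A, r, hA, -⟩ := hd.exists_obj hf.1
    obtain ⟨B, s, hB, -⟩ := hd.exists_obj hf.2.1
    have hg := hF3 m n f g A r B s h1 hA hB
    rw [(hg.1.mem_iff.1 h2).2, (hg.1.mem_iff.1 h2').2]
  · intro n σ a hn h
    obtain ⟨g, h1, h2⟩ := dat_supp.1 h
    obtain ⟨A, r, hA, -⟩ := hd.exists_obj hn
    exact dat_el.2 ⟨A, r, hA, ((hS2 n g A r h1 hA).1.mem_iff.1 h2).1⟩
  · intro n σ hn h
    obtain ⟨A, r, hA, hσ⟩ := dat_el.1 h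
    obtain ⟨g, hg, -⟩ := hS.2 n hn
    exact ⟨app g σ, dat_supp.2 ⟨g, hg, (hS2 n g A r hg hA).1.mem_iff.2 ⟨hσ, rfl⟩⟩⟩
  · intro n σ a b hn h h'
    obtain ⟨g, h1, h2⟩ := dat_supp.1 h
    obtain ⟨g', h1', h2'⟩ := dat_supp.1 h'
    obtain rfl := (hS.2 n hn).unique h1 h1'
    obtain ⟨A, r, hA, -⟩ := hd.exists_obj hn
    have hg := (hS2 n g A r h1 hA).1
    rw [(hg.mem_iff.1 h2).2, (hg.mem_iff.1 h2').2]
  · intro n σ a i hn h hi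
    obtain ⟨g, h1, h2⟩ := dat_supp.1 h
    obtain ⟨A, r, hA, -⟩ := hd.exists_obj hn
    exact (hS2 n g A r h1 hA).2 σ a h2 i hi

/-! ### Normal forms -/

/-- By induction on `m ≤ n`, the set `s ∩ m` is enumerated. The next number `m` is appended if it
lies in `s`. -/
theorem exists_enum {n : M} (s : M) (hn : n ∈ₛ om M) (hs : ∀ i, i ∈ₛ s → i ∈ₛ n) :
    ∃ k e, IsMor k n e ∧ ∀ y, y ∈ₛ s ↔ ∃ i, i ∈ₛ k ∧ y = app e i := by
  have key : ∀ m, m ∈ₛ om M → m ∈ₛ suc n → ∃ k, k ∈ₛ om M ∧ ∃ e, e ∈ₛ mors M ∧ IsMor k n e ∧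
      ∀ y, y ∈ₛ n → (y ∈ₛ s ∧ y ∈ₛ m ↔ ∃ i, i ∈ₛ k ∧ y = app e i) := by
    refine om_induction (fun m => m ∈ₛ suc n → ∃ k, k ∈ₛ om M ∧ ∃ e, e ∈ₛ mors M ∧ IsMor k n e ∧
      ∀ y, y ∈ₛ n → (y ∈ₛ s ∧ y ∈ₛ m ↔ ∃ i, i ∈ₛ k ∧ y = app e i)) ?_ ?_
    · intro _
      have h := isMor_of_subset emp_mem_om hn (fun i hi => absurd hi (not_mem_emp i))
      exact ⟨_, h.1, _, h.mem_mors, h, fun y _ => iff_of_false (fun h => not_mem_emp _ h.2)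
        (fun ⟨i, hi, _⟩ => not_mem_emp _ hi)⟩
    · intro m hm ih hmn
      have hmn' : m ∈ₛ n := by
        rcases mem_suc.1 hmn with h | h
        · exact (isOrd_of_mem_om hn).trans (mem_suc.2 (Or.inr rfl)) h
        · exact h ▸ mem_suc.2 (Or.inr rfl)
      obtain ⟨k, hk, e, he, hke, h⟩ := ih (by simp [hmn'])
      by_cases hms : m ∈ₛ s
      · obtain ⟨e', he', h1, h2⟩ := hke.inc.append hmn' (fun j hj =>
          ((h _ (hke.app_mem hj)).2 ⟨j, hj, rfl⟩).2)
        have hmor : IsMor (suc k) n e' := isMor_iff.2 ⟨hn, he'⟩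
        refine ⟨suc k, suc_mem_om hk, e', hmor.mem_mors, hmor, fun y hy => ?_⟩
        constructor
        · rintro ⟨hys, hym⟩
          rcases mem_suc.1 hym with hym | rfl
          · obtain ⟨i, hi, rfl⟩ := (h y hy).1 ⟨hys, hym⟩
            exact ⟨i, by simp [hi], (h1 i hi).symm⟩
          · exact ⟨k, by simp, h2.symm⟩
        · rintro ⟨i, hi, rfl⟩
          rcases mem_suc.1 hi with hi | rfl
          · rw [h1 i hi] at hy ⊢
            have := (h _ hy).2 ⟨i, hi, rfl⟩
            exact ⟨this.1, by simp [this.2]⟩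
          · rw [h2]; exact ⟨hms, by simp⟩
      · refine ⟨k, hk, e, he, hke, fun y hy => ?_⟩
        rw [← h y hy, mem_suc]
        constructor
        · rintro ⟨hys, hym | rfl⟩
          exacts [⟨hys, hym⟩, absurd hys hms]
        · rintro ⟨hys, hym⟩; exact ⟨hys, Or.inl hym⟩
  obtain ⟨k, -, e, -, h1, h2⟩ := key n hn (by simp)
  refine ⟨k, e, h1, fun y => ⟨fun hy => (h2 y (hs y hy)).1 ⟨hy, hs y hy⟩, ?_⟩⟩
  rintro ⟨i, hi, rfl⟩
  exact ((h2 _ (h1.app_mem hi)).2 ⟨i, hi, rfl⟩).1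

/-- `σ = D(e)(σ₀)` for some `e : k → n` and a trace element `(σ₀, k)`. -/
def Data.Nf (P : Data M) (n σ σ₀ k e : M) : Prop :=
  IsMor k n e ∧ P.Tr σ₀ k ∧ P.mp k n e σ₀ = σ

section
variable {P : Data M} (hP : P.Good)
include hP

/-- The support condition pulls `σ` back along the enumeration of its support. By naturality and
injectivity of the enumeration, the result has full support. -/
theorem Data.Good.exists_nf {n σ : M} (hn : n ∈ₛ om M) (hσ : P.el n σ) :
    ∃ σ₀ k e, P.Nf n σ σ₀ k e := by
  obtain ⟨k, e, he, h⟩ := exists_enum (P.sp n σ) hn (fun i hi => hP.sp_sub hn hσ hi)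
  obtain ⟨σ₀, h0, h1⟩ := hP.exists_mp he hσ (fun y hy => (h y).1 hy)
  refine ⟨σ₀, k, e, he, hP.tr_iff.2 ⟨he.1, h0, mext fun z => ?_⟩, h1⟩
  refine ⟨hP.sp_sub he.1 h0, fun hz => ?_⟩
  have hz' : app e z ∈ₛ P.sp n σ := (h _).2 ⟨z, hz, rfl⟩
  rw [← h1, hP.mem_sp_mp he h0] at hz'
  obtain ⟨x, hx, e'⟩ := hz'
  rwa [he.inc.inj (linOn_of_mem_om hn) hz (hP.sp_sub he.1 h0 hx) e']

theorem Data.Good.nf_sp {n σ σ₀ k e : M} (h : P.Nf n σ σ₀ k e) (y : M) :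
    y ∈ₛ P.sp n σ ↔ ∃ i, i ∈ₛ k ∧ y = app e i := by
  have h2 := hP.tr_iff.1 h.2.1
  rw [← h.2.2, hP.mem_sp_mp h.1 h2.2.1, h2.2.2]

theorem Data.Good.nf_isEnum {n σ σ₀ k e : M} (h : P.Nf n σ σ₀ k e) :
    IsEnum n Mem (P.sp n σ) k e :=
  isEnum_iff.2 ⟨h.1.inc, fun x => by
    rw [hP.nf_sp h]; simp only [h.1.inc.mem_iff]⟩

theorem Data.Good.nf_unique {n σ σ₀ k e σ₁ k' e' : M} (h : P.Nf n σ σ₀ k e)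
    (h' : P.Nf n σ σ₁ k' e') : σ₀ = σ₁ ∧ k = k' ∧ e = e' := by
  obtain ⟨rfl, rfl⟩ := (hP.nf_isEnum h).unique (linOn_of_mem_om h.1.2.1) (hP.nf_isEnum h')
  exact ⟨hP.mp_inj h.1 h.2.1.2.1 h'.2.1.2.1 (h.2.2.trans h'.2.2.symm), rfl, rfl⟩

theorem Data.Good.nf_mp {n σ σ₀ k e n' f : M} (h : P.Nf n σ σ₀ k e) (hf : IsMor n n' f) :
    P.Nf n' (P.mp n n' f σ) σ₀ k (cmp k f e) :=
  ⟨h.1.cmp hf, h.2.1, by rw [← hP.mp_mp h.1 hf h.2.1.2.1, h.2.2]⟩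

theorem Data.Good.nf_self {n σ : M} (h : P.Tr σ n) : P.Nf n σ σ n (lam n (fun i => i)) :=
  ⟨isMor_id h.1, h, hP.mp_id (isMor_id h.1) h.2.1 fun _ hi => app_lam hi⟩

theorem Data.Good.subEl_iff {α n σ : M} (hn : n ∈ₛ om M) : P.subEl α n σ ↔
    P.el n σ ∧ ∃ σ₀ k e, P.Nf n σ σ₀ k e ∧ pr σ₀ k ∈ₛ α := by
  refine and_congr_right fun hσ => ?_
  constructor
  · rintro ⟨a, k, e, σ₀, ha, he, hr, hact, hα⟩
    have h0 := (hP.act_el he hact).1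
    have h1 := (hP.act_iff he h0).1 hact
    have h2 := (hP.supp_iff hn hσ).1 ha
    refine ⟨σ₀, k, e, ⟨he, hP.tr_iff.2 ⟨he.1, h0, mext fun z => ⟨hP.sp_sub he.1 h0, fun hz => ?_⟩⟩,
      h1.symm⟩, hα⟩
    have hz' : app e z ∈ₛ P.sp n σ := by
      rw [← h2, hr]; exact ⟨z, he.inc.mem_iff.2 ⟨hz, rfl⟩⟩
    rw [h1, hP.mem_sp_mp he h0] at hz'
    obtain ⟨x, hx, e'⟩ := hz'
    rwa [he.inc.inj (linOn_of_mem_om hn) hz (hP.sp_sub he.1 h0 hx) e']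
  · rintro ⟨σ₀, k, e, h, hα⟩
    refine ⟨_, k, e, σ₀, hP.supp_sp hn hσ, h.1, fun y => ?_, ?_, hα⟩
    · rw [hP.nf_sp h]; simp only [h.1.inc.mem_iff]
    · exact (hP.act_iff h.1 h.2.1.2.1).2 h.2.2.symm

/-- The action changes the embedding in a normal form but not its trace element, and membership in a
component depends on the latter only. -/
theorem Data.Good.subEl_mp {α m n f σ : M} (hf : IsMor m n f) (hσ : P.el m σ) :
    P.subEl α n (P.mp m n f σ) ↔ P.subEl α m σ := by
  rw [hP.subEl_iff hf.1, hP.subEl_iff hf.2.1]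
  obtain ⟨σ₀, k, e, h⟩ := hP.exists_nf hf.1 hσ
  constructor
  · rintro ⟨-, σ₁, k', e', h', hα⟩
    obtain ⟨rfl, rfl, rfl⟩ := hP.nf_unique h' (hP.nf_mp h hf)
    exact ⟨hσ, _, _, _, h, hα⟩
  · rintro ⟨-, σ₁, k', e', h', hα⟩
    exact ⟨hP.mp_el hf hσ, _, _, _, hP.nf_mp h' hf, hα⟩

theorem Data.Good.subEl_self {α n σ : M} (h : P.Tr σ n) : P.subEl α n σ ↔ pr σ n ∈ₛ α := by
  rw [hP.subEl_iff h.1]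
  constructor
  · rintro ⟨-, σ₁, k', e', h', hα⟩
    obtain ⟨rfl, rfl, rfl⟩ := hP.nf_unique h' (hP.nf_self h)
    exact hα
  · intro hα; exact ⟨h.2.1, _, _, _, hP.nf_self h, hα⟩

theorem Data.Good.subEl_act {α m n f σ τ : M} (hf : IsMor m n f) (h : P.act m n f σ τ) :
    P.subEl α n τ ↔ P.subEl α m σ := by
  have h0 := (hP.act_el hf h).1
  rw [(hP.act_iff hf h0).1 h, hP.subEl_mp hf h0]

theorem Data.Good.sub (α : M) : (P.sub α).Good where
  laws := by
    have hL := hP.laws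
    refine ⟨?_, ?_, ?_, ?_, ?_, ?_, ?_, ?_, ?_⟩
    · exact fun n σ hn h => hL.irrefl n σ hn h.2.2
    · exact fun n σ τ ρ hn h h' => ⟨h.1, h'.2.1, hL.trans n σ τ ρ hn h.2.2 h'.2.2⟩
    · intro n σ τ hn h h'
      rcases hL.total n σ τ hn h.1 h'.1 with h1 | h1 | h1
      exacts [Or.inl ⟨h, h', h1⟩, Or.inr (Or.inl h1), Or.inr (Or.inr ⟨h', h, h1⟩)]
    · exact fun m n f σ τ σ' τ' hf h h' hl => ⟨(hP.subEl_act hf h.2).2 h.1,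
        (hP.subEl_act hf h'.2).2 h'.1, hL.emb m n f σ τ σ' τ' hf h.2 h'.2 hl.2.2⟩
    · exact fun n f σ hf h hσ => ⟨hσ, hL.map_id n f σ hf h hσ.1⟩
    · exact fun m n k f g h σ τ ρ hf hg hh hc h1 h2 =>
        ⟨h1.1, hL.map_comp m n k f g h σ τ ρ hf hg hh hc h1.2 h2.2⟩
    · intro m n f g σ τ ρ hf hg hle h1 h2
      rcases hL.monotone m n f g σ τ ρ hf hg hle h1.2 h2.2 with h | h
      · exact Or.inl ⟨(hP.subEl_act hf h1.2).2 h1.1, (hP.subEl_act hg h2.2).2 h2.1, h⟩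
      · exact Or.inr h
    · exact fun m n f σ τ a b hf h ha hb => hL.supp_nat m n f σ τ a b hf h.2 ha.2 hb.2
    · intro m n f σ a hf ha h
      obtain ⟨τ, hτ⟩ := hL.supp_cond m n f σ a hf ha.2 h
      exact ⟨τ, (hP.subEl_act hf hτ).1 ha.1, hτ⟩
  lt_el := fun _ h => ⟨h.1, h.2.1⟩
  act_el := fun hf h => ⟨h.1, (hP.subEl_act hf h.2).2 h.1⟩
  act_ex := fun hf h => by
    obtain ⟨τ, hτ⟩ := hP.act_ex hf h.1
    exact ⟨τ, h, hτ⟩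
  act_fun := fun hf h h' => hP.act_fun hf h.2 h'.2
  supp_el := fun _ h => h.1
  supp_ex := fun hn h => by
    obtain ⟨τ, hτ⟩ := hP.supp_ex hn h.1
    exact ⟨τ, h, hτ⟩
  supp_fun := fun hn h h' => hP.supp_fun hn h.2 h'.2
  supp_sub := fun hn h => hP.supp_sub hn h.2

theorem Data.Good.sub_tr {α n σ : M} : (P.sub α).Tr σ n ↔ P.Tr σ n ∧ pr σ n ∈ₛ α := by
  constructor
  · rintro ⟨hn, h1, h2⟩
    have : P.Tr σ n := ⟨hn, h1.1, h2.2⟩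
    exact ⟨this, (hP.subEl_self this).1 h1⟩
  · rintro ⟨h, hα⟩
    have := (hP.subEl_self h).2 hα
    exact ⟨h.1, this, this, h.2.2⟩

theorem Data.Good.sub_Lt {α A n σ e k τ e' : M} {lt : M → M → Prop} (hσ : P.subEl α n σ)
    (hτ : P.subEl α k τ) : (P.sub α).Lt A lt n σ e k τ e' ↔ P.Lt A lt n σ e k τ e' := by
  constructor
  · rintro ⟨N, h, f, g, σ', τ', h1, h2, h3, h4, h5, h6, h7, h8⟩
    exact ⟨N, h, f, g, σ', τ', h1, h2, h3, h4, h5, h6.2, h7.2, h8.2.2⟩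
  · rintro ⟨N, h, f, g, σ', τ', h1, h2, h3, h4, h5, h6, h7, h8⟩
    exact ⟨N, h, f, g, σ', τ', h1, h2, h3, h4, h5, ⟨hσ, h6⟩, ⟨hτ, h7⟩,
      (hP.subEl_act h2 h6).2 hσ, (hP.subEl_act h3 h7).2 hτ, h8⟩

/-! ### The order of the components -/

/-- The ranges of two embeddings into an arbitrary `l` have at most `n + k` elements together, so
the comparison can be carried out in `D(n + k)`. -/
theorem Data.Good.ll_iff {n σ k τ : M} (hσ : P.Tr σ n) (hτ : P.Tr τ k) : P.LL σ n τ k ↔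
    ∀ l f g, IsMor n l f → IsMor k l g → P.lt l (P.mp n l f σ) (P.mp k l g τ) := by
  have hN := add_mem_om hσ.1 hτ.1
  have hadd := (isAdd_iff (γ := n) (δ := PRST.add n k) hτ.1).2 ⟨isOrd_of_mem_om hσ.1, rfl⟩
  constructor
  · rintro ⟨N, hN', h⟩ l f g hf hg
    obtain ⟨-, rfl⟩ := (isAdd_iff hτ.1).1 hN'
    obtain ⟨N', u, f', g', hs, hu, hf', hg', hfe, hge, -⟩ :=
      exists_factor (linOn_of_mem_om hf.2.1) hf.inc hg.inc
    have hu' : IsMor N' l u := isMor_iff.2 ⟨hf.2.1, hu⟩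
    have hι := isMor_of_subset hu.1 hN hs
    have := h _ _ _ _ (hf'.cmp hι) (hg'.cmp hι) (hP.act_mp (hf'.cmp hι) hσ.2.1)
      (hP.act_mp (hg'.cmp hι) hτ.2.1)
    rw [← hP.mp_mp hf' hι hσ.2.1, ← hP.mp_mp hg' hι hτ.2.1,
      hP.mp_lt_iff hι (hP.mp_el hf' hσ.2.1) (hP.mp_el hg' hτ.2.1)] at this
    rw [← hP.mp_mp' hf' hu' hf hσ.2.1 hfe, ← hP.mp_mp' hg' hu' hg hτ.2.1 hge]
    exact (hP.mp_lt_iff hu' (hP.mp_el hf' hσ.2.1) (hP.mp_el hg' hτ.2.1)).2 this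
  · intro h
    refine ⟨PRST.add n k, hadd, fun f g σ' τ' hf hg h1 h2 => ?_⟩
    rw [(hP.act_iff hf hσ.2.1).1 h1, (hP.act_iff hg hτ.2.1).1 h2]
    exact h _ f g hf hg

/-- The reason why `≡` is an equivalence relation and `≪` is linear on its classes. If the
conclusion fails, there are embeddings with `D(g)(ρ) ≤ D(f)(σ)` in `D(l₁)` and `D(g')(τ) ≤ D(f')(ρ)`
in `D(l₂)`. Place `l₂` below `l₁`. By monotonicity, `ρ` with arguments in `l₂` is at most `ρ` with
arguments in `l₁`, so that `τ ≤ ρ ≤ ρ ≤ σ` contradicts `σ ≪ τ`. -/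
theorem Data.Good.ll_negtrans {n σ k τ m ρ : M} (hσ : P.Tr σ n) (hτ : P.Tr τ k) (hρ : P.Tr ρ m)
    (h : P.LL σ n τ k) : P.LL σ n ρ m ∨ P.LL ρ m τ k := by
  by_contra hn
  rw [hP.ll_iff hσ hτ] at h
  rw [hP.ll_iff hσ hρ, hP.ll_iff hρ hτ] at hn
  push Not at hn
  obtain ⟨⟨l₁, f, g, hf, hg, h1⟩, l₂, f', g', hf', hg', h2⟩ := hn
  -- The two counterexamples are put side by side in `l₂ + l₁`: `v` is the inclusion of the first
  -- summand, and `u` maps `l₁` onto the final segment.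
  have hv := isMor_add_left hf'.2.1 hf.2.1
  have hu := isMor_add_right hf'.2.1 hf.2.1
  set v := lam l₂ (fun i => i)
  set u := lam l₁ (PRST.add l₂)
  have h3 := h _ _ _ (hf.cmp hu) (hg'.cmp hv)
  have e1 := hP.mp_el (hg.cmp hu) hρ.2.1
  have e2 := hP.mp_el (hf'.cmp hv) hρ.2.1
  have hL := hv.2.1
  rcases hP.lt_negtrans hL e1 h3 with h4 | h4
  · rw [← hP.mp_mp hf hu hσ.2.1, ← hP.mp_mp hg hu hρ.2.1,
      hP.mp_lt_iff hu (hP.mp_el hf hσ.2.1) (hP.mp_el hg hρ.2.1)] at h4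
    exact h1 h4
  rcases hP.lt_negtrans hL e2 h4 with h5 | h5
  · rcases hP.mp_mono (hf'.cmp hv) (hg.cmp hu) hρ.2.1 (fun i hi => by
      left
      rw [app_cmp hi, app_cmp hi, app_lam (hf'.app_mem hi), app_lam (hg.app_mem hi)]
      exact (mem_add (mem_om_of_mem hf.2.1 _ (hg.app_mem hi)) _).2 (Or.inl (hf'.app_mem hi)))
      with h6 | h6
    · exact hP.lt_irrefl hL (hP.lt_trans hL h5 h6)
    · rw [h6] at h5; exact hP.lt_irrefl hL h5
  · rw [← hP.mp_mp hf' hv hρ.2.1, ← hP.mp_mp hg' hv hτ.2.1,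
      hP.mp_lt_iff hv (hP.mp_el hf' hρ.2.1) (hP.mp_el hg' hτ.2.1)] at h5
    exact h2 h5

theorem Data.Good.ll_asymm {n σ k τ : M} (hσ : P.Tr σ n) (hτ : P.Tr τ k)
    (h : P.LL σ n τ k) : ¬ P.LL τ k σ n := by
  rw [hP.ll_iff hσ hτ] at h
  rw [hP.ll_iff hτ hσ]
  intro h'
  have hv := isMor_add_left hσ.1 hτ.1
  have hu := isMor_add_right hσ.1 hτ.1
  exact hP.lt_irrefl hv.2.1 (hP.lt_trans hv.2.1 (h _ _ _ hv hu) (h' _ _ _ hu hv))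

theorem Data.Good.ll_trans {n σ k τ m ρ : M} (hσ : P.Tr σ n) (hτ : P.Tr τ k) (hρ : P.Tr ρ m)
    (h : P.LL σ n τ k) (h' : P.LL τ k ρ m) : P.LL σ n ρ m := by
  rcases hP.ll_negtrans hσ hτ hρ h with h1 | h1
  · exact h1
  · exact absurd h1 (hP.ll_asymm hτ hρ h')

theorem Data.Good.eqv_refl {n σ : M} (hσ : P.Tr σ n) : P.Eqv σ n σ n :=
  ⟨fun h => hP.ll_asymm hσ hσ h h, fun h => hP.ll_asymm hσ hσ h h⟩

theorem Data.Good.eqv_symm {n σ k τ : M} (h : P.Eqv σ n τ k) : P.Eqv τ k σ n := ⟨h.2, h.1⟩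

theorem Data.Good.eqv_trans {n σ k τ m ρ : M} (hσ : P.Tr σ n) (hτ : P.Tr τ k) (hρ : P.Tr ρ m)
    (h : P.Eqv σ n τ k) (h' : P.Eqv τ k ρ m) : P.Eqv σ n ρ m := by
  constructor
  · intro h1
    rcases hP.ll_negtrans hσ hρ hτ h1 with h2 | h2
    exacts [h.1 h2, h'.1 h2]
  · intro h1
    rcases hP.ll_negtrans hρ hσ hτ h1 with h2 | h2
    exacts [h'.2 h2, h.2 h2]

theorem Data.Good.comp_spec {α n σ : M} (hα : P.Comp α) (hσ : pr σ n ∈ₛ α) : P.Tr σ n ∧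
    ∀ p, p ∈ₛ α ↔ ∃ τ k, p = pr τ k ∧ P.Tr τ k ∧ P.Eqv σ n τ k := by
  obtain ⟨σ₀, n₀, h0, h⟩ := hα
  obtain ⟨σ', n', e, h1, h2⟩ := (h _).1 hσ
  obtain ⟨rfl, rfl⟩ := pr_inj.1 e
  refine ⟨h1, fun p => ?_⟩
  rw [h]
  refine exists_congr fun τ => exists_congr fun k => and_congr_right fun _ =>
    and_congr_right fun hτ => ?_
  exact ⟨hP.eqv_trans h1 h0 hτ (hP.eqv_symm h2), hP.eqv_trans h0 h1 hτ h2⟩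

theorem Data.Good.comp_ex {α : M} (hα : P.Comp α) : ∃ σ n, P.Tr σ n ∧ pr σ n ∈ₛ α := by
  obtain ⟨σ, n, h0, h⟩ := hα
  exact ⟨σ, n, h0, (h _).2 ⟨σ, n, rfl, h0, hP.eqv_refl h0⟩⟩

/-- Independence of the representatives: by negative transitivity, each of the two representatives
can be exchanged for an equivalent one. -/
theorem Data.Good.compLt_ll {α β n σ k τ : M} (h : P.CompLt α β) (hσ : pr σ n ∈ₛ α)
    (hτ : pr τ k ∈ₛ β) : P.LL σ n τ k := by
  obtain ⟨hα, hβ, σ₀, n₀, τ₀, k₀, h1, h2, hl⟩ := h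
  obtain ⟨t1, s1⟩ := hP.comp_spec hα h1
  obtain ⟨t2, s2⟩ := hP.comp_spec hβ h2
  obtain ⟨σ', n', e, t3, q1⟩ := (s1 _).1 hσ
  obtain ⟨rfl, rfl⟩ := pr_inj.1 e
  obtain ⟨τ', k', e, t4, q2⟩ := (s2 _).1 hτ
  obtain ⟨rfl, rfl⟩ := pr_inj.1 e
  rcases hP.ll_negtrans t1 t2 t3 hl with h | h
  · exact absurd h q1.1
  rcases hP.ll_negtrans t3 t2 t4 h with h | h
  · exact h
  · exact absurd h q2.2

theorem Data.Good.compLt_irrefl {α : M} : ¬ P.CompLt α α := fun h => by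
  obtain ⟨σ, n, hσ, hα⟩ := hP.comp_ex h.1
  have := hP.compLt_ll h hα hα
  exact hP.ll_asymm hσ hσ this this

theorem Data.Good.compLt_trans {α β δ : M} (h : P.CompLt α β) (h' : P.CompLt β δ) :
    P.CompLt α δ := by
  obtain ⟨σ, n, hσ, hα⟩ := hP.comp_ex h.1
  obtain ⟨τ, k, hτ, hβ⟩ := hP.comp_ex h'.1
  obtain ⟨ρ, m, hρ, hδ⟩ := hP.comp_ex h'.2.1
  exact ⟨h.1, h'.2.1, σ, n, ρ, m, hα, hδ,
    hP.ll_trans hσ hτ hρ (hP.compLt_ll h hα hβ) (hP.compLt_ll h' hβ hδ)⟩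

theorem Data.Good.compLt_total {α β : M} (hα : P.Comp α) (hβ : P.Comp β) :
    P.CompLt α β ∨ α = β ∨ P.CompLt β α := by
  obtain ⟨σ, n, hσ, hσα⟩ := hP.comp_ex hα
  obtain ⟨τ, k, hτ, hτβ⟩ := hP.comp_ex hβ
  by_cases h1 : P.LL σ n τ k
  · exact Or.inl ⟨hα, hβ, σ, n, τ, k, hσα, hτβ, h1⟩
  by_cases h2 : P.LL τ k σ n
  · exact Or.inr (Or.inr ⟨hβ, hα, τ, k, σ, n, hτβ, hσα, h2⟩)
  refine Or.inr (Or.inl (mext fun p => ?_))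
  have : pr σ n ∈ₛ β := ((hP.comp_spec hβ hτβ).2 _).2 ⟨σ, n, rfl, hσ, h2, h1⟩
  rw [(hP.comp_spec hα hσα).2, (hP.comp_spec hβ this).2]

/-- Elements of different components compare like the components. -/
theorem Data.Good.lt_of_compLt {α β n σ k τ l f g : M} (h : P.CompLt α β) (hf : IsMor n l f)
    (hg : IsMor k l g) (hσ : P.subEl α n σ) (hτ : P.subEl β k τ) :
    P.lt l (P.mp n l f σ) (P.mp k l g τ) := by
  obtain ⟨-, σ₀, n₀, e, h1, hα⟩ := (hP.subEl_iff hf.1).1 hσ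
  obtain ⟨-, τ₀, k₀, e', h2, hβ⟩ := (hP.subEl_iff hg.1).1 hτ
  have hl := hP.compLt_ll h hα hβ
  rw [hP.ll_iff h1.2.1 h2.2.1] at hl
  rw [← h1.2.2, ← h2.2.2, hP.mp_mp h1.1 hf h1.2.1.2.1, hP.mp_mp h2.1 hg h2.2.1.2.1]
  exact hl _ _ _ (h1.1.cmp hf) (h2.1.cmp hg)

end

/-- The action and the supports leave the index alone, so each law reduces to a law for one summand,
apart from those on the order, which also use that the indices are linearly ordered. -/
theorem sigma_good {I : M → Prop} {lt : M → M → Prop} {E : M → Data M}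
    (hE : ∀ α, I α → (E α).Good) (irr : ∀ α, I α → ¬ lt α α)
    (tr : ∀ α β δ, I α → I β → I δ → lt α β → lt β δ → lt α δ)
    (tot : ∀ α β, I α → I β → lt α β ∨ α = β ∨ lt β α) : (sigma I lt E).Good where
  laws := by
    refine ⟨?_, ?_, ?_, ?_, ?_, ?_, ?_, ?_, ?_⟩
    · rintro n _ hn ⟨α, σ, β, τ, rfl, e, hα, hβ, hσ, hτ, h⟩
      obtain ⟨rfl, rfl⟩ := pr_inj.1 e
      rcases h with h | h
      · exact irr _ hα h
      · exact (hE _ hα).lt_irrefl hn h.2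
    · rintro n _ _ _ hn ⟨α, σ, β, τ, rfl, rfl, hα, hβ, hσ, hτ, h⟩
        ⟨β', τ', δ, ρ, e, rfl, -, hδ, -, hρ, h'⟩
      obtain ⟨rfl, rfl⟩ := pr_inj.1 e
      refine ⟨α, σ, δ, ρ, rfl, rfl, hα, hδ, hσ, hρ, ?_⟩
      rcases h with h | ⟨rfl, h⟩
      · rcases h' with h' | ⟨rfl, h'⟩
        · exact Or.inl (tr _ _ _ hα hβ hδ h h')
        · exact Or.inl h
      · rcases h' with h' | ⟨rfl, h'⟩
        · exact Or.inl h'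
        · exact Or.inr ⟨rfl, (hE _ hα).lt_trans hn h h'⟩
    · rintro n _ _ hn ⟨α, σ, rfl, hα, hσ⟩ ⟨β, τ, rfl, hβ, hτ⟩
      rcases tot α β hα hβ with h | rfl | h
      · exact Or.inl ⟨α, σ, β, τ, rfl, rfl, hα, hβ, hσ, hτ, Or.inl h⟩
      · rcases (hE _ hα).lt_total hn hσ hτ with h | rfl | h
        · exact Or.inl ⟨α, σ, α, τ, rfl, rfl, hα, hα, hσ, hτ, Or.inr ⟨rfl, h⟩⟩
        · exact Or.inr (Or.inl rfl)
        · exact Or.inr (Or.inr ⟨α, τ, α, σ, rfl, rfl, hα, hα, hτ, hσ, Or.inr ⟨rfl, h⟩⟩)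
      · exact Or.inr (Or.inr ⟨β, τ, α, σ, rfl, rfl, hβ, hα, hτ, hσ, Or.inl h⟩)
    · rintro m n f _ _ _ _ hf ⟨α, σ, σ', rfl, rfl, hα, h1⟩ ⟨β, τ, τ', rfl, rfl, hβ, h2⟩
        ⟨α', σ'', β', τ'', e, e', -, -, hσ, hτ, h⟩
      obtain ⟨rfl, rfl⟩ := pr_inj.1 e
      obtain ⟨rfl, rfl⟩ := pr_inj.1 e'
      refine ⟨α, σ', β, τ', rfl, rfl, hα, hβ, ((hE _ hα).act_el hf h1).2,
        ((hE _ hβ).act_el hf h2).2, ?_⟩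
      rcases h with h | ⟨rfl, h⟩
      · exact Or.inl h
      · exact Or.inr ⟨rfl, (hE _ hα).laws.emb m n f σ τ σ' τ' hf h1 h2 h⟩
    · rintro n f _ hf h ⟨α, σ, rfl, hα, hσ⟩
      exact ⟨α, σ, σ, rfl, rfl, hα, (hE _ hα).laws.map_id n f σ hf h hσ⟩
    · rintro m n k f g h _ _ _ hf hg hh hc ⟨α, σ, τ, rfl, rfl, hα, h1⟩ ⟨β, τ', ρ, e, rfl, -, h2⟩
      obtain ⟨rfl, rfl⟩ := pr_inj.1 e
      exact ⟨α, σ, ρ, rfl, rfl, hα, (hE _ hα).laws.map_comp m n k f g h σ τ ρ hf hg hh hc h1 h2⟩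
    · rintro m n f g _ _ _ hf hg hle ⟨α, σ, τ, rfl, rfl, hα, h1⟩ ⟨β, σ', ρ, e, rfl, -, h2⟩
      obtain ⟨rfl, rfl⟩ := pr_inj.1 e
      rcases (hE _ hα).laws.monotone m n f g σ τ ρ hf hg hle h1 h2 with h | rfl
      · exact Or.inl ⟨α, τ, α, ρ, rfl, rfl, hα, hα, ((hE _ hα).act_el hf h1).2,
          ((hE _ hα).act_el hg h2).2, Or.inr ⟨rfl, h⟩⟩
      · exact Or.inr rfl
    · rintro m n f _ _ a b hf ⟨α, σ, τ, rfl, rfl, hα, h⟩ ⟨α', σ', e, -, ha⟩ ⟨α'', τ', e', -, hb⟩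
      obtain ⟨rfl, rfl⟩ := pr_inj.1 e
      obtain ⟨rfl, rfl⟩ := pr_inj.1 e'
      exact (hE _ hα).laws.supp_nat m n f σ τ a b hf h ha hb
    · rintro m n f _ a hf ⟨α, σ, rfl, hα, ha⟩ h
      obtain ⟨τ, hτ⟩ := (hE _ hα).laws.supp_cond m n f σ a hf ha h
      exact ⟨pr α τ, α, τ, σ, rfl, rfl, hα, hτ⟩
  lt_el := by
    rintro n _ _ hn ⟨α, σ, β, τ, rfl, rfl, hα, hβ, hσ, hτ, -⟩
    exact ⟨⟨α, σ, rfl, hα, hσ⟩, ⟨β, τ, rfl, hβ, hτ⟩⟩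
  act_el := by
    rintro m n f _ _ hf ⟨α, σ, τ, rfl, rfl, hα, h⟩
    have := (hE _ hα).act_el hf h
    exact ⟨⟨α, σ, rfl, hα, this.1⟩, ⟨α, τ, rfl, hα, this.2⟩⟩
  act_ex := by
    rintro m n f _ hf ⟨α, σ, rfl, hα, h⟩
    obtain ⟨τ, hτ⟩ := (hE _ hα).act_ex hf h
    exact ⟨pr α τ, α, σ, τ, rfl, rfl, hα, hτ⟩
  act_fun := by
    rintro m n f _ _ _ hf ⟨α, σ, τ, rfl, rfl, hα, h⟩ ⟨α', σ', τ', e, rfl, -, h'⟩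
    obtain ⟨rfl, rfl⟩ := pr_inj.1 e
    rw [(hE _ hα).act_fun hf h h']
  supp_el := by
    rintro n _ a hn ⟨α, σ, rfl, hα, h⟩
    exact ⟨α, σ, rfl, hα, (hE _ hα).supp_el hn h⟩
  supp_ex := by
    rintro n _ hn ⟨α, σ, rfl, hα, h⟩
    obtain ⟨a, ha⟩ := (hE _ hα).supp_ex hn h
    exact ⟨a, α, σ, rfl, hα, ha⟩
  supp_fun := by
    rintro n _ a b hn ⟨α, σ, rfl, hα, h⟩ ⟨α', σ', e, -, h'⟩
    obtain ⟨rfl, rfl⟩ := pr_inj.1 e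
    exact (hE _ hα).supp_fun hn h h'
  supp_sub := by
    rintro n _ a i hn ⟨α, σ, rfl, hα, h⟩ hi
    exact (hE _ hα).supp_sub hn h hi

theorem Data.Good.below {P : Data M} (hP : P.Good) (ν : M) : (P.below ν).Good :=
  sigma_good (fun α _ => hP.sub α) (fun _ _ => hP.compLt_irrefl)
    (fun _ _ _ _ _ _ => hP.compLt_trans) (fun _ _ h h' => hP.compLt_total h.1 h'.1)

end Components
-- Binary sums and separation of variables
section Sums
open Classical

variable {M : Type u} [prsLang.Structure M] [SetModel M]

theorem emp_ne : ¬ emp M = adj (emp M) (emp M) := emp_ne_one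

theorem ne_emp : ¬ adj (emp M) (emp M) = emp M := fun h => emp_ne h.symm

section
variable {P Q : Data M} {n σ τ : M}

theorem add_el_l : (P.add Q).el n (pr (emp M) σ) ↔ P.el n σ := by
  simp [Data.add, emp_ne]

theorem add_el_r : (P.add Q).el n (pr (adj (emp M) (emp M)) σ) ↔ Q.el n σ := by
  simp [Data.add, ne_emp]

theorem add_lt_ll : (P.add Q).lt n (pr (emp M) σ) (pr (emp M) τ) ↔ P.lt n σ τ := by
  simp [Data.add, emp_ne]

theorem add_lt_lr : (P.add Q).lt n (pr (emp M) σ) (pr (adj (emp M) (emp M)) τ) ↔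
    P.el n σ ∧ Q.el n τ := by
  simp [Data.add, emp_ne, ne_emp]

theorem add_lt_rl : ¬ (P.add Q).lt n (pr (adj (emp M) (emp M)) σ) (pr (emp M) τ) := by
  simp [Data.add, emp_ne, ne_emp]

theorem add_lt_rr : (P.add Q).lt n (pr (adj (emp M) (emp M)) σ) (pr (adj (emp M) (emp M)) τ) ↔
    Q.lt n σ τ := by
  simp [Data.add, ne_emp]

theorem add_act_ll {m f : M} : (P.add Q).act m n f (pr (emp M) σ) (pr (emp M) τ) ↔
    P.act m n f σ τ := by
  simp [Data.add, emp_ne]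

theorem add_act_rr {m f : M} :
    (P.add Q).act m n f (pr (adj (emp M) (emp M)) σ) (pr (adj (emp M) (emp M)) τ) ↔
    Q.act m n f σ τ := by
  simp [Data.add, ne_emp]

theorem add_act_l {m f ρ : M} : (P.add Q).act m n f (pr (emp M) σ) ρ ↔
    ∃ τ, ρ = pr (emp M) τ ∧ P.act m n f σ τ := by
  simp [Data.add, emp_ne]

theorem add_act_r {m f ρ : M} : (P.add Q).act m n f (pr (adj (emp M) (emp M)) σ) ρ ↔
    ∃ τ, ρ = pr (adj (emp M) (emp M)) τ ∧ Q.act m n f σ τ := by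
  simp [Data.add, ne_emp]

theorem add_supp_l {a : M} : (P.add Q).supp n (pr (emp M) σ) a ↔ P.supp n σ a := by
  simp [Data.add, emp_ne]

theorem add_supp_r {a : M} : (P.add Q).supp n (pr (adj (emp M) (emp M)) σ) a ↔ Q.supp n σ a := by
  simp [Data.add, ne_emp]

/-- `ρ` is an element of one of the two summands. -/
def Tagged (ρ : M) : Prop := (∃ σ, ρ = pr (emp M) σ) ∨ ∃ σ, ρ = pr (adj (emp M) (emp M)) σ

theorem add_lt_tagged {ρ ρ' : M} (h : (P.add Q).lt n ρ ρ') : Tagged ρ ∧ Tagged ρ' := by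
  obtain ⟨σ, τ, ⟨rfl, rfl, -⟩ | ⟨rfl, rfl, -⟩ | ⟨rfl, rfl, -⟩⟩ := h
  exacts [⟨Or.inl ⟨_, rfl⟩, Or.inl ⟨_, rfl⟩⟩, ⟨Or.inl ⟨_, rfl⟩, Or.inr ⟨_, rfl⟩⟩,
    ⟨Or.inr ⟨_, rfl⟩, Or.inr ⟨_, rfl⟩⟩]

theorem add_el_tagged {ρ : M} (h : (P.add Q).el n ρ) : Tagged ρ := by
  obtain ⟨σ, ⟨rfl, -⟩ | ⟨rfl, -⟩⟩ := h
  exacts [Or.inl ⟨_, rfl⟩, Or.inr ⟨_, rfl⟩]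

theorem add_act_tagged {m f ρ ρ' : M} (h : (P.add Q).act m n f ρ ρ') : Tagged ρ := by
  obtain ⟨σ, τ, ⟨rfl, -⟩ | ⟨rfl, -⟩⟩ := h
  exacts [Or.inl ⟨_, rfl⟩, Or.inr ⟨_, rfl⟩]

theorem add_supp_tagged {ρ a : M} (h : (P.add Q).supp n ρ a) : Tagged ρ := by
  obtain ⟨σ, ⟨rfl, -⟩ | ⟨rfl, -⟩⟩ := h
  exacts [Or.inl ⟨_, rfl⟩, Or.inr ⟨_, rfl⟩]

end

theorem Data.Good.add {P Q : Data M} (hP : P.Good) (hQ : Q.Good) : (P.add Q).Good where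
  laws := by
    refine ⟨?_, ?_, ?_, ?_, ?_, ?_, ?_, ?_, ?_⟩
    · intro n ρ hn h
      rcases (add_lt_tagged h).1 with ⟨σ, rfl⟩ | ⟨σ, rfl⟩
      · exact hP.lt_irrefl hn (add_lt_ll.1 h)
      · exact hQ.lt_irrefl hn (add_lt_rr.1 h)
    · intro n ρ₁ ρ₂ ρ₃ hn h h'
      rcases (add_lt_tagged h).1 with ⟨σ, rfl⟩ | ⟨σ, rfl⟩ <;>
      rcases (add_lt_tagged h).2 with ⟨τ, rfl⟩ | ⟨τ, rfl⟩ <;>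
      rcases (add_lt_tagged h').2 with ⟨ρ, rfl⟩ | ⟨ρ, rfl⟩ <;>
      simp only [add_lt_ll, add_lt_lr, add_lt_rl, add_lt_rr] at h h' ⊢
      · exact hP.lt_trans hn h h'
      · exact ⟨(hP.lt_el hn h).1, h'.2⟩
      · exact ⟨h.1, (hQ.lt_el hn h').2⟩
      · exact hQ.lt_trans hn h h'
    · intro n ρ ρ' hn h h'
      rcases add_el_tagged h with ⟨σ, rfl⟩ | ⟨σ, rfl⟩ <;>
      rcases add_el_tagged h' with ⟨τ, rfl⟩ | ⟨τ, rfl⟩ <;>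
      simp only [add_lt_ll, add_lt_lr, add_lt_rl, add_lt_rr, add_el_l, add_el_r, pr_inj,
        true_and] at h h' ⊢
      · exact hP.lt_total hn h h'
      · exact Or.inl ⟨h, h'⟩
      · exact Or.inr (Or.inr ⟨h', h⟩)
      · exact hQ.lt_total hn h h'
    · intro m n f ρ₁ ρ₂ ρ₃ ρ₄ hf h1 h2 h
      rcases add_act_tagged h1 with ⟨σ, rfl⟩ | ⟨σ, rfl⟩ <;>
      rcases add_act_tagged h2 with ⟨τ, rfl⟩ | ⟨τ, rfl⟩ <;>
      simp only [add_lt_ll, add_lt_lr, add_lt_rl, add_lt_rr, add_act_l, add_act_r] at h h1 h2 <;>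
      obtain ⟨σ', rfl, h1⟩ := h1 <;> obtain ⟨τ', rfl, h2⟩ := h2 <;>
      simp only [add_lt_ll, add_lt_lr, add_lt_rr]
      · exact hP.laws.emb m n f _ _ _ _ hf h1 h2 h
      · exact ⟨(hP.act_el hf h1).2, (hQ.act_el hf h2).2⟩
      · exact hQ.laws.emb m n f _ _ _ _ hf h1 h2 h
    · intro n f ρ hf hid h
      rcases add_el_tagged h with ⟨σ, rfl⟩ | ⟨σ, rfl⟩
      · exact add_act_ll.2 (hP.laws.map_id n f σ hf hid (add_el_l.1 h))
      · exact add_act_rr.2 (hQ.laws.map_id n f σ hf hid (add_el_r.1 h))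
    · intro m n k f g h ρ₁ ρ₂ ρ₃ hf hg hh hc h1 h2
      rcases add_act_tagged h1 with ⟨σ, rfl⟩ | ⟨σ, rfl⟩
      · obtain ⟨τ, rfl, kh1⟩ := add_act_l.1 h1
        obtain ⟨ρ, rfl, kh2⟩ := add_act_l.1 h2
        exact add_act_ll.2 (hP.laws.map_comp m n k f g h _ _ _ hf hg hh hc kh1 kh2)
      · obtain ⟨τ, rfl, kh1⟩ := add_act_r.1 h1
        obtain ⟨ρ, rfl, kh2⟩ := add_act_r.1 h2
        exact add_act_rr.2 (hQ.laws.map_comp m n k f g h _ _ _ hf hg hh hc kh1 kh2)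
    · intro m n f g ρ₁ ρ₂ ρ₃ hf hg hle h1 h2
      rcases add_act_tagged h1 with ⟨σ, rfl⟩ | ⟨σ, rfl⟩
      · obtain ⟨τ, rfl, kh1⟩ := add_act_l.1 h1
        obtain ⟨ρ, rfl, kh2⟩ := add_act_l.1 h2
        simp only [add_lt_ll, pr_inj, true_and]
        exact hP.laws.monotone m n f g _ _ _ hf hg hle kh1 kh2
      · obtain ⟨τ, rfl, kh1⟩ := add_act_r.1 h1
        obtain ⟨ρ, rfl, kh2⟩ := add_act_r.1 h2
        simp only [add_lt_rr, pr_inj, true_and]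
        exact hQ.laws.monotone m n f g _ _ _ hf hg hle kh1 kh2
    · intro m n f ρ₁ ρ₂ a b hf h ha hb
      rcases add_act_tagged h with ⟨σ, rfl⟩ | ⟨σ, rfl⟩
      · obtain ⟨τ, rfl, kh⟩ := add_act_l.1 h
        exact hP.laws.supp_nat m n f _ _ a b hf kh (add_supp_l.1 ha) (add_supp_l.1 hb)
      · obtain ⟨τ, rfl, kh⟩ := add_act_r.1 h
        exact hQ.laws.supp_nat m n f _ _ a b hf kh (add_supp_r.1 ha) (add_supp_r.1 hb)
    · intro m n f ρ a hf ha h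
      rcases add_supp_tagged ha with ⟨σ, rfl⟩ | ⟨σ, rfl⟩
      · obtain ⟨τ, hτ⟩ := hP.laws.supp_cond m n f _ a hf (add_supp_l.1 ha) h
        exact ⟨_, add_act_ll.2 hτ⟩
      · obtain ⟨τ, hτ⟩ := hQ.laws.supp_cond m n f _ a hf (add_supp_r.1 ha) h
        exact ⟨_, add_act_rr.2 hτ⟩
  lt_el := by
    intro n ρ ρ' hn h
    rcases (add_lt_tagged h).1 with ⟨σ, rfl⟩ | ⟨σ, rfl⟩ <;>
    rcases (add_lt_tagged h).2 with ⟨τ, rfl⟩ | ⟨τ, rfl⟩ <;>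
    simp only [add_lt_ll, add_lt_lr, add_lt_rl, add_lt_rr, add_el_l, add_el_r] at h ⊢
    · exact hP.lt_el hn h
    · exact h
    · exact hQ.lt_el hn h
  act_el := by
    intro m n f ρ ρ' hf h
    rcases add_act_tagged h with ⟨σ, rfl⟩ | ⟨σ, rfl⟩
    · obtain ⟨τ, rfl, kh⟩ := add_act_l.1 h
      rw [add_el_l, add_el_l]; exact hP.act_el hf kh
    · obtain ⟨τ, rfl, kh⟩ := add_act_r.1 h
      rw [add_el_r, add_el_r]; exact hQ.act_el hf kh
  act_ex := by
    intro m n f ρ hf h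
    rcases add_el_tagged h with ⟨σ, rfl⟩ | ⟨σ, rfl⟩
    · obtain ⟨τ, h⟩ := hP.act_ex hf (add_el_l.1 h)
      exact ⟨_, add_act_ll.2 h⟩
    · obtain ⟨τ, h⟩ := hQ.act_ex hf (add_el_r.1 h)
      exact ⟨_, add_act_rr.2 h⟩
  act_fun := by
    intro m n f ρ₁ ρ₂ ρ₃ hf h1 h2
    rcases add_act_tagged h1 with ⟨σ, rfl⟩ | ⟨σ, rfl⟩
    · obtain ⟨τ, rfl, kh1⟩ := add_act_l.1 h1
      obtain ⟨ρ, rfl, kh2⟩ := add_act_l.1 h2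
      rw [hP.act_fun hf kh1 kh2]
    · obtain ⟨τ, rfl, kh1⟩ := add_act_r.1 h1
      obtain ⟨ρ, rfl, kh2⟩ := add_act_r.1 h2
      rw [hQ.act_fun hf kh1 kh2]
  supp_el := by
    intro n ρ a hn h
    rcases add_supp_tagged h with ⟨σ, rfl⟩ | ⟨σ, rfl⟩
    · exact add_el_l.2 (hP.supp_el hn (add_supp_l.1 h))
    · exact add_el_r.2 (hQ.supp_el hn (add_supp_r.1 h))
  supp_ex := by
    intro n ρ hn h
    rcases add_el_tagged h with ⟨σ, rfl⟩ | ⟨σ, rfl⟩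
    · simp only [add_supp_l]; exact hP.supp_ex hn (add_el_l.1 h)
    · simp only [add_supp_r]; exact hQ.supp_ex hn (add_el_r.1 h)
  supp_fun := by
    intro n ρ a b hn h h'
    rcases add_supp_tagged h with ⟨σ, rfl⟩ | ⟨σ, rfl⟩
    · exact hP.supp_fun hn (add_supp_l.1 h) (add_supp_l.1 h')
    · exact hQ.supp_fun hn (add_supp_r.1 h) (add_supp_r.1 h')
  supp_sub := by
    intro n ρ a i hn h hi
    rcases add_supp_tagged h with ⟨σ, rfl⟩ | ⟨σ, rfl⟩
    · exact hP.supp_sub hn (add_supp_l.1 h) hi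
    · exact hQ.supp_sub hn (add_supp_r.1 h) hi

/-! ### Separation of variables -/

/-- `i` with `γ + i = x` -/
noncomputable def rem (γ x : M) : M := sUn (sep (om M) (fun i => add γ i = x))

/-- `γ + f` -/
noncomputable def addMap (γ f x : M) : M := if x ∈ₛ γ then x else add γ (app f (rem γ x))

instance PRf.rem {n : ℕ} (a b : (Fin n → M) → M) [PRf a] [PRf b] :
    PRf (fun x => rem (a x) (b x)) :=
  PRf.comp2 PRST.rem (by unfold PRST.rem; infer_instance) a b

instance PRf.addMap {n : ℕ} (a b c : (Fin n → M) → M) [PRf a] [PRf b] [PRf c] :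
    PRf (fun x => addMap (a x) (b x) (c x)) :=
  PRf.comp3 PRST.addMap (by unfold PRST.addMap; infer_instance) a b c

theorem rem_add {γ i : M} (hi : i ∈ₛ om M) : rem γ (add γ i) = i := by
  refine sUn_unique fun z => ?_
  rw [mem_sep]
  exact ⟨fun h => add_inj h.1 hi h.2, by rintro rfl; exact ⟨hi, rfl⟩⟩

theorem addMap_of_mem {γ f x : M} (h : x ∈ₛ γ) : addMap γ f x = x := if_pos h

theorem addMap_add {γ f i : M} (hi : i ∈ₛ om M) : addMap γ f (add γ i) = add γ (app f i) := by
  rw [addMap, if_neg (add_not_mem hi), rem_add hi]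

section
variable {γ m n f : M}

theorem addMap_mem (hf : IsMor m n f) {x : M} (hx : x ∈ₛ add γ m) : addMap γ f x ∈ₛ add γ n := by
  rcases (mem_add hf.1 x).1 hx with h | ⟨i, hi, rfl⟩
  · rw [addMap_of_mem h]; exact (mem_add hf.2.1 x).2 (Or.inl h)
  · rw [addMap_add (mem_om_of_mem hf.1 i hi)]; exact add_mem_add hf.2.1 (hf.app_mem hi)

theorem addMap_mem_iff (hf : IsMor m n f) {x : M} (hx : x ∈ₛ add γ m) :
    addMap γ f x ∈ₛ γ ↔ x ∈ₛ γ := by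
  rcases (mem_add hf.1 x).1 hx with h | ⟨i, hi, rfl⟩
  · rw [addMap_of_mem h]
  · rw [addMap_add (mem_om_of_mem hf.1 i hi)]
    exact iff_of_false (add_not_mem (mem_om_of_mem hf.2.1 _ (hf.app_mem hi)))
      (add_not_mem (mem_om_of_mem hf.1 i hi))

theorem addMap_lt (hγ : IsOrd γ) (hf : IsMor m n f) {x y : M} (hx : x ∈ₛ add γ m)
    (hy : y ∈ₛ add γ m) (h : x ∈ₛ y) : addMap γ f x ∈ₛ addMap γ f y := by
  rcases (mem_add hf.1 x).1 hx with hx | ⟨i, hi, rfl⟩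
  · rcases (mem_add hf.1 y).1 hy with hy | ⟨j, hj, rfl⟩
    · rwa [addMap_of_mem hx, addMap_of_mem hy]
    · rw [addMap_of_mem hx, addMap_add (mem_om_of_mem hf.1 j hj)]
      exact (mem_add (mem_om_of_mem hf.2.1 _ (hf.app_mem hj)) x).2 (Or.inl hx)
  · have hi' := mem_om_of_mem hf.1 i hi
    rcases (mem_add hf.1 y).1 hy with hy | ⟨j, hj, rfl⟩
    · exact absurd (hγ.trans h hy) (add_not_mem hi')
    · have hj' := mem_om_of_mem hf.1 j hj
      rw [addMap_add hi', addMap_add hj']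
      exact add_mem_add (mem_om_of_mem hf.2.1 _ (hf.app_mem hj))
        (hf.inc.app_lt hj ((add_mem_add_iff hi' hj').1 h))

theorem addMap_iff (hγ : IsOrd γ) (hf : IsMor m n f) {x y : M} (hx : x ∈ₛ add γ m) :
    AddMap γ f x y ↔ y = addMap γ f x := by
  rcases (mem_add hf.1 x).1 hx with hx | ⟨i, hi, rfl⟩
  · rw [addMap_of_mem hx]
    constructor
    · rintro (⟨-, h⟩ | ⟨i, j, hij, h1, -⟩)
      · exact h
      · obtain ⟨hi, -⟩ := hf.inc.mem_iff.1 hij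
        obtain ⟨-, rfl⟩ := (isAdd_iff (mem_om_of_mem hf.1 i hi)).1 h1
        exact absurd hx (add_not_mem (mem_om_of_mem hf.1 i hi))
    · rintro rfl; exact Or.inl ⟨hx, rfl⟩
  · have hi' := mem_om_of_mem hf.1 i hi
    rw [addMap_add hi']
    constructor
    · rintro (⟨h, -⟩ | ⟨k, j, hij, h1, h2⟩)
      · exact absurd h (add_not_mem hi')
      · obtain ⟨hk, rfl⟩ := hf.inc.mem_iff.1 hij
        obtain ⟨-, h1⟩ := (isAdd_iff (mem_om_of_mem hf.1 k hk)).1 h1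
        obtain rfl := add_inj hi' (mem_om_of_mem hf.1 k hk) h1
        exact ((isAdd_iff (mem_om_of_mem hf.2.1 _ (hf.app_mem hi))).1 h2).2
    · rintro rfl
      exact Or.inr ⟨i, app f i, hf.inc.mem_iff.2 ⟨hi, rfl⟩, isAdd_add hγ hi',
        isAdd_add hγ (mem_om_of_mem hf.2.1 _ (hf.app_mem hi))⟩

end

/-- The range of the function `e` with domain `k`. -/
noncomputable def rng (k e : M) : M := img k (app e)

instance PRf.rng {n : ℕ} (a b : (Fin n → M) → M) [PRf a] [PRf b] :
    PRf (fun x => rng (a x) (b x)) :=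
  PRf.comp2 PRST.rng (by unfold PRST.rng; infer_instance) a b

theorem mem_rng {k e y : M} : y ∈ₛ rng k e ↔ ∃ i, i ∈ₛ k ∧ y = app e i := mem_img

theorem isEnum_rng {A a k e : M} {lt : M → M → Prop} :
    IsEnum A lt a k e ↔ Inc A lt k e ∧ a = rng k e := by
  rw [isEnum_iff]
  refine and_congr_right fun h => ?_
  simp only [h.mem_iff]
  constructor
  · intro h; exact mext fun z => by rw [h, mem_rng]
  · rintro rfl; exact fun x => mem_rng

/-- The important coordinate `i(σ)` is the largest `i` such that `e(i) < γ`. -/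
def Data.ImpBelow (P : Data M) (γ σ k e : M) : Prop :=
  ∃ i, P.Imp σ k i ∧ app e i ∈ₛ γ ∧ ∀ j, j ∈ₛ k → app e j ∈ₛ γ → j ∈ₛ i ∨ j = i

/-- `(σ, rng(e))` with `e : k → γ + n` is an element of `{D}^γ(n)`. -/
def Data.SepRep (P : Data M) (γ n σ k e : M) : Prop :=
  Inc (PRST.add γ n) Mem k e ∧ P.Tr σ k ∧ P.ImpBelow γ σ k e

section
variable {P : Data M} {γ n : M}

theorem sepEl_iff (hγ : IsOrd γ) (hn : n ∈ₛ om M) {σ a : M} : P.sepEl γ n σ a ↔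
    ∃ k e, P.SepRep γ n σ k e ∧ a = rng k e := by
  constructor
  · rintro ⟨N, k, e, i, x, hN, he, hσ, hi, hx, hxγ, h⟩
    obtain ⟨-, rfl⟩ := (isAdd_iff hn).1 hN
    obtain ⟨he', rfl⟩ := isEnum_rng.1 he
    obtain ⟨hik, rfl⟩ := he'.mem_iff.1 hx
    exact ⟨k, e, ⟨he', hσ, i, hi, hxγ, fun j hj hjγ => h j _ (he'.mem_iff.2 ⟨hj, rfl⟩) hjγ⟩, rfl⟩
  · rintro ⟨k, e, ⟨he, hσ, i, hi, hxγ, h⟩, rfl⟩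
    refine ⟨add γ n, k, e, i, _, isAdd_add hγ hn, isEnum_rng.2 ⟨he, rfl⟩, hσ, hi,
      he.mem_iff.2 ⟨hi.1, rfl⟩, hxγ, fun j y hj hy => ?_⟩
    obtain ⟨hjk, rfl⟩ := he.mem_iff.1 hj
    exact h j hjk hy

theorem sep_el_iff (hγ : IsOrd γ) (hn : n ∈ₛ om M) {ρ : M} : (P.sep γ).el n ρ ↔
    ∃ σ k e, P.SepRep γ n σ k e ∧ ρ = pr σ (rng k e) := by
  constructor
  · rintro ⟨σ, a, rfl, h⟩
    obtain ⟨k, e, h', rfl⟩ := (sepEl_iff hγ hn).1 h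
    exact ⟨σ, k, e, h', rfl⟩
  · rintro ⟨σ, k, e, h, rfl⟩
    exact ⟨σ, _, rfl, (sepEl_iff hγ hn).2 ⟨k, e, h, rfl⟩⟩

theorem rng_unique {A k e k' e' : M} {lt : M → M → Prop} (hA : LinOn A lt) (h : Inc A lt k e)
    (h' : Inc A lt k' e') (hr : rng k e = rng k' e') : k = k' ∧ e = e' :=
  (isEnum_rng.2 ⟨h, rfl⟩).unique hA (isEnum_rng.2 ⟨h', hr⟩)

theorem sep_lt_iff (hP : P.Good) (hγ : IsOrd γ) (hn : n ∈ₛ om M) {σ k e τ l e' : M}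
    (h : P.SepRep γ n σ k e) (h' : P.SepRep γ n τ l e') :
    (P.sep γ).lt n (pr σ (rng k e)) (pr τ (rng l e')) ↔
      P.Lt (add γ n) Mem k σ e l τ e' := by
  rw [← hP.extLt_iff (isOrd_add hγ hn).linOn h.2.1 h'.2.1 (isEnum_rng.2 ⟨h.1, rfl⟩)
    (isEnum_rng.2 ⟨h'.1, rfl⟩)]
  constructor
  · rintro ⟨σ', a, τ', b, e1, e2, -, -, N, hN, hl⟩
    obtain ⟨rfl, rfl⟩ := pr_inj.1 e1
    obtain ⟨rfl, rfl⟩ := pr_inj.1 e2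
    obtain ⟨-, rfl⟩ := (isAdd_iff hn).1 hN
    exact hl
  · intro hl
    exact ⟨_, _, _, _, rfl, rfl, (sepEl_iff hγ hn).2 ⟨k, e, h, rfl⟩,
      (sepEl_iff hγ hn).2 ⟨l, e', h', rfl⟩, _, isAdd_add hγ hn, hl⟩

/-- `(γ + f) ∘ e` -/
noncomputable def addCmp (γ f k e : M) : M := lam k (fun i => addMap γ f (app e i))

theorem app_addCmp {f k e i : M} (hi : i ∈ₛ k) : app (addCmp γ f k e) i = addMap γ f (app e i) :=
  app_lam hi

theorem inc_addCmp (hγ : IsOrd γ) {m f k e : M} (hf : IsMor m n f) (h : Inc (add γ m) Mem k e) :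
    Inc (add γ n) Mem k (addCmp γ f k e) :=
  h.map (addMap γ f) (fun _ hx => addMap_mem hf hx) fun _ _ hx hy => addMap_lt hγ hf hx hy

/-- As `γ + f` preserves and reflects being below `γ`, the largest position with value below `γ`
remains the same, and hence so does the condition on `i(σ)`. -/
theorem sepRep_addCmp (hγ : IsOrd γ) {m f σ k e : M} (hf : IsMor m n f) (h : P.SepRep γ m σ k e) :
    P.SepRep γ n σ k (addCmp γ f k e) := by
  obtain ⟨he, hσ, i, hi, hx, hj⟩ := h
  refine ⟨inc_addCmp hγ hf he, hσ, i, hi, ?_, fun j hjk hjγ => hj j hjk ?_⟩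
  · rw [app_addCmp hi.1, addMap_mem_iff hf (he.app_mem hi.1)]; exact hx
  · rwa [app_addCmp hjk, addMap_mem_iff hf (he.app_mem hjk)] at hjγ

/-- The second component of an element is given by an enumeration `e`, and the action amounts to
composition of `γ + f` with `e`. -/
theorem sep_act_iff (hγ : IsOrd γ) {m f σ k e ρ : M} (hf : IsMor m n f)
    (h : P.SepRep γ m σ k e) : (P.sep γ).act m n f (pr σ (rng k e)) ρ ↔
      ρ = pr σ (rng k (addCmp γ f k e)) := by
  have key : ∀ y, y ∈ₛ rng k (addCmp γ f k e) ↔ ∃ x, x ∈ₛ rng k e ∧ AddMap γ f x y := by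
    intro y
    rw [mem_rng]
    constructor
    · rintro ⟨i, hi, rfl⟩
      refine ⟨app e i, mem_rng.2 ⟨i, hi, rfl⟩, ?_⟩
      rw [addMap_iff hγ hf (h.1.app_mem hi), app_addCmp hi]
    · rintro ⟨x, hx, hxy⟩
      obtain ⟨i, hi, rfl⟩ := mem_rng.1 hx
      rw [addMap_iff hγ hf (h.1.app_mem hi)] at hxy
      exact ⟨i, hi, by rw [app_addCmp hi, hxy]⟩
  constructor
  · rintro ⟨σ', a, b, e1, rfl, -, hb⟩
    obtain ⟨rfl, rfl⟩ := pr_inj.1 e1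
    have hbe : b = rng k (addCmp γ f k e) := mext fun z => by rw [hb, key]
    rw [hbe]
  · rintro rfl
    exact ⟨σ, _, _, rfl, rfl, (sepEl_iff hγ hf.1).2 ⟨k, e, h, rfl⟩, key⟩

theorem sep_act_rep (hγ : IsOrd γ) {m f ρ ρ' : M} (hf : IsMor m n f)
    (h : (P.sep γ).act m n f ρ ρ') : ∃ σ k e, P.SepRep γ m σ k e ∧ ρ = pr σ (rng k e) ∧
      ρ' = pr σ (rng k (addCmp γ f k e)) := by
  obtain ⟨σ, a, b, rfl, rfl, ha, hb⟩ := id h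
  obtain ⟨k, e, hr, rfl⟩ := (sepEl_iff hγ hf.1).1 ha
  exact ⟨σ, k, e, hr, rfl, (sep_act_iff hγ hf hr).1 h⟩

theorem sep_supp_iff (hγ : IsOrd γ) {σ k e c : M} (hn : n ∈ₛ om M) (h : P.SepRep γ n σ k e) :
    (P.sep γ).supp n (pr σ (rng k e)) c ↔
      ∀ i, i ∈ₛ c ↔ i ∈ₛ n ∧ add γ i ∈ₛ rng k e := by
  have key : ∀ i, (i ∈ₛ n ∧ ∃ x, x ∈ₛ rng k e ∧ IsAdd γ i x) ↔ i ∈ₛ n ∧ add γ i ∈ₛ rng k e := by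
    refine fun i => and_congr_right fun hi => ?_
    have hi' := mem_om_of_mem hn i hi
    constructor
    · rintro ⟨x, hx, h⟩
      obtain ⟨-, rfl⟩ := (isAdd_iff hi').1 h
      exact hx
    · exact fun h => ⟨_, h, isAdd_add hγ hi'⟩
  constructor
  · rintro ⟨σ', a, e1, -, hc⟩ i
    obtain ⟨rfl, rfl⟩ := pr_inj.1 e1
    rw [hc, key]
  · intro hc
    exact ⟨σ, _, rfl, (sepEl_iff hγ hn).2 ⟨k, e, h, rfl⟩, fun i => by rw [hc, key]⟩

theorem sep_supp_rep (hγ : IsOrd γ) {ρ c : M} (hn : n ∈ₛ om M) (h : (P.sep γ).supp n ρ c) :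
    ∃ σ k e, P.SepRep γ n σ k e ∧ ρ = pr σ (rng k e) := by
  obtain ⟨σ, a, rfl, ha, -⟩ := h
  obtain ⟨k, e, hr, rfl⟩ := (sepEl_iff hγ hn).1 ha
  exact ⟨σ, k, e, hr, rfl⟩

theorem sep_lt_rep (hγ : IsOrd γ) {ρ ρ' : M} (hn : n ∈ₛ om M) (h : (P.sep γ).lt n ρ ρ') :
    ∃ σ k e τ l e', P.SepRep γ n σ k e ∧ P.SepRep γ n τ l e' ∧ ρ = pr σ (rng k e) ∧
      ρ' = pr τ (rng l e') := by
  obtain ⟨σ, a, τ, b, rfl, rfl, ha, hb, -⟩ := h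
  obtain ⟨k, e, hr, rfl⟩ := (sepEl_iff hγ hn).1 ha
  obtain ⟨k', e', hr', rfl⟩ := (sepEl_iff hγ hn).1 hb
  exact ⟨σ, k, e, τ, k', e', hr, hr', rfl, rfl⟩

/-- The order is that of `P(γ + n)`, so linearity is inherited. The map `γ + f` is increasing, and
`γ + f ≤ γ + g` when `f ≤ g`, so the functor laws and monotonicity come from those for `P` on
ordinals. The condition that selects the elements is stable under the action by `sepRep_addCmp`. -/
theorem Data.Good.sep (hP : P.Good) (hγ : IsOrd γ) : (P.sep γ).Good where
  laws := by
    refine ⟨?_, ?_, ?_, ?_, ?_, ?_, ?_, ?_, ?_⟩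
    · intro n ρ hn h
      obtain ⟨σ, k, e, -, -, -, hr, -, rfl, -⟩ := sep_lt_rep hγ hn h
      rw [sep_lt_iff hP hγ hn hr hr] at h
      exact hP.Lt_irrefl (isOrd_add hγ hn).linOn hr.2.1.2.1 hr.1 h
    · intro n ρ₁ ρ₂ ρ₃ hn h h'
      obtain ⟨σ, k, e, τ, l, e', hr, hr', rfl, rfl⟩ := sep_lt_rep hγ hn h
      obtain ⟨-, -, -, ρ, k', e'', -, hr'', -, rfl⟩ := sep_lt_rep hγ hn h'
      rw [sep_lt_iff hP hγ hn hr hr'] at h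
      rw [sep_lt_iff hP hγ hn hr' hr''] at h'
      rw [sep_lt_iff hP hγ hn hr hr'']
      exact hP.Lt_trans (isOrd_add hγ hn).linOn hr.2.1.2.1 hr'.2.1.2.1 hr''.2.1.2.1
        hr.1 hr'.1 hr''.1 h h'
    · intro n ρ₁ ρ₂ hn h h'
      obtain ⟨σ, k, e, hr, rfl⟩ := (sep_el_iff hγ hn).1 h
      obtain ⟨τ, l, e', hr', rfl⟩ := (sep_el_iff hγ hn).1 h'
      rw [sep_lt_iff hP hγ hn hr hr', sep_lt_iff hP hγ hn hr' hr]
      by_cases h1 : P.Lt (PRST.add γ n) Mem k σ e l τ e'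
      · exact Or.inl h1
      by_cases h2 : P.Lt (PRST.add γ n) Mem l τ e' k σ e
      · exact Or.inr (Or.inr h2)
      obtain ⟨rfl, rfl, rfl⟩ := hP.eq_of_not_Lt (isOrd_add hγ hn).linOn hr.2.1 hr'.2.1 hr.1 hr'.1
        h1 h2
      exact Or.inr (Or.inl rfl)
    · intro m n f ρ₁ ρ₂ ρ₃ ρ₄ hf h1 h2 h
      obtain ⟨σ, k, e, hr, rfl, rfl⟩ := sep_act_rep hγ hf h1
      obtain ⟨τ, l, e', hr', rfl, rfl⟩ := sep_act_rep hγ hf h2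
      rw [sep_lt_iff hP hγ hf.1 hr hr'] at h
      rw [sep_lt_iff hP hγ hf.2.1 (sepRep_addCmp hγ hf hr) (sepRep_addCmp hγ hf hr')]
      exact (hP.Lt_map (isOrd_add hγ hf.1).linOn (isOrd_add hγ hf.2.1).linOn hr.2.1.2.1
        hr'.2.1.2.1 hr.1 hr'.1 (PRST.addMap γ f) (fun _ hx => addMap_mem hf hx)
        (fun _ _ hx hy => addMap_lt hγ hf hx hy) (fun _ hi => app_addCmp hi)
        (fun _ hi => app_addCmp hi)).2 h
    · intro n f ρ hf hid h
      obtain ⟨σ, k, e, hr, rfl⟩ := (sep_el_iff hγ hf.1).1 h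
      rw [sep_act_iff hγ hf hr]
      congr 2
      refine hr.1.ext (inc_addCmp hγ hf hr.1) fun i hi => ?_
      rw [app_addCmp hi]
      rcases (mem_add hf.1 _).1 (hr.1.app_mem hi) with h | ⟨j, hj, h⟩
      · rw [addMap_of_mem h]
      · rw [h, addMap_add (mem_om_of_mem hf.1 j hj), ← (hf.inc.mem_iff.1 (hid j hj)).2]
    · intro m n k f g h ρ₁ ρ₂ ρ₃ hf hg hh hc h1 h2
      obtain ⟨σ, l, e, hr, rfl, rfl⟩ := sep_act_rep hγ hf h1
      rw [sep_act_iff hγ hg (sepRep_addCmp hγ hf hr)] at h2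
      rw [sep_act_iff hγ hh hr, h2]
      congr 2
      refine (inc_addCmp hγ hg (inc_addCmp hγ hf hr.1)).ext (inc_addCmp hγ hh hr.1) fun i hi => ?_
      rw [app_addCmp hi, app_addCmp hi, app_addCmp hi]
      rcases (mem_add hf.1 _).1 (hr.1.app_mem hi) with h | ⟨j, hj, h⟩
      · rw [addMap_of_mem h, addMap_of_mem h, addMap_of_mem h]
      · have hfj := hf.app_mem hj
        rw [h, addMap_add (mem_om_of_mem hf.1 j hj), addMap_add (mem_om_of_mem hf.1 j hj),
          addMap_add (mem_om_of_mem hf.2.1 _ hfj),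
          (hh.inc.mem_iff.1 (hc j _ _ (hf.inc.mem_iff.2 ⟨hj, rfl⟩)
            (hg.inc.mem_iff.2 ⟨hfj, rfl⟩))).2]
    · intro m n f g ρ₁ ρ₂ ρ₃ hf hg hle h1 h2
      obtain ⟨σ, k, e, hr, rfl, rfl⟩ := sep_act_rep hγ hf h1
      rw [sep_act_iff hγ hg hr] at h2
      subst h2
      have r1 := sepRep_addCmp hγ hf hr
      have r2 := sepRep_addCmp hγ hg hr
      rw [sep_lt_iff hP hγ hf.2.1 r1 r2]
      have hA := (isOrd_add hγ hf.2.1).linOn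
      have hnot := hP.not_Lt_of_le hA hr.2.1.2.1 r1.1 r2.1 (fun i hi => by
        rw [app_addCmp hi, app_addCmp hi]
        rcases (mem_add hf.1 _).1 (hr.1.app_mem hi) with h | ⟨j, hj, h⟩
        · rw [addMap_of_mem h, addMap_of_mem h]; exact Or.inr rfl
        · rw [h, addMap_add (mem_om_of_mem hf.1 j hj), addMap_add (mem_om_of_mem hf.1 j hj)]
          rcases hle j _ _ (hf.inc.mem_iff.2 ⟨hj, rfl⟩) (hg.inc.mem_iff.2 ⟨hj, rfl⟩) with h' | h'
          · exact Or.inl (add_mem_add (mem_om_of_mem hg.2.1 _ (hg.app_mem hj)) h')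
          · rw [h']; exact Or.inr rfl)
      by_cases hl : P.Lt (PRST.add γ n) Mem k σ (addCmp γ f k e) k σ (addCmp γ g k e)
      · exact Or.inl hl
      · obtain ⟨-, he, -⟩ := hP.eq_of_not_Lt hA r1.2.1 r2.2.1 r1.1 r2.1 hl hnot
        rw [he]; exact Or.inr rfl
    · intro m n f ρ₁ ρ₂ a b hf h ha hb y
      obtain ⟨σ, k, e, hr, rfl, rfl⟩ := sep_act_rep hγ hf h
      rw [sep_supp_iff hγ hf.1 hr] at ha
      rw [sep_supp_iff hγ hf.2.1 (sepRep_addCmp hγ hf hr)] at hb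
      rw [hb, mem_rng]
      constructor
      · rintro ⟨hy, i, hi, hyi⟩
        rw [app_addCmp hi] at hyi
        have hy' := mem_om_of_mem hf.2.1 y hy
        rcases (mem_add hf.1 _).1 (hr.1.app_mem hi) with h | ⟨j, hj, h⟩
        · rw [addMap_of_mem h] at hyi
          rw [← hyi] at h
          exact absurd h (add_not_mem hy')
        · rw [h, addMap_add (mem_om_of_mem hf.1 j hj)] at hyi
          obtain rfl := add_inj hy' (mem_om_of_mem hf.2.1 _ (hf.app_mem hj)) hyi
          exact ⟨j, (ha j).2 ⟨hj, mem_rng.2 ⟨i, hi, h.symm⟩⟩, hf.inc.mem_iff.2 ⟨hj, rfl⟩⟩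
      · rintro ⟨j, hja, hjy⟩
        obtain ⟨hj, hjr⟩ := (ha j).1 hja
        obtain ⟨-, rfl⟩ := hf.inc.mem_iff.1 hjy
        obtain ⟨i, hi, h⟩ := mem_rng.1 hjr
        exact ⟨hf.app_mem hj, i, hi, by
          rw [app_addCmp hi, ← h, addMap_add (mem_om_of_mem hf.1 j hj)]⟩
    · intro m n f ρ a hf ha h
      obtain ⟨σ, k, e, hr, rfl⟩ := sep_supp_rep hγ hf.2.1 ha
      rw [sep_supp_iff hγ hf.2.1 hr] at ha
      have hι : Inc (PRST.add γ n) Mem k e := hr.1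
      have hpre : ∀ i, i ∈ₛ k → ∃ x, x ∈ₛ PRST.add γ m ∧ PRST.addMap γ f x = app e i := by
        intro i hi
        rcases (mem_add hf.2.1 _).1 (hr.1.app_mem hi) with h1 | ⟨j, hj, h1⟩
        · exact ⟨_, (mem_add hf.1 _).2 (Or.inl h1), addMap_of_mem h1⟩
        · obtain ⟨x, hx⟩ := h j ((ha j).2 ⟨hj, mem_rng.2 ⟨i, hi, h1.symm⟩⟩)
          obtain ⟨hx', rfl⟩ := hf.inc.mem_iff.1 hx
          exact ⟨PRST.add γ x, add_mem_add hf.1 hx', by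
            rw [addMap_add (mem_om_of_mem hf.1 x hx'), h1]⟩
      -- For the support condition, each entry `e(i)` is replaced by its preimage under `γ + f`. The
      -- preimage exists because the entries beyond `γ` come from the support, and it is unique
      -- because `γ + f` is increasing.
      let F : M → M := fun i => sUn (PRST.sep (PRST.add γ m) (fun x => PRST.addMap γ f x = app e i))
      have hF : PRf (fun x : Fin 1 → M => F (x 0)) := by simp only [F]; infer_instance
      have hlin := (isOrd_add hγ hf.1).linOn
      have hinj : ∀ x y, x ∈ₛ PRST.add γ m → y ∈ₛ PRST.add γ m →
          PRST.addMap γ f x ∈ₛ PRST.addMap γ f y → x ∈ₛ y := by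
        intro x y hx hy hl
        rcases hlin.total x y hx hy with h' | rfl | h'
        · exact h'
        · exact absurd hl (mem_irrefl _)
        · exact absurd hl (mem_asymm (addMap_lt hγ hf hy hx h'))
      have hFs : ∀ i, i ∈ₛ k → F i ∈ₛ PRST.add γ m ∧ PRST.addMap γ f (F i) = app e i := by
        intro i hi
        obtain ⟨x, hx, hxe⟩ := hpre i hi
        have : F i = x := by
          refine sUn_unique fun z => ?_
          rw [mem_sep]
          refine ⟨fun ⟨hz, hze⟩ => ?_, fun h => h ▸ ⟨hx, hxe⟩⟩
          rcases hlin.total z x hz hx with h' | h' | h'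
          · have := addMap_lt hγ hf hz hx h'
            rw [hze, hxe] at this; exact absurd this (mem_irrefl _)
          · exact h'
          · have := addMap_lt hγ hf hx hz h'
            rw [hze, hxe] at this; exact absurd this (mem_irrefl _)
        rw [this]; exact ⟨hx, hxe⟩
      have hko := isOrd_of_mem_om hr.1.1
      have hinc : Inc (PRST.add γ m) Mem k (lam k F) :=
        inc_lam hr.1.1 F (fun i hi => (hFs i hi).1) fun i j hij hj => by
          have hi := hko.trans hij hj
          refine hinj _ _ (hFs i hi).1 (hFs j hj).1 ?_
          rw [(hFs i hi).2, (hFs j hj).2]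
          exact hr.1.app_lt hj hij
      have hr' : P.SepRep γ m σ k (lam k F) := by
        obtain ⟨-, hσ, i, hi, hx, hj⟩ := hr
        refine ⟨hinc, hσ, i, hi, ?_, fun j hjk hjγ => hj j hjk ?_⟩
        · rw [app_lam hi.1, ← addMap_mem_iff hf (hFs i hi.1).1, (hFs i hi.1).2]; exact hx
        · rwa [app_lam hjk, ← addMap_mem_iff hf (hFs j hjk).1, (hFs j hjk).2] at hjγ
      refine ⟨pr σ (rng k (lam k F)), (sep_act_iff hγ hf hr').2 ?_⟩
      congr 2
      refine hr.1.ext (inc_addCmp hγ hf hinc) fun i hi => ?_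
      rw [app_addCmp hi, app_lam hi, (hFs i hi).2]
  lt_el := by
    intro n ρ ρ' hn h
    obtain ⟨σ, k, e, τ, l, e', hr, hr', rfl, rfl⟩ := sep_lt_rep hγ hn h
    exact ⟨(sep_el_iff hγ hn).2 ⟨σ, k, e, hr, rfl⟩, (sep_el_iff hγ hn).2 ⟨τ, l, e', hr', rfl⟩⟩
  act_el := by
    intro m n f ρ ρ' hf h
    obtain ⟨σ, k, e, hr, rfl, rfl⟩ := sep_act_rep hγ hf h
    exact ⟨(sep_el_iff hγ hf.1).2 ⟨σ, k, e, hr, rfl⟩,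
      (sep_el_iff hγ hf.2.1).2 ⟨σ, k, _, sepRep_addCmp hγ hf hr, rfl⟩⟩
  act_ex := by
    intro m n f ρ hf h
    obtain ⟨σ, k, e, hr, rfl⟩ := (sep_el_iff hγ hf.1).1 h
    exact ⟨_, (sep_act_iff hγ hf hr).2 rfl⟩
  act_fun := by
    intro m n f ρ₁ ρ₂ ρ₃ hf h h'
    obtain ⟨σ, k, e, hr, rfl, rfl⟩ := sep_act_rep hγ hf h
    exact ((sep_act_iff hγ hf hr).1 h').symm
  supp_el := by
    intro n ρ c hn h
    obtain ⟨σ, k, e, hr, rfl⟩ := sep_supp_rep hγ hn h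
    exact (sep_el_iff hγ hn).2 ⟨σ, k, e, hr, rfl⟩
  supp_ex := by
    intro n ρ hn h
    obtain ⟨σ, k, e, hr, rfl⟩ := (sep_el_iff hγ hn).1 h
    exact ⟨PRST.sep n (fun i => PRST.add γ i ∈ₛ rng k e), (sep_supp_iff hγ hn hr).2 fun i => mem_sep⟩
  supp_fun := by
    intro n ρ c d hn h h'
    obtain ⟨σ, k, e, hr, rfl⟩ := sep_supp_rep hγ hn h
    rw [sep_supp_iff hγ hn hr] at h h'
    exact mext fun i => by rw [h, h']
  supp_sub := by
    intro n ρ c i hn h hi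
    obtain ⟨σ, k, e, hr, rfl⟩ := sep_supp_rep hγ hn h
    exact (((sep_supp_iff hγ hn hr).1 h i).1 hi).1

end

end Sums
-- Sets that represent predilators given by relations
section Coding
open Classical

variable {M : Type u} [prsLang.Structure M] [SetModel M]

/-- The relations of the family `P` are primitive recursive. -/
class PRr (P : M → Data M) : Prop where
  -- The relations matter only for natural numbers and their morphisms. The guard allows
  -- equivalences that hold only there, such as those for sums `γ + n` with `n ∈ ω`.
  el : PRp (fun x : Fin 3 → M => x 1 ∈ₛ om M ∧ (P (x 0)).el (x 1) (x 2))
  lt : PRp (fun x : Fin 4 → M => x 1 ∈ₛ om M ∧ (P (x 0)).lt (x 1) (x 2) (x 3))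
  act : PRp (fun x : Fin 6 → M => IsMor (x 1) (x 2) (x 3) ∧
    (P (x 0)).act (x 1) (x 2) (x 3) (x 4) (x 5))
  supp : PRp (fun x : Fin 4 → M => x 1 ∈ₛ om M ∧ (P (x 0)).supp (x 1) (x 2) (x 3))

section
variable {P : M → Data M} [h : PRr P] {m : ℕ} (p a b c d e : (Fin m → M) → M) [PRf p] [PRf a]
  [PRf b] [PRf c] [PRf d] [PRf e]

instance PRp.el : PRp (fun x => a x ∈ₛ om M ∧ (P (p x)).el (a x) (b x)) :=
  PRp.comp3 (fun p a b => a ∈ₛ om M ∧ (P p).el a b) h.el p a b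

instance PRp.lt : PRp (fun x => a x ∈ₛ om M ∧ (P (p x)).lt (a x) (b x) (c x)) :=
  PRp.comp4 (fun p a b c => a ∈ₛ om M ∧ (P p).lt a b c) h.lt p a b c

instance PRp.act : PRp (fun x => IsMor (a x) (b x) (c x) ∧
    (P (p x)).act (a x) (b x) (c x) (d x) (e x)) :=
  PRp.comp6 (fun p a b c d e => IsMor a b c ∧ (P p).act a b c d e) h.act p a b c d e

instance PRp.supp : PRp (fun x => a x ∈ₛ om M ∧ (P (p x)).supp (a x) (b x) (c x)) :=
  PRp.comp4 (fun p a b c => a ∈ₛ om M ∧ (P p).supp a b c) h.supp p a b c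

end

/-! ### The set that represents given relations -/

noncomputable def carrier (C : M) (P : Data M) (n : M) : M :=
  sep C (fun σ => n ∈ₛ om M ∧ P.el n σ)

noncomputable def codeObj (C : M) (P : Data M) (n : M) : M :=
  pr (carrier C P n) (sep (prod C C) (fun q => n ∈ₛ om M ∧ P.lt n (fst q) (snd q)))

noncomputable def codeMor (C : M) (P : Data M) (t : M) : M :=
  sep (prod C C) (fun q => IsMor (fst t) (fst (snd t)) (snd (snd t)) ∧
    P.act (fst t) (fst (snd t)) (snd (snd t)) (fst q) (snd q))

noncomputable def codeSupp (C : M) (P : Data M) (n : M) : M :=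
  sep (prod C (fin (om M))) (fun q => n ∈ₛ om M ∧ P.supp n (fst q) (snd q))

/-- The set of triples `(m, (n, f))` for `f : m → n`. -/
noncomputable def triples (M : Type u) [prsLang.Structure M] [SetModel M] : M :=
  sep (prod (om M) (prod (om M) (mors M))) (fun t => IsMor (fst t) (fst (snd t)) (snd (snd t)))

/-- The triple `(O, F, S)` that represents `P`, provided that all elements lie in `C`. -/
noncomputable def code (C : M) (P : Data M) : M :=
  pr (lam (om M) (codeObj C P)) (pr (lam (triples M) (codeMor C P)) (lam (om M) (codeSupp C P)))

section
variable {P : M → Data M} [h : PRr P] {m : ℕ} (c p n : (Fin m → M) → M) [PRf c] [PRf p] [PRf n]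

instance PRf.codeObj : PRf (fun x => codeObj (c x) (P (p x)) (n x)) :=
  PRf.comp3 (fun c p n => PRST.codeObj c (P p) n) (by unfold PRST.codeObj carrier; infer_instance) c p n

instance PRf.codeMor : PRf (fun x => codeMor (c x) (P (p x)) (n x)) :=
  PRf.comp3 (fun c p n => PRST.codeMor c (P p) n) (by unfold PRST.codeMor; infer_instance) c p n

instance PRf.codeSupp : PRf (fun x => codeSupp (c x) (P (p x)) (n x)) :=
  PRf.comp3 (fun c p n => PRST.codeSupp c (P p) n) (by unfold PRST.codeSupp; infer_instance) c p n

theorem PRf.code : PRf (fun x => code (c x) (P (p x))) :=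
  PRf.comp2 (fun c p => PRST.code c (P p)) (by unfold PRST.code; infer_instance) c p

end

theorem mem_triples {t : M} : t ∈ₛ triples M ↔ ∃ m n f, IsMor m n f ∧ t = pr m (pr n f) := by
  rw [triples, mem_sep]
  constructor
  · rintro ⟨h1, h2⟩
    obtain ⟨m, y, -, hy, rfl⟩ := mem_prod.1 h1
    obtain ⟨n, f, -, -, rfl⟩ := mem_prod.1 hy
    simp only [fst_pr, snd_pr] at h2
    exact ⟨m, n, f, h2, rfl⟩
  · rintro ⟨m, n, f, h, rfl⟩
    simp only [fst_pr, snd_pr, pr_mem_prod]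
    exact ⟨⟨h.1, h.2.1, h.mem_mors⟩, h⟩

/-- Since `C` bounds the elements and `fin (om M)` bounds the supports, all parts of the triple are
obtained by separation from products. -/
theorem codes_code {P : M → Data M} [PRr P] {p C : M} (hP : (P p).Good)
    (hC : ∀ n σ, n ∈ₛ om M → (P p).el n σ → σ ∈ₛ C) : Codes (code C (P p)) (P p) := by
  have hcar : ∀ {n σ}, n ∈ₛ om M → (σ ∈ₛ carrier C (P p) n ↔ (P p).el n σ) := fun {n σ} hn => by
    rw [carrier, mem_sep]
    exact ⟨fun h => h.2.2, fun h => ⟨hC n σ hn h, hn, h⟩⟩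
  have hO : ∀ {n A r}, pr n (pr A r) ∈ₛ lam (om M) (codeObj C (P p)) ↔ n ∈ₛ om M ∧
      A = carrier C (P p) n ∧
      r = sep (prod C C) (fun q => n ∈ₛ om M ∧ (P p).lt n (fst q) (snd q)) := fun {n A r} => by
    rw [mem_lam, codeObj, pr_inj]
  have hr : ∀ {n σ τ}, n ∈ₛ om M → (pr σ τ ∈ₛ sep (prod C C)
      (fun q => n ∈ₛ om M ∧ (P p).lt n (fst q) (snd q)) ↔ (P p).lt n σ τ) := fun {n σ τ} hn => by
    rw [mem_sep, pr_mem_prod, fst_pr, snd_pr]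
    exact ⟨fun h => h.2.2, fun h => ⟨⟨hC n _ hn (hP.lt_el hn h).1, hC n _ hn (hP.lt_el hn h).2⟩,
      hn, h⟩⟩
  have hF : ∀ {m n f g}, pr (pr m (pr n f)) g ∈ₛ lam (triples M) (codeMor C (P p)) ↔
      IsMor m n f ∧ g = codeMor C (P p) (pr m (pr n f)) := fun {m n f g} => by
    rw [mem_lam, mem_triples]
    refine and_congr_left fun _ => ⟨?_, fun h => ⟨m, n, f, h, rfl⟩⟩
    rintro ⟨m', n', f', h, e⟩
    simp only [pr_inj] at e
    obtain ⟨rfl, rfl, rfl⟩ := e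
    exact h
  have hact : ∀ {m n f σ τ}, IsMor m n f → (pr σ τ ∈ₛ codeMor C (P p) (pr m (pr n f)) ↔
      (P p).act m n f σ τ) := fun {m n f σ τ} hf => by
    rw [codeMor, mem_sep, pr_mem_prod]
    simp only [fst_pr, snd_pr]
    exact ⟨fun h => h.2.2, fun h => ⟨⟨hC m _ hf.1 (hP.act_el hf h).1,
      hC n _ hf.2.1 (hP.act_el hf h).2⟩, hf, h⟩⟩
  have hsupp : ∀ {n σ a}, n ∈ₛ om M → (pr σ a ∈ₛ codeSupp C (P p) n ↔ (P p).supp n σ a) :=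
    fun {n σ a} hn => by
    rw [codeSupp, mem_sep, pr_mem_prod, fst_pr, snd_pr]
    refine ⟨fun h => h.2.2, fun h => ⟨⟨hC n σ hn (hP.supp_el hn h), ?_⟩, hn, h⟩⟩
    have e : sep n (fun i => i ∈ₛ a) = a := mext fun z => by
      rw [mem_sep]
      exact ⟨fun h => h.2, fun hz => ⟨hP.supp_sub hn h hz, hz⟩⟩
    exact e ▸ sep_mem_fin hn _
  refine ⟨isData_iff.2 ⟨isFun_lam _ _, ?_, ?_, ?_, ?_, isFun_lam _ _, ?_⟩, ?_, ?_, ?_, ?_⟩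
  · intro n q hq
    obtain ⟨hn, rfl⟩ := mem_lam.1 hq
    refine ⟨_, _, rfl, fun z hz => ?_⟩
    obtain ⟨hz1, -, hz2⟩ := mem_sep.1 hz
    obtain ⟨x, y, -, -, rfl⟩ := mem_prod.1 hz1
    rw [fst_pr, snd_pr] at hz2
    exact ⟨x, y, (hcar hn).2 (hP.lt_el hn hz2).1, (hcar hn).2 (hP.lt_el hn hz2).2, rfl⟩
  · intro q hq
    obtain ⟨t, g, ht, rfl⟩ := (isFun_lam (triples M) (codeMor C (P p))).1 q hq
    obtain ⟨m, n, f, hf, rfl⟩ := mem_triples.1 ht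
    exact ⟨m, n, f, g, hf, rfl⟩
  · intro m n f hf
    exact ⟨_, hF.2 ⟨hf, rfl⟩, fun g hg => (hF.1 hg).2⟩
  · intro m n f g A r B s hg hA hB
    obtain ⟨hf, rfl⟩ := hF.1 hg
    obtain ⟨hm, rfl, -⟩ := hO.1 hA
    obtain ⟨hn, rfl, -⟩ := hO.1 hB
    refine ⟨⟨fun q hq => ?_, fun σ hσ => ?_⟩, fun σ τ h => ?_⟩
    · obtain ⟨x, y, -, -, rfl⟩ := mem_prod.1 (mem_sep.1 hq).1
      exact ⟨x, y, (hcar hm).2 (hP.act_el hf ((hact hf).1 hq)).1, rfl⟩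
    · have hσ' := (hcar hm).1 hσ
      exact ⟨_, (hact hf).2 (hP.act_mp hf hσ'), fun τ hτ => (hP.act_iff hf hσ').1 ((hact hf).1 hτ)⟩
    · exact (hcar hn).2 (hP.act_el hf ((hact hf).1 h)).2
  · intro n g A r hg hA
    obtain ⟨hn, rfl⟩ := mem_lam.1 hg
    obtain ⟨-, rfl, -⟩ := hO.1 hA
    refine ⟨⟨fun q hq => ?_, fun σ hσ => ?_⟩, fun σ a h i hi => ?_⟩
    · obtain ⟨x, y, -, -, rfl⟩ := mem_prod.1 (mem_sep.1 hq).1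
      exact ⟨x, y, (hcar hn).2 (hP.supp_el hn ((hsupp hn).1 hq)), rfl⟩
    · have hσ' := (hcar hn).1 hσ
      exact ⟨_, (hsupp hn).2 (hP.supp_sp hn hσ'), fun τ hτ =>
        (hP.supp_iff hn hσ').1 ((hsupp hn).1 hτ)⟩
    · exact hP.supp_sub hn ((hsupp hn).1 h) hi
  · intro n hn σ
    rw [code, dat_el]
    constructor
    · rintro ⟨A, r, hA, hσ⟩
      obtain ⟨-, rfl, -⟩ := hO.1 hA
      exact (hcar hn).1 hσ
    · exact fun h => ⟨_, _, hO.2 ⟨hn, rfl, rfl⟩, (hcar hn).2 h⟩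
  · intro n hn σ τ
    rw [code, dat_lt]
    constructor
    · rintro ⟨A, r, hA, hσ⟩
      obtain ⟨-, -, rfl⟩ := hO.1 hA
      exact (hr hn).1 hσ
    · exact fun h => ⟨_, _, hO.2 ⟨hn, rfl, rfl⟩, (hr hn).2 h⟩
  · intro m n f hf σ τ
    rw [code, dat_act]
    constructor
    · rintro ⟨g, hg, h⟩
      obtain ⟨-, rfl⟩ := hF.1 hg
      exact (hact hf).1 h
    · exact fun h => ⟨_, hF.2 ⟨hf, rfl⟩, (hact hf).2 h⟩
  · intro n hn σ a
    rw [code, dat_supp]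
    constructor
    · rintro ⟨g, hg, h⟩
      obtain ⟨-, rfl⟩ := mem_lam.1 hg
      exact (hsupp hn).1 h
    · exact fun h => ⟨_, mem_lam.2 ⟨hn, rfl⟩, (hsupp hn).2 h⟩

theorem IsFun.ext_mem {f g a b : M} (hf : IsFun f a) (hg : IsFun g b)
    (h : ∀ x y, pr x y ∈ₛ f ↔ pr x y ∈ₛ g) : f = g := mext fun z => by
  constructor
  · intro hz
    obtain ⟨x, y, -, rfl⟩ := hf.1 z hz
    exact (h x y).1 hz
  · intro hz
    obtain ⟨x, y, -, rfl⟩ := hg.1 z hz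
    exact (h x y).2 hz

theorem IsRelOn.ext {r s A B : M} (hr : IsRelOn r A) (hs : IsRelOn s B)
    (h : ∀ x y, pr x y ∈ₛ r ↔ pr x y ∈ₛ s) : r = s := mext fun z => by
  constructor
  · intro hz
    obtain ⟨x, y, -, -, rfl⟩ := hr z hz
    exact (h x y).1 hz
  · intro hz
    obtain ⟨x, y, -, -, rfl⟩ := hs z hz
    exact (h x y).2 hz

/-- The predecessors in `IsPred` are arbitrary sets that represent given relations, whereas the
proof forms one specific code. Uniqueness identifies the two. It holds because relations on sets and
functions are determined by the pairs they contain. -/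
theorem Codes.unique {D D' : M} {P : Data M} (h : Codes D P) (h' : Codes D' P) : D = D' := by
  have key : ∀ {D D' : M}, Codes D P → Codes D' P → ∀ {O F S O' F' S'}, D = pr O (pr F S) →
      D' = pr O' (pr F' S') → (∀ n A r, pr n (pr A r) ∈ₛ O → pr n (pr A r) ∈ₛ O') ∧
      (∀ q, q ∈ₛ F → q ∈ₛ F') ∧ ∀ n g, pr n g ∈ₛ S → pr n g ∈ₛ S' := by
    intro D D' h h' O F S O' F' S' e e'
    subst e e'
    obtain ⟨hD, hel, hlt, hact, hsupp⟩ := h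
    obtain ⟨hD', hel', hlt', hact', hsupp'⟩ := h'
    have i := isData_iff.1 hD
    have i' := isData_iff.1 hD'
    have hO : ∀ n A r, pr n (pr A r) ∈ₛ O → pr n (pr A r) ∈ₛ O' := by
      intro n A r hA
      have hn := (i.1.mem_iff.1 hA).1
      obtain ⟨A', r', hA', hr', -⟩ := hD'.exists_obj hn
      obtain ⟨A₁, r₁, hA₁, hr₁, hu⟩ := hD.exists_obj hn
      obtain ⟨rfl, rfl⟩ := hu _ _ hA
      have hu' := fun A'' r'' h => pr_inj.1 ((i'.1.2 n hn).unique (y₁ := pr A'' r'') h hA')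
      have e1 : A = A' := mext fun z => by
        have h1 := (hel n hn z).trans (hel' n hn z).symm
        rw [dat_el, dat_el] at h1
        constructor
        · intro hz
          obtain ⟨A'', r'', h2, h3⟩ := h1.1 ⟨_, _, hA, hz⟩
          exact (hu' _ _ h2).1 ▸ h3
        · intro hz
          obtain ⟨A'', r'', h2, h3⟩ := h1.2 ⟨_, _, hA', hz⟩
          exact (hu _ _ h2).1 ▸ h3
      have e2 : r = r' := hr₁.ext hr' fun x y => by
        have h1 := (hlt n hn x y).trans (hlt' n hn x y).symm
        rw [dat_lt, dat_lt] at h1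
        constructor
        · intro hz
          obtain ⟨A'', r'', h2, h3⟩ := h1.1 ⟨_, _, hA, hz⟩
          exact (hu' _ _ h2).2 ▸ h3
        · intro hz
          obtain ⟨A'', r'', h2, h3⟩ := h1.2 ⟨_, _, hA', hz⟩
          exact (hu _ _ h2).2 ▸ h3
      rw [e1, e2]; exact hA'
    refine ⟨hO, fun q hq => ?_, fun n g hg => ?_⟩
    · obtain ⟨m, n, f, g, hf, rfl⟩ := i.2.2.1 q hq
      obtain ⟨g', hg', hu'⟩ := i'.2.2.2.1 m n f hf
      have hu := i.2.2.2.1 m n f hf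
      obtain ⟨A, r, hA, -⟩ := hD.exists_obj hf.1
      obtain ⟨B, s, hB, -⟩ := hD.exists_obj hf.2.1
      have e : g = g' := (i.2.2.2.2.1 m n f g A r B s hq hA hB).1.ext_mem
          (i'.2.2.2.2.1 m n f g' A r B s hg' (hO _ _ _ hA) (hO _ _ _ hB)).1 fun x y => by
        have h1 := (hact m n f hf x y).trans (hact' m n f hf x y).symm
        rw [dat_act, dat_act] at h1
        constructor
        · intro hz
          obtain ⟨g'', h2, h3⟩ := h1.1 ⟨_, hq, hz⟩
          exact hu' _ h2 ▸ h3
        · intro hz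
          obtain ⟨g'', h2, h3⟩ := h1.2 ⟨_, hg', hz⟩
          exact hu.unique h2 hq ▸ h3
      rw [e]; exact hg'
    · have hn := (i.2.2.2.2.2.1.mem_iff.1 hg).1
      obtain ⟨g', hg', hu'⟩ := i'.2.2.2.2.2.1.2 n hn
      have hu := i.2.2.2.2.2.1.2 n hn
      obtain ⟨A, r, hA, -⟩ := hD.exists_obj hn
      have e : g = g' := (i.2.2.2.2.2.2 n g A r hg hA).1.ext_mem
          (i'.2.2.2.2.2.2 n g' A r hg' (hO _ _ _ hA)).1 fun x y => by
        have h1 := (hsupp n hn x y).trans (hsupp' n hn x y).symm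
        rw [dat_supp, dat_supp] at h1
        constructor
        · intro hz
          obtain ⟨g'', h2, h3⟩ := h1.1 ⟨_, hg, hz⟩
          exact hu' _ h2 ▸ h3
        · intro hz
          obtain ⟨g'', h2, h3⟩ := h1.2 ⟨_, hg', hz⟩
          exact hu.unique h2 hg ▸ h3
      rw [e]; exact hg'
  obtain ⟨O, F, S, e, -⟩ := id h.1
  obtain ⟨O', F', S', e', -⟩ := id h'.1
  obtain ⟨a1, a2, a3⟩ := key h h' e e'
  obtain ⟨b1, b2, b3⟩ := key h' h e' e
  have hD := h.1
  have hD' := h'.1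
  rw [e, isData_iff] at hD
  rw [e', isData_iff] at hD'
  rw [e, e']
  congr 1
  · refine hD.1.ext_mem hD'.1 fun x y => ⟨fun hz => ?_, fun hz => ?_⟩
    · obtain ⟨A, r, rfl, -⟩ := hD.2.1 _ _ hz
      exact a1 _ _ _ hz
    · obtain ⟨A, r, rfl, -⟩ := hD'.2.1 _ _ hz
      exact b1 _ _ _ hz
  · congr 1
    · exact mext fun z => ⟨a2 z, b2 z⟩
    · exact hD.2.2.2.2.2.1.ext_mem hD'.2.2.2.2.2.1 fun x y => ⟨a3 x y, b3 x y⟩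

theorem Codes.laws {D : M} {P : Data M} (h : Codes D P) (hP : P.Good) : (dat D).Laws := by
  obtain ⟨-, hel, hlt, hact, hsupp⟩ := h
  have hL := hP.laws
  refine ⟨?_, ?_, ?_, ?_, ?_, ?_, ?_, ?_, ?_⟩
  · intro n σ hn h
    exact hL.irrefl n σ hn ((hlt n hn _ _).1 h)
  · intro n σ τ ρ hn h h'
    exact (hlt n hn _ _).2 (hL.trans n σ τ ρ hn ((hlt n hn _ _).1 h) ((hlt n hn _ _).1 h'))
  · intro n σ τ hn h h'
    rw [hlt n hn, hlt n hn]
    exact hL.total n σ τ hn ((hel n hn _).1 h) ((hel n hn _).1 h')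
  · intro m n f σ τ σ' τ' hf h1 h2 h
    exact (hlt n hf.2.1 _ _).2 (hL.emb m n f σ τ σ' τ' hf ((hact m n f hf _ _).1 h1)
      ((hact m n f hf _ _).1 h2) ((hlt m hf.1 _ _).1 h))
  · intro n f σ hf hid h
    exact (hact n n f hf _ _).2 (hL.map_id n f σ hf hid ((hel n hf.1 _).1 h))
  · intro m n k f g h' σ τ ρ hf hg hh hc h1 h2
    exact (hact m k h' hh _ _).2 (hL.map_comp m n k f g h' σ τ ρ hf hg hh hc
      ((hact m n f hf _ _).1 h1) ((hact n k g hg _ _).1 h2))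
  · intro m n f g σ τ ρ hf hg hle h1 h2
    rw [hlt n hf.2.1]
    exact hL.monotone m n f g σ τ ρ hf hg hle ((hact m n f hf _ _).1 h1)
      ((hact m n g hg _ _).1 h2)
  · intro m n f σ τ a b hf h ha hb
    exact hL.supp_nat m n f σ τ a b hf ((hact m n f hf _ _).1 h) ((hsupp m hf.1 _ _).1 ha)
      ((hsupp n hf.2.1 _ _).1 hb)
  · intro m n f σ a hf ha h
    obtain ⟨τ, hτ⟩ := hL.supp_cond m n f σ a hf ((hsupp n hf.2.1 _ _).1 ha) h
    exact ⟨τ, (hact m n f hf _ _).2 hτ⟩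

theorem Codes.isPredilator {D : M} {P : Data M} (h : Codes D P) (hP : P.Good) : IsPredilator D :=
  ⟨h.1, h.laws hP⟩

end Coding
-- Being a predilator is primitive recursive
section PrimrecData
open Classical

variable {M : Type u} [prsLang.Structure M] [SetModel M]

theorem mem_tc_pr_left (x y : M) : x ∈ₛ tc (pr x y) := by
  obtain ⟨v, h1, h2⟩ := mem_sUn.1 (left_mem_sUn_pr x y)
  exact tc_trans h2 (subset_tc h1)

theorem mem_tc_pr_right (x y : M) : y ∈ₛ tc (pr x y) := by
  obtain ⟨v, h1, h2⟩ := mem_sUn.1 (right_mem_sUn_pr x y)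
  exact tc_trans h2 (subset_tc h1)

theorem dat_bounds (O F S : M) : O ∈ₛ tc (pr O (pr F S)) ∧ F ∈ₛ tc (pr O (pr F S)) ∧
    S ∈ₛ tc (pr O (pr F S)) :=
  ⟨mem_tc_pr_left _ _, left_mem_tc (mem_tc_pr_right _ _), right_mem_tc (mem_tc_pr_right _ _)⟩

theorem dat_el_mem {D n σ : M} (h : (dat D).el n σ) : σ ∈ₛ tc D := by
  obtain ⟨O, F, S, A, r, rfl, h1, h2⟩ := h
  exact tc_trans h2 (left_mem_tc (right_mem_tc (tc_trans h1 (dat_bounds O F S).1)))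

theorem dat_lt_mem {D n σ τ : M} (h : (dat D).lt n σ τ) : σ ∈ₛ tc D ∧ τ ∈ₛ tc D := by
  obtain ⟨O, F, S, A, r, rfl, h1, h2⟩ := h
  have := tc_trans h2 (right_mem_tc (right_mem_tc (tc_trans h1 (dat_bounds O F S).1)))
  exact ⟨left_mem_tc this, right_mem_tc this⟩

theorem dat_act_mem {D m n f σ τ : M} (h : (dat D).act m n f σ τ) : σ ∈ₛ tc D ∧ τ ∈ₛ tc D := by
  obtain ⟨O, F, S, g, rfl, h1, h2⟩ := h
  have := tc_trans h2 (right_mem_tc (tc_trans h1 (dat_bounds O F S).2.1))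
  exact ⟨left_mem_tc this, right_mem_tc this⟩

theorem dat_supp_mem {D n σ τ : M} (h : (dat D).supp n σ τ) : σ ∈ₛ tc D ∧ τ ∈ₛ tc D := by
  obtain ⟨O, F, S, g, rfl, h1, h2⟩ := h
  have := tc_trans h2 (right_mem_tc (tc_trans h1 (dat_bounds O F S).2.2))
  exact ⟨left_mem_tc this, right_mem_tc this⟩

/-- `D` is a triple. -/
def IsTriple (D : M) : Prop := D = pr (fst D) (pr (fst (snd D)) (snd (snd D)))

theorem isTriple_pr (O F S : M) : IsTriple (pr O (pr F S)) := by simp [IsTriple]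

section
variable {m : ℕ} (D n k f s t : (Fin m → M) → M) [PRf D] [PRf n] [PRf k] [PRf f] [PRf s] [PRf t]

instance PRp.isTriple : PRp (fun x => IsTriple (D x)) :=
  PRp.comp1 IsTriple (by unfold IsTriple; infer_instance) D

/-- The sets that witness the existential quantifiers occur in the transitive closure of `D`, and
the components of the triple are projections. The same holds for the other three relations. -/
instance PRp.dat_el : PRp (fun x => (dat (D x)).el (n x) (s x)) := by
  refine PRp.comp3 (fun D n s => (dat D).el n s) (PRp.of_iff
    (φ := fun x : Fin 3 → M => IsTriple (x 0) ∧ ∃ A, A ∈ₛ tc (x 0) ∧ ∃ r, r ∈ₛ tc (x 0) ∧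
      pr (x 1) (pr A r) ∈ₛ fst (x 0) ∧ x 2 ∈ₛ A) inferInstance fun x => ?_) D n s
  constructor
  · rintro ⟨O, F, S, A, r, e, h1, h2⟩
    have h3 := right_mem_tc (tc_trans h1 (dat_bounds O F S).1)
    rw [e, fst_pr]
    exact ⟨isTriple_pr _ _ _, A, left_mem_tc h3, r, right_mem_tc h3, h1, h2⟩
  · rintro ⟨e, A, -, r, -, h1, h2⟩
    exact ⟨_, _, _, A, r, e, h1, h2⟩

instance PRp.dat_lt : PRp (fun x => (dat (D x)).lt (n x) (s x) (t x)) := by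
  refine PRp.comp4 (fun D n s t => (dat D).lt n s t) (PRp.of_iff
    (φ := fun x : Fin 4 → M => IsTriple (x 0) ∧ ∃ A, A ∈ₛ tc (x 0) ∧ ∃ r, r ∈ₛ tc (x 0) ∧
      pr (x 1) (pr A r) ∈ₛ fst (x 0) ∧ pr (x 2) (x 3) ∈ₛ r) inferInstance fun x => ?_) D n s t
  constructor
  · rintro ⟨O, F, S, A, r, e, h1, h2⟩
    have h3 := right_mem_tc (tc_trans h1 (dat_bounds O F S).1)
    rw [e, fst_pr]
    exact ⟨isTriple_pr _ _ _, A, left_mem_tc h3, r, right_mem_tc h3, h1, h2⟩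
  · rintro ⟨e, A, -, r, -, h1, h2⟩
    exact ⟨_, _, _, A, r, e, h1, h2⟩

instance PRp.dat_act : PRp (fun x => (dat (D x)).act (n x) (k x) (f x) (s x) (t x)) := by
  refine PRp.comp6 (fun D n k f s t => (dat D).act n k f s t) (PRp.of_iff
    (φ := fun x : Fin 6 → M => IsTriple (x 0) ∧ ∃ g, g ∈ₛ tc (x 0) ∧
      pr (pr (x 1) (pr (x 2) (x 3))) g ∈ₛ fst (snd (x 0)) ∧ pr (x 4) (x 5) ∈ₛ g) inferInstance
      fun x => ?_) D n k f s t
  constructor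
  · rintro ⟨O, F, S, g, e, h1, h2⟩
    rw [e, snd_pr, fst_pr]
    exact ⟨isTriple_pr _ _ _, g, right_mem_tc (tc_trans h1 (dat_bounds O F S).2.1), h1, h2⟩
  · rintro ⟨e, g, -, h1, h2⟩
    exact ⟨_, _, _, g, e, h1, h2⟩

instance PRp.dat_supp : PRp (fun x => (dat (D x)).supp (n x) (s x) (t x)) := by
  refine PRp.comp4 (fun D n s t => (dat D).supp n s t) (PRp.of_iff
    (φ := fun x : Fin 4 → M => IsTriple (x 0) ∧ ∃ g, g ∈ₛ tc (x 0) ∧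
      pr (x 1) g ∈ₛ snd (snd (x 0)) ∧ pr (x 2) (x 3) ∈ₛ g) inferInstance
      fun x => ?_) D n s t
  constructor
  · rintro ⟨O, F, S, g, e, h1, h2⟩
    rw [e, snd_pr, snd_pr]
    exact ⟨isTriple_pr _ _ _, g, right_mem_tc (tc_trans h1 (dat_bounds O F S).2.2), h1, h2⟩
  · rintro ⟨e, g, -, h1, h2⟩
    exact ⟨_, _, _, g, e, h1, h2⟩

end

instance PRr.dat : PRr (M := M) PRST.dat := by
  constructor <;> infer_instance

/-- The laws of predilators and the conditions on the graphs of functions, with bounded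
quantifiers. -/
def Data.LawsOn (P : Data M) (C : M) : Prop :=
  (∀ n, n ∈ₛ om M → ∀ σ, σ ∈ₛ C → ¬ P.lt n σ σ) ∧
  (∀ n, n ∈ₛ om M → ∀ σ, σ ∈ₛ C → ∀ τ, τ ∈ₛ C → ∀ ρ, ρ ∈ₛ C →
    P.lt n σ τ → P.lt n τ ρ → P.lt n σ ρ) ∧
  (∀ n, n ∈ₛ om M → ∀ σ, σ ∈ₛ C → ∀ τ, τ ∈ₛ C → P.el n σ → P.el n τ →
    P.lt n σ τ ∨ σ = τ ∨ P.lt n τ σ) ∧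
  (∀ m, m ∈ₛ om M → ∀ n, n ∈ₛ om M → ∀ f, f ∈ₛ mors M → ∀ σ, σ ∈ₛ C → ∀ τ, τ ∈ₛ C →
    ∀ σ', σ' ∈ₛ C → ∀ τ', τ' ∈ₛ C → IsMor m n f → P.act m n f σ σ' → P.act m n f τ τ' →
    P.lt m σ τ → P.lt n σ' τ') ∧
  (∀ n, n ∈ₛ om M → ∀ f, f ∈ₛ mors M → ∀ σ, σ ∈ₛ C → IsMor n n f →
    (∀ i, i ∈ₛ n → pr i i ∈ₛ f) → P.el n σ → P.act n n f σ σ) ∧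
  (∀ m, m ∈ₛ om M → ∀ n, n ∈ₛ om M → ∀ k, k ∈ₛ om M → ∀ f, f ∈ₛ mors M → ∀ g, g ∈ₛ mors M →
    ∀ h, h ∈ₛ mors M → ∀ σ, σ ∈ₛ C → ∀ τ, τ ∈ₛ C → ∀ ρ, ρ ∈ₛ C →
    IsMor m n f → IsMor n k g → IsMor m k h → (∀ i, i ∈ₛ m → ∀ j, j ∈ₛ n → ∀ l, l ∈ₛ k →
      pr i j ∈ₛ f → pr j l ∈ₛ g → pr i l ∈ₛ h) →
    P.act m n f σ τ → P.act n k g τ ρ → P.act m k h σ ρ) ∧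
  (∀ m, m ∈ₛ om M → ∀ n, n ∈ₛ om M → ∀ f, f ∈ₛ mors M → ∀ g, g ∈ₛ mors M →
    ∀ σ, σ ∈ₛ C → ∀ τ, τ ∈ₛ C → ∀ ρ, ρ ∈ₛ C → IsMor m n f → IsMor m n g →
    (∀ i, i ∈ₛ m → ∀ x, x ∈ₛ n → ∀ y, y ∈ₛ n → pr i x ∈ₛ f → pr i y ∈ₛ g → x ∈ₛ y ∨ x = y) →
    P.act m n f σ τ → P.act m n g σ ρ → P.lt n τ ρ ∨ τ = ρ) ∧
  (∀ m, m ∈ₛ om M → ∀ n, n ∈ₛ om M → ∀ f, f ∈ₛ mors M → ∀ σ, σ ∈ₛ C → ∀ τ, τ ∈ₛ C →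
    ∀ a, a ∈ₛ C → ∀ b, b ∈ₛ C → IsMor m n f → P.act m n f σ τ → P.supp m σ a → P.supp n τ b →
    -- The equivalence in the naturality of supports is split into two implications, so that `y` is
    -- bounded by `b` in one of them and by `n` in the other.
    (∀ y, y ∈ₛ b → ∃ x, x ∈ₛ a ∧ pr x y ∈ₛ f) ∧
      ∀ y, y ∈ₛ n → (∃ x, x ∈ₛ a ∧ pr x y ∈ₛ f) → y ∈ₛ b) ∧
  (∀ m, m ∈ₛ om M → ∀ n, n ∈ₛ om M → ∀ f, f ∈ₛ mors M → ∀ σ, σ ∈ₛ C → ∀ a, a ∈ₛ C →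
    IsMor m n f → P.supp n σ a → (∀ y, y ∈ₛ a → ∃ x, x ∈ₛ m ∧ pr x y ∈ₛ f) →
    ∃ τ, τ ∈ₛ C ∧ P.act m n f τ σ)

set_option synthInstance.maxHeartbeats 400000 in
set_option synthInstance.maxSize 4096 in
instance PRp.lawsOn {m : ℕ} (D C : (Fin m → M) → M) [PRf D] [PRf C] :
    PRp (fun x => (PRST.dat (D x)).LawsOn (C x)) :=
  PRp.comp2 (fun D C => (PRST.dat D).LawsOn C) (by unfold Data.LawsOn; infer_instance) D C

/-- Elements, values and supports that satisfy the relations of `D` lie in `tc D`, and morphisms lie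
in `mors M`. Hence bounding the quantifiers loses nothing. -/
theorem laws_iff_lawsOn {D : M} : (dat D).Laws ↔ (dat D).LawsOn (tc D) := by
  have ha : ∀ {m n f σ τ}, (dat D).act m n f σ τ → σ ∈ₛ tc D ∧ τ ∈ₛ tc D := dat_act_mem
  have hl : ∀ {n σ τ}, (dat D).lt n σ τ → σ ∈ₛ tc D ∧ τ ∈ₛ tc D := dat_lt_mem
  have hs : ∀ {n σ τ}, (dat D).supp n σ τ → σ ∈ₛ tc D ∧ τ ∈ₛ tc D := dat_supp_mem
  have he : ∀ {n σ}, (dat D).el n σ → σ ∈ₛ tc D := dat_el_mem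
  generalize dat D = P at *
  generalize tc D = C at *
  constructor
  · intro h
    refine ⟨?_, ?_, ?_, ?_, ?_, ?_, ?_, ?_, ?_⟩
    · exact fun n hn σ _ => h.irrefl n σ hn
    · exact fun n hn σ _ τ _ ρ _ => h.trans n σ τ ρ hn
    · exact fun n hn σ _ τ _ => h.total n σ τ hn
    · exact fun m _ n _ f _ σ _ τ _ σ' _ τ' _ => h.emb m n f σ τ σ' τ'
    · exact fun n _ f _ σ _ => h.map_id n f σ
    · exact fun m _ n _ k _ f _ g _ h' _ σ _ τ _ ρ _ hf hg hh hc =>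
        h.map_comp m n k f g h' σ τ ρ hf hg hh fun i j l hij hjl =>
          hc i (hf.inc.mem_iff.1 hij).1 j (hf.2.2.1.2 _ _ hij) l (hg.2.2.1.2 _ _ hjl) hij hjl
    · exact fun m _ n _ f _ g _ σ _ τ _ ρ _ hf hg hc =>
        h.monotone m n f g σ τ ρ hf hg fun i x y hx hy =>
          hc i (hf.inc.mem_iff.1 hx).1 x (hf.2.2.1.2 _ _ hx) y (hg.2.2.1.2 _ _ hy) hx hy
    · intro m _ n _ f _ σ _ τ _ a _ b _ hf h1 h2 h3
      have := h.supp_nat m n f σ τ a b hf h1 h2 h3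
      exact ⟨fun y hy => (this y).1 hy, fun y _ hy => (this y).2 hy⟩
    · intro m _ n _ f _ σ _ a _ hf h1 h2
      obtain ⟨τ, hτ⟩ := h.supp_cond m n f σ a hf h1 fun y hy => by
        obtain ⟨x, -, hx⟩ := h2 y hy
        exact ⟨x, hx⟩
      exact ⟨τ, (ha hτ).1, hτ⟩
  · rintro ⟨h1, h2, h3, h4, h5, h6, h7, h8, h9⟩
    refine ⟨?_, ?_, ?_, ?_, ?_, ?_, ?_, ?_, ?_⟩
    · exact fun n σ hn h => h1 n hn σ (hl h).1 h
    · exact fun n σ τ ρ hn h h' => h2 n hn σ (hl h).1 τ (hl h).2 ρ (hl h').2 h h'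
    · exact fun n σ τ hn h h' => h3 n hn σ (he h) τ (he h') h h'
    · exact fun m n f σ τ σ' τ' hf a1 a2 h => h4 m hf.1 n hf.2.1 f hf.mem_mors σ (ha a1).1 τ
        (ha a2).1 σ' (ha a1).2 τ' (ha a2).2 hf a1 a2 h
    · exact fun n f σ hf hc h => h5 n hf.1 f hf.mem_mors σ (he h) hf (fun i hi => hc i hi) h
    · exact fun m n k f g h σ τ ρ hf hg hh hc a1 a2 => h6 m hf.1 n hf.2.1 k hg.2.1 f hf.mem_mors
        g hg.mem_mors h hh.mem_mors σ (ha a1).1 τ (ha a1).2 ρ (ha a2).2 hf hg hh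
        (fun i _ j _ l _ => hc i j l) a1 a2
    · exact fun m n f g σ τ ρ hf hg hc a1 a2 => h7 m hf.1 n hf.2.1 f hf.mem_mors
        g hg.mem_mors σ (ha a1).1 τ (ha a1).2 ρ (ha a2).2 hf hg
        (fun i _ x _ y _ => hc i x y) a1 a2
    · intro m n f σ τ a b hf a1 s1 s2 y
      obtain ⟨c1, c2⟩ := h8 m hf.1 n hf.2.1 f hf.mem_mors σ (ha a1).1 τ (ha a1).2 a (hs s1).2 b
        (hs s2).2 hf a1 s1 s2
      exact ⟨c1 y, fun ⟨x, hx, hxy⟩ => c2 y (hf.2.2.1.2 _ _ hxy) ⟨x, hx, hxy⟩⟩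
    · intro m n f σ a hf s1 hc
      obtain ⟨τ, -, hτ⟩ := h9 m hf.1 n hf.2.1 f hf.mem_mors σ (hs s1).1 a (hs s1).2 hf s1
        fun y hy => by
          obtain ⟨x, hx⟩ := hc y hy
          exact ⟨x, (hf.inc.mem_iff.1 hx).1, hx⟩
      exact ⟨τ, hτ⟩

/-- The conditions on graphs in `Data.Good`, with bounded quantifiers. -/
def Data.GraphsOn (P : Data M) (C : M) : Prop :=
  (∀ n, n ∈ₛ om M → ∀ σ, σ ∈ₛ C → ∀ τ, τ ∈ₛ C → P.lt n σ τ → P.el n σ ∧ P.el n τ) ∧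
  (∀ m, m ∈ₛ om M → ∀ n, n ∈ₛ om M → ∀ f, f ∈ₛ mors M → IsMor m n f → ∀ σ, σ ∈ₛ C →
    (∀ τ, τ ∈ₛ C → P.act m n f σ τ → P.el m σ ∧ P.el n τ) ∧
    (P.el m σ → ∃ τ, τ ∈ₛ C ∧ P.act m n f σ τ) ∧
    ∀ τ, τ ∈ₛ C → ∀ ρ, ρ ∈ₛ C → P.act m n f σ τ → P.act m n f σ ρ → τ = ρ) ∧
  ∀ n, n ∈ₛ om M → ∀ σ, σ ∈ₛ C →
    (∀ a, a ∈ₛ C → P.supp n σ a → P.el n σ ∧ ∀ i, i ∈ₛ a → i ∈ₛ n) ∧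
    (P.el n σ → ∃ a, a ∈ₛ C ∧ P.supp n σ a) ∧
    ∀ a, a ∈ₛ C → ∀ b, b ∈ₛ C → P.supp n σ a → P.supp n σ b → a = b

set_option synthInstance.maxHeartbeats 400000 in
set_option synthInstance.maxSize 4096 in
instance PRp.graphsOn {m : ℕ} (D C : (Fin m → M) → M) [PRf D] [PRf C] :
    PRp (fun x => (PRST.dat (D x)).GraphsOn (C x)) :=
  PRp.comp2 (fun D C => (PRST.dat D).GraphsOn C) (by unfold Data.GraphsOn; infer_instance) D C

theorem good_iff {D : M} :
    (dat D).Good ↔ (dat D).LawsOn (tc D) ∧ (dat D).GraphsOn (tc D) := by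
  rw [← laws_iff_lawsOn]
  have ha : ∀ {m n f σ τ}, (dat D).act m n f σ τ → σ ∈ₛ tc D ∧ τ ∈ₛ tc D := dat_act_mem
  have hl : ∀ {n σ τ}, (dat D).lt n σ τ → σ ∈ₛ tc D ∧ τ ∈ₛ tc D := dat_lt_mem
  have hs : ∀ {n σ τ}, (dat D).supp n σ τ → σ ∈ₛ tc D ∧ τ ∈ₛ tc D := dat_supp_mem
  have he : ∀ {n σ}, (dat D).el n σ → σ ∈ₛ tc D := dat_el_mem
  generalize dat D = P at *
  generalize tc D = C at *
  constructor
  · intro h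
    refine ⟨h.laws, ?_, ?_, ?_⟩
    · exact fun n hn σ _ τ _ h' => h.lt_el hn h'
    · intro m _ n _ f _ hf σ _
      refine ⟨fun τ _ h' => h.act_el hf h', fun h' => ?_, fun τ _ ρ _ => h.act_fun hf⟩
      obtain ⟨τ, hτ⟩ := h.act_ex hf h'
      exact ⟨τ, (ha hτ).2, hτ⟩
    · intro n hn σ _
      refine ⟨fun a _ h' => ⟨h.supp_el hn h', fun i => h.supp_sub hn h'⟩, fun h' => ?_,
        fun a _ b _ => h.supp_fun hn⟩
      obtain ⟨a, h1⟩ := h.supp_ex hn h'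
      exact ⟨a, (hs h1).2, h1⟩
  · rintro ⟨h0, h1, h2, h3⟩
    refine ⟨h0, ?_, ?_, ?_, ?_, ?_, ?_, ?_, ?_⟩
    · exact fun {n σ τ} hn h => h1 n hn σ (hl h).1 τ (hl h).2 h
    · exact fun {m n f σ τ} hf h =>
        (h2 m hf.1 n hf.2.1 f hf.mem_mors hf σ (ha h).1).1 τ (ha h).2 h
    · intro m n f σ hf h
      obtain ⟨τ, -, hτ⟩ := (h2 m hf.1 n hf.2.1 f hf.mem_mors hf σ (he h)).2.1 h
      exact ⟨τ, hτ⟩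
    · exact fun {m n f σ τ ρ} hf h h' => (h2 m hf.1 n hf.2.1 f hf.mem_mors hf σ (ha h).1).2.2
        τ (ha h).2 ρ (ha h').2 h h'
    · exact fun {n σ a} hn h => ((h3 n hn σ (hs h).1).1 a (hs h).2 h).1
    · intro n σ hn h
      obtain ⟨a, -, h'⟩ := (h3 n hn σ (he h)).2.1 h
      exact ⟨a, h'⟩
    · exact fun {n σ a b} hn h h' => (h3 n hn σ (hs h).1).2.2 a (hs h).2 b (hs h').2 h h'
    · exact fun {n σ a i} hn h hi => ((h3 n hn σ (hs h).1).1 a (hs h).2 h).2 i hi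

/-- The clauses on the triple in `IsData` have unbounded quantifiers. By uniqueness of codes they
can be replaced by the equation that `D` is the code computed from its own relations, which is a
primitive recursive condition. -/
theorem isPredilator_iff {D : M} : IsPredilator D ↔ D = code (tc D) (dat D) ∧ (dat D).Good := by
  have key : (dat D).Good → Codes (code (tc D) (dat D)) (dat D) := fun h =>
    codes_code (P := dat) h (fun _ _ _ h => dat_el_mem h)
  constructor
  · exact fun h => ⟨Codes.unique ⟨h.1, fun _ _ _ => Iff.rfl, fun _ _ _ _ => Iff.rfl,
      fun _ _ _ _ _ _ => Iff.rfl, fun _ _ _ _ => Iff.rfl⟩ (key h.good), h.good⟩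
  · rintro ⟨e, h⟩
    rw [e]; exact (key h).isPredilator h

instance PRp.isPredilator {m : ℕ} (D : (Fin m → M) → M) [PRf D] :
    PRp (fun x => IsPredilator (D x)) := by
  refine PRp.comp1 IsPredilator ?_ D
  simp only [isPredilator_iff, good_iff]
  have := PRf.code (P := dat) (fun x : Fin 1 → M => tc (x 0)) (fun x => x 0)
  infer_instance

/-! ### Primitive recursive families of predilators -/

/-- A primitive recursive family of predilators, with elements in the sets `B p`. -/
class PRd (P : M → Data M) (B : outParam (M → M)) : Prop extends PRr P where
  good : ∀ p, (P p).Good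
  bd : ∀ {p n σ}, n ∈ₛ om M → (P p).el n σ → σ ∈ₛ B p
  prb : PRf (fun x : Fin 1 → M => B (x 0))

theorem Data.good_nil : (Data.mk (M := M) (fun _ _ => False) (fun _ _ _ => False)
    (fun _ _ _ _ _ => False) (fun _ _ _ => False)).Good := by
  refine ⟨⟨?_, ?_, ?_, ?_, ?_, ?_, ?_, ?_, ?_⟩, ?_, ?_, ?_, ?_, ?_, ?_, ?_, ?_⟩ <;>
  simp

/-- The relations given by `D` if it is a predilator, and the empty predilator otherwise. -/
def gd (D : M) : Data M where
  el n σ := IsPredilator D ∧ (dat D).el n σ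
  lt n σ τ := IsPredilator D ∧ (dat D).lt n σ τ
  act m n f σ τ := IsPredilator D ∧ (dat D).act m n f σ τ
  supp n σ a := IsPredilator D ∧ (dat D).supp n σ a

theorem gd_eq {D : M} (hD : IsPredilator D) : gd D = dat D := by
  simp [gd, hD]

instance PRd.gd : PRd (M := M) PRST.gd tc where
  el := by unfold PRST.gd; infer_instance
  lt := by unfold PRST.gd; infer_instance
  act := by unfold PRST.gd; infer_instance
  supp := by unfold PRST.gd; infer_instance
  good D := by
    by_cases h : IsPredilator D
    · rw [gd_eq h]; exact h.good
    · have := Data.good_nil (M := M)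
      simpa [PRST.gd, h] using this
  bd _ h := dat_el_mem h.2
  prb := inferInstance

theorem PRd.comp {P : M → Data M} {B : M → M} (hP : PRd P B) (h : M → M)
    (hh : PRf (fun x : Fin 1 → M => h (x 0))) : PRd (fun p => P (h p)) (fun p => B (h p)) where
  el := by have := PRf.comp1 h hh (fun x : Fin 3 → M => x 0); infer_instance
  lt := by have := PRf.comp1 h hh (fun x : Fin 4 → M => x 0); infer_instance
  act := by have := PRf.comp1 h hh (fun x : Fin 6 → M => x 0); infer_instance
  supp := by have := PRf.comp1 h hh (fun x : Fin 4 → M => x 0); infer_instance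
  good p := hP.good _
  bd hn h := hP.bd hn h
  prb := PRf.comp1 B hP.prb (fun x : Fin 1 → M => h (x 0))

end PrimrecData
-- Components, truncated sums and separation as primitive recursive families
section PrimrecFamilies
open Classical

variable {M : Type u} [prsLang.Structure M] [SetModel M]

instance PRf.mors {m : ℕ} : PRf (fun _ : Fin m → M => mors M) := inferInstance

/-- For natural numbers the sum `N` is the value `add n k`. Embeddings are bounded by `mors M`, and
the values of the action are bounded by `C`. -/
theorem LL_iff_bounded {P : Data M} (hP : P.Good) {C σ n τ k : M} (hn : n ∈ₛ om M)
    (hk : k ∈ₛ om M) (hC : ∀ n σ, n ∈ₛ om M → P.el n σ → σ ∈ₛ C) : P.LL σ n τ k ↔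
    ∀ f, f ∈ₛ mors M → ∀ g, g ∈ₛ mors M → ∀ σ', σ' ∈ₛ C → ∀ τ', τ' ∈ₛ C →
      IsMor n (add n k) f ∧ P.act n (add n k) f σ σ' →
      IsMor k (add n k) g ∧ P.act k (add n k) g τ τ' →
      add n k ∈ₛ om M ∧ P.lt (add n k) σ' τ' := by
  constructor
  · rintro ⟨N, hN, h⟩ f - g - σ' - τ' - h1 h2
    obtain ⟨-, rfl⟩ := (isAdd_iff hk).1 hN
    exact ⟨h1.1.2.1, h f g σ' τ' h1.1 h2.1 h1.2 h2.2⟩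
  · intro h
    refine ⟨_, isAdd_add (isOrd_of_mem_om hn) hk, fun f g σ' τ' hf hg h1 h2 => ?_⟩
    exact (h f hf.mem_mors g hg.mem_mors σ' (hC _ _ hf.2.1 (hP.act_el hf h1).2) τ'
      (hC _ _ hf.2.1 (hP.act_el hg h2).2) ⟨hf, h1⟩ ⟨hg, h2⟩).2

theorem Imp_iff_bounded {P : Data M} (hP : P.Good) {C σ n i : M} (hn : n ∈ₛ om M)
    (hC : ∀ n σ, n ∈ₛ om M → P.el n σ → σ ∈ₛ C) : P.Imp σ n i ↔ i ∈ₛ n ∧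
    ∀ f, f ∈ₛ mors M → ∀ g, g ∈ₛ mors M → ∀ σ', σ' ∈ₛ C → ∀ τ', τ' ∈ₛ C →
      app f i ∈ₛ app g i → IsMor n (add n n) f ∧ P.act n (add n n) f σ σ' →
      IsMor n (add n n) g ∧ P.act n (add n n) g σ τ' →
      add n n ∈ₛ om M ∧ P.lt (add n n) σ' τ' := by
  refine and_congr_right fun hi => ?_
  constructor
  · rintro ⟨N, hN, h⟩ f - g - σ' - τ' - hlt h1 h2
    obtain ⟨-, rfl⟩ := (isAdd_iff hn).1 hN
    exact ⟨h1.1.2.1, h f g _ _ σ' τ' h1.1 h2.1 (h1.1.inc.mem_iff.2 ⟨hi, rfl⟩)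
      (h2.1.inc.mem_iff.2 ⟨hi, rfl⟩) hlt h1.2 h2.2⟩
  · intro h
    refine ⟨_, isAdd_add (isOrd_of_mem_om hn) hn, fun f g x y σ' τ' hf hg hx hy hxy h1 h2 => ?_⟩
    obtain ⟨-, rfl⟩ := hf.inc.mem_iff.1 hx
    obtain ⟨-, rfl⟩ := hg.inc.mem_iff.1 hy
    exact (h f hf.mem_mors g hg.mem_mors σ' (hC _ _ hf.2.1 (hP.act_el hf h1).2) τ'
      (hC _ _ hf.2.1 (hP.act_el hg h2).2) hxy ⟨hf, h1⟩ ⟨hg, h2⟩).2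

/-- `Data.Lt` for `x = (n, (σ, e))` and `y = (k, (τ, e'))` -/
def Data.LtP (P : Data M) (A : M) (lt : M → M → Prop) (x y : M) : Prop :=
  P.Lt A lt (fst x) (fst (snd x)) (snd (snd x)) (fst y) (fst (snd y)) (snd (snd y))

section
variable {P : M → Data M} {B : M → M} [hP : PRd P B] {m : ℕ}
  (p α β n k s t i A x y : (Fin m → M) → M) [PRf p] [PRf α] [PRf β] [PRf n] [PRf k]
  [PRf s] [PRf t] [PRf i] [PRf A] [PRf x] [PRf y]

include hP in
theorem PRd.bound : PRf (fun x => B (p x)) := PRf.comp1 B hP.prb p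

instance PRp.tr : PRp (fun x => (P (p x)).Tr (s x) (n x)) :=
  (inferInstance : PRp (fun x => (n x ∈ₛ om M ∧ (P (p x)).el (n x) (s x)) ∧
    (n x ∈ₛ om M ∧ (P (p x)).supp (n x) (s x) (n x)))).of_iff fun x => by
      unfold Data.Tr; tauto

/-- The trace conditions ensure that `n` and `k` are natural numbers, which the bounded form of `≪`
requires. -/
instance PRp.ll : PRp (fun x => ((P (p x)).Tr (s x) (n x) ∧ (P (p x)).Tr (t x) (k x)) ∧
    (P (p x)).LL (s x) (n x) (t x) (k x)) := by
  refine PRp.comp5 (fun p s n t k => ((P p).Tr s n ∧ (P p).Tr t k) ∧ (P p).LL s n t k) ?_ p s n t k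
  have hB : ∀ {m} (b : (Fin m → M) → M) [PRf b], PRf (fun x => B (b x)) :=
    fun b _ => PRd.bound (P := P) b
  refine PRp.of_iff (φ := fun x : Fin 5 → M => ((P (x 0)).Tr (x 1) (x 2) ∧
    (P (x 0)).Tr (x 3) (x 4)) ∧ ∀ f, f ∈ₛ PRST.mors M → ∀ g, g ∈ₛ PRST.mors M → ∀ σ', σ' ∈ₛ B (x 0) →
      ∀ τ', τ' ∈ₛ B (x 0) →
      IsMor (x 2) (add (x 2) (x 4)) f ∧ (P (x 0)).act (x 2) (add (x 2) (x 4)) f (x 1) σ' →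
      IsMor (x 4) (add (x 2) (x 4)) g ∧ (P (x 0)).act (x 4) (add (x 2) (x 4)) g (x 3) τ' →
      add (x 2) (x 4) ∈ₛ om M ∧ (P (x 0)).lt (add (x 2) (x 4)) σ' τ') inferInstance fun x => ?_
  exact and_congr_right fun h => LL_iff_bounded (hP.good _) h.1.1 h.2.1 fun _ _ => hP.bd

instance PRp.eqvTr : PRp (fun x => ((P (p x)).Tr (s x) (n x) ∧ (P (p x)).Tr (t x) (k x)) ∧
    (P (p x)).Eqv (s x) (n x) (t x) (k x)) := by
  have h : PRp (fun x => ((P (p x)).Tr (s x) (n x) ∧ (P (p x)).Tr (t x) (k x)) ∧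
    ¬ (((P (p x)).Tr (s x) (n x) ∧ (P (p x)).Tr (t x) (k x)) ∧
      (P (p x)).LL (s x) (n x) (t x) (k x)) ∧
    ¬ (((P (p x)).Tr (t x) (k x) ∧ (P (p x)).Tr (s x) (n x)) ∧
      (P (p x)).LL (t x) (k x) (s x) (n x))) := inferInstance
  exact h.of_iff fun x => by unfold Data.Eqv; tauto

instance PRp.comp : PRp (fun x => (P (p x)).Comp (α x)) := by
  refine PRp.comp2 (fun p α => (P p).Comp α) ?_ p α
  have hB : ∀ {m} (b : (Fin m → M) → M) [PRf b], PRf (fun x => B (b x)) :=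
    fun b _ => PRd.bound (P := P) b
  refine PRp.of_iff (φ := fun x : Fin 2 → M => ∃ σ, σ ∈ₛ B (x 0) ∧ ∃ n, n ∈ₛ om M ∧
    (P (x 0)).Tr σ n ∧
    (∀ q, q ∈ₛ x 1 → ∃ τ, τ ∈ₛ B (x 0) ∧ ∃ k, k ∈ₛ om M ∧ q = pr τ k ∧
      (((P (x 0)).Tr σ n ∧ (P (x 0)).Tr τ k) ∧ (P (x 0)).Eqv σ n τ k)) ∧
    ∀ τ, τ ∈ₛ B (x 0) → ∀ k, k ∈ₛ om M →
      ((P (x 0)).Tr σ n ∧ (P (x 0)).Tr τ k) ∧ (P (x 0)).Eqv σ n τ k → pr τ k ∈ₛ x 1)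
      inferInstance fun x => ?_
  constructor
  · rintro ⟨σ, n, h, h'⟩
    refine ⟨σ, hP.bd h.1 h.2.1, n, h.1, h, fun q hq => ?_, fun τ _ k _ hk => ?_⟩
    · obtain ⟨τ, k, rfl, h1, h2⟩ := (h' q).1 hq
      exact ⟨τ, hP.bd h1.1 h1.2.1, k, h1.1, rfl, ⟨h, h1⟩, h2⟩
    · exact (h' _).2 ⟨τ, k, rfl, hk.1.2, hk.2⟩
  · rintro ⟨σ, -, n, -, h, h1, h2⟩
    refine ⟨σ, n, h, fun q => ⟨fun hq => ?_, ?_⟩⟩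
    · obtain ⟨τ, -, k, -, rfl, h3⟩ := h1 q hq
      exact ⟨τ, k, rfl, h3.1.2, h3.2⟩
    · rintro ⟨τ, k, rfl, h3, h4⟩
      exact h2 τ (hP.bd h3.1 h3.2.1) k h3.1 ⟨⟨h, h3⟩, h4⟩

instance PRp.compLt : PRp (fun x => (P (p x)).CompLt (α x) (β x)) := by
  refine PRp.comp3 (fun p α β => (P p).CompLt α β) ?_ p α β
  have hB : ∀ {m} (b : (Fin m → M) → M) [PRf b], PRf (fun x => B (b x)) :=
    fun b _ => PRd.bound (P := P) b
  refine PRp.of_iff (φ := fun x : Fin 3 → M => (P (x 0)).Comp (x 1) ∧ (P (x 0)).Comp (x 2) ∧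
    ∃ σ, σ ∈ₛ B (x 0) ∧ ∃ n, n ∈ₛ om M ∧ ∃ τ, τ ∈ₛ B (x 0) ∧ ∃ k, k ∈ₛ om M ∧
      pr σ n ∈ₛ x 1 ∧ pr τ k ∈ₛ x 2 ∧
      (((P (x 0)).Tr σ n ∧ (P (x 0)).Tr τ k) ∧ (P (x 0)).LL σ n τ k)) inferInstance fun x => ?_
  refine and_congr_right fun h => and_congr_right fun h' => ?_
  constructor
  · rintro ⟨σ, n, τ, k, h1, h2, h3⟩
    have t1 := ((hP.good _).comp_spec h h1).1
    have t2 := ((hP.good _).comp_spec h' h2).1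
    exact ⟨σ, hP.bd t1.1 t1.2.1, n, t1.1, τ, hP.bd t2.1 t2.2.1, k, t2.1, h1, h2, ⟨t1, t2⟩, h3⟩
  · rintro ⟨σ, -, n, -, τ, -, k, -, h1, h2, -, h3⟩
    exact ⟨σ, n, τ, k, h1, h2, h3⟩

instance PRp.subEl : PRp (fun x => n x ∈ₛ om M ∧ (P (p x)).subEl (α x) (n x) (s x)) := by
  refine PRp.comp4 (fun p α n s => n ∈ₛ om M ∧ (P p).subEl α n s) ?_ p α n s
  have hB : ∀ {m} (b : (Fin m → M) → M) [PRf b], PRf (fun x => B (b x)) :=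
    fun b _ => PRd.bound (P := P) b
  refine PRp.of_iff (φ := fun x : Fin 4 → M => x 2 ∈ₛ om M ∧ ∃ σ, σ ∈ₛ B (x 0) ∧ ∃ k, k ∈ₛ om M ∧
    ∃ e, e ∈ₛ PRST.mors M ∧ (IsMor k (x 2) e ∧ (P (x 0)).act k (x 2) e σ (x 3)) ∧
      (P (x 0)).Tr σ k ∧ pr σ k ∈ₛ x 1) inferInstance fun x => ?_
  refine and_congr_right fun hn => ?_
  rw [(hP.good _).subEl_iff hn]
  constructor
  · rintro ⟨-, σ, k, e, h, hα⟩
    exact ⟨σ, hP.bd h.1.1 h.2.1.2.1, k, h.1.1, e, h.1.mem_mors,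
      ⟨h.1, ((hP.good _).act_iff h.1 h.2.1.2.1).2 h.2.2.symm⟩, h.2.1, hα⟩
  · rintro ⟨σ, -, k, -, e, -, ⟨h1, h2⟩, h3, hα⟩
    exact ⟨((hP.good _).act_el h1 h2).2, σ, k, e,
      ⟨h1, h3, (((hP.good _).act_iff h1 h3.2.1).1 h2).symm⟩, hα⟩

instance PRp.impTr : PRp (fun x => (P (p x)).Tr (s x) (n x) ∧ (P (p x)).Imp (s x) (n x) (i x)) := by
  refine PRp.comp4 (fun p s n i => (P p).Tr s n ∧ (P p).Imp s n i) ?_ p s n i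
  have hB : ∀ {m} (b : (Fin m → M) → M) [PRf b], PRf (fun x => B (b x)) :=
    fun b _ => PRd.bound (P := P) b
  refine PRp.of_iff (φ := fun x : Fin 4 → M => (P (x 0)).Tr (x 1) (x 2) ∧ x 3 ∈ₛ x 2 ∧
    ∀ f, f ∈ₛ PRST.mors M → ∀ g, g ∈ₛ PRST.mors M → ∀ σ', σ' ∈ₛ B (x 0) → ∀ τ', τ' ∈ₛ B (x 0) →
      app f (x 3) ∈ₛ app g (x 3) →
      IsMor (x 2) (add (x 2) (x 2)) f ∧ (P (x 0)).act (x 2) (add (x 2) (x 2)) f (x 1) σ' →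
      IsMor (x 2) (add (x 2) (x 2)) g ∧ (P (x 0)).act (x 2) (add (x 2) (x 2)) g (x 1) τ' →
      add (x 2) (x 2) ∈ₛ om M ∧ (P (x 0)).lt (add (x 2) (x 2)) σ' τ') inferInstance fun x => ?_
  exact and_congr_right fun h => Imp_iff_bounded (hP.good _) h.1 fun _ _ => hP.bd

instance PRp.sepRep : PRp (fun x => (P (p x)).SepRep (α x) (n x) (s x) (k x) (t x)) := by
  refine PRp.comp6 (fun p α n s k t => (P p).SepRep α n s k t) ?_ p α n s k t
  have h : PRp (fun x : Fin 6 → M => Inc (add (x 1) (x 2)) Mem (x 4) (x 5) ∧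
    (P (x 0)).Tr (x 3) (x 4) ∧ ∃ i, i ∈ₛ x 4 ∧
      ((P (x 0)).Tr (x 3) (x 4) ∧ (P (x 0)).Imp (x 3) (x 4) i) ∧ app (x 5) i ∈ₛ x 1 ∧
      ∀ j, j ∈ₛ x 4 → app (x 5) j ∈ₛ x 1 → j ∈ₛ i ∨ j = i) := inferInstance
  refine h.of_iff fun x => and_congr_right fun _ => and_congr_right fun ht => exists_congr fun i => ?_
  constructor
  · exact fun h => ⟨h.1.1, ⟨ht, h.1⟩, h.2⟩
  · exact fun h => ⟨h.2.1.2, h.2.2⟩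

instance PRp.ltP {lt : M → M → Prop} [hlt : PRp (fun x : Fin 2 → M => lt (x 0) (x 1))] :
    PRp (fun z => (P (p z)).LtP (A z) lt (x z) (y z)) := by
  refine PRp.comp4 (fun p A x y => (P p).LtP A lt x y) ?_ p A x y
  have hB : ∀ {m} (b : (Fin m → M) → M) [PRf b], PRf (fun x => B (b x)) :=
    fun b _ => PRd.bound (P := P) b
  have h : PRp (fun z : Fin 4 → M => ∃ N, N ∈ₛ om M ∧ ∃ h, h ∈ₛ fin (prod (om M) (z 1)) ∧
    ∃ f, f ∈ₛ PRST.mors M ∧ ∃ g, g ∈ₛ PRST.mors M ∧ ∃ σ', σ' ∈ₛ B (z 0) ∧ ∃ τ', τ' ∈ₛ B (z 0) ∧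
      Inc (z 1) lt N h ∧
      (∀ i, i ∈ₛ fst (z 2) → app h (app f i) = app (snd (snd (z 2))) i) ∧
      (∀ i, i ∈ₛ fst (z 3) → app h (app g i) = app (snd (snd (z 3))) i) ∧
      (IsMor (fst (z 2)) N f ∧ (P (z 0)).act (fst (z 2)) N f (fst (snd (z 2))) σ') ∧
      (IsMor (fst (z 3)) N g ∧ (P (z 0)).act (fst (z 3)) N g (fst (snd (z 3))) τ') ∧
      (N ∈ₛ om M ∧ (P (z 0)).lt N σ' τ')) := inferInstance
  refine h.of_iff fun z => ?_
  constructor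
  · rintro ⟨N, h, f, g, σ', τ', h1, h2, h3, h4, h5, h6, h7, h8⟩
    exact ⟨N, h1.1, h, h1.mem_fin, f, h2.mem_mors, g, h3.mem_mors,
      σ', hP.bd h1.1 ((hP.good _).act_el h2 h6).2, τ', hP.bd h1.1 ((hP.good _).act_el h3 h7).2,
      h1, h4, h5, ⟨h2, h6⟩, ⟨h3, h7⟩, h1.1, h8⟩
  · rintro ⟨N, -, h, -, f, -, g, -, σ', -, τ', -, h1, h4, h5, h6, h7, h8⟩
    exact ⟨N, h, f, g, σ', τ', h1, h6.1, h7.1, h4, h5, h6.2, h7.2, h8.2⟩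

end

/-! ### Closure properties of primitive recursive families -/

section
variable {P Q : M → Data M} {B C : M → M}

theorem PRd.sub [hP : PRd P B] : PRd (fun p => (P (fst p)).sub (snd p)) (fun p => B (fst p)) where
  el := by unfold Data.sub; infer_instance
  lt := by
    have h : PRp (fun x : Fin 4 → M => (x 1 ∈ₛ om M ∧ (P (fst (x 0))).subEl (snd (x 0)) (x 1) (x 2)) ∧
      (x 1 ∈ₛ om M ∧ (P (fst (x 0))).subEl (snd (x 0)) (x 1) (x 3)) ∧
      (x 1 ∈ₛ om M ∧ (P (fst (x 0))).lt (x 1) (x 2) (x 3))) := inferInstance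
    exact h.of_iff fun x => by simp only [Data.sub]; tauto
  act := by
    have h : PRp (fun x : Fin 6 → M => (x 1 ∈ₛ om M ∧ (P (fst (x 0))).subEl (snd (x 0)) (x 1) (x 4)) ∧
      (IsMor (x 1) (x 2) (x 3) ∧ (P (fst (x 0))).act (x 1) (x 2) (x 3) (x 4) (x 5))) :=
      inferInstance
    exact h.of_iff fun x => by
      simp only [Data.sub]
      exact ⟨fun h => ⟨⟨h.1.1, h.2.1⟩, h.1, h.2.2⟩, fun h => ⟨h.2.1, h.1.2, h.2.2⟩⟩
  supp := by
    have h : PRp (fun x : Fin 4 → M => (x 1 ∈ₛ om M ∧ (P (fst (x 0))).subEl (snd (x 0)) (x 1) (x 2)) ∧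
      (x 1 ∈ₛ om M ∧ (P (fst (x 0))).supp (x 1) (x 2) (x 3))) := inferInstance
    exact h.of_iff fun x => by simp only [Data.sub]; tauto
  good p := (hP.good _).sub _
  bd hn h := hP.bd hn h.1
  prb := PRd.bound (P := P) _

/-- The set of elements of `L = Tr(D)/≡`, for `D` with elements in `C`. -/
noncomputable def comps (C : M) (P : Data M) : M :=
  img (prod C (om M)) (fun q => PRST.sep (prod C (om M)) (fun r =>
    (P.Tr (fst q) (snd q) ∧ P.Tr (fst r) (snd r)) ∧ P.Eqv (fst q) (snd q) (fst r) (snd r)))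

theorem PRf.comps [hP : PRd P B] {m : ℕ} (p : (Fin m → M) → M) [PRf p] :
    PRf (fun x => comps (B (p x)) (P (p x))) := by
  refine PRf.comp1 (fun p => PRST.comps (B p) (P p)) ?_ p
  have hB : ∀ {m} (b : (Fin m → M) → M) [PRf b], PRf (fun x => B (b x)) :=
    fun b _ => PRd.bound (P := P) b
  unfold PRST.comps
  infer_instance

/-- A component is determined by any of its representatives, so the components are the values of a
primitive recursive function on pairs in `B p × ω`. Since `comps` may contain further sets, such as
the empty set, later definitions separate with `Comp`. -/
theorem mem_comps [hP : PRd P B] {p α : M} (h : (P p).Comp α) : α ∈ₛ comps (B p) (P p) := by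
  obtain ⟨σ, n, h, h'⟩ := h
  rw [comps, mem_img]
  refine ⟨pr σ n, pr_mem_prod.2 ⟨hP.bd h.1 h.2.1, h.1⟩, mext fun z => ?_⟩
  rw [h', mem_sep, fst_pr, snd_pr]
  constructor
  · rintro ⟨τ, k, rfl, h1, h2⟩
    rw [fst_pr, snd_pr, pr_mem_prod]
    exact ⟨⟨hP.bd h1.1 h1.2.1, h1.1⟩, ⟨h, h1⟩, h2⟩
  · rintro ⟨hz, h1, h2⟩
    obtain ⟨τ, k, -, -, rfl⟩ := mem_prod.1 hz
    rw [fst_pr, snd_pr] at *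
    exact ⟨τ, k, rfl, h1.2, h2⟩

section
variable {R : Data M} {ν n ρ ρ' m f a : M}

theorem below_el_iff : (R.below ν).el n ρ ↔ ρ = pr (fst ρ) (snd ρ) ∧ R.CompLt (fst ρ) ν ∧
    R.subEl (fst ρ) n (snd ρ) := by
  constructor
  · rintro ⟨α, σ, rfl, h⟩; simpa [Data.sub] using h
  · rintro ⟨e, h⟩; exact ⟨_, _, e, h⟩

theorem below_lt_iff : (R.below ν).lt n ρ ρ' ↔ ρ = pr (fst ρ) (snd ρ) ∧ ρ' = pr (fst ρ') (snd ρ') ∧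
    R.CompLt (fst ρ) ν ∧ R.CompLt (fst ρ') ν ∧ R.subEl (fst ρ) n (snd ρ) ∧
    R.subEl (fst ρ') n (snd ρ') ∧
    (R.CompLt (fst ρ) (fst ρ') ∨ fst ρ = fst ρ' ∧ R.lt n (snd ρ) (snd ρ')) := by
  constructor
  · rintro ⟨α, σ, β, τ, rfl, rfl, h1, h2, h3, h4, h⟩
    simp only [fst_pr, snd_pr, true_and]
    exact ⟨h1, h2, h3, h4, h.imp id fun h => ⟨h.1, h.2.2.2⟩⟩
  · rintro ⟨e, e', h1, h2, h3, h4, h⟩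
    refine ⟨_, _, _, _, e, e', h1, h2, h3, h4, h.imp id fun h => ⟨h.1, h3, ?_, h.2⟩⟩
    rw [h.1]; exact h4

theorem below_act_iff : (R.below ν).act m n f ρ ρ' ↔ ρ = pr (fst ρ) (snd ρ) ∧
    ρ' = pr (fst ρ) (snd ρ') ∧ R.CompLt (fst ρ) ν ∧ R.subEl (fst ρ) m (snd ρ) ∧
    R.act m n f (snd ρ) (snd ρ') := by
  constructor
  · rintro ⟨α, σ, τ, rfl, rfl, h⟩; simpa [Data.sub] using h
  · rintro ⟨e, e', h⟩; exact ⟨_, _, _, e, e', h⟩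

theorem below_supp_iff : (R.below ν).supp n ρ a ↔ ρ = pr (fst ρ) (snd ρ) ∧ R.CompLt (fst ρ) ν ∧
    R.subEl (fst ρ) n (snd ρ) ∧ R.supp n (snd ρ) a := by
  constructor
  · rintro ⟨α, σ, rfl, h⟩; simpa [Data.sub] using h
  · rintro ⟨e, h⟩; exact ⟨_, _, e, h⟩

end

theorem PRd.below [hP : PRd P B] : PRd (fun p => (P (fst p)).below (snd p))
    (fun p => prod (comps (B (fst p)) (P (fst p))) (B (fst p))) where
  el := by
    have h : PRp (fun x : Fin 3 → M => x 2 = pr (fst (x 2)) (snd (x 2)) ∧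
      (P (fst (x 0))).CompLt (fst (x 2)) (snd (x 0)) ∧
      (x 1 ∈ₛ om M ∧ (P (fst (x 0))).subEl (fst (x 2)) (x 1) (snd (x 2)))) := inferInstance
    exact h.of_iff fun x => by rw [below_el_iff]; tauto
  lt := by
    have h : PRp (fun x : Fin 4 → M => x 2 = pr (fst (x 2)) (snd (x 2)) ∧
      x 3 = pr (fst (x 3)) (snd (x 3)) ∧
      (P (fst (x 0))).CompLt (fst (x 2)) (snd (x 0)) ∧
      (P (fst (x 0))).CompLt (fst (x 3)) (snd (x 0)) ∧
      (x 1 ∈ₛ om M ∧ (P (fst (x 0))).subEl (fst (x 2)) (x 1) (snd (x 2))) ∧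
      (x 1 ∈ₛ om M ∧ (P (fst (x 0))).subEl (fst (x 3)) (x 1) (snd (x 3))) ∧
      ((P (fst (x 0))).CompLt (fst (x 2)) (fst (x 3)) ∨ fst (x 2) = fst (x 3) ∧
        (x 1 ∈ₛ om M ∧ (P (fst (x 0))).lt (x 1) (snd (x 2)) (snd (x 3))))) := inferInstance
    exact h.of_iff fun x => by rw [below_lt_iff]; tauto
  act := by
    have h : PRp (fun x : Fin 6 → M => x 4 = pr (fst (x 4)) (snd (x 4)) ∧
      x 5 = pr (fst (x 4)) (snd (x 5)) ∧
      (P (fst (x 0))).CompLt (fst (x 4)) (snd (x 0)) ∧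
      (x 1 ∈ₛ om M ∧ (P (fst (x 0))).subEl (fst (x 4)) (x 1) (snd (x 4))) ∧
      (IsMor (x 1) (x 2) (x 3) ∧
        (P (fst (x 0))).act (x 1) (x 2) (x 3) (snd (x 4)) (snd (x 5)))) := inferInstance
    refine h.of_iff fun x => ?_
    rw [below_act_iff]
    exact ⟨fun ⟨h0, h1, h2, h3, h4, h5⟩ => ⟨h1, h2, h3, ⟨h0.1, h4⟩, h0, h5⟩,
      fun ⟨h1, h2, h3, h4, h0, h5⟩ => ⟨h0, h1, h2, h3, h4.2, h5⟩⟩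
  supp := by
    have h : PRp (fun x : Fin 4 → M => x 2 = pr (fst (x 2)) (snd (x 2)) ∧
      (P (fst (x 0))).CompLt (fst (x 2)) (snd (x 0)) ∧
      (x 1 ∈ₛ om M ∧ (P (fst (x 0))).subEl (fst (x 2)) (x 1) (snd (x 2))) ∧
      (x 1 ∈ₛ om M ∧ (P (fst (x 0))).supp (x 1) (snd (x 2)) (x 3))) := inferInstance
    exact h.of_iff fun x => by rw [below_supp_iff]; tauto
  good p := (hP.good _).below _
  bd {p n ρ} hn h := by
    rw [below_el_iff] at h
    rw [h.1, pr_mem_prod]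
    exact ⟨mem_comps h.2.1.1, hP.bd hn h.2.2.1⟩
  prb := by
    have := PRd.bound (P := P) (fun x : Fin 1 → M => fst (x 0))
    have := PRf.comps (P := P) (fun x : Fin 1 → M => fst (x 0))
    infer_instance

theorem PRd.add [hP : PRd P B] [hQ : PRd Q C] : PRd (fun p => (P p).add (Q p))
    (fun p => prod (adj (one M) (one M)) (un (B p) (C p))) where
  el := by
    have h : PRp (fun x : Fin 3 → M =>
      (x 2 = pr (emp M) (snd (x 2)) ∧ x 1 ∈ₛ om M ∧ (P (x 0)).el (x 1) (snd (x 2))) ∨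
      (x 2 = pr (one M) (snd (x 2)) ∧ x 1 ∈ₛ om M ∧ (Q (x 0)).el (x 1) (snd (x 2)))) :=
      inferInstance
    refine h.of_iff fun x => ?_
    constructor
    · rintro ⟨hn, σ, ⟨h1, h2⟩ | ⟨h1, h2⟩⟩ <;> rw [h1, snd_pr]
      exacts [Or.inl ⟨rfl, hn, h2⟩, Or.inr ⟨rfl, hn, h2⟩]
    · rintro (⟨h1, hn, h2⟩ | ⟨h1, hn, h2⟩)
      exacts [⟨hn, _, Or.inl ⟨h1, h2⟩⟩, ⟨hn, _, Or.inr ⟨h1, h2⟩⟩]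
  lt := by
    have h : PRp (fun x : Fin 4 → M =>
      (x 2 = pr (emp M) (snd (x 2)) ∧ x 3 = pr (emp M) (snd (x 3)) ∧
        (x 1 ∈ₛ om M ∧ (P (x 0)).lt (x 1) (snd (x 2)) (snd (x 3)))) ∨
      (x 2 = pr (emp M) (snd (x 2)) ∧ x 3 = pr (one M) (snd (x 3)) ∧
        (x 1 ∈ₛ om M ∧ (P (x 0)).el (x 1) (snd (x 2))) ∧
        (x 1 ∈ₛ om M ∧ (Q (x 0)).el (x 1) (snd (x 3)))) ∨
      (x 2 = pr (one M) (snd (x 2)) ∧ x 3 = pr (one M) (snd (x 3)) ∧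
        (x 1 ∈ₛ om M ∧ (Q (x 0)).lt (x 1) (snd (x 2)) (snd (x 3))))) :=
      inferInstance
    refine h.of_iff fun x => ?_
    constructor
    · rintro ⟨hn, σ, τ, ⟨h1, h2, h3⟩ | ⟨h1, h2, h3⟩ | ⟨h1, h2, h3⟩⟩ <;>
        rw [h1, h2, snd_pr, snd_pr]
      exacts [Or.inl ⟨rfl, rfl, hn, h3⟩, Or.inr (Or.inl ⟨rfl, rfl, ⟨hn, h3.1⟩, hn, h3.2⟩),
        Or.inr (Or.inr ⟨rfl, rfl, hn, h3⟩)]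
    · rintro (⟨h1, h2, hn, h3⟩ | ⟨h1, h2, ⟨hn, h3⟩, -, h4⟩ | ⟨h1, h2, hn, h3⟩)
      exacts [⟨hn, _, _, Or.inl ⟨h1, h2, h3⟩⟩, ⟨hn, _, _, Or.inr (Or.inl ⟨h1, h2, h3, h4⟩)⟩,
        ⟨hn, _, _, Or.inr (Or.inr ⟨h1, h2, h3⟩)⟩]
  act := by
    have h : PRp (fun x : Fin 6 → M =>
      (x 4 = pr (emp M) (snd (x 4)) ∧ x 5 = pr (emp M) (snd (x 5)) ∧
        (IsMor (x 1) (x 2) (x 3) ∧ (P (x 0)).act (x 1) (x 2) (x 3) (snd (x 4)) (snd (x 5)))) ∨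
      (x 4 = pr (one M) (snd (x 4)) ∧ x 5 = pr (one M) (snd (x 5)) ∧
        (IsMor (x 1) (x 2) (x 3) ∧ (Q (x 0)).act (x 1) (x 2) (x 3) (snd (x 4)) (snd (x 5))))) :=
      inferInstance
    refine h.of_iff fun x => ?_
    constructor
    · rintro ⟨hn, σ, τ, ⟨h1, h2, h3⟩ | ⟨h1, h2, h3⟩⟩ <;> rw [h1, h2, snd_pr, snd_pr]
      exacts [Or.inl ⟨rfl, rfl, hn, h3⟩, Or.inr ⟨rfl, rfl, hn, h3⟩]
    · rintro (⟨h1, h2, hn, h3⟩ | ⟨h1, h2, hn, h3⟩)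
      exacts [⟨hn, _, _, Or.inl ⟨h1, h2, h3⟩⟩, ⟨hn, _, _, Or.inr ⟨h1, h2, h3⟩⟩]
  supp := by
    have h : PRp (fun x : Fin 4 → M =>
      (x 2 = pr (emp M) (snd (x 2)) ∧ x 1 ∈ₛ om M ∧ (P (x 0)).supp (x 1) (snd (x 2)) (x 3)) ∨
      (x 2 = pr (one M) (snd (x 2)) ∧ x 1 ∈ₛ om M ∧ (Q (x 0)).supp (x 1) (snd (x 2)) (x 3))) :=
      inferInstance
    refine h.of_iff fun x => ?_
    constructor
    · rintro ⟨hn, σ, ⟨h1, h2⟩ | ⟨h1, h2⟩⟩ <;> rw [h1, snd_pr]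
      exacts [Or.inl ⟨rfl, hn, h2⟩, Or.inr ⟨rfl, hn, h2⟩]
    · rintro (⟨h1, hn, h2⟩ | ⟨h1, hn, h2⟩)
      exacts [⟨hn, _, Or.inl ⟨h1, h2⟩⟩, ⟨hn, _, Or.inr ⟨h1, h2⟩⟩]
  good p := (hP.good p).add (hQ.good p)
  bd {p n ρ} hn h := by
    obtain ⟨σ, ⟨rfl, h⟩ | ⟨rfl, h⟩⟩ := h <;> rw [pr_mem_prod, mem_un]
    · exact ⟨mem_adj.2 (Or.inl (by simp [one])), Or.inl (hP.bd hn h)⟩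
    · exact ⟨mem_adj.2 (Or.inr rfl), Or.inr (hQ.bd hn h)⟩
  prb := by
    have := PRd.bound (P := P) (fun x : Fin 1 → M => x 0)
    have := PRd.bound (P := Q) (fun x : Fin 1 → M => x 0)
    infer_instance

/-- `γ` if it is an ordinal, and `0` otherwise -/
noncomputable def toOrd (γ : M) : M := if IsOrd γ then γ else emp M

theorem isOrd_toOrd (γ : M) : IsOrd (toOrd γ) := by
  unfold toOrd; split_ifs with h
  exacts [h, isOrd_emp]

theorem toOrd_eq {γ : M} (h : IsOrd γ) : toOrd γ = γ := if_pos h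

instance PRf.toOrd {m : ℕ} (a : (Fin m → M) → M) [PRf a] : PRf (fun x => toOrd (a x)) :=
  PRf.comp1 PRST.toOrd (by unfold PRST.toOrd; infer_instance) a

instance PRf.addCmp {m : ℕ} (a b c d : (Fin m → M) → M) [PRf a] [PRf b] [PRf c] [PRf d] :
    PRf (fun x => addCmp (a x) (b x) (c x) (d x)) := by
  have h : PRf (fun x : Fin 4 → M => PRST.addCmp (x 0) (x 1) (x 2) (x 3)) := by
    unfold PRST.addCmp; infer_instance
  exact h.subst ![a, b, c, d] (by intro i; fin_cases i <;> assumption)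

/-- A family in `PRd` must be good for every parameter, so `toOrd` replaces parameters that are not
ordinals. The elements are pairs whose second component is a finite subset of `⋃ₙ (γ + n)`. The
enumerations of these finite sets provide the bounded witnesses. -/
theorem PRd.sep [hP : PRd P B] : PRd (fun p => (P (fst p)).sep (toOrd (snd p)))
    (fun p => prod (B (fst p)) (fin (iUn (om M) (PRST.add (toOrd (snd p)))))) where
  el := by
    have h : PRp (fun x : Fin 3 → M => x 1 ∈ₛ om M ∧ ∃ k, k ∈ₛ om M ∧
      ∃ e, e ∈ₛ fin (prod (om M) (PRST.add (toOrd (snd (x 0))) (x 1))) ∧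
      (P (fst (x 0))).SepRep (toOrd (snd (x 0))) (x 1) (fst (x 2)) k e ∧
      x 2 = pr (fst (x 2)) (rng k e)) := inferInstance
    refine h.of_iff fun x => and_congr_right fun hn => ?_
    rw [sep_el_iff (isOrd_toOrd _) hn]
    constructor
    · rintro ⟨σ, k, e, h, hx⟩
      rw [hx, fst_pr]
      exact ⟨k, h.1.1, e, h.1.mem_fin, h, rfl⟩
    · rintro ⟨k, -, e, -, h, hx⟩
      exact ⟨_, k, e, h, hx⟩
  lt := by
    have h : PRp (fun x : Fin 4 → M => x 1 ∈ₛ om M ∧ ∃ k, k ∈ₛ om M ∧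
      ∃ e, e ∈ₛ fin (prod (om M) (PRST.add (toOrd (snd (x 0))) (x 1))) ∧ ∃ l, l ∈ₛ om M ∧
      ∃ e', e' ∈ₛ fin (prod (om M) (PRST.add (toOrd (snd (x 0))) (x 1))) ∧
      (P (fst (x 0))).SepRep (toOrd (snd (x 0))) (x 1) (fst (x 2)) k e ∧
      (P (fst (x 0))).SepRep (toOrd (snd (x 0))) (x 1) (fst (x 3)) l e' ∧
      x 2 = pr (fst (x 2)) (rng k e) ∧ x 3 = pr (fst (x 3)) (rng l e') ∧
      (P (fst (x 0))).LtP (PRST.add (toOrd (snd (x 0))) (x 1)) Mem (pr k (pr (fst (x 2)) e))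
        (pr l (pr (fst (x 3)) e'))) := inferInstance
    refine h.of_iff fun x => and_congr_right fun hn => ?_
    constructor
    · intro h
      obtain ⟨σ, k, e, τ, l, e', h1, h2, h3, h4⟩ := sep_lt_rep (isOrd_toOrd _) hn h
      rw [h3, h4, sep_lt_iff (hP.good _) (isOrd_toOrd _) hn h1 h2] at h
      rw [h3, h4, fst_pr, fst_pr]
      exact ⟨k, h1.1.1, e, h1.1.mem_fin, l, h2.1.1, e', h2.1.mem_fin, h1, h2, rfl, rfl, by
        simpa only [Data.LtP, fst_pr, snd_pr] using h⟩
    · rintro ⟨k, -, e, -, l, -, e', -, h1, h2, h3, h4, h5⟩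
      simp only [Data.LtP, fst_pr, snd_pr] at h5
      rw [h3, h4, sep_lt_iff (hP.good _) (isOrd_toOrd _) hn h1 h2]
      exact h5
  act := by
    have h : PRp (fun x : Fin 6 → M => IsMor (x 1) (x 2) (x 3) ∧ ∃ k, k ∈ₛ om M ∧
      ∃ e, e ∈ₛ fin (prod (om M) (PRST.add (toOrd (snd (x 0))) (x 1))) ∧
      (P (fst (x 0))).SepRep (toOrd (snd (x 0))) (x 1) (fst (x 4)) k e ∧
      x 4 = pr (fst (x 4)) (rng k e) ∧
      x 5 = pr (fst (x 4)) (rng k (addCmp (toOrd (snd (x 0))) (x 3) k e))) := inferInstance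
    refine h.of_iff fun x => and_congr_right fun hf => ?_
    constructor
    · intro h
      obtain ⟨σ, k, e, h1, h2, h3⟩ := sep_act_rep (isOrd_toOrd _) hf h
      rw [h2, h3, fst_pr]
      exact ⟨k, h1.1.1, e, h1.1.mem_fin, h1, rfl, rfl⟩
    · rintro ⟨k, -, e, -, h1, h2, h3⟩
      rw [h2, sep_act_iff (isOrd_toOrd _) hf h1]
      exact h3
  supp := by
    have h : PRp (fun x : Fin 4 → M => x 1 ∈ₛ om M ∧ ∃ k, k ∈ₛ om M ∧
      ∃ e, e ∈ₛ fin (prod (om M) (PRST.add (toOrd (snd (x 0))) (x 1))) ∧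
      (P (fst (x 0))).SepRep (toOrd (snd (x 0))) (x 1) (fst (x 2)) k e ∧
      x 2 = pr (fst (x 2)) (rng k e) ∧
      (∀ i, i ∈ₛ x 3 → i ∈ₛ x 1 ∧ PRST.add (toOrd (snd (x 0))) i ∈ₛ rng k e) ∧
      ∀ i, i ∈ₛ x 1 → PRST.add (toOrd (snd (x 0))) i ∈ₛ rng k e → i ∈ₛ x 3) := inferInstance
    refine h.of_iff fun x => and_congr_right fun hn => ?_
    constructor
    · intro h
      obtain ⟨σ, k, e, h1, h2⟩ := sep_supp_rep (isOrd_toOrd _) hn h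
      rw [h2, sep_supp_iff (isOrd_toOrd _) hn h1] at h
      rw [h2, fst_pr]
      exact ⟨k, h1.1.1, e, h1.1.mem_fin, h1, rfl, fun i hi => (h i).1 hi,
        fun i hi hi' => (h i).2 ⟨hi, hi'⟩⟩
    · rintro ⟨k, -, e, -, h1, h2, h3, h4⟩
      rw [h2, sep_supp_iff (isOrd_toOrd _) hn h1]
      exact fun i => ⟨h3 i, fun h => h4 i h.1 h.2⟩
  good p := (hP.good _).sep (isOrd_toOrd _)
  bd {p n ρ} hn h := by
    obtain ⟨σ, k, e, h', rfl⟩ := (sep_el_iff (isOrd_toOrd _) hn).1 h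
    rw [pr_mem_prod]
    refine ⟨hP.bd h'.2.1.1 h'.2.1.2.1, img_mem_fin h'.1.1 _ fun i hi => ?_⟩
    rw [mem_iUn]
    exact ⟨n, hn, h'.1.app_mem hi⟩
  prb := by
    have := PRd.bound (P := P) (fun x : Fin 1 → M => fst (x 0))
    infer_instance

end

end PrimrecFamilies
-- Predecessors embed into proper initial segments
section Reductions
open Classical

variable {M : Type u} [prsLang.Structure M] [SetModel M]

/-- `x = (n, (σ, e))` for a trace element `(σ, n)` and an increasing `e : n → X` represents the
element `(σ, rng(e))` of `D(X)`. -/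
def Data.ElP (P : Data M) (X : M) (lt : M → M → Prop) (x : M) : Prop :=
  ∃ n σ e, x = pr n (pr σ e) ∧ P.Tr σ n ∧ Inc X lt n e

/-- `P(X)` has a primitive recursive embedding into a proper initial segment of `Q(X)`. -/
def Data.Reduces (P Q : Data M) (X : M) (lt : M → M → Prop) : Prop :=
  ∃ c, Q.ElP X lt c ∧ ∃ J : M → M → Prop, PRp (fun x : Fin 2 → M => J (x 0) (x 1)) ∧
    (∀ x, P.ElP X lt x → ∃ y, Q.ElP X lt y ∧ J x y ∧ Q.LtP X lt y c) ∧
    ∀ x y x' y', P.ElP X lt x → P.ElP X lt x' → J x y → J x' y' → P.LtP X lt x x' →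
      Q.LtP X lt y y'

/-- `X` contains three copies of `δ`, the first of which lies below the range of the embedding `s`
of `X` into itself. -/
structure Room (X δ : M) (lt : M → M → Prop) (s b₀ b₁ b₂ : M → M) : Prop where
  lin : LinOn X lt
  om_sub : ∀ n, n ∈ₛ om M → n ∈ₛ δ
  s_mem : ∀ x, x ∈ₛ X → s x ∈ₛ X
  s_lt : ∀ x y, x ∈ₛ X → y ∈ₛ X → lt x y → lt (s x) (s y)
  b₀_mem : ∀ x, x ∈ₛ δ → b₀ x ∈ₛ X
  b₁_mem : ∀ x, x ∈ₛ δ → b₁ x ∈ₛ X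
  b₂_mem : ∀ x, x ∈ₛ δ → b₂ x ∈ₛ X
  b₀_lt : ∀ x y, x ∈ₛ δ → y ∈ₛ δ → x ∈ₛ y → lt (b₀ x) (b₀ y)
  b₁_lt : ∀ x y, x ∈ₛ δ → y ∈ₛ δ → x ∈ₛ y → lt (b₁ x) (b₁ y)
  b₂_lt : ∀ x y, x ∈ₛ δ → y ∈ₛ δ → x ∈ₛ y → lt (b₂ x) (b₂ y)
  b₀_s : ∀ x y, x ∈ₛ δ → y ∈ₛ X → lt (b₀ x) (s y)
  b₀_b₁ : ∀ x y, x ∈ₛ δ → y ∈ₛ δ → lt (b₀ x) (b₁ y)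
  b₁_b₂ : ∀ x y, x ∈ₛ δ → y ∈ₛ δ → lt (b₁ x) (b₂ y)

section
variable {P : Data M} (hP : P.Good) {X : M} {lt : M → M → Prop} (hX : LinOn X lt)
  [PRp (fun x : Fin 2 → M => lt (x 0) (x 1))]
include hP hX

theorem Data.Good.Lt_of_compLt {α β n σ e k τ e' : M} (h : P.CompLt α β) (hσ : P.subEl α n σ)
    (hτ : P.subEl β k τ) (he : Inc X lt n e) (he' : Inc X lt k e') : P.Lt X lt n σ e k τ e' := by
  obtain ⟨l, u, f, g, -, hu, hf, hg, hfe, hge, -⟩ := exists_factor hX he he'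
  rw [hP.lt_iff_of_factor hX hσ.1 hτ.1 hu hf hg hfe hge]
  exact hP.lt_of_compLt h hf hg hσ hτ

/-- The coordinate `i(σ)` is defined by embeddings into `n + n`. This suffices because two sequences
of length `n` have a common enumeration of length at most `n + n`. -/
theorem Data.Good.Lt_of_imp {n σ e e' i : M} (hσ : P.el n σ) (hi : P.Imp σ n i)
    (he : Inc X lt n e) (he' : Inc X lt n e') (h : lt (app e i) (app e' i)) :
    P.Lt X lt n σ e n σ e' := by
  obtain ⟨l, u, f, g, hl, hu, hf, hg, hfe, hge, -⟩ := exists_factor hX he he'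
  rw [hP.lt_iff_of_factor hX hσ hσ hu hf hg hfe hge]
  obtain ⟨hin, N, hN, hi⟩ := hi
  obtain ⟨-, rfl⟩ := (isAdd_iff hf.1).1 hN
  have hv := isMor_of_subset hu.1 (add_mem_om hf.1 hf.1) hl
  have hfg : app f i ∈ₛ app g i := by
    rw [← hfe i hin, ← hge i hin] at h
    exact (hu.lt_iff hX (hf.app_mem hin) (hg.app_mem hin)).1 h
  rw [← hP.mp_lt_iff hv (hP.mp_el hf hσ) (hP.mp_el hg hσ), hP.mp_mp hf hv hσ, hP.mp_mp hg hv hσ]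
  refine hi _ _ _ _ _ _ (hf.cmp hv) (hg.cmp hv) ((hf.cmp hv).inc.mem_iff.2 ⟨hin, rfl⟩)
    ((hg.cmp hv).inc.mem_iff.2 ⟨hin, rfl⟩) ?_ (hP.act_mp (hf.cmp hv) hσ) (hP.act_mp (hg.cmp hv) hσ)
  rw [app_cmp hin, app_cmp hin]
  exact hv.inc.app_lt (hg.app_mem hin) hfg

/-- Forgetting the index embeds the truncated sum into `P`: within one component the orders agree,
and different components compare like their indices. -/
theorem Data.Good.below_Lt {ν n ρ e k ρ' e' : M}
    (h : (P.below ν).Lt X lt n ρ e k ρ' e') : P.Lt X lt n (snd ρ) e k (snd ρ') e' := by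
  obtain ⟨N, u, f, g, σ, τ, hu, hf, hg, hfe, hge, h1, h2, hl⟩ := h
  rw [below_act_iff] at h1 h2
  rw [below_lt_iff] at hl
  refine ⟨N, u, f, g, snd σ, snd τ, hu, hf, hg, hfe, hge, h1.2.2.2.2, h2.2.2.2.2, ?_⟩
  have e1 : fst σ = fst ρ := by rw [h1.2.1, fst_pr]
  have e2 : fst τ = fst ρ' := by rw [h2.2.1, fst_pr]
  rcases hl.2.2.2.2.2.2 with hc | ⟨-, hc⟩
  · rw [(hP.act_iff hf h1.2.2.2.1.1).1 h1.2.2.2.2, (hP.act_iff hg h2.2.2.2.1.1).1 h2.2.2.2.2]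
    rw [e1, e2] at hc
    exact hP.lt_of_compLt hc hf hg h1.2.2.2.1 h2.2.2.2.1
  · exact hc

end

theorem below_tr {P : Data M} {ν ρ n : M} (h : (P.below ν).Tr ρ n) :
    P.Tr (snd ρ) n ∧ P.CompLt (fst ρ) ν ∧ P.subEl (fst ρ) n (snd ρ) := by
  obtain ⟨hn, h1, h2⟩ := h
  rw [below_el_iff] at h1
  rw [below_supp_iff] at h2
  exact ⟨⟨hn, h1.2.2.1, h2.2.2.2⟩, h1.2⟩

section
variable {X δ : M} {lt : M → M → Prop} {s b₀ b₁ b₂ : M → M}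
  [PRp (fun x : Fin 2 → M => lt (x 0) (x 1))] [hs : PRf (fun x : Fin 1 → M => s (x 0))]
  [hb₀ : PRf (fun x : Fin 1 → M => b₀ (x 0))] [hb₁ : PRf (fun x : Fin 1 → M => b₁ (x 0))]
  [hb₂ : PRf (fun x : Fin 1 → M => b₂ (x 0))] (H : Room X δ lt s b₀ b₁ b₂)
include H

theorem Room.inc_b₁ {n : M} (hn : n ∈ₛ om M) : Inc X lt n (lam n b₁) :=
  inc_lam hn _ (fun i hi => H.b₁_mem i (H.om_sub i (mem_om_of_mem hn i hi))) fun i j hij hj =>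
    H.b₁_lt i j (H.om_sub i (mem_om_of_mem hn i ((isOrd_of_mem_om hn).trans hij hj)))
      (H.om_sub j (mem_om_of_mem hn j hj)) hij

theorem Room.inc_b₂ {n : M} (hn : n ∈ₛ om M) : Inc X lt n (lam n b₂) :=
  inc_lam hn _ (fun i hi => H.b₂_mem i (H.om_sub i (mem_om_of_mem hn i hi))) fun i j hij hj =>
    H.b₂_lt i j (H.om_sub i (mem_om_of_mem hn i ((isOrd_of_mem_om hn).trans hij hj)))
      (H.om_sub j (mem_om_of_mem hn j hj)) hij

theorem Room.inc_s {n e : M} (he : Inc X lt n e) : Inc X lt n (lam n (fun i => s (app e i))) :=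
  he.map s H.s_mem H.s_lt

theorem Room.s_Lt {P : Data M} (hP : P.Good) {n σ e k τ e' : M} (hσ : P.el n σ) (hτ : P.el k τ)
    (he : Inc X lt n e) (he' : Inc X lt k e') (h : P.Lt X lt n σ e k τ e') :
    P.Lt X lt n σ (lam n (fun i => s (app e i))) k τ (lam k (fun i => s (app e' i))) := by
  have hs' : ∀ {m} (a : (Fin m → M) → M) [PRf a], PRf (fun x => s (a x)) :=
    fun a _ => PRf.comp1 s hs a
  exact (hP.Lt_map H.lin H.lin hσ hτ he he' s H.s_mem H.s_lt
    (fun i hi => app_lam hi) (fun i hi => app_lam hi)).2 h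

/-- The embedding forgets the index and shifts the arguments. The bound is a trace element of the
component `ν`, which exceeds all elements of smaller components whatever the arguments are. -/
theorem Room.reduces_below {P : Data M} (hP : P.Good) {ν : M} (hν : P.Comp ν) :
    (P.below ν).Reduces P X lt := by
  have hs' : ∀ {m} (a : (Fin m → M) → M) [PRf a], PRf (fun x => s (a x)) :=
    fun a _ => PRf.comp1 s hs a
  obtain ⟨σ, n, hσ, hσν⟩ := hP.comp_ex hν
  refine ⟨pr n (pr σ (lam n b₂)), ⟨n, σ, _, rfl, hσ, H.inc_b₂ hσ.1⟩,
    fun x y => y = pr (fst x) (pr (snd (fst (snd x)))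
      (lam (fst x) (fun i => s (app (snd (snd x)) i)))), inferInstance, ?_, ?_⟩
  · rintro x ⟨k, ρ, e, rfl, hρ, he⟩
    obtain ⟨h1, h2, h3⟩ := below_tr hρ
    simp only [fst_pr, snd_pr, Data.LtP]
    exact ⟨_, ⟨_, _, _, rfl, h1, H.inc_s he⟩, rfl, by
      simpa only [fst_pr, snd_pr] using hP.Lt_of_compLt H.lin h2 h3 ((hP.subEl_self hσ).2 hσν)
        (H.inc_s he) (H.inc_b₂ hσ.1)⟩
  · rintro x y x' y' ⟨k, ρ, e, rfl, hρ, he⟩ ⟨k', ρ', e', rfl, hρ', he'⟩ rfl rfl hl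
    simp only [fst_pr, snd_pr, Data.LtP] at hl ⊢
    exact H.s_Lt hP (below_tr hρ).1.2.1 (below_tr hρ').1.2.1 he he' (hP.below_Lt H.lin hl)

end

/-! ### Reduction of `∑_{α < μ} D_α + {D_μ}^γ` -/

section
variable {P Q : Data M} {A : M} {lt : M → M → Prop} {n σ e k τ e' : M}

theorem add_Lt_ll (h : (P.add Q).Lt A lt n (pr (emp M) σ) e k (pr (emp M) τ) e') :
    P.Lt A lt n σ e k τ e' := by
  obtain ⟨N, u, f, g, σ', τ', hu, hf, hg, hfe, hge, h1, h2, hl⟩ := h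
  obtain ⟨σ', rfl, h1'⟩ := add_act_l.1 h1
  obtain ⟨τ', rfl, h2'⟩ := add_act_l.1 h2
  exact ⟨N, u, f, g, σ', τ', hu, hf, hg, hfe, hge, h1', h2', add_lt_ll.1 hl⟩

theorem add_Lt_rr (h : (P.add Q).Lt A lt n (pr (one M) σ) e k (pr (one M) τ) e') :
    Q.Lt A lt n σ e k τ e' := by
  obtain ⟨N, u, f, g, σ', τ', hu, hf, hg, hfe, hge, h1, h2, hl⟩ := h
  obtain ⟨σ', rfl, h1'⟩ := add_act_r.1 h1
  obtain ⟨τ', rfl, h2'⟩ := add_act_r.1 h2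
  exact ⟨N, u, f, g, σ', τ', hu, hf, hg, hfe, hge, h1', h2', add_lt_rr.1 hl⟩

theorem add_Lt_rl : ¬ (P.add Q).Lt A lt n (pr (one M) σ) e k (pr (emp M) τ) e' := by
  rintro ⟨N, u, f, g, σ', τ', hu, hf, hg, hfe, hge, h1, h2, hl⟩
  obtain ⟨σ', rfl, h1'⟩ := add_act_r.1 h1
  obtain ⟨τ', rfl, h2'⟩ := add_act_l.1 h2
  exact add_lt_rl hl

theorem add_tr {ρ : M} (h : (P.add Q).Tr ρ n) :
    (∃ σ, ρ = pr (emp M) σ ∧ P.Tr σ n) ∨ ∃ σ, ρ = pr (one M) σ ∧ Q.Tr σ n := by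
  obtain ⟨hn, h1, h2⟩ := h
  rcases add_el_tagged h1 with ⟨σ, rfl⟩ | ⟨σ, rfl⟩
  · exact Or.inl ⟨σ, rfl, hn, add_el_l.1 h1, add_supp_l.1 h2⟩
  · exact Or.inr ⟨σ, rfl, hn, add_el_r.1 h1, add_supp_r.1 h2⟩

end

/-- The map on `γ + n` that is `b₀` on `γ` and maps `γ + i` to `s(e(i))`. -/
noncomputable def sepMap (γ : M) (s b₀ : M → M) (e x : M) : M :=
  if x ∈ₛ γ then b₀ x else s (app e (rem γ x))

section
variable {X δ γ : M} {lt : M → M → Prop} {s b₀ b₁ b₂ : M → M}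
  [PRp (fun x : Fin 2 → M => lt (x 0) (x 1))] [hs : PRf (fun x : Fin 1 → M => s (x 0))]
  [hb₀ : PRf (fun x : Fin 1 → M => b₀ (x 0))] [hb₁ : PRf (fun x : Fin 1 → M => b₁ (x 0))]
  [hb₂ : PRf (fun x : Fin 1 → M => b₂ (x 0))]

instance PRf.sepMap {m : ℕ} (a b : (Fin m → M) → M) [PRf a] [PRf b] :
    PRf (fun x => sepMap γ s b₀ (a x) (b x)) := by
  have hs' : ∀ {m} (a : (Fin m → M) → M) [PRf a], PRf (fun x => s (a x)) :=
    fun a _ => PRf.comp1 s hs a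
  have hb₀' : ∀ {m} (a : (Fin m → M) → M) [PRf a], PRf (fun x => b₀ (a x)) :=
    fun a _ => PRf.comp1 b₀ hb₀ a
  unfold PRST.sepMap
  infer_instance

omit hs hb₀ in
theorem sepMap_of_mem {e x : M} (h : x ∈ₛ γ) : sepMap γ s b₀ e x = b₀ x := if_pos h

omit hs hb₀ in
theorem sepMap_add {e i : M} (hi : i ∈ₛ om M) : sepMap γ s b₀ e (add γ i) = s (app e i) := by
  rw [sepMap, if_neg (add_not_mem hi), rem_add hi]

variable (H : Room X δ lt s b₀ b₁ b₂) (hγ : IsOrd γ) (hγδ : ∀ x, x ∈ₛ γ → x ∈ₛ δ)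
include H hγδ

theorem Room.sepMap_mem {n e x : M} (he : Inc X lt n e) (hx : x ∈ₛ add γ n) :
    sepMap γ s b₀ e x ∈ₛ X := by
  rcases (mem_add he.1 x).1 hx with h | ⟨i, hi, rfl⟩
  · rw [sepMap_of_mem h]; exact H.b₀_mem x (hγδ x h)
  · rw [sepMap_add (mem_om_of_mem he.1 i hi)]; exact H.s_mem _ (he.app_mem hi)

include hγ

theorem Room.sepMap_lt {n e x y : M} (he : Inc X lt n e) (hx : x ∈ₛ add γ n)
    (hy : y ∈ₛ add γ n) (h : x ∈ₛ y) : lt (sepMap γ s b₀ e x) (sepMap γ s b₀ e y) := by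
  rcases (mem_add he.1 x).1 hx with hx | ⟨i, hi, rfl⟩ <;>
  rcases (mem_add he.1 y).1 hy with hy | ⟨j, hj, rfl⟩
  · rw [sepMap_of_mem hx, sepMap_of_mem hy]; exact H.b₀_lt x y (hγδ x hx) (hγδ y hy) h
  · rw [sepMap_of_mem hx, sepMap_add (mem_om_of_mem he.1 j hj)]
    exact H.b₀_s x _ (hγδ x hx) (he.app_mem hj)
  · exact absurd (hγ.trans h hy) (add_not_mem (mem_om_of_mem he.1 i hi))
  · have hi' := mem_om_of_mem he.1 i hi
    have hj' := mem_om_of_mem he.1 j hj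
    rw [sepMap_add hi', sepMap_add hj']
    exact H.s_lt _ _ (he.app_mem hi) (he.app_mem hj)
      (he.app_lt hj ((add_mem_add_iff hi' hj').1 h))

theorem Room.inc_sepMap {n e k a : M} (he : Inc X lt n e) (ha : Inc (add γ n) Mem k a) :
    Inc X lt k (lam k (fun i => sepMap γ s b₀ e (app a i))) :=
  ha.map (sepMap γ s b₀ e) (fun _ hx => H.sepMap_mem hγδ he hx)
    (fun _ _ hx hy => H.sepMap_lt hγ hγδ he hx hy)

/-- A comparison in `{Q}^γ(X)` takes place in `Q(γ + N)` for a common enumeration `u : N → X` of the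
arguments. The increasing map on `γ + N` that is induced by `u` transfers it to `Q(X)`. -/
theorem Room.sep_Lt {Q : Data M} (hQ : Q.Good) {n σ k a e n' τ l b e' : M}
    (hσ : Q.SepRep γ n σ k a) (hτ : Q.SepRep γ n' τ l b)
    (h : (Q.sep γ).Lt X lt n (pr σ (rng k a)) e n' (pr τ (rng l b)) e') :
    Q.Lt X lt k σ (lam k (fun i => sepMap γ s b₀ e (app a i)))
      l τ (lam l (fun i => sepMap γ s b₀ e' (app b i))) := by
  obtain ⟨N, u, f, g, σ', τ', hu, hf, hg, hfe, hge, h1, h2, hl⟩ := h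
  obtain rfl := (sep_act_iff hγ hf hσ).1 h1
  obtain rfl := (sep_act_iff hγ hg hτ).1 h2
  have r1 := sepRep_addCmp hγ hf hσ
  have r2 := sepRep_addCmp hγ hg hτ
  rw [sep_lt_iff hQ hγ hu.1 r1 r2] at hl
  refine (hQ.Lt_map (isOrd_add hγ hu.1).linOn H.lin hσ.2.1.2.1 hτ.2.1.2.1 r1.1 r2.1
    (sepMap γ s b₀ u) (fun _ hx => H.sepMap_mem hγδ hu hx)
    (fun _ _ hx hy => H.sepMap_lt hγ hγδ hu hx hy) ?_ ?_).2 hl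
  · intro i hi
    rw [app_lam hi, app_addCmp hi]
    rcases (mem_add hf.1 _).1 (hσ.1.app_mem hi) with h | ⟨j, hj, h⟩
    · rw [addMap_of_mem h, sepMap_of_mem h, sepMap_of_mem h]
    · rw [h, addMap_add (mem_om_of_mem hf.1 j hj), sepMap_add (mem_om_of_mem hf.1 j hj),
        sepMap_add (mem_om_of_mem hf.2.1 _ (hf.app_mem hj)), hfe j hj]
  · intro i hi
    rw [app_lam hi, app_addCmp hi]
    rcases (mem_add hg.1 _).1 (hτ.1.app_mem hi) with h | ⟨j, hj, h⟩
    · rw [addMap_of_mem h, sepMap_of_mem h, sepMap_of_mem h]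
    · rw [h, addMap_add (mem_om_of_mem hg.1 j hj), sepMap_add (mem_om_of_mem hg.1 j hj),
        sepMap_add (mem_om_of_mem hg.2.1 _ (hg.app_mem hj)), hge j hj]

/-- As `σ` and `τ` belong to the same component, `σ ≪ τ` fails, which yields embeddings `f` and `g`
with `D(g)(τ) ≤ D(f)(σ)` in `D(N)`. With `N` placed in copy `1` of `δ`, there is a chain of three
comparisons. The given element is smaller than `τ` along `g`, because its important coordinate lies
in copy `0`. The latter is at most `σ` along `f`. Finally, this is at most `σ` with arguments in
copy `2`, by monotonicity. -/
theorem Room.sep_Lt_bound {P : Data M} (hP : P.Good) {μ n τ k a e σ l : M} (hμ : P.Comp μ)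
    (hσ : pr σ l ∈ₛ μ) (hτ : (P.sub μ).SepRep γ n τ k a) (he : Inc X lt n e) :
    P.Lt X lt k τ (lam k (fun i => sepMap γ s b₀ e (app a i))) l σ (lam l b₂) := by
  obtain ⟨ha, ht, i, hi, hiγ, -⟩ := hτ
  obtain ⟨htr, hτμ⟩ := hP.sub_tr.1 ht
  obtain ⟨hσt, hspec⟩ := hP.comp_spec hμ hσ
  obtain ⟨τ₁, k₁, e1, -, hnot, -⟩ := (hspec _).1 hτμ
  obtain ⟨rfl, rfl⟩ := pr_inj.1 e1
  rw [hP.ll_iff hσt htr] at hnot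
  push Not at hnot
  obtain ⟨N, f, g, hf, hg, hnot⟩ := hnot
  have hu := H.inc_b₁ hf.2.1
  have hw := H.inc_sepMap hγ hγδ he ha
  have hg' := hu.cmp hg
  have hf' := hu.cmp hf
  have hc := H.inc_b₂ hσt.1
  have hom : ∀ {m j}, m ∈ₛ om M → j ∈ₛ m → j ∈ₛ δ := fun hm hj =>
    H.om_sub _ (mem_om_of_mem hm _ hj)
  have h1 : P.Lt X lt k τ (lam k (fun i => sepMap γ s b₀ e (app a i))) k τ
      (cmp k (lam N b₁) g) := by
    -- The coordinate `i` is important for `τ` as an element of the component, so this comparison is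
    -- made in `P.sub μ`.
    rw [← hP.sub_Lt ht.2.1 ht.2.1]
    refine (hP.sub μ).Lt_of_imp H.lin ht.2.1 hi hw hg' ?_
    rw [app_lam hi.1, sepMap_of_mem hiγ, app_cmp hi.1, app_lam (hg.app_mem hi.1)]
    exact H.b₀_b₁ _ _ (hγδ _ hiγ) (hom hf.2.1 (hg.app_mem hi.1))
  rcases hP.Lt_negtrans H.lin htr.2.1 htr.2.1 hσt.2.1 hw hg' hc h1 with h | h
  · exact h
  -- If the bound `σ` in copy `2` were below `τ` along `g`, then `σ` along `f` would separate them: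
  -- either the first step contradicts monotonicity, or the second one contradicts the choice of `f`
  -- and `g`.
  rcases hP.Lt_negtrans H.lin hσt.2.1 htr.2.1 hσt.2.1 hc hg' hf' h with h | h
  · refine absurd h (hP.not_Lt_of_le H.lin hσt.2.1 hf' hc fun j hj => Or.inl ?_)
    rw [app_cmp hj, app_lam (hf.app_mem hj), app_lam hj]
    exact H.b₁_b₂ _ _ (hom hf.2.1 (hf.app_mem hj)) (hom hσt.1 hj)
  · rw [hP.lt_iff_of_factor H.lin hσt.2.1 htr.2.1 hu hf hg (fun j hj => (app_cmp hj).symm)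
      (fun j hj => (app_cmp hj).symm)] at h
    exact absurd h hnot

theorem sep_tr {Q : Data M} {ρ n : M} (h : (Q.sep γ).Tr ρ n) :
    ∃ σ k a, Q.SepRep γ n σ k a ∧ ρ = pr σ (rng k a) := (sep_el_iff hγ h.1).1 h.2.1

/-- The first summand is treated as in `reduces_below`. In the second, `(τ, rng a)` with arguments
`e` becomes `τ` with arguments `sepMap γ s b₀ e ∘ a`. The second summand stays above the first
because it lands in the component `μ` itself. The relation `J` searches for the enumeration of the
given finite set, which is unique by `rng_unique`. -/
theorem Room.reduces_sep {P : Data M} (hP : P.Good) {μ : M} (hμ : P.Comp μ) :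
    ((P.below μ).add ((P.sub μ).sep γ)).Reduces P X lt := by
  have hs' : ∀ {m} (a : (Fin m → M) → M) [PRf a], PRf (fun x => s (a x)) :=
    fun a _ => PRf.comp1 s hs a
  obtain ⟨σ, l, hσ, hσμ⟩ := hP.comp_ex hμ
  have hlin : ∀ {n : M}, n ∈ₛ om M → LinOn (add γ n) Mem := fun hn => (isOrd_add hγ hn).linOn
  refine ⟨pr l (pr σ (lam l b₂)), ⟨l, σ, _, rfl, hσ, H.inc_b₂ hσ.1⟩,
    fun x y => (fst (fst (snd x)) = emp M ∧ y = pr (fst x) (pr (snd (snd (fst (snd x))))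
      (lam (fst x) (fun i => s (app (snd (snd x)) i))))) ∨
      (fst (fst (snd x)) = one M ∧ ∃ k, k ∈ₛ om M ∧
        ∃ a, a ∈ₛ fin (prod (om M) (add γ (fst x))) ∧ Inc (add γ (fst x)) Mem k a ∧
          snd (snd (fst (snd x))) = rng k a ∧ y = pr k (pr (fst (snd (fst (snd x))))
            (lam k (fun i => sepMap γ s b₀ (snd (snd x)) (app a i))))), ?_, ?_, ?_⟩
  · have hsm : ∀ {m} (a b : (Fin m → M) → M) [PRf a] [PRf b],
        PRf (fun x => sepMap γ s b₀ (a x) (b x)) := fun a b _ _ => PRf.sepMap a b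
    infer_instance
  · rintro x ⟨n, ρ, e, rfl, hρ, he⟩
    rcases add_tr hρ with ⟨ρ₁, rfl, h₁⟩ | ⟨ρ₁, rfl, h₁⟩
    · obtain ⟨h1, h2, h3⟩ := below_tr h₁
      refine ⟨_, ?_, Or.inl ⟨by simp only [fst_pr, snd_pr], rfl⟩, ?_⟩
      · simp only [fst_pr, snd_pr]
        exact ⟨_, _, _, rfl, h1, H.inc_s he⟩
      · simp only [Data.LtP, fst_pr, snd_pr]
        exact hP.Lt_of_compLt H.lin h2 h3 ((hP.subEl_self hσ).2 hσμ) (H.inc_s he) (H.inc_b₂ hσ.1)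
    · obtain ⟨τ, k, a, hr, rfl⟩ := sep_tr H hγ hγδ h₁
      refine ⟨pr k (pr τ (lam k (fun i => sepMap γ s b₀ e (app a i)))),
        ⟨k, τ, _, rfl, (hP.sub_tr.1 hr.2.1).1, H.inc_sepMap hγ hγδ he hr.1⟩, Or.inr ?_, ?_⟩
      · simp only [fst_pr, snd_pr, true_and]
        exact ⟨k, hr.1.1, a, hr.1.mem_fin, hr.1, rfl, rfl⟩
      · simp only [Data.LtP, fst_pr, snd_pr]
        exact H.sep_Lt_bound hγ hγδ hP hμ hσμ hr he
  · rintro x y x' y' ⟨n, ρ, e, rfl, hρ, he⟩ ⟨n', ρ', e', rfl, hρ', he'⟩ hy hy' hl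
    simp only [Data.LtP, fst_pr, snd_pr] at hl hy hy' ⊢
    rcases add_tr hρ with ⟨ρ₁, rfl, h₁⟩ | ⟨ρ₁, rfl, h₁⟩ <;>
    rcases add_tr hρ' with ⟨ρ₁', rfl, h₁'⟩ | ⟨ρ₁', rfl, h₁'⟩ <;>
    simp only [fst_pr, snd_pr, emp_ne_one, emp_ne_one.symm, false_and, or_false, false_or,
      true_and] at hy hy'
    · subst hy hy'
      simp only [fst_pr, snd_pr]
      exact H.s_Lt hP (below_tr h₁).1.2.1 (below_tr h₁').1.2.1 he he'
        (hP.below_Lt H.lin (add_Lt_ll hl))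
    · obtain ⟨τ, k, a, hr, rfl⟩ := sep_tr H hγ hγδ h₁'
      obtain ⟨k', -, a', -, ha', hrng, rfl⟩ := hy'
      rw [snd_pr] at hrng
      -- The sequence found by `J` enumerates the same finite set as the one that represents the
      -- element, so they are equal.
      obtain ⟨rfl, rfl⟩ := rng_unique (hlin h₁'.1) hr.1 ha' hrng
      subst hy
      simp only [fst_pr, snd_pr]
      obtain ⟨h1, h2, h3⟩ := below_tr h₁
      exact hP.Lt_of_compLt H.lin h2 h3 hr.2.1.2.1 (H.inc_s he) (H.inc_sepMap hγ hγδ he' hr.1)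
    · exact absurd hl add_Lt_rl
    · obtain ⟨τ, k, a, hr, rfl⟩ := sep_tr H hγ hγδ h₁
      obtain ⟨k', -, a', -, ha', hrng, rfl⟩ := hy
      rw [snd_pr] at hrng
      obtain ⟨rfl, rfl⟩ := rng_unique (hlin h₁.1) hr.1 ha' hrng
      obtain ⟨τ', l', b, hr', rfl⟩ := sep_tr H hγ hγδ h₁'
      obtain ⟨k', -, a', -, ha', hrng', rfl⟩ := hy'
      rw [snd_pr] at hrng'
      obtain ⟨rfl, rfl⟩ := rng_unique (hlin h₁'.1) hr'.1 ha' hrng'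
      simp only [fst_pr, snd_pr]
      rw [← hP.sub_Lt hr.2.1.2.1 hr'.2.1.2.1]
      exact H.sep_Lt hγ hγδ (hP.sub μ) hr hr' (add_Lt_rr hl)

end

end Reductions
-- The set of predecessors of a predilator
section Predecessors
open Classical

variable {M : Type u} [prsLang.Structure M] [SetModel M]

section
variable {D : M} {S : Data M} (h : Codes D S)
include h

theorem Codes.tr_iff {σ n : M} : (dat D).Tr σ n ↔ S.Tr σ n :=
  and_congr_right fun hn => and_congr (h.2.1 n hn σ) (h.2.2.2.2 n hn σ n)

theorem Codes.Lt_iff {A n σ e k τ e' : M} {lt : M → M → Prop} :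
    (dat D).Lt A lt n σ e k τ e' ↔ S.Lt A lt n σ e k τ e' := by
  constructor <;> rintro ⟨N, u, f, g, σ', τ', hu, hf, hg, hfe, hge, h1, h2, hl⟩
  · exact ⟨N, u, f, g, σ', τ', hu, hf, hg, hfe, hge, (h.2.2.2.1 _ _ _ hf _ _).1 h1,
      (h.2.2.2.1 _ _ _ hg _ _).1 h2, (h.2.2.1 _ hu.1 _ _).1 hl⟩
  · exact ⟨N, u, f, g, σ', τ', hu, hf, hg, hfe, hge, (h.2.2.2.1 _ _ _ hf _ _).2 h1,
      (h.2.2.2.1 _ _ _ hg _ _).2 h2, (h.2.2.1 _ hu.1 _ _).2 hl⟩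

theorem Codes.reduces {Q : Data M} {X : M} {lt : M → M → Prop} (hS : S.Reduces Q X lt) :
    (dat D).Reduces Q X lt := by
  obtain ⟨c, hc, J, hJ, h1, h2⟩ := hS
  have hel : ∀ x, (dat D).ElP X lt x → S.ElP X lt x := by
    rintro x ⟨n, σ, e, rfl, hσ, he⟩
    exact ⟨n, σ, e, rfl, h.tr_iff.1 hσ, he⟩
  exact ⟨c, hc, J, hJ, fun x hx => h1 x (hel x hx), fun x y x' y' hx hx' hy hy' hl =>
    h2 x y x' y' (hel x hx) (hel x' hx') hy hy' (h.Lt_iff.1 hl)⟩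

end

/-- `∑_{α < μ} D_α` for a pair `p = (D, μ)` -/
noncomputable def belowFam (p : M) : Data M := (gd (fst p)).below (snd p)

noncomputable def belowBound (p : M) : M := prod (comps (tc (fst p)) (gd (fst p))) (tc (fst p))

instance PRd.belowFam : PRd (M := M) PRST.belowFam belowBound :=
  PRd.below (P := PRST.gd)

/-- `∑_{α < μ} D_α + {D_μ}^γ` for `p = ((D, μ), γ)` -/
noncomputable def sepFam (p : M) : Data M :=
  (PRST.belowFam (fst p)).add (((gd (fst (fst p))).sub (snd (fst p))).sep (toOrd (snd p)))

noncomputable def sepBound (p : M) : M :=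
  prod (adj (one M) (one M)) (un (belowBound (fst p))
    (prod (tc (fst (fst p))) (fin (iUn (om M) (PRST.add (toOrd (snd p)))))))

instance PRd.sepFam : PRd (M := M) PRST.sepFam sepBound :=
  have h1 : PRd (M := M) (fun p => PRST.belowFam (fst p)) (fun p => belowBound (fst p)) :=
    PRd.comp PRd.belowFam fst inferInstance
  have h2 := PRd.sep (hP := PRd.sub (P := PRST.gd (M := M)))
  PRd.add (hP := h1) (hQ := h2)

/-- A set that contains the predecessors of `D`. -/
noncomputable def preds (ξ D : M) : M :=
  iUn (sep (comps (tc D) (gd D)) (fun μ => (gd D).Comp μ)) (fun μ =>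
    un (adj (emp M) (code (belowBound (pr D μ)) (belowFam (pr D μ))))
      (img (sep ξ IsOrd) (fun γ =>
        code (sepBound (pr (pr D μ) γ)) (sepFam (pr (pr D μ) γ)))))

theorem PRf.codeBound {P : M → Data M} {B : M → M} [PRd P B] {m : ℕ} (p : (Fin m → M) → M)
    [PRf p] : PRf (fun x => PRST.code (B (p x)) (P (p x))) :=
  have := PRd.bound (P := P) p
  PRf.code (P := P) (fun x => B (p x)) p

instance PRf.preds {m : ℕ} (a b : (Fin m → M) → M) [PRf a] [PRf b] :
    PRf (fun x => preds (a x) (b x)) := by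
  refine PRf.comp2 PRST.preds ?_ a b
  have h1 : ∀ {m} (p : (Fin m → M) → M) [PRf p],
      PRf (fun x => PRST.code (belowBound (p x)) (belowFam (p x))) := fun p _ => PRf.codeBound p
  have h2 : ∀ {m} (p : (Fin m → M) → M) [PRf p],
      PRf (fun x => PRST.code (sepBound (p x)) (sepFam (p x))) := fun p _ => PRf.codeBound p
  have h3 : ∀ {m} (p : (Fin m → M) → M) [PRf p],
      PRf (fun x => PRST.comps (PRST.tc (p x)) (PRST.gd (p x))) := fun p _ => PRf.comps (P := PRST.gd) p
  unfold PRST.preds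
  infer_instance

theorem mem_preds {ξ D D' : M} : D' ∈ₛ preds ξ D ↔ ∃ μ, (gd D).Comp μ ∧
    (D' = code (belowBound (pr D μ)) (belowFam (pr D μ)) ∨ ∃ γ, γ ∈ₛ ξ ∧ IsOrd γ ∧
      D' = code (sepBound (pr (pr D μ) γ)) (sepFam (pr (pr D μ) γ))) := by
  have h1 : ∀ {m} (p : (Fin m → M) → M) [PRf p],
      PRf (fun x => PRST.code (belowBound (p x)) (belowFam (p x))) := fun p _ => PRf.codeBound p
  have h2 : ∀ {m} (p : (Fin m → M) → M) [PRf p],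
      PRf (fun x => PRST.code (sepBound (p x)) (sepFam (p x))) := fun p _ => PRf.codeBound p
  rw [preds, mem_iUn]
  constructor
  · rintro ⟨μ, hμ, h⟩
    rw [mem_sep] at hμ
    rw [mem_un, mem_img] at h
    refine ⟨μ, hμ.2, h.imp (fun h => by simpa using h) ?_⟩
    rintro ⟨γ, hγ, h⟩
    rw [mem_sep] at hγ
    exact ⟨γ, hγ.1, hγ.2, h⟩
  · rintro ⟨μ, hμ, h⟩
    refine ⟨μ, mem_sep.2 ⟨mem_comps (P := gd) hμ, hμ⟩, ?_⟩
    rw [mem_un, mem_img]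
    refine h.imp (fun h => by simpa using h) ?_
    rintro ⟨γ, h1, h2, h⟩
    exact ⟨γ, mem_sep.2 ⟨h1, h2⟩, h⟩

theorem PRd.codes {P : M → Data M} {B : M → M} [hP : PRd P B] (p : M) :
    Codes (code (B p) (P p)) (P p) :=
  codes_code (hP.good p) fun _ _ hn h => hP.bd hn h

section
variable {ξ D D' : M}

/-- This needs no assumption on `D`, as `gd` and `toOrd` turn every parameter into an admissible
one. -/
theorem isPredilator_of_mem_preds (h : D' ∈ₛ preds ξ D) : IsPredilator D' := by
  obtain ⟨μ, -, rfl | ⟨γ, -, -, rfl⟩⟩ := mem_preds.1 h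
  · exact (PRd.codes (P := belowFam) _).isPredilator (PRd.belowFam.good _)
  · exact (PRd.codes (P := sepFam) _).isPredilator (PRd.sepFam.good _)

theorem codes_belowFam (hD : IsPredilator D) (μ : M) :
    Codes (code (belowBound (pr D μ)) (belowFam (pr D μ))) ((dat D).below μ) := by
  have h := PRd.codes (P := belowFam) (pr D μ)
  rw [← gd_eq hD]
  have e : belowFam (pr D μ) = (gd D).below μ := by rw [belowFam, fst_pr, snd_pr]
  rwa [e] at h ⊢

theorem codes_sepFam (hD : IsPredilator D) (μ : M) {γ : M} (hγ : IsOrd γ) :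
    Codes (code (sepBound (pr (pr D μ) γ)) (sepFam (pr (pr D μ) γ)))
      (((dat D).below μ).add (((dat D).sub μ).sep γ)) := by
  have h := PRd.codes (P := sepFam) (pr (pr D μ) γ)
  rw [← gd_eq hD]
  have e : sepFam (pr (pr D μ) γ) = ((gd D).below μ).add (((gd D).sub μ).sep γ) := by
    rw [sepFam, belowFam, fst_pr, snd_pr, fst_pr, snd_pr, toOrd_eq hγ]
  rwa [e] at h ⊢

/-- The set `preds ξ D` disregards the type of `D`: for each component `μ` it contains the truncated
sum and all its extensions by `{D_μ}^γ`. A superset of `P_ξ(D)` suffices, because the reductions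
work for every component. -/
theorem mem_preds_of_isPred (hD : IsPredilator D) (h : IsPred ξ D D') : D' ∈ₛ preds ξ D := by
  rw [mem_preds, gd_eq hD]
  rcases h with ⟨μ, hμ, h⟩ | ⟨-, μ, hμ, h⟩ | ⟨μ, hμ, γ, hγ, hγξ, h⟩
  · exact ⟨μ, hμ.1.1, Or.inl (h.unique (codes_belowFam hD μ))⟩
  · exact ⟨μ, hμ, Or.inl (h.unique (codes_belowFam hD μ))⟩
  · exact ⟨μ, hμ.1.1, Or.inr ⟨γ, hγξ, hγ, h.unique (codes_sepFam hD μ hγ)⟩⟩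

theorem codes_of_mem_preds (hD : IsPredilator D) (h : D' ∈ₛ preds ξ D) : ∃ μ, (dat D).Comp μ ∧
    (Codes D' ((dat D).below μ) ∨ ∃ γ, γ ∈ₛ ξ ∧ IsOrd γ ∧
      Codes D' (((dat D).below μ).add (((dat D).sub μ).sep γ))) := by
  obtain ⟨μ, hμ, h⟩ := mem_preds.1 h
  rw [gd_eq hD] at hμ
  refine ⟨μ, hμ, h.imp ?_ ?_⟩
  · rintro rfl
    exact codes_belowFam hD μ
  · rintro ⟨γ, hγ, hγ', rfl⟩
    exact ⟨γ, hγ, hγ', codes_sepFam hD μ hγ'⟩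

/-- The hypothesis on `ξ` ensures that each relevant `γ` is included in `δ`, so that copy `0` has
room for it. -/
theorem Room.reduces_preds {X δ : M} {lt : M → M → Prop} {s b₀ b₁ b₂ : M → M}
    [PRp (fun x : Fin 2 → M => lt (x 0) (x 1))] [PRf (fun x : Fin 1 → M => s (x 0))]
    [PRf (fun x : Fin 1 → M => b₀ (x 0))] [PRf (fun x : Fin 1 → M => b₁ (x 0))]
    [PRf (fun x : Fin 1 → M => b₂ (x 0))] (H : Room X δ lt s b₀ b₁ b₂)
    (hξ : ∀ γ, γ ∈ₛ ξ → IsOrd γ → ∀ x, x ∈ₛ γ → x ∈ₛ δ) (hD : IsPredilator D)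
    (h : D' ∈ₛ preds ξ D) : (dat D').Reduces (dat D) X lt := by
  have hg : (dat D).Good := (isPredilator_iff.1 hD).2
  obtain ⟨μ, hμ, h | ⟨γ, hγ, hγ', h⟩⟩ := codes_of_mem_preds hD h
  · exact h.reduces (H.reduces_below hg hμ)
  · exact h.reduces (H.reduces_sep hγ' (hξ γ hγ hγ') hg hμ)

end

end Predecessors
-- Ranks of the elements of `D(X)`
section Ranks
open Classical

variable {M : Type u} [prsLang.Structure M] [SetModel M]

theorem mem_tc_sing (a : M) : a ∈ₛ tc (adj (emp M) a) := subset_tc (by simp)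

theorem set_induction (φ : M → Prop) [PRp (fun x : Fin 1 → M => φ (x 0))]
    (h : ∀ x, (∀ y, y ∈ₛ x → φ y) → φ x) (x : M) : φ x :=
  mem_induction (tc (adj (emp M) x)) φ (fun y hy ih => h y fun z hz => ih z hz (tc_trans hz hy)) x
    (mem_tc_sing x)

theorem IsLinOrd.linOn {A r : M} (h : IsLinOrd A r) : LinOn A (fun x y => pr x y ∈ₛ r) where
  irrefl x _ := h.2.1 x
  trans x y z _ _ _ := h.2.2.1 x y z
  total x y := h.2.2.2 x y

section
variable {P : M → Data M} {B : M → M} [hP : PRd P B] {X : M} {lt : M → M → Prop}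
  [hlt : PRp (fun x : Fin 2 → M => lt (x 0) (x 1))]

omit hP hlt in
theorem elP_iff {P : Data M} {x : M} : P.ElP X lt x ↔ x = pr (fst x) (pr (fst (snd x)) (snd (snd x))) ∧
    P.Tr (fst (snd x)) (fst x) ∧ Inc X lt (fst x) (snd (snd x)) := by
  constructor
  · rintro ⟨n, σ, e, rfl, h⟩
    simpa only [fst_pr, snd_pr, true_and] using h
  · rintro ⟨h, h'⟩; exact ⟨_, _, _, h, h'⟩

instance PRp.elP {m : ℕ} (p x : (Fin m → M) → M) [PRf p] [PRf x] :
    PRp (fun z => (P (p z)).ElP X lt (x z)) := by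
  have hlt : ∀ {m : ℕ} (a b : (Fin m → M) → M) [PRf a] [PRf b], PRp (fun x => lt (a x) (b x)) :=
    fun a b _ _ => PRp.comp2 lt hlt a b
  simp only [elP_iff]
  infer_instance

end

variable (X : M) (lt : M → M → Prop) [hlt : PRp (fun x : Fin 2 → M => lt (x 0) (x 1))]

/-- The set that represents `D(X)`. -/
noncomputable def els (D : M) : M :=
  sep (prod (om M) (prod (tc D) (fin (prod (om M) X)))) (fun x => (gd D).ElP X lt x)

instance PRf.els {m : ℕ} (a : (Fin m → M) → M) [PRf a] : PRf (fun x => els X lt (a x)) :=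
  PRf.comp1 (PRST.els X lt) (by unfold PRST.els; infer_instance) a

theorem mem_els {D x : M} : x ∈ₛ els X lt D ↔ (gd D).ElP X lt x := by
  rw [els, mem_sep, and_iff_right_iff_imp]
  rintro ⟨n, σ, e, rfl, h, he⟩
  rw [pr_mem_prod, pr_mem_prod]
  exact ⟨h.1, PRd.gd.bd h.1 h.2.1, he.mem_fin⟩

/-- Recursion on `α` along `∈`: an element enters at `α` when all smaller elements have entered at
some `β ∈ α`. The scheme supplies precisely the union of the earlier stages. Arbitrary sets serve as
ranks, so they need not be linearly ordered. -/
theorem exists_rk : ∃ R : M → M → M, PRf (fun x : Fin 2 → M => R (x 0) (x 1)) ∧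
    ∀ α D x, x ∈ₛ R α D ↔ (gd D).ElP X lt x ∧
      ∀ y, (gd D).ElP X lt y → (gd D).LtP X lt y x → ∃ β, β ∈ₛ α ∧ y ∈ₛ R β D := by
  have hH : PRf (fun x : Fin 3 → M => sep (els X lt (x 2)) (fun z => ∀ y, y ∈ₛ els X lt (x 2) →
    (gd (x 2)).LtP X lt y z → y ∈ₛ x 0)) := inferInstance
  obtain ⟨R, hR, h⟩ := PRf.exists_recur hH
  refine ⟨fun α D => R ![α, D], ?_, fun α D x => ?_⟩
  · convert hR using 3 with x
    funext i; fin_cases i <;> rfl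
  · obtain ⟨u, hu, hRu⟩ := h α ![D]
    have e : ∀ β, (Fin.cons β ![D] : Fin 2 → M) = ![β, D] := fun β => rfl
    simp only [e] at hu hRu
    beta_reduce
    rw [hRu]
    change x ∈ₛ sep (els X lt D) (fun z => ∀ y, y ∈ₛ els X lt D → (gd D).LtP X lt y z → y ∈ₛ u) ↔ _
    rw [mem_sep, mem_els]
    simp only [mem_els, hu]

/-- The set of elements of `D(X)` with rank at most `α`. -/
noncomputable def rk (α D : M) : M := (exists_rk X lt).choose α D

instance PRf.rk {m : ℕ} (a b : (Fin m → M) → M) [PRf a] [PRf b] :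
    PRf (fun x => rk X lt (a x) (b x)) :=
  PRf.comp2 (PRST.rk X lt) (exists_rk X lt).choose_spec.1 a b

theorem mem_rk {α D x : M} : x ∈ₛ rk X lt α D ↔ (gd D).ElP X lt x ∧
    ∀ y, (gd D).ElP X lt y → (gd D).LtP X lt y x → ∃ β, β ∈ₛ α ∧ y ∈ₛ rk X lt β D :=
  (exists_rk X lt).choose_spec.2 α D x

/-- All elements of `D(X)` have rank in `θ`. -/
def Ranked (D θ : M) : Prop := ∀ x, x ∈ₛ els X lt D → ∃ α, α ∈ₛ θ ∧ x ∈ₛ rk X lt α D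

instance PRp.ranked {m : ℕ} (a b : (Fin m → M) → M) [PRf a] [PRf b] :
    PRp (fun x => Ranked X lt (a x) (b x)) :=
  PRp.comp2 (Ranked X lt) (by unfold Ranked; infer_instance) a b

variable {X lt}

/-- Let `c` be the bound of the reduction and `α ∈ θ` a rank for it. All images lie below `c` and
thus have ranks in `α`. Since the reduction preserves the order, ranks of images are also ranks of
the original elements. So `D'` is ranked by an element of `θ`, and this decrease drives the main
induction. -/
theorem Data.Reduces.ranked {D D' θ : M} (h : (gd D').Reduces (gd D) X lt) (hD : Ranked X lt D θ) :
    ∃ α, α ∈ₛ θ ∧ Ranked X lt D' α := by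
  obtain ⟨c, hc, J, hJ, h1, h2⟩ := h
  have hJ' : ∀ {m : ℕ} (a b : (Fin m → M) → M) [PRf a] [PRf b], PRp (fun x => J (a x) (b x)) :=
    fun a b _ _ => PRp.comp2 J hJ a b
  obtain ⟨α, hα, hcα⟩ := hD c ((mem_els X lt).2 hc)
  -- Ranks are pulled back along `J`, simultaneously for all related pairs, by induction on the
  -- rank.
  have key := set_induction (fun β => ∀ x, x ∈ₛ els X lt D' → ∀ y, y ∈ₛ els X lt D → J x y →
    y ∈ₛ rk X lt β D → x ∈ₛ rk X lt β D') fun β ih x hx y hy hxy hyβ => by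
      rw [mem_els] at hx hy
      rw [mem_rk] at hyβ ⊢
      refine ⟨hx, fun x' hx' hl => ?_⟩
      obtain ⟨y', hy', hxy', -⟩ := h1 x' hx'
      obtain ⟨β', hβ', hy'β⟩ := hyβ.2 y' hy' (h2 x' y' x y hx' hx hxy' hxy hl)
      exact ⟨β', hβ', ih β' hβ' x' ((mem_els X lt).2 hx') y' ((mem_els X lt).2 hy') hxy' hy'β⟩
  refine ⟨α, hα, fun x hx => ?_⟩
  obtain ⟨y, hy, hxy, hyc⟩ := h1 x ((mem_els X lt).1 hx)
  obtain ⟨β, hβ, hyβ⟩ := ((mem_rk X lt).1 hcα).2 y hy hyc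
  exact ⟨β, hβ, key β x hx y ((mem_els X lt).2 hy) hxy hyβ⟩

/-- A ranked order is well-founded: the set `Z` is transported to `D(X)` along `φ`, and foundation
provides an `∈`-minimal rank among those that occur. An element of this rank is minimal, as a
smaller one would have a rank in that rank. -/
theorem Ranked.exists_minimal {D θ A r : M} (hD : IsPredilator D) (h : Ranked X lt D θ)
    (hX : LinOn X lt) (hA : LinOn A (fun x y => pr x y ∈ₛ r)) (φ : M → M)
    [hφ : PRf (fun x : Fin 1 → M => φ (x 0))] (h1 : ∀ x, x ∈ₛ A → φ x ∈ₛ X)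
    (h2 : ∀ x y, x ∈ₛ A → y ∈ₛ A → pr x y ∈ₛ r → lt (φ x) (φ y)) {Z : M} (hZ : ∃ z, z ∈ₛ Z)
    (hZA : ∀ z, z ∈ₛ Z → ∃ σ a, z = pr σ a ∧ (dat D).ExtEl A (fun x y => pr x y ∈ₛ r) σ a) :
    ∃ τ b, pr τ b ∈ₛ Z ∧
      ∀ σ a, pr σ a ∈ₛ Z → ¬ (dat D).ExtLt A (fun x y => pr x y ∈ₛ r) σ a τ b := by
  have hg : (dat D).Good := (isPredilator_iff.1 hD).2
  have hφ' : ∀ {m} (a : (Fin m → M) → M) [PRf a], PRf (fun x => φ (a x)) :=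
    fun a _ => PRf.comp1 φ hφ a
  let Ψ : M → M := fun x => pr (fst x) (pr (fst (snd x))
    (lam (fst x) (fun i => φ (app (snd (snd x)) i))))
  have hΨ : ∀ {m} (a : (Fin m → M) → M) [PRf a], PRf (fun x => Ψ (a x)) :=
    fun a _ => PRf.comp1 Ψ (by simp only [Ψ]; infer_instance) a
  have hrep : ∀ z, z ∈ₛ Z → ∃ n σ e, z = pr σ (rng n e) ∧ (dat D).Tr σ n ∧
      Inc A (fun x y => pr x y ∈ₛ r) n e := fun z hz => by
    obtain ⟨σ, a, rfl, n, e, he, hσ⟩ := hZA z hz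
    obtain ⟨he', rfl⟩ := isEnum_rng.1 he
    exact ⟨n, σ, e, rfl, hσ, he'⟩
  have hel : ∀ {n σ e}, (dat D).Tr σ n → Inc A (fun x y => pr x y ∈ₛ r) n e →
      pr n (pr σ e) ∈ₛ els A (fun x y => pr x y ∈ₛ r) D ∧
      (gd D).ElP X lt (Ψ (pr n (pr σ e))) := fun {n σ e} hσ he => by
    rw [mem_els, gd_eq hD]
    simp only [Ψ, fst_pr, snd_pr]
    exact ⟨⟨n, σ, e, rfl, hσ, he⟩, n, σ, _, rfl, hσ, he.map φ h1 h2⟩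
  obtain ⟨z, hz⟩ := hZ
  obtain ⟨n, σ, e, rfl, hσ, he⟩ := hrep z hz
  obtain ⟨h3, h4⟩ := hel hσ he
  obtain ⟨α, hα, hα'⟩ := h _ ((mem_els X lt).2 h4)
  -- The candidates are taken from `tc θ` rather than `θ`, so that elements of candidates are again
  -- in the range considered.
  obtain ⟨β, hβ, hmin⟩ := foundation (sep (tc θ) (fun α =>
    ∃ x, x ∈ₛ els A (fun x y => pr x y ∈ₛ r) D ∧ pr (fst (snd x)) (rng (fst x) (snd (snd x))) ∈ₛ Z ∧
      Ψ x ∈ₛ rk X lt α D)) ⟨α, mem_sep.2 ⟨subset_tc hα, _, h3, by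
        simpa only [fst_pr, snd_pr] using hz, hα'⟩⟩
  rw [mem_sep] at hβ
  obtain ⟨hβ, x, hx, hxZ, hxβ⟩ := hβ
  obtain ⟨k, τ, b, rfl, hτ, hb⟩ := (mem_els A _).1 hx
  rw [gd_eq hD] at hτ
  rw [fst_pr, snd_pr, snd_pr, fst_pr] at hxZ
  refine ⟨τ, _, hxZ, fun σ' a' hZ' hl => ?_⟩
  obtain ⟨n', σ'', e', heq, hσ', he'⟩ := hrep _ hZ'
  obtain ⟨rfl, rfl⟩ := pr_inj.1 heq
  obtain ⟨h5, h6⟩ := hel hσ' he'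
  rw [hg.extLt_iff hA hσ' hτ (isEnum_rng.2 ⟨he', rfl⟩) (isEnum_rng.2 ⟨hb, rfl⟩)] at hl
  obtain ⟨γ, hγ, hγ'⟩ := ((mem_rk X lt).1 hxβ).2 _ h6 (by
    rw [gd_eq hD]
    simp only [Ψ, Data.LtP, fst_pr, snd_pr]
    exact (hg.Lt_map hA hX hσ'.2.1 hτ.2.1 he' hb φ h1 h2 (fun i hi => app_lam hi)
      (fun i hi => app_lam hi)).2 hl)
  exact hmin γ (mem_sep.2 ⟨tc_trans hγ hβ, _, h5, by
    simpa only [fst_pr, snd_pr] using hZ', hγ'⟩) hγ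

end Ranks

/-! ### Axiom beta turns well-foundedness into ranks -/

section Beta
open Classical

variable {M : Type u} [prsLang.Structure M] [SetModel M]

theorem exists_collapse (r : M)
    (h : ∀ a : M, (∃ x, x ∈ₛ a) → ∃ y, y ∈ₛ a ∧ ∀ x, x ∈ₛ a → ¬ pr x y ∈ₛ r) :
    ∃ f : M, (∀ y, (∃ x, pr x y ∈ₛ r ∨ pr y x ∈ₛ r) → ∃ v, pr y v ∈ₛ f) ∧
      (∀ y v w, pr y v ∈ₛ f → pr y w ∈ₛ f → v = w) ∧
      ∀ y v, pr y v ∈ₛ f → ∀ z, z ∈ₛ v ↔ ∃ x, pr x y ∈ₛ r ∧ pr x z ∈ₛ f := by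
  obtain ⟨f, -, h⟩ := realize_axBeta.1
    ((SetModel.out (M := M)).realize_of_mem _ (Or.inr (Or.inl rfl))) r h
  exact ⟨f, h⟩

/-- The collapse of the order on `D(X)` satisfies `f(y) = {f(x) | x < y}`, and by induction `f(y)`
is a rank for `y`. -/
theorem IsDilator.exists_ranked {D X r : M} (hD : IsDilator D) (hX : IsWellOrd X r) :
    ∃ θ, Ranked X (fun x y => pr x y ∈ₛ r) D θ := by
  have hg : (dat D).Good := (isPredilator_iff.1 hD.1).2
  have hlin := hX.1.linOn
  have hmem : ∀ {x}, x ∈ₛ els X (fun x y => pr x y ∈ₛ r) D ↔ _ := mem_els X _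
  let E := els X (fun x y => pr x y ∈ₛ r) D
  let R := sep (prod E E) (fun q => (gd D).LtP X (fun x y => pr x y ∈ₛ r) (fst q) (snd q))
  have hR : ∀ {x y}, pr x y ∈ₛ R ↔ (x ∈ₛ E ∧ y ∈ₛ E) ∧
      (gd D).LtP X (fun x y => pr x y ∈ₛ r) x y := fun {x y} => by
    simp only [R]; rw [mem_sep, pr_mem_prod, fst_pr, snd_pr]
  obtain ⟨f, h1, h2, h3⟩ := exists_collapse R fun a ⟨x, hx⟩ => by
    -- Axiom beta asks for minimal elements of arbitrary sets `a`. If `a` is disjoint from `D(X)`,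
    -- then any element is minimal. Otherwise the dilator property is applied to `a ∩ D(X)`,
    -- rewritten with ranges in place of enumerations.
    by_cases hE : ∃ y, y ∈ₛ a ∧ y ∈ₛ E
    · obtain ⟨y, hy, hyE⟩ := hE
      let Z := img (sep E (fun y => y ∈ₛ a)) (fun x => pr (fst (snd x)) (rng (fst x) (snd (snd x))))
      have hrep : ∀ z, z ∈ₛ Z ↔ ∃ n σ e, z = pr σ (rng n e) ∧ pr n (pr σ e) ∈ₛ a ∧
          (dat D).Tr σ n ∧ Inc X (fun x y => pr x y ∈ₛ r) n e := fun z => by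
        simp only [Z]
        rw [mem_img]
        constructor
        · rintro ⟨x, hx, rfl⟩
          rw [mem_sep] at hx
          obtain ⟨n, σ, e, rfl, h⟩ := hmem.1 hx.1
          rw [gd_eq hD.1] at h
          simp only [fst_pr, snd_pr]
          exact ⟨n, σ, e, rfl, hx.2, h⟩
        · rintro ⟨n, σ, e, rfl, h, h'⟩
          refine ⟨pr n (pr σ e), mem_sep.2 ⟨hmem.2 ?_, h⟩, by simp only [fst_pr, snd_pr]⟩
          rw [gd_eq hD.1]
          exact ⟨n, σ, e, rfl, h'⟩
      obtain ⟨τ, b, hτ, hmin⟩ := hD.2 X r hX Z ⟨_, mem_img.2 ⟨y, mem_sep.2 ⟨hyE, hy⟩, rfl⟩⟩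
        fun z hz => by
          obtain ⟨n, σ, e, rfl, -, h, he⟩ := (hrep z).1 hz
          exact ⟨σ, _, rfl, n, e, isEnum_rng.2 ⟨he, rfl⟩, h⟩
      obtain ⟨k, τ', e, heq, hka, hτ', he⟩ := (hrep _).1 hτ
      obtain ⟨rfl, rfl⟩ := pr_inj.1 heq
      refine ⟨_, hka, fun x hx hxR => ?_⟩
      obtain ⟨⟨hxE, -⟩, hl⟩ := hR.1 hxR
      obtain ⟨n, σ, e', rfl, hσ, he'⟩ := hmem.1 hxE
      rw [gd_eq hD.1] at hσ hl
      simp only [Data.LtP, fst_pr, snd_pr] at hl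
      refine hmin σ _ ((hrep _).2 ⟨n, σ, e', rfl, hx, hσ, he'⟩) ?_
      exact (hg.extLt_iff hlin hσ hτ' (isEnum_rng.2 ⟨he', rfl⟩) (isEnum_rng.2 ⟨he, rfl⟩)).2 hl
    · exact ⟨x, hx, fun y _ h => hE ⟨x, hx, (hR.1 h).1.2⟩⟩
  have key := set_induction (fun v => ∀ y, y ∈ₛ E → pr y v ∈ₛ f →
    y ∈ₛ rk X (fun x y => pr x y ∈ₛ r) v D) fun v ih y hy hyv => by
      rw [mem_rk]
      refine ⟨hmem.1 hy, fun x hx hl => ?_⟩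
      have hxy : pr x y ∈ₛ R := hR.2 ⟨⟨hmem.2 hx, hy⟩, hl⟩
      obtain ⟨w, hw⟩ := h1 x ⟨y, Or.inr hxy⟩
      have hwv := (h3 y v hyv w).2 ⟨x, hxy, hw⟩
      exact ⟨w, hwv, ih w hwv x (hmem.2 hx) hw⟩
  -- The double union contains all values of the collapse. The set `∅` is added for elements outside
  -- of the field of the relation, where the collapse is not defined; these have no predecessors.
  refine ⟨adj (sUn (sUn f)) (emp M), fun y hy => ?_⟩
  by_cases hf : ∃ x, pr x y ∈ₛ R ∨ pr y x ∈ₛ R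
  · obtain ⟨v, hv⟩ := h1 y hf
    exact ⟨v, mem_adj.2 (Or.inl (mem_sUn_sUn hv).2), key v y hy hv⟩
  · refine ⟨emp M, mem_adj.2 (Or.inr rfl), (mem_rk X _).2 ⟨hmem.1 hy, fun x hx hl => ?_⟩⟩
    exact absurd ⟨x, Or.inl (hR.2 ⟨⟨hmem.2 hx, hy⟩, hl⟩)⟩ hf

end Beta
-- The well order `δ·ω + A`
section LexOrder
open Classical

variable {M : Type u} [prsLang.Structure M] [SetModel M]

theorem emp_mem_suc {n : M} (hn : n ∈ₛ om M) : emp M ∈ₛ suc n :=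
  om_induction (fun n => emp M ∈ₛ suc n) (by simp) (fun _ _ h => mem_suc.2 (Or.inl h)) n hn

/-- The carrier of the order `δ · ω + A`. -/
noncomputable def lexCarrier (δ A : M) : M := un (prod (om M) δ) (prod (adj (emp M) (om M)) A)

/-- The order relation of `δ · ω + A`, for a set `δ` of ordinals and `(A, r)`. -/
noncomputable def lexRel (δ A r : M) : M :=
  sep (prod (lexCarrier δ A) (lexCarrier δ A)) (fun q => fst (fst q) ∈ₛ fst (snd q) ∨
    fst (fst q) = fst (snd q) ∧ ((fst (fst q) ∈ₛ om M ∧ snd (fst q) ∈ₛ snd (snd q)) ∨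
      (fst (fst q) = om M ∧ pr (snd (fst q)) (snd (snd q)) ∈ₛ r)))

variable {δ A r : M}

theorem mem_lexCarrier {x : M} : x ∈ₛ lexCarrier δ A ↔
    (∃ n z, n ∈ₛ om M ∧ z ∈ₛ δ ∧ x = pr n z) ∨ ∃ z, z ∈ₛ A ∧ x = pr (om M) z := by
  rw [lexCarrier, mem_un, mem_prod, mem_prod]
  simp

theorem mem_lexRel {n z n' z' : M} : pr (pr n z) (pr n' z') ∈ₛ lexRel δ A r ↔
    (pr n z ∈ₛ lexCarrier δ A ∧ pr n' z' ∈ₛ lexCarrier δ A) ∧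
      (n ∈ₛ n' ∨ n = n' ∧ ((n ∈ₛ om M ∧ z ∈ₛ z') ∨ (n = om M ∧ pr z z' ∈ₛ r))) := by
  rw [lexRel, mem_sep, pr_mem_prod]
  simp only [fst_pr, snd_pr]

theorem pr_mem_lexCarrier {n z : M} :
    pr n z ∈ₛ lexCarrier δ A ↔ (n ∈ₛ om M ∧ z ∈ₛ δ) ∨ (n = om M ∧ z ∈ₛ A) := by
  rw [lexCarrier, mem_un, pr_mem_prod, pr_mem_prod]
  simp

theorem exists_pr_of_mem_lexCarrier {x : M} (h : x ∈ₛ lexCarrier δ A) : ∃ n z, x = pr n z := by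
  rcases mem_lexCarrier.1 h with ⟨n, z, -, -, rfl⟩ | ⟨z, -, rfl⟩
  exacts [⟨n, z, rfl⟩, ⟨_, z, rfl⟩]

theorem fst_mem_suc_om {n z : M} (h : pr n z ∈ₛ lexCarrier δ A) : n ∈ₛ suc (om M) := by
  rw [mem_suc]
  exact (pr_mem_lexCarrier.1 h).imp And.left And.left

/-- The copies of `δ` have natural numbers as indices and `A` has index `ω`. A minimal element is
found by minimizing the index and then the second coordinate, where foundation serves for `δ` and
the assumption on `A` for index `ω`. -/
theorem isWellOrd_lex (hδ : ∀ x, x ∈ₛ δ → IsOrd x) (hA : IsWellOrd A r) :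
    IsWellOrd (lexCarrier δ A) (lexRel δ A r) := by
  have hrel : IsRelOn (lexRel δ A r) (lexCarrier δ A) := fun p hp => by
    rw [lexRel, mem_sep, mem_prod] at hp
    obtain ⟨⟨x, y, hx, hy, rfl⟩, -⟩ := hp
    exact ⟨x, y, hx, hy, rfl⟩
  have hmem : ∀ {x y}, pr x y ∈ₛ lexRel δ A r → x ∈ₛ lexCarrier δ A ∧ y ∈ₛ lexCarrier δ A :=
    fun {x y} h => by
      obtain ⟨x', y', hx, hy, h⟩ := hrel _ h
      obtain ⟨rfl, rfl⟩ := pr_inj.1 h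
      exact ⟨hx, hy⟩
  have hom : ∀ {n : M}, n ∈ₛ om M → n ≠ om M := fun h h' => mem_irrefl _ (h' ▸ h)
  have ho := (isOrd_om (M := M)).suc
  refine ⟨⟨hrel, ?_, ?_, ?_⟩, ?_⟩
  · intro x hx
    obtain ⟨n, z, rfl⟩ := exists_pr_of_mem_lexCarrier (hmem hx).1
    rcases (mem_lexRel.1 hx).2 with h | ⟨-, ⟨-, h⟩ | ⟨-, h⟩⟩
    exacts [mem_irrefl _ h, mem_irrefl _ h, hA.1.2.1 _ h]
  · intro x y w hxy hyw
    obtain ⟨n, z, rfl⟩ := exists_pr_of_mem_lexCarrier (hmem hxy).1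
    obtain ⟨n', z', rfl⟩ := exists_pr_of_mem_lexCarrier (hmem hxy).2
    obtain ⟨n'', z'', rfl⟩ := exists_pr_of_mem_lexCarrier (hmem hyw).2
    rw [mem_lexRel] at hxy hyw ⊢
    refine ⟨⟨hxy.1.1, hyw.1.2⟩, ?_⟩
    have hn'' := ho.of_mem (fst_mem_suc_om hyw.1.2)
    rcases hxy.2 with h | ⟨rfl, h⟩
    · rcases hyw.2 with h' | ⟨rfl, -⟩
      · exact Or.inl (hn''.trans h h')
      · exact Or.inl h
    · rcases hyw.2 with h' | ⟨rfl, h'⟩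
      · exact Or.inl h'
      · refine Or.inr ⟨rfl, ?_⟩
        rcases h with ⟨hn, h⟩ | ⟨rfl, h⟩
        · rcases h' with ⟨-, h'⟩ | ⟨rfl, -⟩
          · rcases pr_mem_lexCarrier.1 hyw.1.2 with ⟨-, hz⟩ | ⟨rfl, -⟩
            · exact Or.inl ⟨hn, (hδ _ hz).trans h h'⟩
            · exact absurd rfl (hom hn)
          · exact absurd rfl (hom hn)
        · rcases h' with ⟨hn, -⟩ | ⟨-, h'⟩
          · exact absurd rfl (hom hn)
          · exact Or.inr ⟨rfl, hA.1.2.2.1 _ _ _ h h'⟩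
  · intro x y hx hy
    obtain ⟨n, z, rfl⟩ := exists_pr_of_mem_lexCarrier hx
    obtain ⟨n', z', rfl⟩ := exists_pr_of_mem_lexCarrier hy
    rw [mem_lexRel, mem_lexRel]
    rcases (ho.of_mem (fst_mem_suc_om hx)).trichotomy (ho.of_mem (fst_mem_suc_om hy)) with h | rfl | h
    · exact Or.inl ⟨⟨hx, hy⟩, Or.inl h⟩
    · rcases pr_mem_lexCarrier.1 hx with ⟨hn, hz⟩ | ⟨rfl, hz⟩
      · rcases pr_mem_lexCarrier.1 hy with ⟨-, hz'⟩ | ⟨rfl, -⟩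
        · rcases (hδ z hz).trichotomy (hδ z' hz') with h | rfl | h
          · exact Or.inl ⟨⟨hx, hy⟩, Or.inr ⟨rfl, Or.inl ⟨hn, h⟩⟩⟩
          · exact Or.inr (Or.inl rfl)
          · exact Or.inr (Or.inr ⟨⟨hy, hx⟩, Or.inr ⟨rfl, Or.inl ⟨hn, h⟩⟩⟩)
        · exact absurd rfl (hom hn)
      · rcases pr_mem_lexCarrier.1 hy with ⟨hn, -⟩ | ⟨-, hz'⟩
        · exact absurd rfl (hom hn)
        · rcases hA.1.2.2.2 z z' hz hz' with h | rfl | h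
          · exact Or.inl ⟨⟨hx, hy⟩, Or.inr ⟨rfl, Or.inr ⟨rfl, h⟩⟩⟩
          · exact Or.inr (Or.inl rfl)
          · exact Or.inr (Or.inr ⟨⟨hy, hx⟩, Or.inr ⟨rfl, Or.inr ⟨rfl, h⟩⟩⟩)
    · exact Or.inr (Or.inr ⟨⟨hy, hx⟩, Or.inl h⟩)
  · rintro Z ⟨x, hx⟩ hZ
    have hrep : ∀ {m}, m ∈ₛ img Z fst → ∃ z, pr m z ∈ₛ Z := fun {m} hm => by
      obtain ⟨y, hy, rfl⟩ := mem_img.1 hm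
      obtain ⟨n, z, rfl⟩ := exists_pr_of_mem_lexCarrier (hZ y hy)
      exact ⟨z, by rwa [fst_pr]⟩
    obtain ⟨m, hm, hmin⟩ := foundation (img Z fst) ⟨_, mem_img.2 ⟨x, hx, rfl⟩⟩
    obtain ⟨z₀, hz₀⟩ := hrep hm
    have hfst : ∀ {n z}, pr n z ∈ₛ Z → ¬ n ∈ₛ m := fun {n z} h =>
      hmin n (mem_img.2 ⟨_, h, by rw [fst_pr]⟩)
    let Z' := sep (img Z snd) (fun z => pr m z ∈ₛ Z)
    have hZ' : ∀ {z}, z ∈ₛ Z' ↔ pr m z ∈ₛ Z := fun {z} => by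
      simp only [Z']
      rw [mem_sep, mem_img, and_iff_right_iff_imp]
      exact fun h => ⟨_, h, by rw [snd_pr]⟩
    rcases pr_mem_lexCarrier.1 (hZ _ hz₀) with ⟨hm', -⟩ | ⟨rfl, -⟩
    · obtain ⟨z, hz, hzmin⟩ := foundation Z' ⟨z₀, hZ'.2 hz₀⟩
      refine ⟨_, hZ'.1 hz, fun w hw hwz => ?_⟩
      obtain ⟨n, v, rfl⟩ := exists_pr_of_mem_lexCarrier (hZ w hw)
      rcases (mem_lexRel.1 hwz).2 with h | ⟨rfl, ⟨-, h⟩ | ⟨rfl, -⟩⟩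
      exacts [hfst hw h, hzmin v (hZ'.2 hw) h, hom hm' rfl]
    · obtain ⟨z, hz, hzmin⟩ := hA.2 Z' ⟨z₀, hZ'.2 hz₀⟩ fun z hz => by
        rcases pr_mem_lexCarrier.1 (hZ _ (hZ'.1 hz)) with ⟨h, -⟩ | ⟨-, h⟩
        exacts [absurd rfl (hom h), h]
      refine ⟨_, hZ'.1 hz, fun w hw hwz => ?_⟩
      obtain ⟨n, v, rfl⟩ := exists_pr_of_mem_lexCarrier (hZ w hw)
      rcases (mem_lexRel.1 hwz).2 with h | ⟨rfl, ⟨h, -⟩ | ⟨-, h⟩⟩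
      exacts [hfst hw h, hom h rfl, hzmin v (hZ'.2 hw) h]

/-- The map that moves each copy of `δ` to the next one. -/
noncomputable def lexShift (x : M) : M :=
  pr (if fst x ∈ₛ om M then suc (fst x) else om M) (snd x)

theorem lexShift_of_mem {n z : M} (h : n ∈ₛ om M) : lexShift (pr n z) = pr (suc n) z := by
  rw [lexShift, fst_pr, snd_pr, if_pos h]

theorem lexShift_om {z : M} : lexShift (pr (om M) z) = pr (om M) z := by
  rw [lexShift, fst_pr, snd_pr, if_neg (mem_irrefl _)]

instance PRf.lexShift {m : ℕ} (a : (Fin m → M) → M) [PRf a] : PRf (fun x => lexShift (a x)) :=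
  PRf.comp1 PRST.lexShift (by unfold PRST.lexShift; infer_instance) a

/-- With `ω` many copies, each of them can be shifted to the next while `A`, which lies above all
copies, stays fixed. The range of the shift omits copy `0`; the three copies demanded by `Room` are
those with indices `0`, `1` and `2`. -/
theorem room_lex (hδ : ∀ x, x ∈ₛ δ → IsOrd x) (hω : ∀ n, n ∈ₛ om M → n ∈ₛ δ)
    (hA : IsWellOrd A r) : Room (lexCarrier δ A) δ (fun x y => pr x y ∈ₛ lexRel δ A r)
      lexShift (pr (emp M)) (pr (one M)) (pr (suc (one M))) := by
  have h1 : one M ∈ₛ om M := suc_mem_om emp_mem_om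
  have hmem : ∀ {n z : M}, n ∈ₛ om M → z ∈ₛ δ → pr n z ∈ₛ lexCarrier δ A := fun hn hz =>
    pr_mem_lexCarrier.2 (Or.inl ⟨hn, hz⟩)
  have hlt : ∀ {n z z' : M}, n ∈ₛ om M → z ∈ₛ δ → z' ∈ₛ δ → z ∈ₛ z' →
      pr (pr n z) (pr n z') ∈ₛ lexRel δ A r := fun hn hz hz' h =>
    mem_lexRel.2 ⟨⟨hmem hn hz, hmem hn hz'⟩, Or.inr ⟨rfl, Or.inl ⟨hn, h⟩⟩⟩
  have hlt' : ∀ {n n' z z' : M}, n ∈ₛ om M → n' ∈ₛ om M → z ∈ₛ δ → z' ∈ₛ δ → n ∈ₛ n' →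
      pr (pr n z) (pr n' z') ∈ₛ lexRel δ A r := fun hn hn' hz hz' h =>
    mem_lexRel.2 ⟨⟨hmem hn hz, hmem hn' hz'⟩, Or.inl h⟩
  have hs : ∀ x, x ∈ₛ lexCarrier δ A → lexShift x ∈ₛ lexCarrier δ A := fun x hx => by
    rcases mem_lexCarrier.1 hx with ⟨n, z, hn, hz, rfl⟩ | ⟨z, hz, rfl⟩
    · rw [lexShift_of_mem hn]; exact hmem (suc_mem_om hn) hz
    · rwa [lexShift_om]
  refine ⟨(isWellOrd_lex hδ hA).1.linOn, hω, hs, ?_, fun x hx => hmem emp_mem_om hx,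
    fun x hx => hmem h1 hx, fun x hx => hmem (suc_mem_om h1) hx,
    fun x y hx hy h => hlt emp_mem_om hx hy h, fun x y hx hy h => hlt h1 hx hy h,
    fun x y hx hy h => hlt (suc_mem_om h1) hx hy h, ?_,
    fun x y hx hy => hlt' emp_mem_om h1 hx hy (by simp [one]),
    fun x y hx hy => hlt' h1 (suc_mem_om h1) hx hy (by simp)⟩
  · intro x y hx hy h
    have hx' := hs x hx
    have hy' := hs y hy
    rcases mem_lexCarrier.1 hx with ⟨n, z, hn, hz, rfl⟩ | ⟨z, hz, rfl⟩ <;>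
    rcases mem_lexCarrier.1 hy with ⟨n', z', hn', hz', rfl⟩ | ⟨z', hz', rfl⟩
    · rw [lexShift_of_mem hn, lexShift_of_mem hn']
      rcases (mem_lexRel.1 h).2 with h | ⟨rfl, ⟨-, h⟩ | ⟨rfl, -⟩⟩
      · exact hlt' (suc_mem_om hn) (suc_mem_om hn') hz hz' (suc_mem_suc hn' h)
      · exact hlt (suc_mem_om hn) hz hz' h
      · exact absurd hn (mem_irrefl _)
    · rw [lexShift_of_mem hn, lexShift_om] at *
      exact mem_lexRel.2 ⟨⟨hx', hy'⟩, Or.inl (suc_mem_om hn)⟩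
    · rcases (mem_lexRel.1 h).2 with h | ⟨rfl, -⟩
      · exact absurd h (mem_asymm hn')
      · exact absurd hn' (mem_irrefl _)
    · rwa [lexShift_om, lexShift_om]
  · intro x y hx hy
    have hy' := hs y hy
    rcases mem_lexCarrier.1 hy with ⟨n, z, hn, hz, rfl⟩ | ⟨z, hz, rfl⟩
    · rw [lexShift_of_mem hn]
      exact hlt' emp_mem_om (suc_mem_om hn) hx hz (emp_mem_suc hn)
    · rw [lexShift_om]
      exact mem_lexRel.2 ⟨⟨hmem emp_mem_om hx, hy⟩, Or.inl emp_mem_om⟩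

end LexOrder

/-! ### Closure under predecessors and the induction -/

section GuardedInduction
open Classical

variable {M : Type u} [prsLang.Structure M] [SetModel M]

theorem isWellOrd_emp : IsWellOrd (emp M) (emp M) := by
  have h : ∀ x : M, ¬ x ∈ₛ emp M := not_mem_emp
  refine ⟨⟨fun p hp => absurd hp (h p), fun x hx => h _ hx, fun x y z hx => absurd hx (h _),
    fun x y hx => absurd hx (h x)⟩, ?_⟩
  rintro Z ⟨z, hz⟩ hZ
  exact absurd (hZ z hz) (h z)

variable (F : M → M) [hF : PRf (fun x : Fin 1 → M => F (x 0))]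

/-- Each element of `T` is reached from `D₀` in finitely many steps. So a primitive recursive
property that passes to predecessors holds on all of `T`, by induction on the number of steps. -/
theorem exists_closure (D₀ : M) : ∃ T : M, D₀ ∈ₛ T ∧
    (∀ D D', D ∈ₛ T → D' ∈ₛ preds (F D) D → D' ∈ₛ T) ∧
    ∀ (φ : M → Prop) [PRp (fun x : Fin 1 → M => φ (x 0))], φ D₀ →
      (∀ D D', φ D → D' ∈ₛ preds (F D) D → φ D') → ∀ D, D ∈ₛ T → φ D := by
  have hF' : ∀ {m} (a : (Fin m → M) → M) [PRf a], PRf (fun x => F (a x)) :=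
    fun a _ => PRf.comp1 F hF a
  obtain ⟨R, hR, h0, hs, -⟩ := exists_om_recursion (fun y : M => adj (emp M) y)
    (fun u _ => un u (iUn u (fun D => preds (F D) D))) (fun u y z hz => by rw [mem_un]; exact Or.inl hz)
  have hR' : ∀ {m} (a b : (Fin m → M) → M) [PRf a] [PRf b], PRf (fun x => R (a x) (b x)) :=
    fun a b _ _ => PRf.comp2 R hR a b
  refine ⟨iUn (om M) (R D₀), ?_, ?_, ?_⟩
  · rw [mem_iUn]
    exact ⟨emp M, emp_mem_om, by rw [h0]; simp⟩
  · intro D D' hD hD'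
    rw [mem_iUn] at hD ⊢
    obtain ⟨n, hn, hD⟩ := hD
    refine ⟨suc n, suc_mem_om hn, ?_⟩
    rw [hs D₀ n hn, mem_un, mem_iUn]
    exact Or.inr ⟨D, hD, hD'⟩
  · intro φ hφ hφ0 hφs D hD
    have hφ' : ∀ {m} (a : (Fin m → M) → M) [PRf a], PRp (fun x => φ (a x)) :=
      fun a _ => PRp.comp1 φ hφ a
    rw [mem_iUn] at hD
    obtain ⟨n, hn, hD⟩ := hD
    refine om_induction (fun n => ∀ D, D ∈ₛ R D₀ n → φ D) ?_ ?_ n hn D hD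
    · intro D hD
      rw [h0] at hD
      obtain rfl : D = D₀ := by simpa using hD
      exact hφ0
    · intro n hn ih D hD
      rw [hs D₀ n hn, mem_un, mem_iUn] at hD
      rcases hD with hD | ⟨D', hD', hD⟩
      exacts [ih D hD, hφs D' D (ih D' hD') hD]

/-- Induction on dilators for the predecessors `P_{F(D)}(D)`. -/
theorem dilator_induction (Q : M → Prop) [hQ' : PRp (fun x : Fin 1 → M => Q (x 0))]
    (hQ : ∀ D, IsDilator D → (∀ D', IsPred (F D) D D' → Q D') → Q D) (D₀ : M)
    (hD₀ : IsDilator D₀) : Q D₀ := by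
  have hF' : ∀ {m} (a : (Fin m → M) → M) [PRf a], PRf (fun x => F (a x)) :=
    fun a _ => PRf.comp1 F hF a
  have hQ'' : ∀ {m} (a : (Fin m → M) → M) [PRf a], PRp (fun x => Q (a x)) :=
    fun a _ => PRp.comp1 Q hQ' a
  obtain ⟨T, hT₀, hTs, hT⟩ := exists_closure F D₀
  -- The elements of `T` are not yet known to be dilators, so `F D` need not be an ordinal, and only
  -- ordinals among its elements contribute. The natural numbers are included because the bounding
  -- elements place finite sequences in copies of `δ`.
  let δ := un (om M) (iUn T (fun D => sUn (sep (F D) IsOrd)))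
  have hmem : ∀ {x}, x ∈ₛ δ ↔ x ∈ₛ om M ∨ ∃ D, D ∈ₛ T ∧ ∃ γ, (γ ∈ₛ F D ∧ IsOrd γ) ∧ x ∈ₛ γ :=
    fun {x} => by
      simp only [δ]
      rw [mem_un, mem_iUn]
      simp only [mem_sUn, mem_sep]
  have hδ : ∀ x, x ∈ₛ δ → IsOrd x := fun x hx => by
    rcases hmem.1 hx with hx | ⟨D, -, γ, hγ, hx⟩
    exacts [isOrd_of_mem_om hx, hγ.2.of_mem hx]
  have hpre : ∀ D, D ∈ₛ T → IsPredilator D :=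
    hT IsPredilator hD₀.1 fun D D' _ h => isPredilator_of_mem_preds h
  have hred : ∀ {A r}, IsWellOrd A r → ∀ {D D' θ}, D ∈ₛ T → D' ∈ₛ preds (F D) D →
      Ranked (lexCarrier δ A) (fun x y => pr x y ∈ₛ lexRel δ A r) D θ →
      ∃ α, α ∈ₛ θ ∧ Ranked (lexCarrier δ A) (fun x y => pr x y ∈ₛ lexRel δ A r) D' α := by
    intro A r hA D D' θ hD hD' h
    refine Data.Reduces.ranked ?_ h
    rw [gd_eq (hpre D hD), gd_eq (isPredilator_of_mem_preds hD')]
    exact (room_lex hδ (fun n hn => hmem.2 (Or.inl hn)) hA).reduces_preds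
      (fun γ hγ hγ' x hx => hmem.2 (Or.inr ⟨D, hD, γ, ⟨hγ, hγ'⟩, hx⟩)) (hpre D hD) hD'
  -- Axiom beta is applied to `D₀` only. The rank is then inherited along `T`, where it moves to
  -- elements and hence stays in `tc {θ}`. This bound makes the property primitive recursive, as the
  -- induction on `T` requires.
  have hrank : ∀ {A r}, IsWellOrd A r → ∃ θ, ∀ D, D ∈ₛ T → ∃ α, α ∈ₛ tc (adj (emp M) θ) ∧
      Ranked (lexCarrier δ A) (fun x y => pr x y ∈ₛ lexRel δ A r) D α := by
    intro A r hA
    obtain ⟨θ, hθ⟩ := hD₀.exists_ranked (isWellOrd_lex hδ hA)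
    -- Membership in `T` is part of the induction statement, because the reductions are available
    -- for elements of `T` only.
    refine ⟨θ, fun D hD => (hT (fun D => D ∈ₛ T ∧ ∃ α, α ∈ₛ tc (adj (emp M) θ) ∧
      Ranked (lexCarrier δ A) (fun x y => pr x y ∈ₛ lexRel δ A r) D α)
      ⟨hT₀, θ, mem_tc_sing θ, hθ⟩ ?_ D hD).2⟩
    rintro D D' ⟨hD, α, hα, h⟩ hD'
    obtain ⟨β, hβ, h⟩ := hred hA hD hD' h
    exact ⟨hTs D D' hD hD', β, tc_trans hβ hα, h⟩
  -- An arbitrary well order `A` embeds into the corresponding order `δ·ω + A` as its final segment,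
  -- and ranks for the latter give minimal elements for `D(A)`.
  have hdil : ∀ D, D ∈ₛ T → IsDilator D := fun D hD => ⟨hpre D hD, fun A r hA Z hZ hZA => by
    obtain ⟨θ, hθ⟩ := hrank hA
    obtain ⟨α, -, h⟩ := hθ D hD
    refine h.exists_minimal (hpre D hD) (isWellOrd_lex hδ hA).1.linOn hA.1.linOn (pr (om M))
      (fun x hx => pr_mem_lexCarrier.2 (Or.inr ⟨rfl, hx⟩)) (fun x y hx hy h => ?_) hZ hZA
    exact mem_lexRel.2 ⟨⟨pr_mem_lexCarrier.2 (Or.inr ⟨rfl, hx⟩),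
      pr_mem_lexCarrier.2 (Or.inr ⟨rfl, hy⟩)⟩, Or.inr ⟨rfl, Or.inr ⟨rfl, h⟩⟩⟩⟩
  by_contra hn
  -- The descent needs one fixed order with sufficient room, for which `A = ∅` is enough.
  obtain ⟨θ, hθ⟩ := hrank (isWellOrd_emp (M := M))
  let S := sep (tc (adj (emp M) θ)) (fun α => ∃ D, D ∈ₛ T ∧ ¬ Q D ∧
    Ranked (lexCarrier δ (emp M)) (fun x y => pr x y ∈ₛ lexRel δ (emp M) (emp M)) D α)
  have hS : ∀ {D α}, D ∈ₛ T → ¬ Q D → α ∈ₛ tc (adj (emp M) θ) →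
      Ranked (lexCarrier δ (emp M)) (fun x y => pr x y ∈ₛ lexRel δ (emp M) (emp M)) D α →
      α ∈ₛ S := fun hD hn hα h => mem_sep.2 ⟨hα, _, hD, hn, h⟩
  obtain ⟨α₀, h1, h2⟩ := hθ D₀ hT₀
  -- A counterexample with minimal rank: it is a dilator, so the hypothesis provides a predecessor
  -- outside of `Q`, and that has a rank in `α`.
  obtain ⟨α, hα, hmin⟩ := foundation S ⟨α₀, hS hT₀ hn h1 h2⟩
  obtain ⟨hαθ, D, hD, hnD, h⟩ := mem_sep.1 hα
  refine hnD (hQ D (hdil D hD) fun D' hD' => ?_)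
  by_contra hn'
  have hp := mem_preds_of_isPred (hpre D hD) hD'
  obtain ⟨β, hβ, h'⟩ := hred isWellOrd_emp hD hp h
  exact hmin β (hS (hTs D D' hD hp) hn' (tc_trans hβ hαθ) h') hβ

end GuardedInduction
end PRST

/-! ### The theorem for function symbols with parameters -/

theorem mainTheorem4 {M : Type u} [PRST.prsLang.Structure M] (hM : M ⊨ PRST.ATR0set)
    {k l : ℕ} (Q : PRST.PRSet (k + 1)) (p : Fin k → M) (G : PRST.PRSet (l + 1)) (s : Fin l → M)
    (hG : ∀ D : M, PRST.IsDilator D → PRST.IsOrd (PRST.ev G (Fin.cons D s)))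
    (hQ : ∀ D : M, PRST.IsDilator D →
      (∀ D' : M, PRST.IsPred (PRST.ev G (Fin.cons D s)) D D' → PRST.InClass Q p D') →
      PRST.InClass Q p D) :
    ∀ D : M, PRST.IsDilator D → PRST.InClass Q p D := by
  have : PRST.SetModel M := ⟨hM⟩
  have h : ∀ {m : ℕ} (f : PRST.PRSet (m + 1)) (q : Fin m → M),
      PRST.PRf (fun x : Fin 1 → M => PRST.ev f (Fin.cons (x 0) q)) := fun {m} f q => by
    have h := PRST.PRf.ev f (fun i x => (Fin.cons (x 0) q : Fin (m + 1) → M) i) (n := 1)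
      (Fin.cases (PRST.PRf.proj 0) fun i => PRST.PRf.const (q i))
    exact h
  have hF := h G s
  have hQ' := h Q p
  refine PRST.dilator_induction (fun D => PRST.ev G (Fin.cons D s)) (PRST.InClass Q p) (hQ' := ?_) hQ
  unfold PRST.InClass
  infer_instance
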